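/- Let $\tau\ge 0$ be a fixed integer and $d=\tau+1$. Let $(X_i)_{i\ge1}$, $X_i=(X_{i1},\dots,X_{id})$, be a strictly stationary sequence of random vectors in $\mathbb R_+^d$ whose common law has a probability density $f$ on $\mathbb R_+^d=[0,\infty)^d$, twice continuously differentiable in the interior. For a bandwidth $b>0$ put $$\hat f_{n,b}(x)=\frac1n\sum_{i=1}^n\mathcal K_{x,b}(X_i),\qquad \mathcal K_{x,b}(t)=\prod_{j=1}^dK_{\rho(x_j,b),b}(t_j),\qquad K_{\rho,b}(t)=\frac{t^{\rho-1}e^{-t/b}}{b^{\rho}\,\Gamma(\rho)},$$ with $\rho(u,b)=u/b$ if $u\ge 2b$ and $\rho(u,b)=(u/(2b))^2+1$ if $0\le u<2b$, and let $\mathrm{MISE}_n(b)=\mathsf E\int_{\mathbb R_+^d}(f(x)-\hat f_{n,b}(x))^2dx$. Write $\operatorname{Var}\hat f_{n,b}(x)=V_n(b,x)+C_n(b,x)$ with $$V_n(b,x)=\frac1{n^2}\sum_{i=1}^n\operatorname{Var}\mathcal K_{x,b}(X_i),\qquad C_n(b,x)=\frac1{n^2}\sum_{i\ne k}\operatorname{Cov}\big(\mathcal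 K_{x,b}(X_i),\mathcal K_{x,b}(X_k)\big).$$ Let $\alpha(k)=\sup_t\sup\{|P(A\cap B)-P(A)P(B)|: A\in\sigma(X_s,s\le t),\,B\in\sigma(X_s,s\ge t+k)\}$ be the strong mixing coefficients. Assume: 1. for some $\kappa\in(0,\tfrac12)$: $\sum_{k\ge1}k\,\alpha(k)^{2\kappa}<\infty$ and $\int_{\mathbb R_+^d}\prod_jx_j^{-(\kappa+1/2)}f(x)\,dx<\infty$; 2. for every $k\ge1$ the pair $(X_1,X_{1+k})$ has a joint density $f_k$ on $\mathbb R_+^d\times\mathbb R_+^d$, and for some constant $M$, $|f_k(x,y)-f(x)f(y)|\le M$ for all $k\ge1$ and all $x,y$; 3. $f$ and each $x_j\,\partial^2f/\partial x_j^2$ $(1\le j\le d)$ belong to $L^2(\mathbb R_+^d)$, and $\int_{\mathbb R_+^d}\big(\sum_jx_j\,\partial^2f/\partial x_j^2\big)^2dx>0$. Then: (a) The covariance term is negligible: for every sequence $b_n>0$ with $b_n\to0$ we have, as $n\to\infty$, $C_n(b_n,x)=o(V_n(b_n,x))$ at every $x\in(0,\infty)^d$ with $f(x)>0$; moreover $C_n(b_n,\cdot)$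 and $V_n(b_n,\cdot)$ are integrable over $\mathbb R_+^d$ and $\int C_n(b_n,x)\,dx=o\big(\int V_n(b_n,x)\,dx\big)$. (b) The MISE-optimal bandwidth is, asymptotically, $$b_n^*=\left(\frac{(\tau+1)\int_{\mathbb R_+^d}\Big(\prod_{j}\frac{x_j^{-1/2}}{2\sqrt\pi}\Big)f(x)\,dx}{\int_{\mathbb R_+^d}\Big(\sum_{j}x_j\frac{\partial^2f}{\partial x_j^2}(x)\Big)^2dx}\right)^{\frac{2}{\tau+5}}n^{-\frac{2}{\tau+5}}.$$ That is, there is $\delta_0>0$ such that for every $\delta\in(0,\delta_0]$ the function $\mathrm{MISE}_n$ attains its minimum over $(0,\delta]$ for all large $n$, and for any choice of minimizers $\beta_n\in(0,\delta]$ we have $\beta_n/b_n^*\to1$ and $\mathrm{MISE}_n(b_n^*)/\mathrm{MISE}_n(\beta_n)\to1$. -/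

import Mathlib

open MeasureTheory ProbabilityTheory Filter Topology Asymptotics

namespace GammaKDE

/-- The open positive orthant of `ℝ^(τ+1)`. Its boundary is Lebesgue-null, so integrals over it are
the integrals over `[0,∞)^(τ+1)`. -/
def orthant (τ : ℕ) : Set (Fin (τ + 1) → ℝ) := {x | ∀ j, 0 < x j}

/-- Lebesgue measure on the orthant. -/
noncomputable def orthantVolume (τ : ℕ) : Measure (Fin (τ + 1) → ℝ) :=
  volume.restrict (orthant τ)

/-- The (modified) shape parameter of the gamma kernel at the point `x`, for the bandwidth `b`. -/
noncomputable def shape (x b : ℝ) : ℝ :=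
  if 2 * b ≤ x then x / b else (x / (2 * b)) ^ 2 + 1

/-- The gamma kernel `t ↦ t^(ρ-1) exp(-t/b) / (b^ρ Γ(ρ))`, `t ≥ 0`, with `ρ = shape x b`: the density
of the gamma law with shape `ρ` and scale `b` (that is, rate `1/b`). -/
noncomputable def gammaKernel (x b t : ℝ) : ℝ := gammaPDFReal (shape x b) (1 / b) t

/-- The product gamma kernel at the point `x`, evaluated at `t`, all bandwidths being equal. -/
noncomputable def productKernel {τ : ℕ} (b : ℝ) (x t : Fin (τ + 1) → ℝ) : ℝ :=
  ∏ j, gammaKernel (x j) b (t j)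

/-- The product gamma kernel density estimator at `x`, from the `n` observations
`X 0, …, X (n-1)`. -/
noncomputable def estimator {Ω : Type*} {τ : ℕ} (X : ℕ → Ω → (Fin (τ + 1) → ℝ))
    (n : ℕ) (b : ℝ) (x : Fin (τ + 1) → ℝ) (ω : Ω) : ℝ :=
  (1 / (n : ℝ)) * ∑ i ∈ Finset.range n, productKernel b x (X i ω)

/-- Mean integrated squared error of the estimator, as a function of the bandwidth `b`. -/
noncomputable def mise {Ω : Type*} [MeasurableSpace Ω] {τ : ℕ} (P : Measure Ω)
    (X : ℕ → Ω → (Fin (τ + 1) → ℝ)) (f : (Fin (τ + 1) → ℝ) → ℝ) (n : ℕ) (b : ℝ) : ENNReal :=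
  ∫⁻ ω, ∫⁻ x, ENNReal.ofReal ((f x - estimator X n b x ω) ^ 2) ∂(orthantVolume τ) ∂P

/-- The diagonal part of the variance of the estimator at `x`. -/
noncomputable def varTerm {Ω : Type*} [MeasurableSpace Ω] {τ : ℕ} (P : Measure Ω)
    (X : ℕ → Ω → (Fin (τ + 1) → ℝ)) (n : ℕ) (b : ℝ) (x : Fin (τ + 1) → ℝ) : ℝ :=
  (1 / (n : ℝ) ^ 2) * ∑ i ∈ Finset.range n, variance (fun ω => productKernel b x (X i ω)) P

/-- The off-diagonal part (covariance term) of the variance of the estimator at `x`. -/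
noncomputable def covTerm {Ω : Type*} [MeasurableSpace Ω] {τ : ℕ} (P : Measure Ω)
    (X : ℕ → Ω → (Fin (τ + 1) → ℝ)) (n : ℕ) (b : ℝ) (x : Fin (τ + 1) → ℝ) : ℝ :=
  (1 / (n : ℝ) ^ 2) * ∑ i ∈ Finset.range n, ∑ k ∈ (Finset.range n).erase i,
    covariance (fun ω => productKernel b x (X i ω)) (fun ω => productKernel b x (X k ω)) P

/-- Strict stationarity: all time shifts of the process have the same law (on path space). -/
def IsStationary {Ω E : Type*} [MeasurableSpace Ω] [MeasurableSpace E] (P : Measure Ω)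
    (X : ℕ → Ω → E) : Prop :=
  ∀ h : ℕ, P.map (fun ω s => X (s + h) ω) = P.map (fun ω s => X s ω)

/-- The strong mixing coefficient: the supremum of `|P(A ∩ B) - P(A) P(B)|` over all times `t`,
all `A ∈ σ(X_s, s ≤ t)` and all `B ∈ σ(X_s, s ≥ t + k)`. -/
noncomputable def alphaMixing {Ω E : Type*} [MeasurableSpace Ω] [MeasurableSpace E]
    (P : Measure Ω) (X : ℕ → Ω → E) (k : ℕ) : ℝ :=
  sSup {r : ℝ | ∃ (t : ℕ) (A B : Set Ω),
    MeasurableSet[⨆ s ∈ Set.Iic t, MeasurableSpace.comap (X s) inferInstance] A ∧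
    MeasurableSet[⨆ s ∈ Set.Ici (t + k), MeasurableSpace.comap (X s) inferInstance] B ∧
    r = |P.real (A ∩ B) - P.real A * P.real B|}

/-- The second partial derivative of `f` in the coordinate `j`. -/
noncomputable def secondPartial {τ : ℕ} (f : (Fin (τ + 1) → ℝ) → ℝ) (j : Fin (τ + 1))
    (x : Fin (τ + 1) → ℝ) : ℝ :=
  iteratedDeriv 2 (fun t => f (Function.update x j t)) (x j)

/-- The integral `∫ (∏_j x_j^(-1/2) / (2 √π)) f(x) dx`. -/
noncomputable def varianceConst {τ : ℕ} (f : (Fin (τ + 1) → ℝ) → ℝ) : ℝ :=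
  ∫ x, (∏ j, x j ^ (-(1 / 2) : ℝ) / (2 * √Real.pi)) * f x ∂(orthantVolume τ)

/-- The integral `∫ (∑_j x_j ∂²f/∂x_j²)² dx`. -/
noncomputable def biasConst {τ : ℕ} (f : (Fin (τ + 1) → ℝ) → ℝ) : ℝ :=
  ∫ x, (∑ j, x j * secondPartial f j x) ^ 2 ∂(orthantVolume τ)

/-- The asymptotically optimal bandwidth: an explicit constant times `n^(-2/(τ+5))`. -/
noncomputable def optBandwidth {τ : ℕ} (f : (Fin (τ + 1) → ℝ) → ℝ) (n : ℕ) : ℝ :=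
  (((τ : ℝ) + 1) * varianceConst f / biasConst f) ^ (2 / ((τ : ℝ) + 5)) *
    (n : ℝ) ^ (-(2 / ((τ : ℝ) + 5)))

end GammaKDE

open GammaKDE

namespace GammaKDE

open Set
open scoped ENNReal NNReal

/-! ### One-dimensional gamma densities -/

/-! Write d = τ + 1. The risk splits into integrated squared bias, integrated diagonal variance and
integrated covariance. The first behaves like (b²/4)·`biasConst f`, the second like `varianceConst
f`/(n b^(d/2)), and the third is o(1)/(n b^(d/2)) as b → 0, uniformly in n
(`tendsto_integral_sq_bias`, `tendsto_integral_kernelVar`, `abs_integral_covTerm_le` with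
`tendsto_tsum_lagCov`). What remains is the minimization of an explicit two-term function.

Bias and second moment are both images of a fixed function under kernels acting on one coordinate at
a time. The Schur test bounds such operators on L^p by their row and column masses, and
`IsApproxIdentity` adds what is needed for strong convergence to a multiple of the identity. The
column masses are the unusual ingredient, since x enters the kernel through the shape parameter:
gamma densities of unit rate and integer shape, read as functions of the shape, are Poisson
probabilities, and log-convexity of Γ interpolates between integers.

For x ≥ 2b the kernel has mean x and variance bx. Taylor's formula with Peano kernel writes the
one-dimensional bias exactly as b∫R(x,s) s g''(s) ds. The partial first moments of a gamma law are
explicit, which gives 0 ≤ R ≤ K, and the mass of R tends to 1/2; hence bias/b → (x/2)g'' in L². For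
x < 2b the bias is at most b times a kernel applied to |g'|. That kernel tends to 0 strongly, and g'
is square integrable by a Hardy inequality on slices. Telescoping over coordinates yields
`tendsto_bias`.

The square of a gamma density is a multiple of a gamma density, so √b K² √t is an approximate
identity on L¹ of mass 1/(2√π). Applied in every coordinate to f ∏ x_j^(-1/2), it gives the limit of
the scaled second moment. The squared mean stays bounded in L¹ and disappears after scaling by
b^(d/2).

For the integrated covariance at lag k there are two estimates. At a fixed lag the covariance is at
most M and at most the second moment, so the scaled integral tends to 0. Uniformly in b, the kernel
is regarded as a random element of L²(dx). A truncation argument gives a covariance inequality for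
scalar functions under α-mixing, and averaging over random signs along orthonormal systems transfers
it to L²(dx) without dimensional loss (`MixingPair.abs_sub_le_list`,
`MixingPair.abs_integral_kernel_le`). With moment order 2 + 4κ all powers of b cancel, the moment
hypothesis is exactly what is needed, and the bound decays like k^(-2/(1+2κ)), which is summable
because κ < 1/2. Tannery's theorem gives the o(1).

At a fixed point x the covariance is at most M and at most (sup K)²α(k); the geometric mean of the
two is summable after scaling. The variance is bounded below because the kernel carries half of its
mass on a ball of volume of order b^(d/2) (`exists_le_kernelSq`), while the scaled squared mean
vanishes since f is in L² (`tendsto_sq_kernelMean`).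

In the ratio r = b/b* the main part of the risk is proportional to r²/4 + r^(-d/2)/d, which exceeds
its value at r = 1 by at least (log r)²/8. Near-minimizers therefore have ratio close to 1.
Minimizers exist because the risk is lower semicontinuous in b, by Fatou, and its variance part
blows up as b → 0. -/

theorem gammaPDFReal_of_pos (a r : ℝ) {t : ℝ} (ht : 0 < t) :
    gammaPDFReal a r t = r ^ a / Real.Gamma a * t ^ (a - 1) * Real.exp (-(r * t)) := by
  simp [gammaPDFReal, ht.le]

theorem lintegral_Ioi_gammaPDFReal {a r : ℝ} (ha : 0 < a) (hr : 0 < r) :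
    ∫⁻ t in Ioi 0, ENNReal.ofReal (gammaPDFReal a r t) = 1 := by
  have h := lintegral_gammaPDF_eq_one ha hr
  rw [← lintegral_add_compl _ (measurableSet_Ioi (a := (0 : ℝ))), compl_Ioi,
    ← setLIntegral_congr (Iio_ae_eq_Iic (a := (0 : ℝ))),
    lintegral_gammaPDF_of_nonpos le_rfl, add_zero] at h
  exact h

theorem integrableOn_gammaPDFReal {a r : ℝ} (ha : 0 < a) (hr : 0 < r) :
    IntegrableOn (gammaPDFReal a r) (Ioi 0) := by
  refine ⟨(measurable_gammaPDFReal a r).aestronglyMeasurable, ?_⟩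
  rw [hasFiniteIntegral_iff_ofReal (ae_of_all _ (gammaPDFReal_nonneg ha hr)),
    lintegral_Ioi_gammaPDFReal ha hr]
  exact ENNReal.one_lt_top

theorem integral_Ioi_gammaPDFReal {a r : ℝ} (ha : 0 < a) (hr : 0 < r) :
    ∫ t in Ioi 0, gammaPDFReal a r t = 1 := by
  rw [integral_eq_lintegral_of_nonneg_ae (ae_of_all _ (gammaPDFReal_nonneg ha hr))
    (measurable_gammaPDFReal a r).aestronglyMeasurable, lintegral_Ioi_gammaPDFReal ha hr]
  simp

/-- Size biasing, from Γ(a+1) = aΓ(a). It reduces every moment of a gamma law to a normalization,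
and is used again to absorb stray factors t. -/
theorem mul_gammaPDFReal {a r t : ℝ} (ha : 0 < a) (hr : 0 < r) (ht : 0 < t) :
    t * gammaPDFReal a r t = a / r * gammaPDFReal (a + 1) r t := by
  rw [gammaPDFReal_of_pos _ _ ht, gammaPDFReal_of_pos _ _ ht, Real.Gamma_add_one ha.ne',
    Real.rpow_add_one hr.ne', show a + 1 - 1 = (a - 1) + 1 by ring, Real.rpow_add_one ht.ne']
  have := (Real.Gamma_pos_of_pos ha).ne'
  field_simp

theorem integrableOn_mul_gammaPDFReal {a r : ℝ} (ha : 0 < a) (hr : 0 < r) :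
    IntegrableOn (fun t => t * gammaPDFReal a r t) (Ioi 0) :=
  IntegrableOn.congr_fun (Integrable.const_mul
    (integrableOn_gammaPDFReal (by linarith : 0 < a + 1) hr) (a / r))
    (fun _ ht => (mul_gammaPDFReal ha hr ht).symm) measurableSet_Ioi

theorem integral_mul_gammaPDFReal {a r : ℝ} (ha : 0 < a) (hr : 0 < r) :
    ∫ t in Ioi 0, t * gammaPDFReal a r t = a / r := by
  rw [setIntegral_congr_fun measurableSet_Ioi (fun _ ht => mul_gammaPDFReal ha hr ht),
    integral_const_mul, integral_Ioi_gammaPDFReal (by linarith) hr, mul_one]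

theorem integrableOn_sq_mul_gammaPDFReal {a r : ℝ} (ha : 0 < a) (hr : 0 < r) :
    IntegrableOn (fun t => t ^ 2 * gammaPDFReal a r t) (Ioi 0) :=
  IntegrableOn.congr_fun (Integrable.const_mul
    (integrableOn_mul_gammaPDFReal (by linarith : 0 < a + 1) hr) (a / r))
    (fun t ht => by
      have := mul_gammaPDFReal ha hr ht
      linear_combination -t * this) measurableSet_Ioi

theorem integral_sq_mul_gammaPDFReal {a r : ℝ} (ha : 0 < a) (hr : 0 < r) :
    ∫ t in Ioi 0, t ^ 2 * gammaPDFReal a r t = a * (a + 1) / r ^ 2 := by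
  have : ∀ t ∈ Ioi (0 : ℝ), t ^ 2 * gammaPDFReal a r t =
      a / r * (t * gammaPDFReal (a + 1) r t) := fun t ht => by
    linear_combination t * mul_gammaPDFReal ha hr ht
  rw [setIntegral_congr_fun measurableSet_Ioi this, integral_const_mul,
    integral_mul_gammaPDFReal (by linarith) hr]
  field_simp

theorem integrableOn_sub_sq_mul_gammaPDFReal {a r : ℝ} (ha : 0 < a) (hr : 0 < r) (y : ℝ) :
    IntegrableOn (fun t => (t - y) ^ 2 * gammaPDFReal a r t) (Ioi 0) := by
  have := ((integrableOn_sq_mul_gammaPDFReal ha hr).sub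
    ((integrableOn_mul_gammaPDFReal ha hr).const_mul (2 * y))).add
    ((integrableOn_gammaPDFReal ha hr).const_mul (y ^ 2))
  refine this.congr (ae_of_all _ fun t => ?_)
  simp only [Pi.add_apply, Pi.sub_apply]
  ring

/-- Second moment of a gamma law about an arbitrary point. -/
theorem integral_sub_sq_mul_gammaPDFReal {a r : ℝ} (ha : 0 < a) (hr : 0 < r) (y : ℝ) :
    ∫ t in Ioi 0, (t - y) ^ 2 * gammaPDFReal a r t = (a / r - y) ^ 2 + a / r ^ 2 := by
  have h : ∀ t : ℝ, (t - y) ^ 2 * gammaPDFReal a r t = t ^ 2 * gammaPDFReal a r t -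
      2 * y * (t * gammaPDFReal a r t) + y ^ 2 * gammaPDFReal a r t := fun t => by ring
  simp_rw [h]
  have h1 := integrableOn_sq_mul_gammaPDFReal ha hr
  have h2 := (integrableOn_mul_gammaPDFReal ha hr).const_mul (2 * y)
  have h3 := (integrableOn_gammaPDFReal ha hr).const_mul (y ^ 2)
  have h12 : IntegrableOn (fun t => t ^ 2 * gammaPDFReal a r t -
      2 * y * (t * gammaPDFReal a r t)) (Ioi 0) := h1.sub h2
  rw [integral_add h12 h3, integral_sub h1 h2, integral_const_mul, integral_const_mul,
    integral_sq_mul_gammaPDFReal ha hr, integral_mul_gammaPDFReal ha hr,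
    integral_Ioi_gammaPDFReal ha hr]
  field_simp
  ring

theorem lintegral_sub_sq_mul_gammaPDFReal {a r : ℝ} (ha : 0 < a) (hr : 0 < r) (y : ℝ) :
    ∫⁻ t in Ioi 0, ENNReal.ofReal ((t - y) ^ 2 * gammaPDFReal a r t) =
      ENNReal.ofReal ((a / r - y) ^ 2 + a / r ^ 2) := by
  rw [← integral_sub_sq_mul_gammaPDFReal ha hr y, ofReal_integral_eq_lintegral_ofReal
    (integrableOn_sub_sq_mul_gammaPDFReal ha hr y)
    (ae_of_all _ fun t => mul_nonneg (sq_nonneg _) (gammaPDFReal_nonneg ha hr t))]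

/-- The square of a gamma density is a multiple of another gamma density. -/
theorem gammaPDFReal_sq {a r t : ℝ} (ha : 1 / 2 < a) (hr : 0 < r) (ht : 0 < t) :
    gammaPDFReal a r t ^ 2 = r * (Real.Gamma (a - 1 / 2) / (2 * √Real.pi * Real.Gamma a)) *
      gammaPDFReal (2 * a - 1) (2 * r) t := by
  -- Legendre duplication at a - 1/2 trades the normalization Γ(2a-1) of the squared density for
  -- Γ(a-1/2)Γ(a).
  have hdup := Real.Gamma_mul_Gamma_add_half (a - 1 / 2)
  rw [show a - 1 / 2 + 1 / 2 = a by ring, show 2 * (a - 1 / 2) = 2 * a - 1 by ring] at hdup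
  rw [gammaPDFReal_of_pos _ _ ht, gammaPDFReal_of_pos _ _ ht]
  have hG := Real.Gamma_pos_of_pos (show 0 < a by linarith)
  have hG2 := Real.Gamma_pos_of_pos (show 0 < 2 * a - 1 by linarith)
  have hG1 := Real.Gamma_pos_of_pos (show 0 < a - 1 / 2 by linarith)
  have hpi : 0 < √Real.pi := Real.sqrt_pos.2 Real.pi_pos
  have e1 : (t ^ (a - 1)) ^ 2 = t ^ (2 * a - 1 - 1) := by
    rw [← Real.rpow_natCast, ← Real.rpow_mul ht.le]; congr 1; push_cast; ring
  have e2 : Real.exp (-(r * t)) ^ 2 = Real.exp (-(2 * r * t)) := by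
    rw [← Real.exp_nat_mul]; congr 1; push_cast; ring
  have e3 : (r ^ a) ^ 2 = r * r ^ (2 * a - 1) := by
    rw [← Real.rpow_natCast, ← Real.rpow_mul hr.le, Real.rpow_sub hr, Real.rpow_one]
    rw [mul_div_cancel₀ _ hr.ne']; congr 1; push_cast; ring
  have e4 : (2 * r) ^ (2 * a - 1) = 2 ^ (2 * a - 1) * r ^ (2 * a - 1) :=
    Real.mul_rpow (by norm_num) hr.le
  have e5 : (2 : ℝ) ^ (1 - (2 * a - 1)) * 2 ^ (2 * a - 1) = 2 := by
    rw [← Real.rpow_add (by norm_num)]; norm_num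
  rw [mul_pow, mul_pow, e1, e2, div_pow, e3, e4]
  have e6 : Real.Gamma (a - 1 / 2) * 2 ^ (2 * a - 1) =
      2 * √Real.pi * Real.Gamma (2 * a - 1) / Real.Gamma a := by
    rw [eq_div_iff hG.ne']
    linear_combination (2 : ℝ) ^ (2 * a - 1) * hdup + Real.Gamma (2 * a - 1) * √Real.pi * e5
  have : Real.Gamma (a - 1 / 2) / (2 * √Real.pi * Real.Gamma a) *
      (2 ^ (2 * a - 1) * r ^ (2 * a - 1) / Real.Gamma (2 * a - 1)) =
      r ^ (2 * a - 1) / Real.Gamma a ^ 2 := by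
    rw [div_mul_div_comm, ← mul_assoc, e6]
    field_simp
  linear_combination -(r * t ^ (2 * a - 1 - 1) * Real.exp (-(2 * r * t))) * this

/-- Lower and upper bounds for the ratio `Γ(a - 1/2) / Γ(a)`. -/
theorem rpow_neg_half_le_Gamma_ratio {a : ℝ} (ha : 1 / 2 < a) :
    1 / √(a - 1 / 2) ≤ Real.Gamma (a - 1 / 2) / Real.Gamma a := by
  -- Log-convexity of Γ at a, the midpoint of a - 1/2 and a + 1/2.
  have h := Real.Gamma_mul_add_mul_le_rpow_Gamma_mul_rpow_Gamma
    (show 0 < a - 1 / 2 by linarith) (show 0 < a - 1 / 2 + 1 by linarith)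
    (show (0 : ℝ) < 1 / 2 by norm_num) (show (0 : ℝ) < 1 / 2 by norm_num) (by norm_num)
  have hG1 := Real.Gamma_pos_of_pos (show 0 < a - 1 / 2 by linarith)
  have hG := Real.Gamma_pos_of_pos (show 0 < a by linarith)
  rw [Real.Gamma_add_one (by linarith), show 1 / 2 * (a - 1 / 2) + 1 / 2 * (a - 1 / 2 + 1) = a by
    ring, Real.mul_rpow (by linarith) hG1.le, ← Real.sqrt_eq_rpow, ← Real.sqrt_eq_rpow] at h
  have hs : 0 < √(a - 1 / 2) := Real.sqrt_pos.2 (by linarith)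
  rw [div_le_div_iff₀ hs hG]
  nlinarith [Real.mul_self_sqrt hG1.le]

/-- Log-convexity of Γ at a + 1/2, the midpoint of a and a + 1, followed by Γ(a+1/2) =
(a-1/2)Γ(a-1/2). -/
theorem Gamma_ratio_le {a : ℝ} (ha : 1 / 2 < a) :
    Real.Gamma (a - 1 / 2) / Real.Gamma a ≤ √a / (a - 1 / 2) := by
  have h := Real.Gamma_mul_add_mul_le_rpow_Gamma_mul_rpow_Gamma
    (show 0 < a by linarith) (show 0 < a + 1 by linarith)
    (show (0 : ℝ) < 1 / 2 by norm_num) (show (0 : ℝ) < 1 / 2 by norm_num) (by norm_num)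
  have hG := Real.Gamma_pos_of_pos (show 0 < a by linarith)
  rw [Real.Gamma_add_one (by linarith), show 1 / 2 * a + 1 / 2 * (a + 1) = (a - 1 / 2) + 1 by
    ring, Real.Gamma_add_one (by linarith), Real.mul_rpow (by linarith) hG.le,
    ← Real.sqrt_eq_rpow, ← Real.sqrt_eq_rpow] at h
  rw [div_le_div_iff₀ hG (by linarith)]
  linarith [show √(Real.Gamma a) * (√a * √(Real.Gamma a)) = √a * Real.Gamma a by
    linear_combination √a * Real.mul_self_sqrt hG.le]

/-- The logarithmic derivative of s^a exp(-rs) is a/s - r, so the density times the deviation from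
the mean has an explicit antiderivative. This makes partial first moments explicit, which later
dominates the remainder kernel by the gamma kernel. -/
theorem hasDerivAt_mul_gammaPDFReal {a r t : ℝ} (hr : 0 < r) (ht : 0 < t) :
    HasDerivAt (fun s => s * gammaPDFReal a r s / r) ((a / r - t) * gammaPDFReal a r t) t := by
  have h1 : HasDerivAt (fun s : ℝ => r ^ a / Real.Gamma a / r * (s ^ a * Real.exp (-(r * s))))
      (r ^ a / Real.Gamma a / r * (a * t ^ (a - 1) * Real.exp (-(r * t)) +
        t ^ a * (Real.exp (-(r * t)) * (-(r * 1))))) t :=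
    ((Real.hasDerivAt_rpow_const (Or.inl ht.ne')).mul
      ((((hasDerivAt_id t).const_mul r).neg).exp)).const_mul _
  have e : ∀ s : ℝ, 0 < s → s ^ a = s * s ^ (a - 1) := fun s hs => by
    rw [Real.rpow_sub_one hs.ne', mul_div_cancel₀ _ hs.ne']
  refine (h1.congr_of_eventuallyEq ?_).congr_deriv ?_
  · filter_upwards [lt_mem_nhds ht] with s hs
    rw [gammaPDFReal_of_pos _ _ hs, e s hs]
    ring
  · rw [gammaPDFReal_of_pos _ _ ht, e t ht]
    field_simp
    ring

theorem tendsto_mul_gammaPDFReal_atTop (a : ℝ) {r : ℝ} (hr : 0 < r) :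
    Tendsto (fun s => s * gammaPDFReal a r s / r) atTop (𝓝 0) := by
  have h := (tendsto_rpow_mul_exp_neg_mul_atTop_nhds_zero a r hr).const_mul
    (r ^ a / Real.Gamma a / r)
  rw [mul_zero] at h
  refine h.congr' ?_
  filter_upwards [eventually_gt_atTop 0] with s hs
  rw [gammaPDFReal_of_pos _ _ hs, Real.rpow_sub_one hs.ne', neg_mul]
  field_simp

theorem integrableOn_sub_mul_gammaPDFReal {a r : ℝ} (ha : 0 < a) (hr : 0 < r) (y : ℝ) :
    IntegrableOn (fun t => (t - y) * gammaPDFReal a r t) (Ioi 0) := by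
  have := (integrableOn_mul_gammaPDFReal ha hr).sub
    ((integrableOn_gammaPDFReal ha hr).const_mul y)
  refine this.congr (ae_of_all _ fun t => ?_)
  simp only [Pi.sub_apply]
  ring

/-- The upper partial first moment of a gamma law about its mean. -/
theorem integral_Ioi_sub_mul_gammaPDFReal {a r s : ℝ} (ha : 0 < a) (hr : 0 < r) (hs : 0 < s) :
    ∫ t in Ioi s, (t - a / r) * gammaPDFReal a r t = s * gammaPDFReal a r s / r := by
  have hI : IntegrableOn (fun t => (a / r - t) * gammaPDFReal a r t) (Ioi s) := by
    refine ((integrableOn_sub_mul_gammaPDFReal ha hr (a / r)).mono_set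
      (Ioi_subset_Ioi hs.le)).neg.congr (ae_of_all _ fun t => ?_)
    simp only [Pi.neg_apply]; ring
  have h := integral_Ioi_of_hasDerivAt_of_tendsto'
    (fun t (ht : t ∈ Ici s) => hasDerivAt_mul_gammaPDFReal (a := a) hr (hs.trans_le ht)) hI
    (tendsto_mul_gammaPDFReal_atTop a hr)
  rw [zero_sub] at h
  rw [← neg_inj, ← h, ← integral_neg]
  congr 1; ext t; ring

/-- The lower partial first moment of a gamma law about its mean. -/
theorem integral_Ioc_sub_mul_gammaPDFReal {a r s : ℝ} (ha : 0 < a) (hr : 0 < r) (hs : 0 < s) :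
    ∫ t in Ioc 0 s, (a / r - t) * gammaPDFReal a r t = s * gammaPDFReal a r s / r := by
  have hI := integrableOn_sub_mul_gammaPDFReal ha hr (a / r)
  -- The total first moment about the mean vanishes, so the lower part equals the upper part.
  have h0 : ∫ t in Ioi 0, (t - a / r) * gammaPDFReal a r t = 0 := by
    have : ∀ t : ℝ, (t - a / r) * gammaPDFReal a r t =
      t * gammaPDFReal a r t - a / r * gammaPDFReal a r t := fun t => by ring
    simp_rw [this]
    rw [integral_sub (integrableOn_mul_gammaPDFReal ha hr)
      ((integrableOn_gammaPDFReal ha hr).const_mul _), integral_const_mul,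
      integral_mul_gammaPDFReal ha hr, integral_Ioi_gammaPDFReal ha hr]
    ring
  rw [← Ioc_union_Ioi_eq_Ioi hs.le, setIntegral_union (Ioc_disjoint_Ioi le_rfl) measurableSet_Ioi
    (hI.mono_set (Ioc_subset_Ioi_self)) (hI.mono_set (Ioi_subset_Ioi hs.le)),
    integral_Ioi_sub_mul_gammaPDFReal ha hr hs] at h0
  have : ∫ t in Ioc 0 s, (a / r - t) * gammaPDFReal a r t =
      -∫ t in Ioc 0 s, (t - a / r) * gammaPDFReal a r t := by
    rw [← integral_neg]; congr 1; ext t; ring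
  rw [this]; linarith

/-- After division by r the left side is an upper partial first moment about the mean. It is at most
the standard deviation √a/r, through t - m ≤ (t-m)²/(2σ) + σ/2 with σ = √a/r. -/
theorem mul_gammaPDFReal_le_sqrt {a r s : ℝ} (ha : 0 < a) (hr : 0 < r) (hs : 0 < s) :
    s * gammaPDFReal a r s ≤ √a := by
  have hI := integrableOn_sub_mul_gammaPDFReal ha hr (a / r)
  have hI2 := integrableOn_sub_sq_mul_gammaPDFReal ha hr (a / r)
  have hsa : 0 < √a := Real.sqrt_pos.2 ha
  have key : s * gammaPDFReal a r s / r ≤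
      ∫ t in Ioi 0, (r / (2 * √a) * ((t - a / r) ^ 2 * gammaPDFReal a r t) +
        √a / (2 * r) * gammaPDFReal a r t) := by
    rw [← integral_Ioi_sub_mul_gammaPDFReal ha hr hs]
    have hR : IntegrableOn (fun t => r / (2 * √a) * ((t - a / r) ^ 2 * gammaPDFReal a r t) +
        √a / (2 * r) * gammaPDFReal a r t) (Ioi 0) := (hI2.const_mul (r / (2 * √a))).add
      ((integrableOn_gammaPDFReal ha hr).const_mul (√a / (2 * r)))
    refine (setIntegral_mono_on (hI.mono_set (Ioi_subset_Ioi hs.le))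
      (hR.mono_set (Ioi_subset_Ioi hs.le)) measurableSet_Ioi fun t _ => ?_).trans
      (setIntegral_mono_set hR (ae_of_all _ fun t => ?_) (Ioi_subset_Ioi hs.le).eventuallyLE)
    · have h1 : t - a / r ≤ r / (2 * √a) * (t - a / r) ^ 2 + √a / (2 * r) := by
        have : r / (2 * √a) * (t - a / r) ^ 2 + √a / (2 * r) - (t - a / r) =
            r / (2 * √a) * (t - a / r - √a / r) ^ 2 := by
          field_simp; ring
        have : 0 ≤ r / (2 * √a) * (t - a / r - √a / r) ^ 2 := by positivity
        linarith
      have := mul_le_mul_of_nonneg_right h1 (gammaPDFReal_nonneg ha hr t)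
      linarith
    · have := gammaPDFReal_nonneg ha hr t
      simp only [Pi.zero_apply]
      positivity
  rw [integral_add (hI2.const_mul _) ((integrableOn_gammaPDFReal ha hr).const_mul _),
    integral_const_mul, integral_const_mul, integral_sub_sq_mul_gammaPDFReal ha hr,
    integral_Ioi_gammaPDFReal ha hr, sub_self, zero_pow two_ne_zero, zero_add, mul_one,
    div_le_iff₀ hr] at key
  refine key.trans_eq ?_
  have := Real.mul_self_sqrt ha.le
  field_simp
  nlinarith

/-- A gamma density with shape `a > 1` is bounded by `r / √(a - 1)`. -/
theorem gammaPDFReal_le {a r : ℝ} (ha : 1 < a) (hr : 0 < r) (t : ℝ) :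
    gammaPDFReal a r t ≤ r / √(a - 1) := by
  rcases lt_trichotomy t 0 with ht | rfl | ht
  · simp only [gammaPDFReal, not_le.2 ht, if_false]; positivity
  · simp only [gammaPDFReal, le_refl, if_true]
    rw [Real.zero_rpow (by linarith)]; simp; positivity
  -- The bound on t times the density of shape a - 1 is a bound on the density of shape a.
  · have h := mul_gammaPDFReal (show 0 < a - 1 by linarith) hr ht
    rw [sub_add_cancel] at h
    have h2 := mul_gammaPDFReal_le_sqrt (show 0 < a - 1 by linarith) hr ht
    have hs : 0 < √(a - 1) := Real.sqrt_pos.2 (by linarith)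
    rw [h] at h2
    rw [le_div_iff₀ hs]
    have h3 : (a - 1) * gammaPDFReal a r t ≤ r * √(a - 1) := by
      have := mul_le_mul_of_nonneg_left h2 hr.le
      rwa [← mul_assoc, mul_div_cancel₀ _ hr.ne'] at this
    have h4 := Real.mul_self_sqrt (show 0 ≤ a - 1 by linarith)
    have h5 : √(a - 1) * (gammaPDFReal a r t * √(a - 1)) ≤ √(a - 1) * r := by
      calc _ = √(a - 1) * √(a - 1) * gammaPDFReal a r t := by ring
        _ ≤ _ := by rw [h4]; linarith
    exact le_of_mul_le_mul_left h5 hs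

/-! ### Integrating gamma densities over the shape -/

/-- A converse to log-convexity at the cost of a factor 2. The point m + 1 is the convex combination
of m + s and m + s + 1 with weights s and 1 - s; the recursion for Γ(m+s+1) then leaves only Γ(m+s),
and m + s ≤ 2m controls the extra power. -/
theorem half_mul_Gamma_le {m s : ℝ} (hm : 1 ≤ m) (hs : 0 < s) (hs1 : s < 1) :
    1 / 2 * (Real.Gamma m ^ (1 - s) * Real.Gamma (m + 1) ^ s) ≤ Real.Gamma (m + s) := by
  have hG := Real.Gamma_pos_of_pos (show 0 < m by linarith)
  have hGs := Real.Gamma_pos_of_pos (show 0 < m + s by linarith)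
  have h := Real.Gamma_mul_add_mul_le_rpow_Gamma_mul_rpow_Gamma
    (show 0 < m + s by linarith) (show 0 < m + s + 1 by linarith) hs
    (show 0 < 1 - s by linarith) (by ring)
  rw [show s * (m + s) + (1 - s) * (m + s + 1) = m + 1 by ring, Real.Gamma_add_one (by linarith),
    Real.Gamma_add_one (by linarith), Real.mul_rpow (by linarith) hGs.le, mul_left_comm,
    ← Real.rpow_add hGs, add_sub_cancel, Real.rpow_one] at h
  have e : Real.Gamma m ^ (1 - s) * (m ^ s * Real.Gamma m ^ s) = m ^ s * Real.Gamma m := by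
    rw [mul_left_comm, ← Real.rpow_add hG, sub_add_cancel, Real.rpow_one]
  rw [Real.Gamma_add_one (by linarith), Real.mul_rpow (by linarith) hG.le, e]
  have h5 : (m + s) ^ (1 - s) ≤ 2 * m ^ (1 - s) := by
    calc (m + s) ^ (1 - s) ≤ (2 * m) ^ (1 - s) :=
          Real.rpow_le_rpow (by linarith) (by linarith) (by linarith)
      _ = 2 ^ (1 - s) * m ^ (1 - s) := Real.mul_rpow (by norm_num) (by linarith)
      _ ≤ 2 * m ^ (1 - s) := by
          gcongr
          calc (2 : ℝ) ^ (1 - s) ≤ 2 ^ (1 : ℝ) :=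
                Real.rpow_le_rpow_of_exponent_le (by norm_num) (by linarith)
            _ = 2 := by norm_num
  have hmp : 0 < m ^ (1 - s) := Real.rpow_pos_of_pos (by linarith) _
  have h6 : m * Real.Gamma m ≤ 2 * m ^ (1 - s) * Real.Gamma (m + s) :=
    h.trans (mul_le_mul_of_nonneg_right h5 hGs.le)
  have h7 : m = m ^ (1 - s) * m ^ s := by
    rw [← Real.rpow_add (by linarith), sub_add_cancel, Real.rpow_one]
  have h8 : m ^ (1 - s) * (m ^ s * Real.Gamma m) ≤ m ^ (1 - s) * (2 * Real.Gamma (m + s)) := by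
    calc _ = m * Real.Gamma m := by rw [← mul_assoc, ← h7]
      _ ≤ _ := h6.trans_eq (by ring)
  have := le_of_mul_le_mul_left h8 hmp
  linarith

/-- Without its normalization the density is log-linear in the shape. The normalization costs a
factor 2, and the weighted arithmetic-geometric mean inequality replaces the geometric mean of the
neighbouring shapes by their sum. -/
theorem gammaPDFReal_add_le {m s t : ℝ} (hm : 1 ≤ m) (hs : 0 ≤ s) (hs1 : s < 1) (ht : 0 < t) :
    gammaPDFReal (m + s) 1 t ≤ 2 * (gammaPDFReal m 1 t + gammaPDFReal (m + 1) 1 t) := by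
  have p1 := gammaPDFReal_pos (show 0 < m by linarith) one_pos ht
  have p2 := gammaPDFReal_pos (show 0 < m + 1 by linarith) one_pos ht
  rcases hs.eq_or_lt with rfl | hs
  · rw [add_zero]; linarith
  have hG := Real.Gamma_pos_of_pos (show 0 < m by linarith)
  have hG1 := Real.Gamma_pos_of_pos (show 0 < m + 1 by linarith)
  have hGs := Real.Gamma_pos_of_pos (show 0 < m + s by linarith)
  have key : gammaPDFReal (m + s) 1 t ≤
      2 * (gammaPDFReal m 1 t ^ (1 - s) * gammaPDFReal (m + 1) 1 t ^ s) := by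
    have h := half_mul_Gamma_le hm hs hs1
    simp only [gammaPDFReal_of_pos _ _ ht, Real.one_rpow, one_mul]
    have e : ∀ c u : ℝ, 0 < c → (1 / c * t ^ (u - 1) * Real.exp (-t)) =
        t ^ (u - 1) * Real.exp (-t) / c := fun c u hc => by field_simp
    rw [e _ _ hG, e _ _ hG1, e _ _ hGs, Real.div_rpow (by positivity) hG.le,
      Real.div_rpow (by positivity) hG1.le, Real.mul_rpow (by positivity) (by positivity),
      Real.mul_rpow (by positivity) (by positivity), ← Real.rpow_mul ht.le, ← Real.rpow_mul ht.le,
      div_mul_div_comm, mul_mul_mul_comm, ← Real.rpow_add ht, ← Real.rpow_add (Real.exp_pos _),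
      sub_add_cancel, Real.rpow_one, show (m - 1) * (1 - s) + (m + 1 - 1) * s = m + s - 1 by ring,
      ← mul_div_assoc, div_le_div_iff₀ hGs (by positivity)]
    have : 0 < t ^ (m + s - 1) * Real.exp (-t) := by positivity
    nlinarith
  refine key.trans ?_
  have h9 := Real.geom_mean_le_arith_mean2_weighted (show 0 ≤ 1 - s by linarith) hs.le p1.le p2.le
    (by ring)
  nlinarith

/-- At unit rate and shape m + 1 the density at t is the Poisson probability of m with parameter t.
-/
theorem tsum_gammaPDFReal_natCast {t : ℝ} (ht : 0 < t) :
    ∑' m : ℕ, ENNReal.ofReal (gammaPDFReal ((m : ℝ) + 1) 1 t) = 1 := by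
  have h : ∀ m : ℕ, gammaPDFReal ((m : ℝ) + 1) 1 t = Real.exp (-t) * (t ^ m / m.factorial) :=
    fun m => by
      rw [gammaPDFReal_of_pos _ _ ht, Real.Gamma_nat_eq_factorial, add_sub_cancel_right,
        Real.rpow_natCast, Real.one_rpow, one_mul]
      ring
  have hs : HasSum (fun m : ℕ => t ^ m / m.factorial) (Real.exp t) := by
    rw [Real.exp_eq_exp_ℝ]; exact NormedSpace.expSeries_div_hasSum_exp t
  have hs' := hs.mul_left (Real.exp (-t))
  rw [← Real.exp_add, neg_add_cancel, Real.exp_zero] at hs'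
  simp_rw [h]
  rw [← ENNReal.ofReal_tsum_of_nonneg (fun m => by positivity) hs'.summable, hs'.tsum_eq,
    ENNReal.ofReal_one]

/-- On each unit interval of shapes the density is at most twice the sum of its values at the two
end shapes, and the end values sum to at most 1 each: 2·(1 + 1) = 4. This is the source of all
column bounds in the Schur test. -/
theorem lintegral_gammaPDFReal_shape_le {t : ℝ} (ht : 0 < t) :
    ∫⁻ u in Ici 1, ENNReal.ofReal (gammaPDFReal u 1 t) ≤ 4 := by
  have hU : (Ici (1 : ℝ)) = ⋃ m : ℕ, Ico ((m : ℝ) + 1) ((m : ℝ) + 1 + 1) := by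
    ext u
    simp only [mem_Ici, mem_iUnion, mem_Ico]
    constructor
    · intro hu
      refine ⟨⌊u - 1⌋₊, ?_, ?_⟩
      · linarith [Nat.floor_le (show 0 ≤ u - 1 by linarith)]
      · linarith [Nat.lt_floor_add_one (u - 1)]
    · rintro ⟨m, hm, -⟩
      have : (0 : ℝ) ≤ m := m.cast_nonneg
      linarith
  rw [hU]
  refine (lintegral_iUnion_le _ _).trans ?_
  have hb : ∀ m : ℕ, ∫⁻ u in Ico ((m : ℝ) + 1) ((m : ℝ) + 1 + 1),
      ENNReal.ofReal (gammaPDFReal u 1 t) ≤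
      2 * (ENNReal.ofReal (gammaPDFReal ((m : ℝ) + 1) 1 t) +
        ENNReal.ofReal (gammaPDFReal (((m + 1 : ℕ) : ℝ) + 1) 1 t)) := by
    intro m
    have hm : (1 : ℝ) ≤ (m : ℝ) + 1 := by linarith [(m.cast_nonneg : (0 : ℝ) ≤ m)]
    have p1 := gammaPDFReal_nonneg (show 0 < (m : ℝ) + 1 by linarith) one_pos t
    have p2 := gammaPDFReal_nonneg (show 0 < (m : ℝ) + 1 + 1 by linarith) one_pos t
    calc _ ≤ ∫⁻ u in Ico ((m : ℝ) + 1) ((m : ℝ) + 1 + 1), ENNReal.ofReal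
          (2 * (gammaPDFReal ((m : ℝ) + 1) 1 t + gammaPDFReal ((m : ℝ) + 1 + 1) 1 t)) := by
          refine setLIntegral_mono' measurableSet_Ico fun u hu => ENNReal.ofReal_le_ofReal ?_
          have := gammaPDFReal_add_le (s := u - (m + 1)) hm (by linarith [hu.1])
            (by linarith [hu.2]) ht
          rwa [add_sub_cancel] at this
      _ = _ := by
          rw [setLIntegral_const, Real.volume_Ico, ENNReal.ofReal_mul (by norm_num),
            ENNReal.ofReal_add p1 p2]
          simp
  refine (ENNReal.tsum_le_tsum hb).trans ?_
  rw [ENNReal.tsum_mul_left, ENNReal.tsum_add, tsum_gammaPDFReal_natCast ht]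
  have h2 : ∑' m : ℕ, ENNReal.ofReal (gammaPDFReal (((m + 1 : ℕ) : ℝ) + 1) 1 t) ≤ 1 := by
    rw [← tsum_gammaPDFReal_natCast ht]
    exact ENNReal.tsum_comp_le_tsum_of_injective (add_left_injective 1)
      (fun m : ℕ => ENNReal.ofReal (gammaPDFReal ((m : ℝ) + 1) 1 t))
  calc (2 : ENNReal) * (1 + _) ≤ 2 * (1 + 1) := by gcongr
    _ = 4 := by norm_num

/-! ### Kernel operators acting on one coordinate -/

theorem orthantVolume_eq_pi (τ : ℕ) :
    orthantVolume τ = Measure.pi fun _ => (volume.restrict (Ioi 0) : Measure ℝ) := by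
  have h : orthant τ = univ.pi fun _ => Ioi 0 := by
    ext x
    simp [orthant, Set.mem_pi]
  rw [orthantVolume, volume_pi, h, Measure.restrict_pi_pi]

theorem isOpen_orthant (τ : ℕ) : IsOpen (orthant τ) := by
  have : orthant τ = ⋂ j, {x | 0 < x j} := by ext; simp [orthant]
  rw [this]
  exact isOpen_iInter_of_finite fun j => isOpen_lt continuous_const (continuous_apply j)

theorem measurableSet_orthant (τ : ℕ) : MeasurableSet (orthant τ) := (isOpen_orthant τ).measurableSet

theorem ae_mem_orthant (τ : ℕ) : ∀ᵐ x ∂orthantVolume τ, x ∈ orthant τ :=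
  ae_restrict_mem (measurableSet_orthant τ)

instance (τ : ℕ) : SigmaFinite (orthantVolume τ) := by
  rw [orthantVolume_eq_pi]; infer_instance

instance (τ : ℕ) : (orthantVolume τ).Regular := by
  rw [orthantVolume_eq_pi]; infer_instance

variable {τ : ℕ}

/-- The integral operator with kernel `Q`, acting on the coordinate `j`. -/
noncomputable def coordOp (Q : ℝ → ℝ → ℝ) (j : Fin (τ + 1)) (u : (Fin (τ + 1) → ℝ) → ℝ)
    (x : Fin (τ + 1) → ℝ) : ℝ :=
  ∫ t in Ioi 0, Q (x j) t * u (Function.update x j t)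

/-- The integral operator with the absolute kernel, applied to the absolute value. -/
noncomputable def coordAbs (Q : ℝ → ℝ → ℝ) (j : Fin (τ + 1)) (u : (Fin (τ + 1) → ℝ) → ℝ)
    (x : Fin (τ + 1) → ℝ) : ℝ≥0∞ :=
  ∫⁻ t in Ioi 0, ‖Q (x j) t‖ₑ * ‖u (Function.update x j t)‖ₑ

theorem measurable_update_pair (j : Fin (τ + 1)) :
    Measurable fun z : (Fin (τ + 1) → ℝ) × ℝ => Function.update z.1 j z.2 := by
  refine measurable_pi_iff.2 fun i => ?_
  by_cases h : i = j
  · subst h; simpa using measurable_snd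
  · simp only [Function.update_of_ne h]
    exact (measurable_pi_apply i).comp measurable_fst

/-- Tonelli's theorem for a kernel acting on one coordinate. -/
theorem lintegral_coord_kernel {K : ℝ → ℝ → ℝ≥0∞} (hK : Measurable (Function.uncurry K))
    (j : Fin (τ + 1)) {A : (Fin (τ + 1) → ℝ) → ℝ≥0∞} (hA : Measurable A) :
    ∫⁻ x, (∫⁻ t in Ioi 0, K (x j) t * A (Function.update x j t)) ∂orthantVolume τ =
      ∫⁻ x, (∫⁻ s in Ioi 0, K s (x j)) * A x ∂orthantVolume τ := by
  have hm : Measurable fun z : (Fin (τ + 1) → ℝ) × ℝ => K (z.1 j) z.2 *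
      A (Function.update z.1 j z.2) := by
    have h1 : Measurable fun z : (Fin (τ + 1) → ℝ) × ℝ => (z.1 j, z.2) := by fun_prop
    exact (hK.comp h1).mul (hA.comp (measurable_update_pair j))
  rw [orthantVolume_eq_pi]
  -- It is enough to compare the integrals over the coordinate j alone, where the claim is a swap of
  -- two one-dimensional integrals.
  refine lintegral_eq_of_lmarginal_eq {j} hm.lintegral_prod_right' ?_ ?_
  · refine Measurable.mul ?_ hA
    exact (hK.comp measurable_swap).lintegral_prod_right'.comp (measurable_pi_apply j)
  · rw [lmarginal_singleton, lmarginal_singleton]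
    funext x
    simp only [Function.update_self, Function.update_idem]
    rw [lintegral_lintegral_swap]
    · refine lintegral_congr fun t => ?_
      rw [lintegral_mul_const]
      exact hK.comp (measurable_id.prodMk measurable_const)
    · exact (hK.mul ((hA.comp (measurable_update x)).comp measurable_snd)).aemeasurable

theorem lintegral_exp_neg_Ioi : ∫⁻ s in Ioi (0 : ℝ), ENNReal.ofReal (Real.exp (-s)) = 1 := by
  have h := lintegral_Ioi_gammaPDFReal one_pos one_pos
  rw [← h]
  refine setLIntegral_congr_fun measurableSet_Ioi fun t ht => ?_
  simp [gammaPDFReal_of_pos _ _ ht]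

/-- A slice integral does not depend on x_j, so a probability weight in x_j makes its integral over
the orthant equal to the full integral. Null sets and inequalities on slices pass to the orthant in
this way. -/
theorem lintegral_slices (j : Fin (τ + 1)) {A : (Fin (τ + 1) → ℝ) → ℝ≥0∞} (hA : Measurable A) :
    ∫⁻ x, ENNReal.ofReal (Real.exp (-(x j))) * (∫⁻ t in Ioi 0, A (Function.update x j t))
      ∂orthantVolume τ = ∫⁻ x, A x ∂orthantVolume τ := by
  have hK : Measurable (Function.uncurry fun (s : ℝ) (_ : ℝ) => ENNReal.ofReal (Real.exp (-s))) := by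
    fun_prop
  have h := lintegral_coord_kernel hK j hA
  simp only [lintegral_exp_neg_Ioi, one_mul] at h
  rw [← h]
  refine lintegral_congr fun x => ?_
  exact (lintegral_const_mul _ (hA.comp (measurable_update x))).symm

theorem ae_ae_slice (j : Fin (τ + 1)) {p : (Fin (τ + 1) → ℝ) → Prop}
    (h : ∀ᵐ x ∂orthantVolume τ, p x) :
    ∀ᵐ x ∂orthantVolume τ, ∀ᵐ t ∂(volume.restrict (Ioi 0) : Measure ℝ),
      p (Function.update x j t) := by
  obtain ⟨N, hN, hNm, hN0⟩ := exists_measurable_superset_of_null (ae_iff.1 h)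
  have h1 := lintegral_slices (τ := τ) j (A := N.indicator 1) (measurable_one.indicator hNm)
  have hm : Measurable fun x : Fin (τ + 1) → ℝ => ∫⁻ t in Ioi 0,
      N.indicator (1 : (Fin (τ + 1) → ℝ) → ℝ≥0∞) (Function.update x j t) :=
    ((measurable_one.indicator hNm).comp (measurable_update_pair j)).lintegral_prod_right'
  have hm2 : Measurable fun x : Fin (τ + 1) → ℝ => ENNReal.ofReal (Real.exp (-(x j))) := by fun_prop
  rw [lintegral_indicator_one hNm, hN0] at h1
  have h1' := (lintegral_eq_zero_iff (hm2.mul hm)).1 h1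
  filter_upwards [h1'] with x hx
  have hx0 : ∫⁻ t in Ioi 0, N.indicator (1 : (Fin (τ + 1) → ℝ) → ℝ≥0∞) (Function.update x j t) = 0 := by
    rcases mul_eq_zero.1 hx with h | h
    · simp [not_le.2 (Real.exp_pos _)] at h
    · exact h
  have hx1 := (lintegral_eq_zero_iff ((measurable_one.indicator hNm).comp (measurable_update x))).1 hx0
  filter_upwards [hx1] with t ht
  by_contra hp
  have : Function.update x j t ∈ N := hN hp
  simp [this] at ht

/-- Bounds for the row and column sums of a kernel on the half line. -/
structure KernelBound (Q : ℝ → ℝ → ℝ) (C : ℝ≥0) : Prop where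
  meas : Measurable (Function.uncurry Q)
  row : ∀ x, 0 < x → ∫⁻ t in Ioi 0, ‖Q x t‖ₑ ≤ C
  col : ∀ t, 0 < t → ∫⁻ x in Ioi 0, ‖Q x t‖ₑ ≤ C

/-- Jensen's inequality for the measure with density k, which need not have mass one. -/
theorem rpow_lintegral_mul_le {α : Type*} [MeasurableSpace α] (μ : Measure α) {k : α → ℝ≥0∞}
    (hk : Measurable k) {a : α → ℝ} (ha : Measurable a) {p : ℝ} (hp : 1 ≤ p) :
    (∫⁻ t, k t * ‖a t‖ₑ ∂μ) ^ p ≤ (∫⁻ t, k t ∂μ) ^ (p - 1) * ∫⁻ t, k t * ‖a t‖ₑ ^ p ∂μ := by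
  have hp0 : 0 < p := by linarith
  have h := eLpNorm'_le_eLpNorm'_mul_rpow_measure_univ (μ := μ.withDensity k) one_pos hp
    (ha.aestronglyMeasurable (f := a))
  simp only [eLpNorm'] at h
  rw [lintegral_withDensity_eq_lintegral_mul _ hk (by fun_prop),
    lintegral_withDensity_eq_lintegral_mul _ hk (by fun_prop), withDensity_apply _ .univ,
    Measure.restrict_univ] at h
  simp only [Pi.mul_apply, ENNReal.rpow_one, div_one] at h
  calc _ ≤ ((∫⁻ t, k t * ‖a t‖ₑ ^ p ∂μ) ^ (1 / p) * (∫⁻ t, k t ∂μ) ^ (1 - 1 / p)) ^ p := by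
        gcongr
    _ = _ := by
        rw [ENNReal.mul_rpow_of_nonneg _ _ hp0.le, ← ENNReal.rpow_mul, ← ENNReal.rpow_mul,
          one_div_mul_cancel hp0.ne', ENNReal.rpow_one, mul_comm, sub_mul, one_mul,
          one_div_mul_cancel hp0.ne']

theorem enorm_coordOp_le (Q : ℝ → ℝ → ℝ) (j : Fin (τ + 1)) (u : (Fin (τ + 1) → ℝ) → ℝ)
    (x : Fin (τ + 1) → ℝ) : ‖coordOp Q j u x‖ₑ ≤ coordAbs Q j u x := by
  refine (enorm_integral_le_lintegral_enorm _).trans_eq ?_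
  simp only [enorm_mul, coordAbs]

section
variable {Q : ℝ → ℝ → ℝ} {C : ℝ≥0} {u v : (Fin (τ + 1) → ℝ) → ℝ} {p : ℝ≥0∞}

theorem measurable_coord_integrand (hQ : Measurable (Function.uncurry Q)) (hu : Measurable u)
    (j : Fin (τ + 1)) : Measurable fun z : (Fin (τ + 1) → ℝ) × ℝ =>
      Q (z.1 j) z.2 * u (Function.update z.1 j z.2) := by
  have h1 : Measurable fun z : (Fin (τ + 1) → ℝ) × ℝ => (z.1 j, z.2) := by fun_prop
  exact (hQ.comp h1).mul (hu.comp (measurable_update_pair j))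

theorem measurable_coordOp (hQ : Measurable (Function.uncurry Q)) (hu : Measurable u)
    (j : Fin (τ + 1)) : Measurable (coordOp Q j u) :=
  (measurable_coord_integrand hQ hu j).stronglyMeasurable.integral_prod_right'.measurable

theorem measurable_coordAbs (hQ : Measurable (Function.uncurry Q)) (hu : Measurable u)
    (j : Fin (τ + 1)) : Measurable (coordAbs Q j u) := by
  have := (measurable_coord_integrand hQ hu j).enorm.lintegral_prod_right' (ν := volume.restrict (Ioi 0))
  simp only [enorm_mul] at this
  exact this

/-- Schur test. Jensen in each row costs C^(p-1) by the row bound; Tonelli and the column bound cost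
another C. -/
theorem eLpNorm_coordAbs_le (hQ : KernelBound Q C) (hu : Measurable u) (hp : 1 ≤ p) (hp' : p ≠ ∞)
    (j : Fin (τ + 1)) :
    eLpNorm (coordAbs Q j u) p (orthantVolume τ) ≤ C * eLpNorm u p (orthantVolume τ) := by
  have hp0 : p ≠ 0 := (zero_lt_one.trans_le hp).ne'
  have hr : 1 ≤ p.toReal := by
    rw [← ENNReal.toReal_one]; exact ENNReal.toReal_mono hp' hp
  have hr0 : 0 < p.toReal := by linarith
  rw [eLpNorm_eq_lintegral_rpow_enorm_toReal hp0 hp', eLpNorm_eq_lintegral_rpow_enorm_toReal hp0 hp']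
  have hQm : ∀ x, Measurable fun t => ‖Q x t‖ₑ := fun x =>
    (hQ.meas.comp (measurable_const.prodMk measurable_id)).enorm
  have key : ∫⁻ x, ‖coordAbs Q j u x‖ₑ ^ p.toReal ∂orthantVolume τ ≤
      (C : ℝ≥0∞) ^ p.toReal * ∫⁻ x, ‖u x‖ₑ ^ p.toReal ∂orthantVolume τ := by
    calc _ ≤ ∫⁻ x, (C : ℝ≥0∞) ^ (p.toReal - 1) * (∫⁻ t in Ioi 0, ‖Q (x j) t‖ₑ *
          ‖u (Function.update x j t)‖ₑ ^ p.toReal) ∂orthantVolume τ := by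
          refine lintegral_mono_ae ?_
          filter_upwards [ae_mem_orthant τ] with x hx
          rw [enorm_eq_self]
          refine (rpow_lintegral_mul_le _ (hQm _) (hu.comp (measurable_update x)) hr).trans ?_
          exact mul_le_mul_left (ENNReal.rpow_le_rpow (hQ.row _ (hx j)) (by linarith)) _
      _ = (C : ℝ≥0∞) ^ (p.toReal - 1) * ∫⁻ x, (∫⁻ s in Ioi 0, ‖Q s (x j)‖ₑ) * ‖u x‖ₑ ^ p.toReal
          ∂orthantVolume τ := by
          rw [lintegral_const_mul, lintegral_coord_kernel (K := fun s t => ‖Q s t‖ₑ)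
            (A := fun x => ‖u x‖ₑ ^ p.toReal) hQ.meas.enorm j (by fun_prop)]
          refine Measurable.lintegral_prod_right' (f := fun z : (Fin (τ + 1) → ℝ) × ℝ =>
            ‖Q (z.1 j) z.2‖ₑ * ‖u (Function.update z.1 j z.2)‖ₑ ^ p.toReal) ?_
          have h1 : Measurable fun z : (Fin (τ + 1) → ℝ) × ℝ => (z.1 j, z.2) := by fun_prop
          exact (hQ.meas.comp h1).enorm.mul
            ((hu.comp (measurable_update_pair j)).enorm.pow_const _)
      _ ≤ (C : ℝ≥0∞) ^ (p.toReal - 1) * ∫⁻ x, C * ‖u x‖ₑ ^ p.toReal ∂orthantVolume τ := by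
          gcongr _ * ?_
          refine lintegral_mono_ae ?_
          filter_upwards [ae_mem_orthant τ] with x hx
          gcongr
          exact hQ.col _ (hx j)
      _ = _ := by
          rw [lintegral_const_mul _ (by fun_prop), ← mul_assoc]
          congr 1
          nth_rewrite 2 [← ENNReal.rpow_one (C : ℝ≥0∞)]
          rw [← ENNReal.rpow_add_of_nonneg _ _ (by linarith) zero_le_one, sub_add_cancel]
  refine (ENNReal.rpow_le_rpow key (by positivity)).trans_eq ?_
  rw [ENNReal.mul_rpow_of_nonneg _ _ (by positivity), ← ENNReal.rpow_mul, mul_one_div_cancel hr0.ne',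
    ENNReal.rpow_one]

theorem ae_coordAbs_lt_top (hQ : KernelBound Q C) (hu : Measurable u) (hp : 1 ≤ p) (hp' : p ≠ ∞)
    (hup : MemLp u p (orthantVolume τ)) (j : Fin (τ + 1)) :
    ∀ᵐ x ∂orthantVolume τ, coordAbs Q j u x < ∞ := by
  have hp0 : p ≠ 0 := (zero_lt_one.trans_le hp).ne'
  have h : eLpNorm (coordAbs Q j u) p (orthantVolume τ) < ∞ :=
    (eLpNorm_coordAbs_le hQ hu hp hp' j).trans_lt (ENNReal.mul_lt_top ENNReal.coe_lt_top hup.2)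
  have hr0 : 0 < p.toReal := ENNReal.toReal_pos hp0 hp'
  have h2 := lintegral_rpow_enorm_lt_top_of_eLpNorm_lt_top hp0 hp' h
  filter_upwards [ae_lt_top ((measurable_coordAbs hQ.meas hu j).enorm.pow_const _) h2.ne] with x hx
  rw [enorm_eq_self] at hx
  exact (ENNReal.rpow_lt_top_iff_of_pos hr0).1 hx

theorem integrable_of_coordAbs_lt_top (hQ : Measurable (Function.uncurry Q)) (hu : Measurable u)
    {j : Fin (τ + 1)} {x : Fin (τ + 1) → ℝ} (h : coordAbs Q j u x < ∞) :
    Integrable (fun t => Q (x j) t * u (Function.update x j t)) (volume.restrict (Ioi 0)) := by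
  refine ⟨((measurable_coord_integrand hQ hu j).comp
    (measurable_const.prodMk measurable_id)).aestronglyMeasurable, ?_⟩
  rw [hasFiniteIntegral_iff_enorm]
  simpa only [enorm_mul, coordAbs] using h

theorem eLpNorm_coordOp_le (hQ : KernelBound Q C) (hu : Measurable u) (hp : 1 ≤ p) (hp' : p ≠ ∞)
    (j : Fin (τ + 1)) :
    eLpNorm (coordOp Q j u) p (orthantVolume τ) ≤ C * eLpNorm u p (orthantVolume τ) :=
  (eLpNorm_mono_enorm fun x => by
    rw [enorm_eq_self]; exact enorm_coordOp_le Q j u x).trans (eLpNorm_coordAbs_le hQ hu hp hp' j)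

theorem memLp_coordOp (hQ : KernelBound Q C) (hu : Measurable u) (hp : 1 ≤ p) (hp' : p ≠ ∞)
    (hup : MemLp u p (orthantVolume τ)) (j : Fin (τ + 1)) :
    MemLp (coordOp Q j u) p (orthantVolume τ) :=
  ⟨(measurable_coordOp hQ.meas hu j).aestronglyMeasurable,
    (eLpNorm_coordOp_le hQ hu hp hp' j).trans_lt (ENNReal.mul_lt_top ENNReal.coe_lt_top hup.2)⟩

theorem coordOp_sub_ae (hQ : KernelBound Q C) (hu : Measurable u) (hv : Measurable v) (hp : 1 ≤ p)
    (hp' : p ≠ ∞) (hup : MemLp u p (orthantVolume τ)) (hvp : MemLp v p (orthantVolume τ))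
    (j : Fin (τ + 1)) :
    coordOp Q j (u - v) =ᵐ[orthantVolume τ] coordOp Q j u - coordOp Q j v := by
  filter_upwards [ae_coordAbs_lt_top hQ hu hp hp' hup j, ae_coordAbs_lt_top hQ hv hp hp' hvp j]
    with x hx hx'
  simp only [coordOp, Pi.sub_apply, mul_sub]
  exact integral_sub (integrable_of_coordAbs_lt_top hQ.meas hu hx)
    (integrable_of_coordAbs_lt_top hQ.meas hv hx')

theorem eLpNorm_coordOp_sub_le (hQ : KernelBound Q C) (hu : Measurable u) (hv : Measurable v)
    (hp : 1 ≤ p) (hp' : p ≠ ∞) (hup : MemLp u p (orthantVolume τ))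
    (hvp : MemLp v p (orthantVolume τ)) (j : Fin (τ + 1)) :
    eLpNorm (coordOp Q j u - coordOp Q j v) p (orthantVolume τ) ≤
      C * eLpNorm (u - v) p (orthantVolume τ) := by
  rw [← eLpNorm_congr_ae (coordOp_sub_ae hQ hu hv hp hp' hup hvp j)]
  exact eLpNorm_coordOp_le hQ (hu.sub hv) hp hp' j

end

/-- A family of kernels on the half line, indexed by `b > 0`, that converges to `c` times the
identity as `b → 0`, with the control needed for convergence in `L^p`. -/
structure IsApproxIdentity (Q : ℝ → ℝ → ℝ → ℝ) (c : ℝ) (p : ℝ≥0∞) : Prop where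
  bound : ∃ C : ℝ≥0, ∀ b, 0 < b → KernelBound (Q b) C
  mass : ∀ x, 0 < x → Tendsto (fun b => ∫ t in Ioi 0, Q b x t) (𝓝[>] 0) (𝓝 c)
  conc : ∀ x, 0 < x → Tendsto (fun b => ∫⁻ t in Ioi 0, ‖Q b x t‖ₑ * ENNReal.ofReal ((t - x) ^ 2))
    (𝓝[>] 0) (𝓝 0)
  -- A function supported in coordinates at most R is not mapped to one with bounded support. The
  -- mass that rows at x > 2R place on (0, R] therefore needs a p-integrable majorant independent of
  -- b.
  tail : ∀ R, 0 < R → ∃ D : ℝ → ℝ≥0∞, Measurable D ∧ ∫⁻ x in Ioi (2 * R), D x ^ p.toReal < ∞ ∧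
    ∀ᶠ b in 𝓝[>] 0, ∀ x, 2 * R < x → ∫⁻ t in Ioc 0 R, ‖Q b x t‖ₑ ≤ D x

/-! ### Strong convergence of approximate identities on L^p -/

section
variable {Q : ℝ → ℝ → ℝ → ℝ} {c : ℝ} {p : ℝ≥0∞}

/-- Chebyshev's argument: a bounded continuous slice differs from its value at x_j by at most ε +
(2B/η²)(t - x_j)². The row mass bounds the first term, and `conc` sends the second to 0. -/
theorem IsApproxIdentity.tendsto_apply (hQ : IsApproxIdentity Q c p) {φ : (Fin (τ + 1) → ℝ) → ℝ}
    (hφ : Continuous φ) {B : ℝ} (hB : ∀ x, |φ x| ≤ B) (j : Fin (τ + 1)) {x : Fin (τ + 1) → ℝ}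
    (hx : 0 < x j) :
    Tendsto (fun b => ‖coordOp (Q b) j φ x - c * φ x‖ₑ) (𝓝[>] 0) (𝓝 0) := by
  obtain ⟨C, hC⟩ := hQ.bound
  have hB0 : 0 ≤ B := (abs_nonneg _).trans (hB x)
  have hpos : ∀ᶠ b : ℝ in 𝓝[>] 0, 0 < b := eventually_mem_nhdsWithin
  set I : ℝ → ℝ≥0∞ := fun b => ∫⁻ t in Ioi 0, ‖Q b (x j) t‖ₑ * ENNReal.ofReal ((t - x j) ^ 2)
  have hmain : ∀ ε : ℝ, 0 < ε → ∃ A : ℝ, 0 ≤ A ∧ ∀ b, 0 < b → ‖coordOp (Q b) j φ x - c * φ x‖ₑ ≤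
      ENNReal.ofReal ε * C + ENNReal.ofReal A * I b +
        ‖(∫ t in Ioi 0, Q b (x j) t) - c‖ₑ * ENNReal.ofReal B := by
    intro ε hε
    have hcont : Continuous fun t => φ (Function.update x j t) :=
      hφ.comp (continuous_const.update j continuous_id)
    have h0 : Tendsto (fun t => φ (Function.update x j t)) (𝓝 (x j)) (𝓝 (φ x)) := by
      have := hcont.tendsto (x j)
      rwa [Function.update_eq_self] at this
    obtain ⟨η, hη, hη'⟩ := Metric.tendsto_nhds_nhds.1 h0 ε hε
    refine ⟨2 * B / η ^ 2, by positivity, fun b hb => ?_⟩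
    have hKB := hC b hb
    have hmQ : Measurable fun t => Q b (x j) t := hKB.meas.comp (measurable_const.prodMk measurable_id)
    have hQi : Integrable (fun t => Q b (x j) t) (volume.restrict (Ioi 0)) :=
      ⟨hmQ.aestronglyMeasurable, (hKB.row _ hx).trans_lt ENNReal.coe_lt_top⟩
    have hQφ : Integrable (fun t => Q b (x j) t * φ (Function.update x j t))
        (volume.restrict (Ioi 0)) :=
      hQi.mul_bdd (c := B) hcont.aestronglyMeasurable (ae_of_all _ fun t => hB _)
    have hb1 : ∀ t, |φ (Function.update x j t) - φ x| ≤ ε + 2 * B / η ^ 2 * (t - x j) ^ 2 := by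
      intro t
      by_cases ht : dist t (x j) < η
      · have := (hη' ht).le
        rw [Real.dist_eq] at this
        have : 0 ≤ 2 * B / η ^ 2 * (t - x j) ^ 2 := by positivity
        linarith
      · rw [Real.dist_eq, not_lt] at ht
        have h1 : |φ (Function.update x j t) - φ x| ≤ 2 * B := by
          have := abs_sub (φ (Function.update x j t)) (φ x)
          linarith [hB (Function.update x j t), hB x]
        have h2 : η ^ 2 ≤ (t - x j) ^ 2 := by
          rw [← sq_abs (t - x j)]; gcongr
        have h3 : 2 * B ≤ 2 * B / η ^ 2 * (t - x j) ^ 2 := by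
          rw [div_mul_eq_mul_div, le_div_iff₀ (by positivity)]
          exact mul_le_mul_of_nonneg_left h2 (by positivity)
        linarith
    have hsplit : coordOp (Q b) j φ x - c * φ x =
        (∫ t in Ioi 0, Q b (x j) t * (φ (Function.update x j t) - φ x)) +
          ((∫ t in Ioi 0, Q b (x j) t) - c) * φ x := by
      simp only [mul_sub]
      rw [integral_sub hQφ (hQi.mul_const _), integral_mul_const, coordOp]
      ring
    rw [hsplit]
    refine (enorm_add_le _ _).trans (add_le_add ?_ ?_)
    · refine (enorm_integral_le_lintegral_enorm _).trans ?_
      calc _ ≤ ∫⁻ t in Ioi 0, (ENNReal.ofReal ε * ‖Q b (x j) t‖ₑ + ENNReal.ofReal (2 * B / η ^ 2) *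
            (‖Q b (x j) t‖ₑ * ENNReal.ofReal ((t - x j) ^ 2))) := by
            refine lintegral_mono fun t => ?_
            rw [enorm_mul, mul_left_comm, mul_comm (ENNReal.ofReal ε), ← mul_add,
              ← ENNReal.ofReal_mul (by positivity), ← ENNReal.ofReal_add hε.le (by positivity)]
            gcongr
            rw [Real.enorm_eq_ofReal_abs]
            exact ENNReal.ofReal_le_ofReal (hb1 t)
        _ = ENNReal.ofReal ε * (∫⁻ t in Ioi 0, ‖Q b (x j) t‖ₑ) + ENNReal.ofReal (2 * B / η ^ 2) *
            I b := by
            rw [lintegral_add_left (by fun_prop), lintegral_const_mul _ (by fun_prop),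
              lintegral_const_mul _ (by fun_prop)]
        _ ≤ _ := by
            gcongr
            exact hKB.row _ hx
    · rw [enorm_mul]
      gcongr
      rw [Real.enorm_eq_ofReal_abs]
      exact ENNReal.ofReal_le_ofReal (hB x)
  have hmass : Tendsto (fun b => ‖(∫ t in Ioi 0, Q b (x j) t) - c‖ₑ * ENNReal.ofReal B)
      (𝓝[>] 0) (𝓝 0) := by
    have h1 : Tendsto (fun b => (∫ t in Ioi 0, Q b (x j) t) - c) (𝓝[>] 0) (𝓝 0) := by
      simpa using (hQ.mass _ hx).sub_const c
    have h2 := (continuous_enorm.tendsto (0 : ℝ)).comp h1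
    rw [enorm_zero] at h2
    simpa using ENNReal.Tendsto.mul_const h2 (Or.inr ENNReal.ofReal_ne_top)
  rw [ENNReal.tendsto_nhds_zero]
  intro ε hε
  by_cases hεt : ε = ∞
  · simp [hεt]
  obtain ⟨δ, hδ, hδε⟩ : ∃ δ : ℝ, 0 < δ ∧ ENNReal.ofReal δ * C ≤ ε / 3 := by
    refine ⟨(ε / 3).toReal / (C + 1), ?_, ?_⟩
    · have : 0 < (ε / 3).toReal := ENNReal.toReal_pos (by simp [hε.ne']) (by
        exact (ENNReal.div_lt_top hεt (by norm_num)).ne)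
      positivity
    · rw [← ENNReal.ofReal_coe_nnreal, ← ENNReal.ofReal_mul (by positivity)]
      refine ENNReal.ofReal_le_of_le_toReal ?_
      rw [div_mul_eq_mul_div, div_le_iff₀ (by positivity)]
      have : 0 ≤ (ε / 3).toReal := ENNReal.toReal_nonneg
      nlinarith
  obtain ⟨A, hA, hAb⟩ := hmain δ hδ
  have h2 : Tendsto (fun b => ENNReal.ofReal A * I b) (𝓝[>] 0) (𝓝 0) := by
    simpa using ENNReal.Tendsto.const_mul (hQ.conc _ hx) (Or.inr ENNReal.ofReal_ne_top)
  have hε3 : 0 < ε / 3 := by simp [hε.ne']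
  filter_upwards [hpos, ENNReal.tendsto_nhds_zero.1 h2 _ hε3,
    ENNReal.tendsto_nhds_zero.1 hmass _ hε3] with b hb h3 h4
  calc _ ≤ _ := hAb b hb
    _ ≤ ε / 3 + ε / 3 + ε / 3 := by gcongr
    _ = ε := ENNReal.add_thirds ε

/-- Dominated convergence: the limit is pointwise, and the majorant is constant for x_j ≤ 2R, comes
from `tail` for x_j > 2R, and vanishes once another coordinate exceeds R, where both functions are
0. -/
theorem IsApproxIdentity.tendsto_of_hasCompactSupport (hQ : IsApproxIdentity Q c p) (hp : 1 ≤ p)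
    (hp' : p ≠ ∞) {φ : (Fin (τ + 1) → ℝ) → ℝ} (hφ : Continuous φ) (hsupp : HasCompactSupport φ)
    (j : Fin (τ + 1)) :
    Tendsto (fun b => eLpNorm (coordOp (Q b) j φ - fun x => c * φ x) p (orthantVolume τ))
      (𝓝[>] 0) (𝓝 0) := by
  obtain ⟨C, hC⟩ := hQ.bound
  have hp0 : p ≠ 0 := (zero_lt_one.trans_le hp).ne'
  have hr0 : 0 < p.toReal := ENNReal.toReal_pos hp0 hp'
  have hpos : ∀ᶠ b : ℝ in 𝓝[>] 0, 0 < b := eventually_mem_nhdsWithin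
  obtain ⟨B, hB⟩ := hsupp.exists_bound_of_continuous hφ
  simp only [Real.norm_eq_abs] at hB
  have hB0 : 0 ≤ B := (abs_nonneg _).trans (hB 0)
  obtain ⟨R₀, hR₀⟩ := hsupp.isCompact.isBounded.subset_closedBall 0
  -- At least 1, so that the dummy coordinate t ∈ (0, 1] used below stays within the box `S`.
  set R : ℝ := max R₀ 1
  have hR1 : 1 ≤ R := le_max_right _ _
  have hR : 0 < R := by linarith
  have hzero : ∀ x i, R < x i → φ x = 0 := by
    intro x i hxi
    by_contra hne
    have := hR₀ (subset_tsupport _ hne)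
    rw [mem_closedBall_zero_iff] at this
    have h2 := norm_le_pi_norm x i
    rw [Real.norm_eq_abs] at h2
    linarith [le_abs_self (x i), le_max_left R₀ 1]
  obtain ⟨D, hDm, hD, hDb⟩ := hQ.tail R hR
  simp_rw [eLpNorm_eq_lintegral_rpow_enorm_toReal hp0 hp']
  suffices H : Tendsto (fun b => ∫⁻ x, ‖(coordOp (Q b) j φ - fun x => c * φ x) x‖ₑ ^ p.toReal
      ∂orthantVolume τ) (𝓝[>] 0) (𝓝 0) by
    have := (ENNReal.continuous_rpow_const (y := 1 / p.toReal)).tendsto 0 |>.comp H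
    rwa [ENNReal.zero_rpow_of_pos (by positivity)] at this
  set M : ℝ≥0∞ := (C + ‖c‖ₑ) * ENNReal.ofReal B
  set g : ℝ → ℝ≥0∞ := fun s => (if s ≤ 2 * R then M else ENNReal.ofReal B * D s) ^ p.toReal
  have hg : Measurable g :=
    (Measurable.ite measurableSet_Iic measurable_const (hDm.const_mul _)).pow_const _
  set S : Set (Fin (τ + 1) → ℝ) := Set.pi univ fun _ => Iic R
  have hS : MeasurableSet S := MeasurableSet.univ_pi fun _ => measurableSet_Iic
  set K : ℝ → ℝ → ℝ≥0∞ := fun s t => g s * (Iic (1 : ℝ)).indicator 1 t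
  have hK : Measurable (Function.uncurry K) :=
    (hg.comp measurable_fst).mul ((measurable_one.indicator measurableSet_Iic).comp measurable_snd)
  -- Equal to g(x_j) times the indicator that the other coordinates are at most R. It is written as
  -- a coordinate kernel so that `lintegral_coord_kernel` computes its integral.
  set G : (Fin (τ + 1) → ℝ) → ℝ≥0∞ := fun x =>
    ∫⁻ t in Ioi 0, K (x j) t * S.indicator 1 (Function.update x j t)
  have hgfin : ∫⁻ s in Ioi 0, g s < ∞ := by
    have hM : M < ∞ := ENNReal.mul_lt_top (by simp) ENNReal.ofReal_lt_top
    rw [← Ioc_union_Ioi_eq_Ioi (show (0 : ℝ) ≤ 2 * R by positivity)]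
    refine (lintegral_union_le _ _ _).trans_lt (ENNReal.add_lt_top.2 ⟨?_, ?_⟩)
    · calc _ ≤ ∫⁻ s in Ioc 0 (2 * R), M ^ p.toReal := by
            refine setLIntegral_mono' measurableSet_Ioc fun s hs => ?_
            simp only [g, if_pos hs.2]; rfl
        _ < ∞ := by
            rw [setLIntegral_const]
            exact ENNReal.mul_lt_top (ENNReal.rpow_lt_top_of_nonneg hr0.le hM.ne)
              (by rw [Real.volume_Ioc]; exact ENNReal.ofReal_lt_top)
    · calc _ ≤ ∫⁻ s in Ioi (2 * R), ENNReal.ofReal B ^ p.toReal * D s ^ p.toReal := by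
            refine setLIntegral_mono' measurableSet_Ioi fun s hs => ?_
            simp only [g, if_neg (not_le.2 (mem_Ioi.1 hs))]
            rw [ENNReal.mul_rpow_of_nonneg _ _ hr0.le]
        _ < ∞ := by
            rw [lintegral_const_mul _ (by fun_prop)]
            exact ENNReal.mul_lt_top (ENNReal.rpow_lt_top_of_nonneg hr0.le ENNReal.ofReal_ne_top) hD
  have hGfin : ∫⁻ x, G x ∂orthantVolume τ ≠ ∞ := by
    rw [lintegral_coord_kernel hK j (measurable_one.indicator hS)]
    have hle : ∀ x : Fin (τ + 1) → ℝ, (∫⁻ s in Ioi 0, K s (x j)) * S.indicator 1 x ≤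
        (∫⁻ s in Ioi 0, g s) * S.indicator 1 x := by
      intro x
      gcongr ?_ * _
      refine lintegral_mono fun s => ?_
      simp only [K]
      exact mul_le_of_le_one_right' (indicator_le_self' (by simp) _ |>.trans (by simp))
    refine ((lintegral_mono hle).trans_lt ?_).ne
    rw [lintegral_const_mul _ (measurable_one.indicator hS), lintegral_indicator_one hS]
    refine ENNReal.mul_lt_top hgfin ?_
    rw [orthantVolume_eq_pi, Measure.pi_pi]
    refine ENNReal.prod_lt_top fun i _ => ?_
    rw [Measure.restrict_apply measurableSet_Iic, Iic_inter_Ioi, Real.volume_Ioc]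
    exact ENNReal.ofReal_lt_top
  have hGval : ∀ x, (∀ i, i ≠ j → x i ≤ R) → g (x j) ≤ G x := by
    intro x hx
    calc g (x j) = ∫⁻ t in Ioc (0 : ℝ) 1, g (x j) := by simp
      _ = ∫⁻ t in Ioc 0 1, K (x j) t * S.indicator 1 (Function.update x j t) := by
          refine setLIntegral_congr_fun measurableSet_Ioc fun t ht => ?_
          have h1 : Function.update x j t ∈ S := by
            intro i _
            by_cases hi : i = j
            · subst hi; simp only [Function.update_self, mem_Iic]; linarith [ht.2]
            · rw [Function.update_of_ne hi]; exact hx i hi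
          simp [K, h1, ht.2]
      _ ≤ G x := lintegral_mono_set Ioc_subset_Ioi_self
  have hdom : ∀ᶠ b in 𝓝[>] (0 : ℝ), ∀ᵐ x ∂orthantVolume τ,
      ‖(coordOp (Q b) j φ - fun x => c * φ x) x‖ₑ ^ p.toReal ≤ G x := by
    filter_upwards [hpos, hDb] with b hb hDb
    filter_upwards [ae_mem_orthant τ] with x hx
    by_cases hxR : ∀ i, i ≠ j → x i ≤ R
    · refine le_trans ?_ (hGval x hxR)
      simp only [g]
      refine ENNReal.rpow_le_rpow ?_ hr0.le
      have hφB : ∀ y, ‖φ y‖ₑ ≤ ENNReal.ofReal B := fun y => by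
        rw [Real.enorm_eq_ofReal_abs]; exact ENNReal.ofReal_le_ofReal (hB y)
      have hmQ : Measurable fun t => ‖Q b (x j) t‖ₑ :=
        ((hC b hb).meas.comp (measurable_const.prodMk measurable_id)).enorm
      split_ifs with hxj
      · calc _ ≤ coordAbs (Q b) j φ x + ‖c‖ₑ * ‖φ x‖ₑ := by
              rw [← enorm_mul]
              exact enorm_sub_le.trans (add_le_add_left (enorm_coordOp_le _ _ _ _) _)
          _ ≤ C * ENNReal.ofReal B + ‖c‖ₑ * ENNReal.ofReal B := by
              gcongr
              · calc coordAbs (Q b) j φ x ≤ ∫⁻ t in Ioi 0, ‖Q b (x j) t‖ₑ * ENNReal.ofReal B :=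
                      lintegral_mono fun t => by gcongr; exact hφB _
                  _ ≤ _ := by
                      rw [lintegral_mul_const _ hmQ]
                      gcongr
                      exact (hC b hb).row _ (hx j)
              · exact hφB x
          _ = M := by rw [← add_mul]
      · rw [not_le] at hxj
        have hφx : φ x = 0 := hzero x j (by linarith)
        simp only [Pi.sub_apply, hφx, mul_zero, sub_zero]
        refine (enorm_coordOp_le _ _ _ _).trans ?_
        have hsplit : coordAbs (Q b) j φ x ≤ ∫⁻ t in Ioc 0 R, ‖Q b (x j) t‖ₑ * ENNReal.ofReal B := by
          rw [coordAbs, ← Ioc_union_Ioi_eq_Ioi hR.le]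
          refine (lintegral_union_le _ _ _).trans ?_
          have : ∫⁻ t in Ioi R, ‖Q b (x j) t‖ₑ * ‖φ (Function.update x j t)‖ₑ = 0 := by
            rw [setLIntegral_congr_fun (g := 0) measurableSet_Ioi]
            · simp
            · intro t ht
              simp [hzero (Function.update x j t) j (by simpa using ht)]
          rw [this, add_zero]
          exact lintegral_mono fun t => by gcongr; exact hφB _
        refine hsplit.trans ?_
        rw [lintegral_mul_const _ hmQ, mul_comm]
        gcongr
        exact hDb _ hxj
    · push Not at hxR
      obtain ⟨i, hij, hi⟩ := hxR
      have h1 : φ x = 0 := hzero x i hi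
      have h2 : coordOp (Q b) j φ x = 0 := by
        simp only [coordOp]
        rw [integral_eq_zero_of_ae]
        refine ae_of_all _ fun t => ?_
        simp [hzero (Function.update x j t) i (by rwa [Function.update_of_ne hij])]
      simp [h1, h2, hr0]
  have hlim : ∀ᵐ x ∂orthantVolume τ, Tendsto (fun b =>
      ‖(coordOp (Q b) j φ - fun x => c * φ x) x‖ₑ ^ p.toReal) (𝓝[>] 0) (𝓝 0) := by
    filter_upwards [ae_mem_orthant τ] with x hx
    have := (ENNReal.continuous_rpow_const (y := p.toReal)).tendsto 0 |>.comp
      (hQ.tendsto_apply hφ hB j (hx j))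
    rwa [ENNReal.zero_rpow_of_pos hr0] at this
  have := tendsto_lintegral_filter_of_dominated_convergence (μ := orthantVolume τ) (f := 0) G
    ?_ hdom hGfin hlim
  · simpa using this
  · filter_upwards [hpos] with b hb
    exact (((measurable_coordOp (hC b hb).meas hφ.measurable j).sub
      (hφ.measurable.const_mul c)).enorm.pow_const _)

/-- Density of compactly supported continuous functions in L^p, with the operator norms bounded by C
uniformly in b. -/
theorem IsApproxIdentity.tendsto_const (hQ : IsApproxIdentity Q c p) (hp : 1 ≤ p)
    (hp' : p ≠ ∞) {u : (Fin (τ + 1) → ℝ) → ℝ} (hu : Measurable u)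
    (hup : MemLp u p (orthantVolume τ)) (j : Fin (τ + 1)) :
    Tendsto (fun b => eLpNorm (coordOp (Q b) j u - fun x => c * u x) p (orthantVolume τ))
      (𝓝[>] 0) (𝓝 0) := by
  obtain ⟨C, hC⟩ := hQ.bound
  have hpos : ∀ᶠ b : ℝ in 𝓝[>] 0, 0 < b := eventually_mem_nhdsWithin
  rw [ENNReal.tendsto_nhds_zero]
  intro ε hε
  -- The extra 1 only makes A nonzero, so that division by it is legitimate.
  set A : ℝ≥0 := C + ‖c‖₊ + 1
  have hA : (A : ℝ≥0∞) ≠ 0 := by simp [A]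
  have hδ : ε / 2 / A ≠ 0 := by simp [hε.ne']
  obtain ⟨φ, hsupp, hδφ, hφ, hφp⟩ := hup.exists_hasCompactSupport_eLpNorm_sub_le hp' hδ
  have h1 := hQ.tendsto_of_hasCompactSupport hp hp' hφ hsupp j
  filter_upwards [hpos, ENNReal.tendsto_nhds_zero.1 h1 (ε / 2) (by simp [hε.ne'])] with b hb h2
  have hmu := (measurable_coordOp (hC b hb).meas hu j).aestronglyMeasurable (μ := orthantVolume τ)
  have hmφ := (measurable_coordOp (hC b hb).meas hφ.measurable j).aestronglyMeasurable
    (μ := orthantVolume τ)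
  have hcφ : AEStronglyMeasurable (fun x => c * φ x) (orthantVolume τ) :=
    (hφ.measurable.const_mul c).aestronglyMeasurable
  have hcu : AEStronglyMeasurable (fun x => c * u x) (orthantVolume τ) :=
    (hu.const_mul c).aestronglyMeasurable
  have e : (coordOp (Q b) j u - fun x => c * u x) = (coordOp (Q b) j u - coordOp (Q b) j φ) +
      ((coordOp (Q b) j φ - fun x => c * φ x) + (-c) • (u - φ)) := by
    ext x; simp only [Pi.sub_apply, Pi.add_apply, Pi.smul_apply, smul_eq_mul]; ring
  rw [e]
  calc _ ≤ eLpNorm (coordOp (Q b) j u - coordOp (Q b) j φ) p (orthantVolume τ) +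
        (eLpNorm (coordOp (Q b) j φ - fun x => c * φ x) p (orthantVolume τ) +
          eLpNorm ((-c) • (u - φ)) p (orthantVolume τ)) := by
        refine (eLpNorm_add_le (hmu.sub hmφ) ((hmφ.sub hcφ).add
          ((hup.1.sub hφp.1).const_smul _)) hp).trans ?_
        gcongr
        exact eLpNorm_add_le (hmφ.sub hcφ) ((hup.1.sub hφp.1).const_smul _) hp
    _ ≤ C * eLpNorm (u - φ) p (orthantVolume τ) + (ε / 2 + ‖-c‖ₑ * eLpNorm (u - φ) p
          (orthantVolume τ)) := by
        gcongr
        · exact eLpNorm_coordOp_sub_le (hC b hb) hu hφ.measurable hp hp' hup hφp j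
        · exact eLpNorm_const_smul_le
    _ = (C + ‖c‖ₑ) * eLpNorm (u - φ) p (orthantVolume τ) + ε / 2 := by
        rw [enorm_neg]; ring
    _ ≤ A * (ε / 2 / A) + ε / 2 := by
        gcongr
        simp only [A, ENNReal.coe_add, ENNReal.coe_one, enorm_eq_nnnorm]
        exact le_self_add
    _ = ε := by rw [ENNReal.mul_div_cancel hA ENNReal.coe_ne_top, ENNReal.add_halves]

/-- An approximate identity acting on one coordinate preserves convergence in `L^p`. -/
theorem IsApproxIdentity.tendsto (hQ : IsApproxIdentity Q c p) (hp : 1 ≤ p)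
    (hp' : p ≠ ∞) {u : ℝ → (Fin (τ + 1) → ℝ) → ℝ} {v : (Fin (τ + 1) → ℝ) → ℝ}
    (hu : ∀ b, 0 < b → Measurable (u b)) (hup : ∀ b, 0 < b → MemLp (u b) p (orthantVolume τ))
    (hv : Measurable v) (hvp : MemLp v p (orthantVolume τ))
    (huv : Tendsto (fun b => eLpNorm (u b - v) p (orthantVolume τ)) (𝓝[>] 0) (𝓝 0))
    (j : Fin (τ + 1)) :
    Tendsto (fun b => eLpNorm (coordOp (Q b) j (u b) - fun x => c * v x) p (orthantVolume τ))
      (𝓝[>] 0) (𝓝 0) := by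
  obtain ⟨C, hC⟩ := hQ.bound
  have h1 := hQ.tendsto_const hp hp' hv hvp j
  have h2 : Tendsto (fun b => C * eLpNorm (u b - v) p (orthantVolume τ)) (𝓝[>] 0) (𝓝 0) := by
    simpa using ENNReal.Tendsto.const_mul huv (Or.inr (ENNReal.coe_ne_top (r := C)))
  have h3 := h2.add h1
  rw [add_zero] at h3
  refine tendsto_of_tendsto_of_tendsto_of_le_of_le' tendsto_const_nhds h3
    (Eventually.of_forall fun _ => zero_le) ?_
  filter_upwards [eventually_mem_nhdsWithin] with b (hb : 0 < b)
  have hmu := (measurable_coordOp (hC b hb).meas (hu b hb) j).aestronglyMeasurable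
    (μ := orthantVolume τ)
  have hmv := (measurable_coordOp (hC b hb).meas hv j).aestronglyMeasurable (μ := orthantVolume τ)
  have e : (coordOp (Q b) j (u b) - fun x => c * v x) =
      (coordOp (Q b) j (u b) - coordOp (Q b) j v) + (coordOp (Q b) j v - fun x => c * v x) := by
    ext x; simp
  rw [e]
  refine (eLpNorm_add_le (hmu.sub hmv) (hmv.sub (hv.const_mul c).aestronglyMeasurable) hp).trans ?_
  gcongr
  exact eLpNorm_coordOp_sub_le (hC b hb) (hu b hb) hv hp hp' (hup b hb) hvp j

end

/-! ### The modified gamma kernel in one dimension -/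

theorem shape_of_le {x b : ℝ} (h : 2 * b ≤ x) : shape x b = x / b := if_pos h

theorem shape_of_lt {x b : ℝ} (h : x < 2 * b) : shape x b = (x / (2 * b)) ^ 2 + 1 :=
  if_neg (not_le.2 h)

theorem one_le_shape {b : ℝ} (hb : 0 < b) (x : ℝ) : 1 ≤ shape x b := by
  unfold shape
  split_ifs with h
  · rw [le_div_iff₀ hb]; linarith
  · nlinarith [sq_nonneg (x / (2 * b))]

theorem shape_pos {b : ℝ} (hb : 0 < b) (x : ℝ) : 0 < shape x b := by
  linarith [one_le_shape hb x]

theorem one_lt_shape {b x : ℝ} (hb : 0 < b) (hx : 0 < x) : 1 < shape x b := by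
  unfold shape
  split_ifs with h
  · rw [lt_div_iff₀ hb]; linarith
  · have : 0 < (x / (2 * b)) ^ 2 := by positivity
    linarith

theorem shape_lt_two {b x : ℝ} (hb : 0 < b) (hx : 0 < x) (h : x < 2 * b) : shape x b < 2 := by
  rw [shape_of_lt h]
  have h1 : x / (2 * b) < 1 := by rw [div_lt_one (by positivity)]; exact h
  have h2 : 0 < x / (2 * b) := by positivity
  nlinarith

theorem continuous_shape {b : ℝ} (hb : 0 < b) : Continuous fun x => shape x b := by
  unfold shape
  refine Continuous.if_le (by fun_prop) (by fun_prop) continuous_const continuous_id fun x hx => ?_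
  rw [← hx]
  field_simp
  norm_num

theorem continuousAt_Gamma_of_pos {a : ℝ} (ha : 0 < a) : ContinuousAt Real.Gamma a :=
  (Real.differentiableAt_Gamma fun m => by
    have : (0 : ℝ) ≤ m := m.cast_nonneg
    linarith).continuousAt

theorem measurable_gammaPDFReal_comp {α : Type*} [MeasurableSpace α] [TopologicalSpace α]
    [OpensMeasurableSpace α] {a : α → ℝ} (ha : Continuous a) (ha0 : ∀ x, 0 < a x) (r : ℝ) :
    Measurable fun z : α × ℝ => gammaPDFReal (a z.1) r z.2 := by
  have hG : Continuous fun x => Real.Gamma (a x) :=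
    continuous_iff_continuousAt.2 fun x =>
      ContinuousAt.comp (f := a) (continuousAt_Gamma_of_pos (ha0 x)) ha.continuousAt
  have hGm := hG.measurable
  have ham := ha.measurable
  have h1 : Measurable fun z : α × ℝ => r ^ a z.1 / Real.Gamma (a z.1) :=
    (ham.const_pow r).div hGm |>.comp measurable_fst
  have h2 : Measurable fun z : α × ℝ => z.2 ^ (a z.1 - 1) :=
    measurable_snd.pow ((ham.comp measurable_fst).sub_const 1)
  unfold gammaPDFReal
  exact Measurable.ite (measurableSet_le measurable_const measurable_snd)
    ((h1.mul h2).mul (by fun_prop)) measurable_const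

theorem measurable_gammaKernel {b : ℝ} (hb : 0 < b) :
    Measurable (Function.uncurry fun x t => gammaKernel x b t) :=
  measurable_gammaPDFReal_comp (continuous_shape hb) (shape_pos hb) (1 / b)

theorem gammaKernel_nonneg {b : ℝ} (hb : 0 < b) (x t : ℝ) : 0 ≤ gammaKernel x b t :=
  gammaPDFReal_nonneg (shape_pos hb x) (by positivity) t

theorem gammaKernel_enorm {b : ℝ} (hb : 0 < b) (x t : ℝ) :
    ‖gammaKernel x b t‖ₑ = ENNReal.ofReal (gammaKernel x b t) :=
  Real.enorm_of_nonneg (gammaKernel_nonneg hb x t)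

theorem lintegral_gammaKernel {b : ℝ} (hb : 0 < b) (x : ℝ) :
    ∫⁻ t in Ioi 0, ENNReal.ofReal (gammaKernel x b t) = 1 :=
  lintegral_Ioi_gammaPDFReal (shape_pos hb x) (by positivity)

theorem integrableOn_gammaKernel {b : ℝ} (hb : 0 < b) (x : ℝ) :
    IntegrableOn (gammaKernel x b) (Ioi 0) :=
  integrableOn_gammaPDFReal (shape_pos hb x) (by positivity)

theorem integral_gammaKernel {b : ℝ} (hb : 0 < b) (x : ℝ) :
    ∫ t in Ioi 0, gammaKernel x b t = 1 :=
  integral_Ioi_gammaPDFReal (shape_pos hb x) (by positivity)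

theorem shape_div_of_le {x b : ℝ} (hb : 0 < b) (h : 2 * b ≤ x) : shape x b / (1 / b) = x := by
  rw [shape_of_le h]; field_simp

theorem integrableOn_sub_sq_mul_gammaKernel {b : ℝ} (hb : 0 < b) (x y : ℝ) :
    IntegrableOn (fun t => (t - y) ^ 2 * gammaKernel x b t) (Ioi 0) :=
  integrableOn_sub_sq_mul_gammaPDFReal (shape_pos hb x) (by positivity) y

theorem integral_sub_sq_mul_gammaKernel {x b : ℝ} (hb : 0 < b) (h : 2 * b ≤ x) :
    ∫ t in Ioi 0, (t - x) ^ 2 * gammaKernel x b t = b * x := by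
  refine (integral_sub_sq_mul_gammaPDFReal (shape_pos hb x) (by positivity) x).trans ?_
  rw [shape_div_of_le hb h, shape_of_le h]; field_simp; ring

theorem lintegral_sub_sq_mul_gammaKernel {x b : ℝ} (hb : 0 < b) (h : 2 * b ≤ x) :
    ∫⁻ t in Ioi 0, ENNReal.ofReal ((t - x) ^ 2 * gammaKernel x b t) = ENNReal.ofReal (b * x) := by
  rw [← integral_sub_sq_mul_gammaKernel hb h, ofReal_integral_eq_lintegral_ofReal
    (integrableOn_sub_sq_mul_gammaKernel hb x x)
    (ae_of_all _ fun t => mul_nonneg (sq_nonneg _) (gammaKernel_nonneg hb x t))]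

theorem gammaKernel_le {x b : ℝ} (hb : 0 < b) (hx : 0 < x) (t : ℝ) :
    gammaKernel x b t ≤ 1 / (b * √(shape x b - 1)) := by
  refine (gammaPDFReal_le (one_lt_shape hb hx) (by positivity) t).trans_eq ?_
  rw [div_div]

theorem gammaPDFReal_scale (a : ℝ) {r t : ℝ} (hr : 0 < r) (ht : 0 < t) :
    gammaPDFReal a r t = r * gammaPDFReal a 1 (r * t) := by
  rw [gammaPDFReal_of_pos _ _ ht, gammaPDFReal_of_pos _ _ (mul_pos hr ht),
    Real.mul_rpow hr.le ht.le, Real.rpow_sub_one hr.ne', Real.one_rpow, one_mul]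
  field_simp

theorem gammaKernel_scale (x : ℝ) {b t : ℝ} (hb : 0 < b) (ht : 0 < t) :
    gammaKernel x b t = 1 / b * gammaPDFReal (shape x b) 1 (t / b) := by
  rw [gammaKernel, gammaPDFReal_scale _ (by positivity) ht, one_div_mul_eq_div b t]

/-- Near the boundary the kernel is controlled by an exponential. -/
theorem gammaKernel_boundary_le {x b t : ℝ} (hb : 0 < b) (hx : 0 < x) (h : x < 2 * b) (ht : 0 < t) :
    gammaKernel x b t ≤ 2 / b * ((1 + t / b) * Real.exp (-(t / b))) := by
  have hT : 0 < t / b := by positivity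
  rw [gammaKernel_scale x hb ht]
  -- Near the boundary the shape lies between 1 and 2; with T = t/b, the unit-rate neighbours are
  -- exp(-T) and T exp(-T).
  have h1 := gammaPDFReal_add_le (m := 1) (s := shape x b - 1) le_rfl
    (by linarith [one_le_shape hb x]) (by linarith [shape_lt_two hb hx h]) hT
  rw [add_sub_cancel] at h1
  have h2 : gammaPDFReal 1 1 (t / b) + gammaPDFReal (1 + 1) 1 (t / b) =
      (1 + t / b) * Real.exp (-(t / b)) := by
    rw [gammaPDFReal_of_pos _ _ hT, gammaPDFReal_of_pos _ _ hT, Real.Gamma_add_one one_ne_zero]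
    simp
    ring
  rw [h2] at h1
  calc _ ≤ 1 / b * (2 * ((1 + t / b) * Real.exp (-(t / b)))) := by gcongr
    _ = _ := by ring

theorem gammaKernel_boundary_le' {x b t : ℝ} (hb : 0 < b) (hx : 0 < x) (h : x < 2 * b)
    (ht : 0 < t) : gammaKernel x b t ≤ 2 / b := by
  refine (gammaKernel_boundary_le hb hx h ht).trans (mul_le_of_le_one_right (by positivity) ?_)
  rw [Real.exp_neg, ← div_eq_mul_inv, div_le_one (Real.exp_pos _)]
  linarith [Real.add_one_le_exp (t / b)]

theorem lintegral_comp_mul_left {F : ℝ → ℝ≥0∞} (hF : Measurable F) {c : ℝ} (hc : 0 < c) :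
    ∫⁻ x, F (c * x) = ENNReal.ofReal c⁻¹ * ∫⁻ x, F x := by
  have h := Real.map_volume_mul_left hc.ne'
  rw [← lintegral_map hF (measurable_const_mul c), h, lintegral_smul_measure,
    abs_of_pos (inv_pos.2 hc), smul_eq_mul]

theorem lintegral_gammaPDFReal_shape_affine_le {c d A t : ℝ} (hc : 0 < c) (ht : 0 < t)
    (hA : ∀ x, A ≤ x → 1 ≤ c * x - d) :
    ∫⁻ x in Ici A, ENNReal.ofReal (gammaPDFReal (c * x - d) 1 t) ≤ ENNReal.ofReal c⁻¹ * 4 := by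
  -- Clamping the shape at 1 keeps it positive, where Γ is continuous; this gives measurability
  -- without changing the values used.
  set F : ℝ → ℝ≥0∞ := (Ici 1).indicator fun u => ENNReal.ofReal (gammaPDFReal (max u 1) 1 t)
  have hF : Measurable F := by
    refine Measurable.indicator ?_ measurableSet_Ici
    have := (measurable_gammaPDFReal_comp (a := fun u : ℝ => max u 1) (by fun_prop)
      (fun u => lt_max_of_lt_right one_pos) 1).comp
      (measurable_id.prodMk (measurable_const (a := t)))
    exact this.ennreal_ofReal
  calc _ ≤ ∫⁻ x in Ici A, F (c * x - d) := by
        refine setLIntegral_mono' measurableSet_Ici fun x hx => ?_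
        have := hA x hx
        simp only [F]
        rw [indicator_of_mem (by exact this), max_eq_left this]
    _ ≤ ∫⁻ x, F (c * x - d) := setLIntegral_le_lintegral _ _
    _ = ENNReal.ofReal c⁻¹ * ∫⁻ x, F x := by
        rw [lintegral_comp_mul_left (F := fun x => F (x - d))
          (hF.comp (measurable_id.sub_const d)) hc, lintegral_sub_right_eq_self]
    _ ≤ ENNReal.ofReal c⁻¹ * 4 := by
        gcongr
        rw [lintegral_indicator measurableSet_Ici]
        refine le_trans (le_of_eq ?_) (lintegral_gammaPDFReal_shape_le ht)
        refine setLIntegral_congr_fun measurableSet_Ici fun u hu => ?_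
        simp only [max_eq_left (mem_Ici.1 hu)]

theorem lintegral_Ioi_le_boundary_add {b : ℝ} (hb : 0 < b) (F : ℝ → ℝ≥0∞) :
    ∫⁻ x in Ioi 0, F x ≤ (∫⁻ x in Ioo 0 (2 * b), F x) + ∫⁻ x in Ici (2 * b), F x := by
  rw [← Ioo_union_Ici_eq_Ioi (show 0 < 2 * b by positivity)]
  exact lintegral_union_le _ _ _

theorem lintegral_boundary_le {b : ℝ} (hb : 0 < b) {F : ℝ → ℝ≥0∞} {c : ℝ} (hc : 0 ≤ c)
    (h : ∀ x, 0 < x → x < 2 * b → F x ≤ ENNReal.ofReal (c / b)) :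
    ∫⁻ x in Ioo 0 (2 * b), F x ≤ ENNReal.ofReal (2 * c) := by
  calc _ ≤ ∫⁻ x in Ioo 0 (2 * b), ENNReal.ofReal (c / b) :=
        setLIntegral_mono' measurableSet_Ioo fun x hx => h x hx.1 hx.2
    _ = _ := by
        rw [setLIntegral_const, Real.volume_Ioo, ← ENNReal.ofReal_mul (by positivity)]
        congr 1; field_simp; ring

/-- A bound 2/b on an interval of length 2b contributes 4. On x ≥ 2b the shape is x/b, and the
change of variable to the shape contributes another 4. -/
theorem lintegral_gammaKernel_left_le {b t : ℝ} (hb : 0 < b) (ht : 0 < t) :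
    ∫⁻ x in Ioi 0, ENNReal.ofReal (gammaKernel x b t) ≤ 8 := by
  refine (lintegral_Ioi_le_boundary_add hb _).trans ?_
  calc _ ≤ ENNReal.ofReal (2 * 2) + 4 := by
        gcongr
        · exact lintegral_boundary_le hb (by norm_num) fun x hx h =>
            ENNReal.ofReal_le_ofReal (gammaKernel_boundary_le' hb hx h ht)
        · calc _ = ∫⁻ x in Ici (2 * b), ENNReal.ofReal (1 / b) *
                ENNReal.ofReal (gammaPDFReal (b⁻¹ * x - 0) 1 (t / b)) := by
                refine setLIntegral_congr_fun measurableSet_Ici fun x hx => ?_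
                simp only [gammaKernel_scale x hb ht, shape_of_le (mem_Ici.1 hx)]
                rw [ENNReal.ofReal_mul (by positivity), sub_zero, inv_mul_eq_div]
            _ ≤ ENNReal.ofReal (1 / b) * (ENNReal.ofReal (b⁻¹)⁻¹ * 4) := by
                rw [lintegral_const_mul' _ _ ENNReal.ofReal_ne_top]
                gcongr
                refine lintegral_gammaPDFReal_shape_affine_le (by positivity) (by positivity)
                  fun x hx => ?_
                rw [sub_zero, inv_mul_eq_div, le_div_iff₀ hb]; linarith
            _ = 4 := by
                rw [← mul_assoc, ← ENNReal.ofReal_mul (by positivity), inv_inv,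
                  one_div_mul_cancel hb.ne', ENNReal.ofReal_one, one_mul]
    _ = 8 := by norm_num

theorem kernelBound_gammaKernel {b : ℝ} (hb : 0 < b) : KernelBound (fun x t => gammaKernel x b t) 8 where
  meas := measurable_gammaKernel hb
  row x _ := by
    simp only [gammaKernel_enorm hb, lintegral_gammaKernel hb]
    norm_num
  col t ht := by
    simp only [gammaKernel_enorm hb]
    exact lintegral_gammaKernel_left_le hb ht

theorem eventually_two_mul_le {x : ℝ} (hx : 0 < x) : ∀ᶠ b : ℝ in 𝓝[>] 0, 0 < b ∧ 2 * b ≤ x := by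
  filter_upwards [Ioo_mem_nhdsGT (show 0 < x / 2 by positivity)] with b hb
  exact ⟨hb.1, by linarith [hb.2]⟩

theorem lintegral_rpow_tail_lt_top {R r : ℝ} (hR : 0 < R) {p q : ℝ} (hp : 0 < p) (h : 1 < p * q)
    (c : ℝ) (hc : 0 ≤ c) (hr : r = 2 * R) :
    ∫⁻ x in Ioi r, (ENNReal.ofReal (c * x ^ (-q))) ^ p < ∞ := by
  have hr0 : 0 < r := by linarith
  have hi : IntegrableOn (fun x : ℝ => x ^ (-(p * q))) (Ioi r) :=
    integrableOn_Ioi_rpow_of_lt (by linarith) hr0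
  have := (hi.const_mul (c ^ p)).lintegral_lt_top
  refine lt_of_le_of_lt (setLIntegral_mono' measurableSet_Ioi fun x hx => ?_) this
  have hx0 : 0 < x := hr0.trans hx
  rw [ENNReal.ofReal_rpow_of_nonneg (by positivity) hp.le, Real.mul_rpow hc (by positivity),
    ← Real.rpow_mul hx0.le]
  apply le_of_eq
  congr 3
  ring

/-- Chebyshev bound for the mass of the gamma kernel far to the left of its centre. -/
theorem lintegral_Ioc_le_of_sub_sq {F : ℝ → ℝ} (hF : ∀ t, 0 ≤ F t) {R x m : ℝ}
    (hR : 0 < R) (hx : 2 * R < x)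
    (h : ∫⁻ t in Ioi 0, ENNReal.ofReal ((t - x) ^ 2 * F t) ≤ ENNReal.ofReal m) :
    ∫⁻ t in Ioc 0 R, ENNReal.ofReal (F t) ≤ ENNReal.ofReal (4 / x ^ 2 * m) := by
  have hx0 : 0 < x := by linarith
  calc _ ≤ ∫⁻ t in Ioc 0 R, ENNReal.ofReal (4 / x ^ 2) * ENNReal.ofReal ((t - x) ^ 2 * F t) := by
        -- Here t ≤ R < x/2, so |t - x| ≥ x/2 and the inserted factor is at least 1.
        refine setLIntegral_mono' measurableSet_Ioc fun t ht => ?_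
        rw [← ENNReal.ofReal_mul (by positivity), ← mul_assoc]
        refine ENNReal.ofReal_le_ofReal (le_mul_of_one_le_left (hF t) ?_)
        rw [div_mul_eq_mul_div, one_le_div (by positivity)]
        nlinarith [ht.2, ht.1]
    _ ≤ ENNReal.ofReal (4 / x ^ 2) * ∫⁻ t in Ioi 0, ENNReal.ofReal ((t - x) ^ 2 * F t) := by
        rw [lintegral_const_mul' _ _ ENNReal.ofReal_ne_top]
        gcongr
        exact Ioc_subset_Ioi_self
    _ ≤ _ := by
        rw [ENNReal.ofReal_mul (by positivity)]
        gcongr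

/-- The gamma kernel is an approximate identity in `L²`. -/
theorem isApproxIdentity_gammaKernel :
    IsApproxIdentity (fun b x t => gammaKernel x b t) 1 2 where
  bound := ⟨8, fun _ hb => kernelBound_gammaKernel hb⟩
  mass x _ := by
    refine tendsto_const_nhds.congr' ?_
    filter_upwards [eventually_mem_nhdsWithin] with b hb
    exact (integral_gammaKernel hb x).symm
  conc x hx := by
    have h0 : Tendsto (fun b : ℝ => ENNReal.ofReal (b * x)) (𝓝[>] 0) (𝓝 0) := by
      have : Tendsto (fun b : ℝ => ENNReal.ofReal (b * x)) (𝓝 0) (𝓝 (ENNReal.ofReal (0 * x))) :=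
        (ENNReal.continuous_ofReal.comp (continuous_mul_const x)).tendsto 0
      rw [zero_mul, ENNReal.ofReal_zero] at this
      exact this.mono_left nhdsWithin_le_nhds
    refine h0.congr' ?_
    filter_upwards [eventually_two_mul_le hx] with b hb
    rw [← lintegral_sub_sq_mul_gammaKernel hb.1 hb.2]
    refine lintegral_congr fun t => ?_
    rw [gammaKernel_enorm hb.1, ENNReal.ofReal_mul (sq_nonneg _), mul_comm]
  tail R hR := by
    -- Chebyshev gives 4bx/x² ≤ 4R/x when b < R. This is square integrable at infinity but not
    -- integrable, so it serves p = 2 and not p = 1.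
    refine ⟨fun x => ENNReal.ofReal (4 * R * x ^ (-1 : ℝ)), by fun_prop, ?_, ?_⟩
    · exact lintegral_rpow_tail_lt_top hR (by norm_num) (by norm_num) _ (by positivity) rfl
    · filter_upwards [Ioo_mem_nhdsGT hR] with b hb x hx
      have hx0 : 0 < x := by linarith
      simp only [gammaKernel_enorm hb.1]
      refine (lintegral_Ioc_le_of_sub_sq (gammaKernel_nonneg hb.1 x) hR hx
        (lintegral_sub_sq_mul_gammaKernel hb.1 (by linarith [hb.2])).le).trans ?_
      refine ENNReal.ofReal_le_ofReal ?_
      rw [Real.rpow_neg_one, div_mul_eq_mul_div, div_le_iff₀ (by positivity)]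
      field_simp
      linarith [hb.2]

/-! ### The squared kernel -/

/-- The kernel `√b K(x,t)² √t`, whose action describes the second moment of the estimator. -/
noncomputable def sqKernel (b x t : ℝ) : ℝ := √b * gammaKernel x b t ^ 2 * √t

theorem sqKernel_nonneg (b x t : ℝ) : 0 ≤ sqKernel b x t := by unfold sqKernel; positivity

theorem measurable_sqKernel {b : ℝ} (hb : 0 < b) :
    Measurable (Function.uncurry fun x t => sqKernel b x t) :=
  (((measurable_gammaKernel hb).pow_const 2).const_mul _).mul measurable_snd.sqrt

/-- The `L²` norm constant of the gamma kernel, up to scaling. -/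
noncomputable def gammaRatio (a : ℝ) : ℝ := Real.Gamma (a - 1 / 2) / Real.Gamma a

theorem gammaRatio_pos {a : ℝ} (ha : 1 ≤ a) : 0 < gammaRatio a :=
  div_pos (Real.Gamma_pos_of_pos (by linarith)) (Real.Gamma_pos_of_pos (by linarith))

theorem gammaRatio_le {a : ℝ} (ha : 1 ≤ a) : gammaRatio a ≤ 2 / √a := by
  refine (Gamma_ratio_le (by linarith)).trans ?_
  have hs : 0 < √a := Real.sqrt_pos.2 (by linarith)
  rw [div_le_div_iff₀ (by linarith) hs, Real.mul_self_sqrt (by linarith)]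
  linarith

theorem gammaKernel_sq {b t : ℝ} (hb : 0 < b) (x : ℝ) (ht : 0 < t) :
    gammaKernel x b t ^ 2 = gammaRatio (shape x b) / (2 * √Real.pi * b) *
      gammaPDFReal (2 * shape x b - 1) (2 * (1 / b)) t := by
  rw [gammaKernel, gammaPDFReal_sq (by linarith [one_le_shape hb x]) (by positivity) ht, gammaRatio]
  field_simp

/-- The square is a multiple of a gamma density of shape 2ρ - 1 and rate 2/b, whose mean is x - b/2
when x ≥ 2b. The mass of the kernel is thus a half-order moment of a law that concentrates at x. -/
theorem sqKernel_eq {b t : ℝ} (hb : 0 < b) (x : ℝ) (ht : 0 < t) :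
    sqKernel b x t = gammaRatio (shape x b) / (2 * √Real.pi * √b) *
      (√t * gammaPDFReal (2 * shape x b - 1) (2 * (1 / b)) t) := by
  rw [sqKernel, gammaKernel_sq hb x ht]
  have hs : 0 < √b := Real.sqrt_pos.2 hb
  have hpi : 0 < √Real.pi := Real.sqrt_pos.2 Real.pi_pos
  have : √b * √b = b := Real.mul_self_sqrt hb.le
  field_simp
  rw [sq, this, mul_comm b]

theorem one_lt_sqrt_pi : 1 < √Real.pi := by
  rw [Real.lt_sqrt (by norm_num)]; linarith [Real.pi_gt_three]

theorem sqrt_le_half_add {t m : ℝ} (ht : 0 ≤ t) (hm : 0 < m) : √t ≤ √m / 2 * (1 + t / m) := by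
  have hs : 0 < √m := Real.sqrt_pos.2 hm
  have h1 := Real.mul_self_sqrt hm.le
  have h2 := Real.mul_self_sqrt ht
  have : √m / 2 * (1 + t / m) = (m + t) / (2 * √m) := by
    field_simp
    nlinarith
  rw [this, le_div_iff₀ (by positivity)]
  nlinarith [sq_nonneg (√t - √m)]

/-- With t = ms² the difference of the two sides is √m (s-1)²((s+1)² - 1)/2. The quadratic
correction makes the bound tight to second order in the spread. -/
theorem sqrt_ge_quadratic {t m : ℝ} (ht : 0 ≤ t) (hm : 0 < m) :
    √m * (1 + (t - m) / (2 * m) - (t - m) ^ 2 / (2 * m ^ 2)) ≤ √t := by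
  have hs : 0 < √m := Real.sqrt_pos.2 hm
  obtain ⟨s, hs0, hts⟩ : ∃ s, 0 ≤ s ∧ t = m * s ^ 2 :=
    ⟨√(t / m), Real.sqrt_nonneg _, by rw [Real.sq_sqrt (by positivity)]; field_simp⟩
  have : √t = √m * s := by rw [hts, Real.sqrt_mul hm.le, Real.sqrt_sq hs0]
  rw [this]
  refine mul_le_mul_of_nonneg_left ?_ hs.le
  have e : 1 + (t - m) / (2 * m) - (t - m) ^ 2 / (2 * m ^ 2) =
      1 + (s ^ 2 - 1) / 2 - (s ^ 2 - 1) ^ 2 / 2 := by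
    rw [hts]; field_simp
  rw [e]
  nlinarith [mul_nonneg (sq_nonneg (s - 1)) (show 0 ≤ (s + 1) ^ 2 - 1 by nlinarith)]

theorem integrableOn_sqrt_mul_gammaPDFReal {a r : ℝ} (ha : 0 < a) (hr : 0 < r) :
    IntegrableOn (fun t => √t * gammaPDFReal a r t) (Ioi 0) := by
  refine Integrable.mono' ((integrableOn_gammaPDFReal ha hr).add
    (integrableOn_mul_gammaPDFReal ha hr)) (by fun_prop) ?_
  filter_upwards [ae_restrict_mem measurableSet_Ioi] with t ht
  have hp := gammaPDFReal_nonneg ha hr t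
  rw [Real.norm_of_nonneg (by positivity)]
  simp only [Pi.add_apply]
  have h1 := sqrt_le_half_add (le_of_lt ht) one_pos
  have h2 : 0 < t := ht
  rw [Real.sqrt_one] at h1
  nlinarith

/-- Jensen for the square root, by integrating its tangent line at the mean. -/
theorem integral_sqrt_mul_gammaPDFReal_le {a r : ℝ} (ha : 0 < a) (hr : 0 < r) :
    ∫ t in Ioi 0, √t * gammaPDFReal a r t ≤ √(a / r) := by
  have hm : 0 < a / r := by positivity
  have i1 := integrableOn_gammaPDFReal ha hr
  have i2 := integrableOn_mul_gammaPDFReal ha hr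
  calc _ ≤ ∫ t in Ioi 0, (√(a / r) / 2 * gammaPDFReal a r t +
        √(a / r) / 2 / (a / r) * (t * gammaPDFReal a r t)) := by
        refine setIntegral_mono_on (integrableOn_sqrt_mul_gammaPDFReal ha hr)
          ((i1.const_mul _).add (i2.const_mul _)) measurableSet_Ioi fun t ht => ?_
        have := mul_le_mul_of_nonneg_right (sqrt_le_half_add (le_of_lt ht) hm)
          (gammaPDFReal_nonneg ha hr t)
        refine this.trans_eq ?_
        ring
    _ = √(a / r) := by
        rw [integral_add (i1.const_mul _) (i2.const_mul _), integral_const_mul, integral_const_mul,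
          integral_Ioi_gammaPDFReal ha hr, integral_mul_gammaPDFReal ha hr,
          div_mul_cancel₀ _ hm.ne']
        ring

/-- Integrating the quadratic minorant about the mean m kills the linear term, and the variance m²/a
gives the relative loss 1/(2a). -/
theorem le_integral_sqrt_mul_gammaPDFReal {a r : ℝ} (ha : 0 < a) (hr : 0 < r) :
    √(a / r) * (1 - 1 / (2 * a)) ≤ ∫ t in Ioi 0, √t * gammaPDFReal a r t := by
  have hm : 0 < a / r := by positivity
  have i0 := integrableOn_gammaPDFReal ha hr
  have i1 := integrableOn_mul_gammaPDFReal ha hr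
  have i2 := integrableOn_sub_sq_mul_gammaPDFReal ha hr (a / r)
  set m := a / r with hmdef
  have i01 : IntegrableOn (fun t => √m / 2 * gammaPDFReal a r t +
      √m / (2 * m) * (t * gammaPDFReal a r t)) (Ioi 0) := (i0.const_mul _).add (i1.const_mul _)
  calc √m * (1 - 1 / (2 * a)) = ∫ t in Ioi 0, (√m / 2 * gammaPDFReal a r t +
        √m / (2 * m) * (t * gammaPDFReal a r t) -
        √m / (2 * m ^ 2) * ((t - m) ^ 2 * gammaPDFReal a r t)) := by
        rw [integral_sub i01 (i2.const_mul _), integral_add (i0.const_mul _) (i1.const_mul _),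
          integral_const_mul, integral_const_mul, integral_const_mul,
          integral_Ioi_gammaPDFReal ha hr, integral_mul_gammaPDFReal ha hr,
          integral_sub_sq_mul_gammaPDFReal ha hr, ← hmdef, sub_self]
        have : a / r ^ 2 = m ^ 2 / a := by rw [hmdef]; field_simp
        rw [this]
        field_simp
        ring
    _ ≤ _ := by
        refine setIntegral_mono_on (i01.sub (i2.const_mul _))
          (integrableOn_sqrt_mul_gammaPDFReal ha hr) measurableSet_Ioi fun t ht => ?_
        have := mul_le_mul_of_nonneg_right (sqrt_ge_quadratic (le_of_lt ht) hm)
          (gammaPDFReal_nonneg ha hr t)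
        refine le_trans (le_of_eq ?_) this
        field_simp
        ring

theorem integrableOn_sqKernel {b : ℝ} (hb : 0 < b) (x : ℝ) : IntegrableOn (sqKernel b x) (Ioi 0) :=
  IntegrableOn.congr_fun (Integrable.const_mul (integrableOn_sqrt_mul_gammaPDFReal
    (by linarith [one_le_shape hb x]) (by positivity)) _)
    (fun _ ht => (sqKernel_eq hb x ht).symm) measurableSet_Ioi

theorem integral_sqKernel {b : ℝ} (hb : 0 < b) (x : ℝ) :
    ∫ t in Ioi 0, sqKernel b x t = gammaRatio (shape x b) / (2 * √Real.pi * √b) *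
      ∫ t in Ioi 0, √t * gammaPDFReal (2 * shape x b - 1) (2 * (1 / b)) t := by
  rw [← integral_const_mul]
  exact setIntegral_congr_fun measurableSet_Ioi fun t ht => sqKernel_eq hb x ht

theorem sqrt_mean_sqKernel {b : ℝ} (hb : 0 < b) (x : ℝ) :
    √((2 * shape x b - 1) / (2 * (1 / b))) = √b * √(shape x b - 1 / 2) := by
  rw [← Real.sqrt_mul hb.le]
  congr 1
  field_simp

/-- The factor √(ρ - 1/2) from the half-order moment nearly cancels the ratio Γ(ρ-1/2)/Γ(ρ). The
lower bound below matches, so the mass tends to 1/(2√π) as the shape grows. -/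
theorem integral_sqKernel_le {b : ℝ} (hb : 0 < b) (x : ℝ) :
    ∫ t in Ioi 0, sqKernel b x t ≤
      1 / (2 * √Real.pi) * √(shape x b / (shape x b - 1 / 2)) := by
  have h1 := one_le_shape hb x
  have hg := gammaRatio_pos h1
  have hs : 0 < √b := Real.sqrt_pos.2 hb
  have hs2 : 0 < √(shape x b - 1 / 2) := Real.sqrt_pos.2 (by linarith)
  have hpi : 0 < √Real.pi := Real.sqrt_pos.2 Real.pi_pos
  rw [integral_sqKernel hb]
  have h2 := integral_sqrt_mul_gammaPDFReal_le (a := 2 * shape x b - 1) (r := 2 * (1 / b))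
    (by linarith) (by positivity)
  rw [sqrt_mean_sqKernel hb] at h2
  calc _ ≤ gammaRatio (shape x b) / (2 * √Real.pi * √b) * (√b * √(shape x b - 1 / 2)) := by gcongr
    _ = 1 / (2 * √Real.pi) * (gammaRatio (shape x b) * √(shape x b - 1 / 2)) := by field_simp
    _ ≤ 1 / (2 * √Real.pi) * (√(shape x b) / (shape x b - 1 / 2) * √(shape x b - 1 / 2)) := by
        gcongr
        exact Gamma_ratio_le (by linarith)
    _ = _ := by
        rw [Real.sqrt_div (by linarith)]
        congr 1
        rw [div_mul_eq_mul_div, div_eq_div_iff (by linarith) hs2.ne', mul_assoc,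
          Real.mul_self_sqrt (by linarith)]

theorem le_integral_sqKernel {b : ℝ} (hb : 0 < b) (x : ℝ) :
    1 / (2 * √Real.pi) * (1 - 1 / (2 * (2 * shape x b - 1))) ≤ ∫ t in Ioi 0, sqKernel b x t := by
  have h1 := one_le_shape hb x
  have hg := gammaRatio_pos h1
  have hs : 0 < √b := Real.sqrt_pos.2 hb
  have hs2 : 0 < √(shape x b - 1 / 2) := Real.sqrt_pos.2 (by linarith)
  have hpi : 0 < √Real.pi := Real.sqrt_pos.2 Real.pi_pos
  rw [integral_sqKernel hb]
  have h2 := le_integral_sqrt_mul_gammaPDFReal (a := 2 * shape x b - 1) (r := 2 * (1 / b))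
    (by linarith) (by positivity)
  rw [sqrt_mean_sqKernel hb] at h2
  have h3 : 0 ≤ 1 - 1 / (2 * (2 * shape x b - 1)) := by
    rw [sub_nonneg, div_le_one (by linarith)]; linarith
  calc _ = 1 / (2 * √Real.pi) * (1 / √(shape x b - 1 / 2) * √(shape x b - 1 / 2) *
        (1 - 1 / (2 * (2 * shape x b - 1)))) := by rw [one_div_mul_cancel hs2.ne', one_mul]
    _ ≤ 1 / (2 * √Real.pi) * (gammaRatio (shape x b) * √(shape x b - 1 / 2) *
        (1 - 1 / (2 * (2 * shape x b - 1)))) := by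
        gcongr
        exact rpow_neg_half_le_Gamma_ratio (by linarith)
    _ = gammaRatio (shape x b) / (2 * √Real.pi * √b) * (√b * √(shape x b - 1 / 2) *
        (1 - 1 / (2 * (2 * shape x b - 1)))) := by field_simp
    _ ≤ _ := by gcongr

theorem sqKernel_enorm (b x t : ℝ) : ‖sqKernel b x t‖ₑ = ENNReal.ofReal (sqKernel b x t) :=
  Real.enorm_of_nonneg (sqKernel_nonneg b x t)

theorem lintegral_sqKernel {b : ℝ} (hb : 0 < b) (x : ℝ) :
    ∫⁻ t in Ioi 0, ENNReal.ofReal (sqKernel b x t) =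
      ENNReal.ofReal (∫ t in Ioi 0, sqKernel b x t) :=
  (ofReal_integral_eq_lintegral_ofReal (integrableOn_sqKernel hb x)
    (ae_of_all _ (sqKernel_nonneg b x))).symm

theorem lintegral_sqKernel_le {b : ℝ} (hb : 0 < b) (x : ℝ) :
    ∫⁻ t in Ioi 0, ENNReal.ofReal (sqKernel b x t) ≤ 1 := by
  rw [lintegral_sqKernel hb]
  refine ENNReal.ofReal_le_one.2 ((integral_sqKernel_le hb x).trans ?_)
  have h1 := one_le_shape hb x
  have h2 : √(shape x b / (shape x b - 1 / 2)) ≤ 2 := by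
    rw [Real.sqrt_le_left (by norm_num), div_le_iff₀ (by linarith)]; linarith
  calc _ ≤ 1 / (2 * 1) * (2 : ℝ) := by
        gcongr
        exact one_lt_sqrt_pi.le
    _ = 1 := by norm_num

/-- One factor K is bounded by 2/b; the exponential decay of the other absorbs √(t/b). -/
theorem sqKernel_boundary_le {x b t : ℝ} (hb : 0 < b) (hx : 0 < x) (h : x < 2 * b) (ht : 0 < t) :
    sqKernel b x t ≤ 4 / b := by
  have h1 := gammaKernel_boundary_le hb hx h ht
  have h2 := gammaKernel_boundary_le' hb hx h ht
  have h0 := gammaKernel_nonneg hb x t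
  have hT : 0 < t / b := by positivity
  have hE : √(t / b) * ((1 + t / b) * Real.exp (-(t / b))) ≤ 1 := by
    rw [Real.exp_neg, ← div_eq_mul_inv, ← mul_div_assoc, div_le_one (Real.exp_pos _)]
    have h3 := Real.quadratic_le_exp_of_nonneg hT.le
    have h4 := sqrt_le_half_add hT.le one_pos
    rw [Real.sqrt_one, div_one] at h4
    nlinarith
  have hbt : √b * √t = b * √(t / b) := by
    rw [Real.sqrt_div ht.le, mul_div_assoc', eq_div_iff (Real.sqrt_pos.2 hb).ne']
    linear_combination √t * Real.mul_self_sqrt hb.le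
  calc sqKernel b x t = (√b * √t) * gammaKernel x b t * gammaKernel x b t := by
        unfold sqKernel; ring
    _ ≤ (b * √(t / b)) * (2 / b * ((1 + t / b) * Real.exp (-(t / b)))) * (2 / b) := by
        rw [hbt]; gcongr
    _ = 4 / b * (√(t / b) * ((1 + t / b) * Real.exp (-(t / b)))) := by field_simp; ring
    _ ≤ 4 / b * 1 := by gcongr
    _ = 4 / b := mul_one _

/-- With u = 2x/b - 1 and T = 2t/b the kernel is at most (2/b)√(T/u) times the unit-rate density of
shape u at T. Since √(T/u) ≤ (1 + T/u)/2, size biasing leaves densities of shapes u and u + 1, whose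
integrals over the shape are under control. -/
theorem sqKernel_interior_le {x b t : ℝ} (hb : 0 < b) (h : 2 * b ≤ x) (ht : 0 < t) :
    sqKernel b x t ≤ 1 / b * (gammaPDFReal (2 / b * x - 1) 1 (2 / b * t) +
      gammaPDFReal (2 / b * x - 0) 1 (2 / b * t)) := by
  have hρ : 2 ≤ x / b := by rw [le_div_iff₀ hb]; exact h
  set u := 2 / b * x - 1 with hu
  have hu3 : 3 ≤ u := by
    have : 2 / b * x = 2 * (x / b) := by ring
    linarith
  set T := 2 / b * t with hT
  have hT0 : 0 < T := by positivity
  have hx : 0 < x := by linarith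
  have hpu := gammaPDFReal_pos (show 0 < u by linarith) one_pos hT0
  have hpi := one_lt_sqrt_pi
  have hsu : 0 < √u := Real.sqrt_pos.2 (by linarith)
  have hsb : 0 < √b := Real.sqrt_pos.2 hb
  have e1 : 2 * shape x b - 1 = u := by rw [shape_of_le h, hu]; ring
  have hm := mul_gammaPDFReal (show 0 < u by linarith) one_pos hT0
  rw [div_one, show u + 1 = 2 / b * x - 0 by rw [hu]; ring] at hm
  have hR : gammaRatio (shape x b) ≤ 2 / √u := by
    have h1 := one_le_shape hb x
    refine (Gamma_ratio_le (by linarith)).trans ?_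
    have e2 : shape x b - 1 / 2 = u / 2 := by linarith
    rw [e2, div_le_div_iff₀ (by linarith) hsu]
    have : √(shape x b) ≤ √u := Real.sqrt_le_sqrt (by linarith)
    nlinarith [Real.mul_self_sqrt (show 0 ≤ u by linarith)]
  have hst : √t ≤ √b * √T := by
    rw [← Real.sqrt_mul hb.le]
    refine Real.sqrt_le_sqrt ?_
    rw [hT]; field_simp; linarith
  have hTu : √T / √u ≤ 1 / 2 * (1 + T / u) := by
    rw [div_le_iff₀ hsu]
    have := sqrt_le_half_add hT0.le (show 0 < u by linarith)
    linarith
  rw [sqKernel_eq hb x ht, e1, gammaPDFReal_scale u (show 0 < 2 * (1 / b) by positivity) ht,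
    show 2 * (1 / b) * t = T by rw [hT]; ring]
  calc _ ≤ 2 / √u / (2 * 1 * √b) * (√b * √T * (2 * (1 / b) * gammaPDFReal u 1 T)) := by
        gcongr
    _ = 2 / b * (√T / √u) * gammaPDFReal u 1 T := by field_simp
    _ ≤ 2 / b * (1 / 2 * (1 + T / u)) * gammaPDFReal u 1 T := by gcongr
    _ = 1 / b * (gammaPDFReal u 1 T + T * gammaPDFReal u 1 T / u) := by field_simp
    _ = _ := by
        rw [hm, mul_div_assoc, mul_div_cancel₀]
        linarith

/-- The boundary strip gives (4/b)(2b) = 8. The interior gives (1/b)·2·(b/2)·4 = 4. -/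
theorem lintegral_sqKernel_left_le {b t : ℝ} (hb : 0 < b) (ht : 0 < t) :
    ∫⁻ x in Ioi 0, ENNReal.ofReal (sqKernel b x t) ≤ 12 := by
  refine (lintegral_Ioi_le_boundary_add hb _).trans ?_
  have hT : 0 < 2 / b * t := by positivity
  have hx0 : ∀ x ∈ Ici (2 * b), 1 ≤ 2 / b * x - 1 := fun x hx => by
    have : 2 / b * (2 * b) ≤ 2 / b * x := by gcongr; exact hx
    have e : 2 / b * (2 * b) = 4 := by field_simp; norm_num
    linarith
  calc _ ≤ ENNReal.ofReal (2 * 4) + 4 := by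
        gcongr
        · exact lintegral_boundary_le hb (by norm_num) fun x hx h =>
            ENNReal.ofReal_le_ofReal (sqKernel_boundary_le hb hx h ht)
        · calc _ ≤ ∫⁻ x in Ici (2 * b), (ENNReal.ofReal (1 / b) *
                (ENNReal.ofReal (gammaPDFReal (2 / b * x - 1) 1 (2 / b * t)) +
                ENNReal.ofReal (gammaPDFReal (2 / b * x - 0) 1 (2 / b * t)))) := by
                refine setLIntegral_mono' measurableSet_Ici fun x hx => ?_
                have h0 := hx0 x hx
                rw [← ENNReal.ofReal_add (gammaPDFReal_nonneg (by linarith) one_pos _)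
                  (gammaPDFReal_nonneg (by linarith) one_pos _), ← ENNReal.ofReal_mul (by positivity)]
                exact ENNReal.ofReal_le_ofReal (sqKernel_interior_le hb hx ht)
            _ ≤ ENNReal.ofReal (1 / b) * (ENNReal.ofReal (2 / b)⁻¹ * 4 +
                  ENNReal.ofReal (2 / b)⁻¹ * 4) := by
                rw [lintegral_const_mul' _ _ ENNReal.ofReal_ne_top]
                gcongr
                refine (le_of_eq (lintegral_add_left' ?_ _)).trans (add_le_add ?_ ?_)
                · have hc : Continuous fun x : ℝ => max (2 / b * x - 1) 1 := by fun_prop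
                  have := (measurable_gammaPDFReal_comp hc
                    (fun u => lt_max_of_lt_right one_pos) 1).comp
                    (measurable_id.prodMk (measurable_const (a := 2 / b * t)))
                  refine (this.ennreal_ofReal.aemeasurable).congr ?_
                  filter_upwards [ae_restrict_mem measurableSet_Ici] with x hx
                  simp [max_eq_left (hx0 x hx)]
                · exact lintegral_gammaPDFReal_shape_affine_le (by positivity) hT fun x hx => hx0 x hx
                · exact lintegral_gammaPDFReal_shape_affine_le (by positivity) hT fun x hx => by
                    linarith [hx0 x hx]
            _ = 4 := by
                rw [← two_mul, ← mul_assoc, ← mul_assoc, mul_comm (ENNReal.ofReal (1 / b)),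
                  mul_assoc 2, ← ENNReal.ofReal_mul (by positivity)]
                have : 1 / b * (2 / b)⁻¹ = 1 / 2 := by field_simp
                rw [this, ENNReal.ofReal_div_of_pos two_pos, ENNReal.ofReal_one,
                  ENNReal.ofReal_ofNat, ENNReal.mul_div_cancel (by norm_num) (by norm_num), one_mul]
    _ = 12 := by norm_num

theorem kernelBound_sqKernel {b : ℝ} (hb : 0 < b) : KernelBound (sqKernel b) 12 where
  meas := measurable_sqKernel hb
  row x _ := by
    simp only [sqKernel_enorm]
    exact (lintegral_sqKernel_le hb x).trans (by norm_num)
  col t ht := by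
    simp only [sqKernel_enorm]
    exact lintegral_sqKernel_left_le hb ht

theorem tendsto_ofReal_of_le {α : Type*} {l : Filter α} {F : α → ℝ≥0∞} {G : α → ℝ}
    (hG : Tendsto G l (𝓝 0)) (h : ∀ᶠ a in l, F a ≤ ENNReal.ofReal (G a)) : Tendsto F l (𝓝 0) := by
  have := (ENNReal.continuous_ofReal.tendsto 0).comp hG
  rw [ENNReal.ofReal_zero] at this
  exact tendsto_of_tendsto_of_tendsto_of_le_of_le' tendsto_const_nhds this
    (Eventually.of_forall fun _ => zero_le) h

theorem gammaRatio_div_sqrt_le {x b : ℝ} (hb : 0 < b) (h : 2 * b ≤ x) :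
    gammaRatio (shape x b) / (2 * √Real.pi * √b) ≤ 1 / √x := by
  have hx : 0 < x := by linarith
  have hsb : 0 < √b := Real.sqrt_pos.2 hb
  have hsx : 0 < √x := Real.sqrt_pos.2 hx
  have := gammaRatio_le (one_le_shape hb x)
  rw [shape_of_le h] at this ⊢
  rw [Real.sqrt_div hx.le] at this
  calc _ ≤ 2 / (√x / √b) / (2 * 1 * √b) := by
        gcongr
        exact one_lt_sqrt_pi.le
    _ = _ := by field_simp

theorem isApproxIdentity_sqKernel : IsApproxIdentity sqKernel (1 / (2 * √Real.pi)) 1 where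
  bound := ⟨12, fun _ hb => kernelBound_sqKernel hb⟩
  mass x hx := by
    have hinv : Tendsto (fun b : ℝ => b / x) (𝓝[>] 0) (𝓝 0) := by
      have : Tendsto (fun b : ℝ => b / x) (𝓝 0) (𝓝 (0 / x)) :=
        (continuous_id.div_const x).tendsto 0
      rw [zero_div] at this
      exact this.mono_left nhdsWithin_le_nhds
    have hlow : Tendsto (fun b : ℝ => 1 / (2 * √Real.pi) * (1 - (b / x) / (2 * (2 - b / x))))
        (𝓝[>] 0) (𝓝 (1 / (2 * √Real.pi))) := by
      have := ((hinv.div ((hinv.const_sub 2).const_mul 2) (by norm_num)).const_sub 1).const_mul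
        (1 / (2 * √Real.pi))
      simpa using this
    have hup : Tendsto (fun b : ℝ => 1 / (2 * √Real.pi) * √(1 / (1 - (b / x) / 2)))
        (𝓝[>] 0) (𝓝 (1 / (2 * √Real.pi))) := by
      have h1 := (tendsto_const_nhds (x := (1 : ℝ))).div ((hinv.div_const 2).const_sub 1) (by norm_num)
      have := ((Real.continuous_sqrt.tendsto _).comp h1).const_mul (1 / (2 * √Real.pi))
      simpa using this
    refine tendsto_of_tendsto_of_tendsto_of_le_of_le' hlow hup ?_ ?_
    · filter_upwards [eventually_two_mul_le hx] with b hb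
      refine le_trans (le_of_eq ?_) (le_integral_sqKernel hb.1 x)
      rw [shape_of_le hb.2]
      have hb0 := hb.1
      have : 0 < 2 * x - b := by linarith [hb.2]
      congr 2
      have e1 : 2 - b / x = (2 * x - b) / x := by field_simp
      have e2 : 2 * (x / b) - 1 = (2 * x - b) / b := by field_simp
      rw [e1, e2]
      field_simp
    · filter_upwards [eventually_two_mul_le hx] with b hb
      refine (integral_sqKernel_le hb.1 x).trans (le_of_eq ?_)
      rw [shape_of_le hb.2]
      have hb0 := hb.1
      have : 0 < 2 * x - b := by linarith [hb.2]
      congr 2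
      have e1 : 1 - b / x / 2 = (2 * x - b) / (2 * x) := by field_simp
      have e2 : x / b - 1 / 2 = (2 * x - b) / (2 * b) := by field_simp
      rw [e1, e2]
      field_simp
  -- √t ≤ 1 + t and size biasing reduce the claim to second moments about x of gamma laws with means
  -- x - b/2 and x and variances of order b.
  conc x hx := by
    have hlim : Tendsto (fun b : ℝ => 1 / √x * ((b ^ 2 / 4 + (x - b / 2) * b / 2) +
        (x - b / 2) * (x * b / 2))) (𝓝[>] 0) (𝓝 0) := by
      have : Continuous fun b : ℝ => 1 / √x * ((b ^ 2 / 4 + (x - b / 2) * b / 2) +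
        (x - b / 2) * (x * b / 2)) := by fun_prop
      have h := this.tendsto 0
      simp only [mul_zero, zero_div, add_zero, ne_eq, OfNat.ofNat_ne_zero, not_false_eq_true,
        zero_pow] at h
      exact h.mono_left nhdsWithin_le_nhds
    refine tendsto_ofReal_of_le hlim ?_
    filter_upwards [eventually_two_mul_le hx] with b hb
    have hb0 := hb.1
    have h1 := one_le_shape hb.1 x
    have hg := gammaRatio_pos h1
    set a := 2 * shape x b - 1 with ha
    have ha0 : 0 < a := by linarith
    set r := 2 * (1 / b) with hr
    have hr0 : 0 < r := by positivity
    have ea : a / r = x - b / 2 := by rw [ha, hr, shape_of_le hb.2]; field_simp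
    have ea1 : (a + 1) / r = x := by rw [ha, hr, shape_of_le hb.2]; field_simp; ring
    have e2 : a / r ^ 2 = (x - b / 2) * b / 2 := by
      rw [← ea, hr]; field_simp
    have e3 : (a + 1) / r ^ 2 = x * b / 2 := by
      have : x * b / 2 = (a + 1) / r * (b / 2) := by rw [ea1]; ring
      rw [this, hr]; field_simp
    have hxb : 0 ≤ x - b / 2 := by linarith [hb.2]
    calc _ ≤ ∫⁻ t in Ioi 0, ENNReal.ofReal (1 / √x) * (ENNReal.ofReal ((t - x) ^ 2 *
          gammaPDFReal a r t) + ENNReal.ofReal (a / r) * ENNReal.ofReal ((t - x) ^ 2 *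
          gammaPDFReal (a + 1) r t)) := by
          refine setLIntegral_mono' measurableSet_Ioi fun t ht => ?_
          have p0 := gammaPDFReal_nonneg ha0 hr0 t
          have p1 := gammaPDFReal_nonneg (show 0 < a + 1 by linarith) hr0 t
          rw [sqKernel_enorm, ← ENNReal.ofReal_mul (sqKernel_nonneg _ _ _),
            ← ENNReal.ofReal_mul (by positivity), ← ENNReal.ofReal_add (by positivity) (by positivity),
            ← ENNReal.ofReal_mul (by positivity)]
          refine ENNReal.ofReal_le_ofReal ?_
          rw [sqKernel_eq hb.1 x ht]
          have hst : √t ≤ 1 + t := by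
            have h1 := sqrt_le_half_add (le_of_lt ht) one_pos
            rw [Real.sqrt_one, div_one] at h1
            have : 0 < t := ht
            linarith
          calc _ ≤ 1 / √x * ((1 + t) * gammaPDFReal a r t) * (t - x) ^ 2 := by
                refine mul_le_mul_of_nonneg_right (mul_le_mul
                  (gammaRatio_div_sqrt_le hb.1 hb.2) ?_ (by positivity) (by positivity))
                  (sq_nonneg _)
                exact mul_le_mul_of_nonneg_right hst p0
            _ = 1 / √x * ((t - x) ^ 2 * gammaPDFReal a r t + (t - x) ^ 2 *
                (t * gammaPDFReal a r t)) := by ring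
            _ = _ := by rw [mul_gammaPDFReal ha0 hr0 ht]; ring
      _ = ENNReal.ofReal (1 / √x) * (ENNReal.ofReal (b ^ 2 / 4 + (x - b / 2) * b / 2) +
          ENNReal.ofReal (x - b / 2) * ENNReal.ofReal (x * b / 2)) := by
          rw [lintegral_const_mul' _ _ ENNReal.ofReal_ne_top, lintegral_add_left (by fun_prop),
            lintegral_const_mul' _ _ ENNReal.ofReal_ne_top,
            lintegral_sub_sq_mul_gammaPDFReal ha0 hr0,
            lintegral_sub_sq_mul_gammaPDFReal (by linarith) hr0, ea, ea1, e2, e3]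
          congr 3
          · ring_nf
          · ring_nf
      _ = _ := by
          rw [← ENNReal.ofReal_mul hxb, ← ENNReal.ofReal_add (by positivity) (by positivity),
            ← ENNReal.ofReal_mul (by positivity)]
  tail R hR := by
    -- The normalizing constant is at most x^(-1/2) and √t ≤ √R, so the Chebyshev bound gains half a
    -- power of x and becomes integrable at infinity, as p = 1 requires.
    refine ⟨fun x => ENNReal.ofReal (4 * R * √R * x ^ (-(3 / 2) : ℝ)), by fun_prop, ?_, ?_⟩
    · exact lintegral_rpow_tail_lt_top hR (by norm_num) (by norm_num) _ (by positivity) rfl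
    · filter_upwards [Ioo_mem_nhdsGT hR] with b hb x hx
      have hb0 := hb.1
      have hx0 : 0 < x := by linarith
      have h2b : 2 * b ≤ x := by linarith [hb.2]
      have h1 := one_le_shape hb.1 x
      simp only [sqKernel_enorm]
      set a := 2 * shape x b - 1 with ha
      have ha0 : 0 < a := by linarith
      set r := 2 * (1 / b) with hr
      have hr0 : 0 < r := by positivity
      have ea : a / r = x - b / 2 := by rw [ha, hr, shape_of_le h2b]; field_simp
      have e2 : a / r ^ 2 = (x - b / 2) * b / 2 := by
        rw [← ea, hr]; field_simp
      have hP := lintegral_Ioc_le_of_sub_sq (m := R * x) (gammaPDFReal_nonneg ha0 hr0) hR hx (by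
        rw [lintegral_sub_sq_mul_gammaPDFReal ha0 hr0, ea, e2]
        refine ENNReal.ofReal_le_ofReal ?_
        nlinarith [hb.2])
      calc _ ≤ ∫⁻ t in Ioc 0 R, ENNReal.ofReal (1 / √x * √R) * ENNReal.ofReal (gammaPDFReal a r t) := by
            refine setLIntegral_mono' measurableSet_Ioc fun t ht => ?_
            have p0 := gammaPDFReal_nonneg ha0 hr0 t
            rw [← ENNReal.ofReal_mul (by positivity)]
            refine ENNReal.ofReal_le_ofReal ?_
            rw [sqKernel_eq hb.1 x ht.1, mul_assoc (1 / √x)]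
            refine mul_le_mul (gammaRatio_div_sqrt_le hb.1 h2b) ?_ (by positivity) (by positivity)
            exact mul_le_mul_of_nonneg_right (Real.sqrt_le_sqrt ht.2) p0
        _ ≤ ENNReal.ofReal (1 / √x * √R) * ENNReal.ofReal (4 / x ^ 2 * (R * x)) := by
            rw [lintegral_const_mul' _ _ ENNReal.ofReal_ne_top]
            gcongr
        _ = _ := by
            rw [← ENNReal.ofReal_mul (by positivity)]
            congr 1
            have : x ^ (-(3 / 2) : ℝ) = 1 / (x * √x) := by
              rw [Real.rpow_neg hx0.le, show (3 / 2 : ℝ) = 1 + 1 / 2 by norm_num,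
                Real.rpow_add hx0, Real.rpow_one, ← Real.sqrt_eq_rpow, one_div]
            rw [this]
            have : 0 < √x := Real.sqrt_pos.2 hx0
            field_simp

/-! ### The remainder kernel and the boundary kernel -/

/-- Every condition except the limiting mass is monotone in |Q|, so a dominated kernel needs only
its own mass computed. -/
theorem IsApproxIdentity.of_le {Q Q' : ℝ → ℝ → ℝ → ℝ} {c c' : ℝ} {p : ℝ≥0∞}
    (hQ : IsApproxIdentity Q c p) (hm : ∀ b, 0 < b → Measurable (Function.uncurry (Q' b)))
    (hle : ∀ b, 0 < b → ∀ x, 0 < x → ∀ t, 0 < t → ‖Q' b x t‖ₑ ≤ ‖Q b x t‖ₑ)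
    (hmass : ∀ x, 0 < x → Tendsto (fun b => ∫ t in Ioi 0, Q' b x t) (𝓝[>] 0) (𝓝 c')) :
    IsApproxIdentity Q' c' p where
  bound := by
    obtain ⟨C, hC⟩ := hQ.bound
    refine ⟨C, fun b hb => ⟨hm b hb, fun x hx => ?_, fun t ht => ?_⟩⟩
    · exact (setLIntegral_mono' measurableSet_Ioi fun t ht => hle b hb x hx t ht).trans
        ((hC b hb).row x hx)
    · exact (setLIntegral_mono' measurableSet_Ioi fun x hx => hle b hb x hx t ht).trans
        ((hC b hb).col t ht)
  mass := hmass
  conc x hx := by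
    refine tendsto_of_tendsto_of_tendsto_of_le_of_le' tendsto_const_nhds (hQ.conc x hx)
      (Eventually.of_forall fun _ => zero_le) ?_
    filter_upwards [eventually_mem_nhdsWithin] with b hb
    refine setLIntegral_mono' measurableSet_Ioi fun t ht => ?_
    gcongr
    exact hle b hb x hx t ht
  tail R hR := by
    obtain ⟨D, hD, hD2, hD3⟩ := hQ.tail R hR
    refine ⟨D, hD, hD2, ?_⟩
    filter_upwards [hD3, eventually_mem_nhdsWithin] with b hb hb0 x hx
    exact (setLIntegral_mono' measurableSet_Ioc fun t ht =>
      hle b hb0 x (by linarith) t ht.1).trans (hb x hx)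

/-- The kernel `|t - s|`, for `s` between `x` and `t`. -/
noncomputable def peanoKernel (x t s : ℝ) : ℝ :=
  if min x t < s ∧ s ≤ max x t then |t - s| else 0

theorem peanoKernel_nonneg (x t s : ℝ) : 0 ≤ peanoKernel x t s := by
  unfold peanoKernel; split_ifs <;> positivity

theorem peanoKernel_le (x t s : ℝ) : peanoKernel x t s ≤ |t - s| := by
  unfold peanoKernel; split_ifs <;> [exact le_rfl; positivity]

theorem measurable_peanoKernel :
    Measurable fun z : (ℝ × ℝ) × ℝ => peanoKernel z.1.1 z.2 z.1.2 := by
  unfold peanoKernel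
  have h1 : Measurable fun z : (ℝ × ℝ) × ℝ => min z.1.1 z.2 := by fun_prop
  have h2 : Measurable fun z : (ℝ × ℝ) × ℝ => max z.1.1 z.2 := by fun_prop
  have h3 : Measurable fun z : (ℝ × ℝ) × ℝ => z.1.2 := by fun_prop
  refine Measurable.ite ?_ (by fun_prop) measurable_const
  exact (measurableSet_lt h1 h3).inter (measurableSet_le h3 h2)

/-- The kernel that represents `∫ K(x,t) g(t) dt - g(x)` in terms of `s g''(s)` at points `x ≥ 2b`. -/
noncomputable def remainderKernel (b x s : ℝ) : ℝ :=
  if 2 * b ≤ x then 1 / (b * s) * ∫ t in Ioi 0, gammaKernel x b t * peanoKernel x t s else 0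

theorem measurable_gammaKernel_pair {b : ℝ} (hb : 0 < b) :
    Measurable fun z : (ℝ × ℝ) × ℝ => gammaKernel z.1.1 b z.2 :=
  (measurable_gammaKernel hb).comp
    ((measurable_fst.comp measurable_fst).prodMk measurable_snd : Measurable
      fun z : (ℝ × ℝ) × ℝ => (z.1.1, z.2))

theorem measurable_gammaKernel_right (x b : ℝ) : Measurable (gammaKernel x b) :=
  measurable_gammaPDFReal _ _

theorem measurable_peanoKernel_mid (x s : ℝ) : Measurable fun t => peanoKernel x t s :=
  measurable_peanoKernel.comp (g := fun z : (ℝ × ℝ) × ℝ => peanoKernel z.1.1 z.2 z.1.2)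
    (f := fun t : ℝ => ((x, s), t)) (by fun_prop)

theorem measurable_peanoKernel_prod (x : ℝ) : Measurable fun z : ℝ × ℝ => peanoKernel x z.1 z.2 :=
  measurable_peanoKernel.comp (g := fun z : (ℝ × ℝ) × ℝ => peanoKernel z.1.1 z.2 z.1.2)
    (f := fun z : ℝ × ℝ => ((x, z.2), z.1)) (by fun_prop)

theorem measurable_remainderKernel {b : ℝ} (hb : 0 < b) :
    Measurable (Function.uncurry (remainderKernel b)) := by
  have h := ((measurable_gammaKernel_pair hb).mul
    measurable_peanoKernel).stronglyMeasurable.integral_prod_right' (ν := volume.restrict (Ioi 0))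
  refine Measurable.ite (measurableSet_le measurable_const measurable_fst) ?_ measurable_const
  exact Measurable.mul (by fun_prop) h.measurable

theorem integrableOn_peano {b : ℝ} (hb : 0 < b) (x s : ℝ) :
    IntegrableOn (fun t => gammaKernel x b t * peanoKernel x t s) (Ioi 0) := by
  have h1 := integrableOn_mul_gammaPDFReal (shape_pos hb x) (show 0 < 1 / b by positivity)
  have h2 := (integrableOn_gammaKernel hb x).const_mul |s|
  refine Integrable.mono' (h1.add h2) ((measurable_gammaKernel_right x b).mul
    (measurable_peanoKernel_mid x s)).aestronglyMeasurable ?_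
  filter_upwards [ae_restrict_mem measurableSet_Ioi] with t ht
  have hK := gammaKernel_nonneg hb x t
  rw [Real.norm_of_nonneg (mul_nonneg hK (peanoKernel_nonneg _ _ _))]
  have h3 : peanoKernel x t s ≤ t + |s| := (peanoKernel_le x t s).trans
    ((abs_sub t s).trans (by rw [abs_of_pos (mem_Ioi.1 ht)]))
  calc _ ≤ gammaKernel x b t * (t + |s|) := by gcongr
    _ = t * gammaKernel x b t + |s| * gammaKernel x b t := by ring

theorem integral_peano_nonneg {b : ℝ} (hb : 0 < b) (x s : ℝ) :
    0 ≤ ∫ t in Ioi 0, gammaKernel x b t * peanoKernel x t s :=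
  integral_nonneg fun t => mul_nonneg (gammaKernel_nonneg hb x t) (peanoKernel_nonneg _ _ _)

/-- The remainder kernel is dominated by the gamma kernel. -/
theorem integral_peano_le {b x s : ℝ} (hb : 0 < b) (h : 2 * b ≤ x) (hs : 0 < s) :
    ∫ t in Ioi 0, gammaKernel x b t * peanoKernel x t s ≤ b * s * gammaKernel x b s := by
  have ha := shape_pos hb x
  have hr : 0 < 1 / b := by positivity
  have hmean := shape_div_of_le hb h
  have e : s * gammaPDFReal (shape x b) (1 / b) s / (1 / b) = b * s * gammaKernel x b s := by
    rw [gammaKernel]; field_simp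
  have hi := integrableOn_sub_mul_gammaPDFReal ha hr x
  -- Only t on the far side of s from x contribute, and there |t - s| ≤ |t - x|. The resulting
  -- partial first moment about the mean x is exactly b s K(x,s).
  rcases lt_or_ge x s with hxs | hxs
  · have h1 := integral_Ioi_sub_mul_gammaPDFReal ha hr hs
    rw [e, hmean] at h1
    rw [← h1]
    calc _ ≤ ∫ t in Ioi 0, (Ioi s).indicator
          (fun t => (t - x) * gammaPDFReal (shape x b) (1 / b) t) t := by
          refine setIntegral_mono_on (integrableOn_peano hb x s)
            (hi.indicator measurableSet_Ioi) measurableSet_Ioi fun t _ => ?_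
          have hK := gammaKernel_nonneg hb x t
          by_cases hts : s < t
          · rw [indicator_of_mem (by exact hts), mul_comm]
            refine mul_le_mul_of_nonneg_right ((peanoKernel_le x t s).trans ?_) hK
            rw [abs_of_pos (by linarith)]; linarith
          · rw [indicator_of_notMem (by exact hts)]
            have : peanoKernel x t s = 0 := by
              unfold peanoKernel
              split_ifs with hc
              · have h3 : s ≤ t := by
                  rcases le_max_iff.1 hc.2 with h | h <;> linarith
                rw [le_antisymm h3 (not_lt.1 hts), sub_self, abs_zero]
              · rfl
            rw [this, mul_zero]
      _ = _ := by
          rw [setIntegral_indicator measurableSet_Ioi]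
          congr 2
          ext t; simp only [mem_inter_iff, mem_Ioi]; constructor
          · exact fun h => h.2
          · exact fun h => ⟨hs.trans h, h⟩
  · have h1 := integral_Ioc_sub_mul_gammaPDFReal ha hr hs
    rw [e, hmean] at h1
    rw [← h1]
    have hi' : IntegrableOn (fun t => (x - t) * gammaPDFReal (shape x b) (1 / b) t) (Ioi 0) :=
      hi.neg.congr (ae_of_all _ fun t => by simp only [Pi.neg_apply]; ring)
    calc _ ≤ ∫ t in Ioi 0, (Iic s).indicator
          (fun t => (x - t) * gammaPDFReal (shape x b) (1 / b) t) t := by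
          refine setIntegral_mono_on (integrableOn_peano hb x s)
            (hi'.indicator measurableSet_Iic) measurableSet_Ioi fun t _ => ?_
          have hK := gammaKernel_nonneg hb x t
          by_cases hts : t ≤ s
          · rw [indicator_of_mem (by exact hts), mul_comm]
            refine mul_le_mul_of_nonneg_right ((peanoKernel_le x t s).trans ?_) hK
            rw [abs_of_nonpos (by linarith)]; linarith
          · rw [indicator_of_notMem (by exact hts)]
            have : peanoKernel x t s = 0 := by
              unfold peanoKernel
              rw [if_neg]
              rintro ⟨hc, -⟩
              rcases min_lt_iff.1 hc with h | h <;> linarith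
            rw [this, mul_zero]
      _ = _ := by
          rw [setIntegral_indicator measurableSet_Iic, Ioi_inter_Iic]

theorem remainderKernel_nonneg {b : ℝ} (hb : 0 < b) {x s : ℝ} (hs : 0 < s) :
    0 ≤ remainderKernel b x s := by
  unfold remainderKernel
  split_ifs
  · exact mul_nonneg (by positivity) (integral_peano_nonneg hb x s)
  · exact le_rfl

theorem remainderKernel_le {b : ℝ} (hb : 0 < b) {x s : ℝ} (hs : 0 < s) :
    remainderKernel b x s ≤ gammaKernel x b s := by
  unfold remainderKernel
  split_ifs with h
  · rw [one_div_mul_eq_div, div_le_iff₀ (by positivity), mul_comm]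
    exact integral_peano_le hb h hs
  · exact gammaKernel_nonneg hb x s

theorem lintegral_peanoKernel {x t : ℝ} (hx : 0 < x) (ht : 0 < t) :
    ∫⁻ s in Ioi 0, ENNReal.ofReal (peanoKernel x t s) = ENNReal.ofReal ((t - x) ^ 2 / 2) := by
  have hmin : 0 < min x t := lt_min hx ht
  have h1 : ∀ s, ENNReal.ofReal (peanoKernel x t s) =
      (Ioc (min x t) (max x t)).indicator (fun s => ENNReal.ofReal |t - s|) s := by
    intro s
    by_cases hs : s ∈ Ioc (min x t) (max x t)
    · rw [indicator_of_mem hs, peanoKernel, if_pos (mem_Ioc.1 hs)]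
    · rw [indicator_of_notMem hs, peanoKernel, if_neg (fun h : min x t < s ∧ s ≤ max x t => hs h), ENNReal.ofReal_zero]
  simp_rw [h1]
  have hsub : Ioc (min x t) (max x t) ⊆ Ioi 0 := fun s hs => hmin.trans hs.1
  have hi : IntegrableOn (fun s => |t - s|) (Ioc (min x t) (max x t)) :=
    Continuous.integrableOn_Ioc (by fun_prop)
  rw [setLIntegral_indicator measurableSet_Ioc, inter_eq_left.2 hsub,
    ← ofReal_integral_eq_lintegral_ofReal hi (ae_of_all _ fun s => abs_nonneg _)]
  congr 1
  rcases le_total x t with h | h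
  · rw [min_eq_left h, max_eq_right h]
    rw [setIntegral_congr_fun (g := fun s => t - s) measurableSet_Ioc
      (fun s hs => abs_of_nonneg (by linarith [hs.2])), ← intervalIntegral.integral_of_le h,
      intervalIntegral.integral_sub intervalIntegrable_const intervalIntegral.intervalIntegrable_id,
      intervalIntegral.integral_const, integral_id, smul_eq_mul]
    ring
  · rw [min_eq_right h, max_eq_left h]
    rw [setIntegral_congr_fun (g := fun s => s - t) measurableSet_Ioc
      (fun s hs => by
        show |t - s| = s - t
        rw [abs_of_nonpos (by linarith [hs.1])]; ring), ← intervalIntegral.integral_of_le h]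
    simp
    ring

theorem ofReal_integral_peano {b : ℝ} (hb : 0 < b) (x s : ℝ) :
    ENNReal.ofReal (∫ t in Ioi 0, gammaKernel x b t * peanoKernel x t s) =
      ∫⁻ t in Ioi 0, ENNReal.ofReal (gammaKernel x b t) * ENNReal.ofReal (peanoKernel x t s) := by
  rw [ofReal_integral_eq_lintegral_ofReal (integrableOn_peano hb x s)
    (ae_of_all _ fun t => mul_nonneg (gammaKernel_nonneg hb x t) (peanoKernel_nonneg _ _ _))]
  simp_rw [ENNReal.ofReal_mul (gammaKernel_nonneg hb x _)]

/-- The weight s cancels the division by s. After Tonelli the Peano kernel integrates to (t-x)²/2,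
and the variance bx of the gamma kernel finishes. -/
theorem integral_mul_remainderKernel {b x : ℝ} (hb : 0 < b) (h : 2 * b ≤ x) :
    ∫ s in Ioi 0, s * remainderKernel b x s = x / 2 := by
  have hx : 0 < x := by linarith
  have hm : Measurable fun s => remainderKernel b x s :=
    (measurable_remainderKernel hb).comp (measurable_const.prodMk measurable_id)
  have key : ∫⁻ s in Ioi 0, ENNReal.ofReal (s * remainderKernel b x s) = ENNReal.ofReal (x / 2) := by
    calc _ = ∫⁻ s in Ioi 0, ENNReal.ofReal (1 / b) * ∫⁻ t in Ioi 0,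
          ENNReal.ofReal (gammaKernel x b t) * ENNReal.ofReal (peanoKernel x t s) := by
          refine setLIntegral_congr_fun measurableSet_Ioi fun s hs => ?_
          rw [← ofReal_integral_peano hb, ← ENNReal.ofReal_mul (by positivity), remainderKernel,
            if_pos h]
          congr 1
          have : s ≠ 0 := (mem_Ioi.1 hs).ne'
          field_simp
      _ = ENNReal.ofReal (1 / b) * ∫⁻ t in Ioi 0, ENNReal.ofReal (gammaKernel x b t) *
          ∫⁻ s in Ioi 0, ENNReal.ofReal (peanoKernel x t s) := by
          rw [lintegral_const_mul' _ _ ENNReal.ofReal_ne_top, lintegral_lintegral_swap]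
          · simp_rw [lintegral_const_mul' _ _ ENNReal.ofReal_ne_top]
          · refine Measurable.aemeasurable ?_
            exact Measurable.mul
              (((measurable_gammaKernel_right x b).comp measurable_snd).ennreal_ofReal)
              (((measurable_peanoKernel_prod x).comp measurable_swap).ennreal_ofReal)
      _ = ENNReal.ofReal (1 / b) * ∫⁻ t in Ioi 0, ENNReal.ofReal (1 / 2) *
          ENNReal.ofReal ((t - x) ^ 2 * gammaKernel x b t) := by
          congr 1
          refine setLIntegral_congr_fun measurableSet_Ioi fun t ht => ?_
          rw [lintegral_peanoKernel hx ht, ← ENNReal.ofReal_mul (gammaKernel_nonneg hb x t),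
            ← ENNReal.ofReal_mul (by norm_num)]
          congr 1; ring
      _ = _ := by
          rw [lintegral_const_mul' _ _ ENNReal.ofReal_ne_top, lintegral_sub_sq_mul_gammaKernel hb h,
            ← ENNReal.ofReal_mul (by norm_num), ← ENNReal.ofReal_mul (by positivity)]
          congr 1; field_simp
  rw [integral_eq_lintegral_of_nonneg_ae, key, ENNReal.toReal_ofReal (by positivity)]
  · filter_upwards [ae_restrict_mem measurableSet_Ioi] with s hs
    exact mul_nonneg (le_of_lt hs) (remainderKernel_nonneg hb hs)
  · exact (measurable_id.mul hm).aestronglyMeasurable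

/-- The previous moment identity makes x times the deviation equal to ∫(x-s)R(x,s)ds. Since R ≤ K,
this is at most the standard deviation √(bx) of the gamma kernel. -/
theorem abs_integral_remainderKernel_sub_le {b x : ℝ} (hb : 0 < b) (h : 2 * b ≤ x) :
    |(∫ s in Ioi 0, remainderKernel b x s) - 1 / 2| ≤ √(b * x) / x := by
  have hx : 0 < x := by linarith
  have hm : Measurable fun s => remainderKernel b x s :=
    (measurable_remainderKernel hb).comp (measurable_const.prodMk measurable_id)
  have i0 : IntegrableOn (remainderKernel b x) (Ioi 0) := by
    refine Integrable.mono' (integrableOn_gammaKernel hb x) hm.aestronglyMeasurable ?_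
    filter_upwards [ae_restrict_mem measurableSet_Ioi] with s hs
    rw [Real.norm_of_nonneg (remainderKernel_nonneg hb hs)]
    exact remainderKernel_le hb hs
  have i1 : IntegrableOn (fun s => s * remainderKernel b x s) (Ioi 0) := by
    refine Integrable.mono' (integrableOn_mul_gammaPDFReal (shape_pos hb x)
      (show 0 < 1 / b by positivity)) (measurable_id.mul hm).aestronglyMeasurable ?_
    filter_upwards [ae_restrict_mem measurableSet_Ioi] with s hs
    rw [Real.norm_of_nonneg (mul_nonneg (le_of_lt hs) (remainderKernel_nonneg hb hs))]
    exact mul_le_mul_of_nonneg_left (remainderKernel_le hb hs) (le_of_lt hs)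
  have hs : 0 < √(b * x) := Real.sqrt_pos.2 (by positivity)
  have e : x * ((∫ s in Ioi 0, remainderKernel b x s) - 1 / 2) =
      ∫ s in Ioi 0, (x - s) * remainderKernel b x s := by
    have : ∀ s, (x - s) * remainderKernel b x s = x * remainderKernel b x s -
        s * remainderKernel b x s := fun s => by ring
    simp_rw [this]
    rw [integral_sub (i0.const_mul x) i1, integral_const_mul, integral_mul_remainderKernel hb h]
    ring
  have i2 := integrableOn_sub_sq_mul_gammaKernel hb x x
  have i3 := integrableOn_gammaKernel hb x
  have hle : ‖∫ s in Ioi 0, (x - s) * remainderKernel b x s‖ ≤ √(b * x) := by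
    calc ‖∫ s in Ioi 0, (x - s) * remainderKernel b x s‖ ≤ ∫ s in Ioi 0, (1 / (2 * √(b * x)) * ((s - x) ^ 2 * gammaKernel x b s) +
          √(b * x) / 2 * gammaKernel x b s) := by
          refine norm_integral_le_of_norm_le ((i2.const_mul _).add (i3.const_mul _)) ?_
          filter_upwards [ae_restrict_mem measurableSet_Ioi] with s hs'
          rw [norm_mul, Real.norm_of_nonneg (remainderKernel_nonneg hb hs'), Real.norm_eq_abs]
          have h1 : |x - s| ≤ 1 / (2 * √(b * x)) * (s - x) ^ 2 + √(b * x) / 2 := by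
            have : 1 / (2 * √(b * x)) * (s - x) ^ 2 + √(b * x) / 2 - |x - s| =
                1 / (2 * √(b * x)) * (|x - s| - √(b * x)) ^ 2 := by
              field_simp
              rw [show (s - x) ^ 2 = |x - s| ^ 2 by rw [sq_abs]; ring]
              ring
            have : 0 ≤ 1 / (2 * √(b * x)) * (|x - s| - √(b * x)) ^ 2 := by positivity
            linarith
          have := mul_le_mul h1 (remainderKernel_le (x := x) hb hs')
            (remainderKernel_nonneg hb hs') (by positivity)
          linarith
      _ = √(b * x) := by
          rw [integral_add (i2.const_mul _) (i3.const_mul _), integral_const_mul,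
            integral_const_mul, integral_sub_sq_mul_gammaKernel hb h, integral_gammaKernel hb]
          have := Real.mul_self_sqrt (show 0 ≤ b * x by positivity)
          field_simp
          nlinarith
  rw [le_div_iff₀ hx, ← abs_of_pos hx, ← abs_mul, abs_of_pos hx, mul_comm, e]
  exact hle

theorem isApproxIdentity_remainderKernel : IsApproxIdentity remainderKernel (1 / 2) 2 := by
  refine isApproxIdentity_gammaKernel.of_le (fun b hb => measurable_remainderKernel hb)
    (fun b hb x hx t ht => ?_) fun x hx => ?_
  · rw [Real.enorm_of_nonneg (remainderKernel_nonneg hb ht), gammaKernel_enorm hb]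
    exact ENNReal.ofReal_le_ofReal (remainderKernel_le hb ht)
  · rw [tendsto_iff_norm_sub_tendsto_zero]
    have h0 : Tendsto (fun b : ℝ => √(b * x) / x) (𝓝[>] 0) (𝓝 0) := by
      have : Continuous fun b : ℝ => √(b * x) / x := by fun_prop
      have h := this.tendsto 0
      simp only [zero_mul, Real.sqrt_zero, zero_div] at h
      exact h.mono_left nhdsWithin_le_nhds
    refine squeeze_zero' (Eventually.of_forall fun _ => norm_nonneg _) ?_ h0
    filter_upwards [eventually_two_mul_le hx] with b hb
    exact abs_integral_remainderKernel_sub_le hb.1 hb.2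

/-- The upper tail of the gamma kernel. -/
noncomputable def gammaTail (b x s : ℝ) : ℝ :=
  ∫ t in Ioi 0, gammaKernel x b t * (Ici s).indicator 1 t

/-- The kernel that controls `∫ K(x,t) g(t) dt - g(x)` by `|g'|` at points `x < 2b`. -/
noncomputable def boundaryKernel (b x s : ℝ) : ℝ :=
  if x < 2 * b then 1 / b * ((Iic x).indicator 1 s + gammaTail b x s) else 0

theorem integrableOn_gammaTail {b : ℝ} (hb : 0 < b) (x s : ℝ) :
    IntegrableOn (fun t => gammaKernel x b t * (Ici s).indicator 1 t) (Ioi 0) := by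
  refine (integrableOn_gammaKernel hb x).mul_bdd (c := 1)
    (measurable_one.indicator measurableSet_Ici).aestronglyMeasurable (ae_of_all _ fun t => ?_)
  by_cases h : t ∈ Ici s <;> simp [h]

theorem gammaTail_nonneg {b : ℝ} (hb : 0 < b) (x s : ℝ) : 0 ≤ gammaTail b x s :=
  integral_nonneg fun t => mul_nonneg (gammaKernel_nonneg hb x t)
    (indicator_nonneg (fun _ _ => zero_le_one) _)

theorem gammaTail_le_one {b : ℝ} (hb : 0 < b) (x s : ℝ) : gammaTail b x s ≤ 1 := by
  rw [← integral_gammaKernel hb x]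
  refine integral_mono (integrableOn_gammaTail hb x s) (integrableOn_gammaKernel hb x) fun t => ?_
  refine mul_le_of_le_one_right (gammaKernel_nonneg hb x t) ?_
  by_cases h : t ∈ Ici s <;> simp [h]

theorem boundaryKernel_nonneg {b : ℝ} (hb : 0 < b) (x s : ℝ) : 0 ≤ boundaryKernel b x s := by
  unfold boundaryKernel
  split_ifs
  · exact mul_nonneg (by positivity) (add_nonneg (indicator_nonneg (fun _ _ => zero_le_one) _)
      (gammaTail_nonneg hb x s))
  · exact le_rfl

theorem measurable_boundaryKernel {b : ℝ} (hb : 0 < b) :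
    Measurable (Function.uncurry (boundaryKernel b)) := by
  have hind : Measurable fun z : (ℝ × ℝ) × ℝ => (Ici z.1.2).indicator (1 : ℝ → ℝ) z.2 := by
    have : (fun z : (ℝ × ℝ) × ℝ => (Ici z.1.2).indicator (1 : ℝ → ℝ) z.2) =
        fun z => if z.1.2 ≤ z.2 then 1 else 0 := by
      ext z; simp [indicator_apply]
    rw [this]
    exact Measurable.ite (measurableSet_le (by fun_prop) (by fun_prop)) measurable_const
      measurable_const
  have h := ((measurable_gammaKernel_pair hb).mul hind).stronglyMeasurable.integral_prod_right'
    (ν := volume.restrict (Ioi 0))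
  have hind2 : Measurable fun z : ℝ × ℝ => (Iic z.1).indicator (1 : ℝ → ℝ) z.2 := by
    have : (fun z : ℝ × ℝ => (Iic z.1).indicator (1 : ℝ → ℝ) z.2) =
        fun z => if z.2 ≤ z.1 then 1 else 0 := by
      ext z; simp [indicator_apply]
    rw [this]
    exact Measurable.ite (measurableSet_le (by fun_prop) (by fun_prop)) measurable_const
      measurable_const
  refine Measurable.ite (measurableSet_lt measurable_fst measurable_const) ?_ measurable_const
  exact (hind2.add h.measurable).const_mul _

theorem ofReal_gammaTail {b : ℝ} (hb : 0 < b) (x s : ℝ) :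
    ENNReal.ofReal (gammaTail b x s) =
      ∫⁻ t in Ioi 0, ENNReal.ofReal (gammaKernel x b t) * (Ici s).indicator 1 t := by
  rw [gammaTail, ofReal_integral_eq_lintegral_ofReal (integrableOn_gammaTail hb x s)
    (ae_of_all _ fun t => mul_nonneg (gammaKernel_nonneg hb x t)
      (indicator_nonneg (fun _ _ => zero_le_one) _))]
  refine lintegral_congr fun t => ?_
  rw [ENNReal.ofReal_mul (gammaKernel_nonneg hb x _)]
  congr 1
  by_cases h : t ∈ Ici s <;> simp [h]

theorem enorm_boundaryKernel {b x : ℝ} (hb : 0 < b) (h : x < 2 * b) (s : ℝ) :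
    ‖boundaryKernel b x s‖ₑ = ENNReal.ofReal (1 / b) * ((Iic x).indicator 1 s +
      ∫⁻ t in Ioi 0, ENNReal.ofReal (gammaKernel x b t) * (Ici s).indicator 1 t) := by
  have h0 : 0 ≤ (Iic x).indicator (1 : ℝ → ℝ) s := indicator_nonneg (fun _ _ => zero_le_one) _
  rw [Real.enorm_of_nonneg (boundaryKernel_nonneg hb x s), boundaryKernel, if_pos h,
    ENNReal.ofReal_mul (by positivity), ENNReal.ofReal_add h0 (gammaTail_nonneg hb x s), ofReal_gammaTail hb]
  congr 2
  by_cases h : s ∈ Iic x <;> simp [h]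

theorem measurable_indicator_Ici_swap :
    Measurable fun z : ℝ × ℝ => (Ici z.1).indicator (1 : ℝ → ℝ≥0∞) z.2 := by
  have : (fun z : ℝ × ℝ => (Ici z.1).indicator (1 : ℝ → ℝ≥0∞) z.2) =
      fun z => if z.1 ≤ z.2 then 1 else 0 := by
    ext z; simp [indicator_apply]
  rw [this]
  exact Measurable.ite (measurableSet_le (by fun_prop) (by fun_prop)) measurable_const
    measurable_const

/-- For fixed x the kernel vanishes as soon as 2b ≤ x, so only uniform bounds need work. A row has
mass (x + ρb)/b < 2 + 2, with ρb the mean of the gamma kernel; a column is at most 2/b on a strip of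
width 2b. -/
theorem isApproxIdentity_boundaryKernel : IsApproxIdentity boundaryKernel 0 2 where
  bound := by
    refine ⟨4, fun b hb => ⟨measurable_boundaryKernel hb, fun x hx => ?_, fun s hs => ?_⟩⟩
    · by_cases h : x < 2 * b
      · simp_rw [enorm_boundaryKernel hb h]
        rw [lintegral_const_mul' _ _ ENNReal.ofReal_ne_top,
          lintegral_add_left (measurable_one.indicator measurableSet_Iic),
          lintegral_indicator_one measurableSet_Iic, lintegral_lintegral_swap]
        · have e1 : ∀ t ∈ Ioi (0 : ℝ), (∫⁻ s in Ioi 0, ENNReal.ofReal (gammaKernel x b t) *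
              (Ici s).indicator 1 t) = ENNReal.ofReal (t * gammaKernel x b t) := by
            intro t ht
            rw [lintegral_const_mul' _ _ ENNReal.ofReal_ne_top]
            have : ∀ s, (Ici s).indicator (1 : ℝ → ℝ≥0∞) t = (Iic t).indicator 1 s := by
              intro s; simp [indicator_apply]
            simp_rw [this]
            rw [lintegral_indicator_one measurableSet_Iic, Measure.restrict_apply measurableSet_Iic,
              Iic_inter_Ioi, Real.volume_Ioc, sub_zero,
              ← ENNReal.ofReal_mul (gammaKernel_nonneg hb x t), mul_comm]
          have i1 : IntegrableOn (fun t => t * gammaKernel x b t) (Ioi 0) :=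
            integrableOn_mul_gammaPDFReal (shape_pos hb x) (by positivity)
          rw [setLIntegral_congr_fun measurableSet_Ioi e1, Measure.restrict_apply measurableSet_Iic,
            Iic_inter_Ioi, Real.volume_Ioc, sub_zero, ← ofReal_integral_eq_lintegral_ofReal i1]
          · have e2 : ∫ t in Ioi 0, t * gammaKernel x b t = shape x b * b := by
              refine (integral_mul_gammaPDFReal (shape_pos hb x) (by positivity)).trans ?_
              field_simp
            rw [e2, ← ENNReal.ofReal_add hx.le (by have := shape_pos hb x; positivity),
              ← ENNReal.ofReal_mul (by positivity)]
            have := shape_lt_two hb hx h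
            refine (ENNReal.ofReal_le_ofReal (q := 4) ?_).trans (by norm_num)
            rw [one_div_mul_eq_div, div_le_iff₀ hb]
            nlinarith
          · filter_upwards [ae_restrict_mem measurableSet_Ioi] with t ht
            exact mul_nonneg (le_of_lt ht) (gammaKernel_nonneg hb x t)
        · exact (((measurable_gammaKernel_right x b).comp measurable_snd).ennreal_ofReal.mul
            measurable_indicator_Ici_swap).aemeasurable
      · have : ∀ t, boundaryKernel b x t = 0 := fun t => if_neg h
        simp [this]
    · refine (lintegral_Ioi_le_boundary_add hb _).trans ?_
      have h1 : ∫⁻ x in Ici (2 * b), ‖boundaryKernel b x s‖ₑ = 0 := by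
        rw [setLIntegral_congr_fun (g := 0) measurableSet_Ici]
        · simp
        · intro x hx
          simp [boundaryKernel, not_lt.2 (mem_Ici.1 hx)]
      rw [h1, add_zero]
      refine (lintegral_boundary_le hb (c := 2) (by norm_num) fun x hx h => ?_).trans (by norm_num)
      rw [Real.enorm_of_nonneg (boundaryKernel_nonneg hb x s)]
      refine ENNReal.ofReal_le_ofReal ?_
      rw [boundaryKernel, if_pos h, one_div_mul_eq_div]
      gcongr
      have h2 : (Iic x).indicator (1 : ℝ → ℝ) s ≤ 1 := by
        by_cases h : s ∈ Iic x <;> simp [h]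
      linarith [gammaTail_le_one hb x s]
  mass x hx := by
    refine tendsto_const_nhds.congr' ?_
    filter_upwards [eventually_two_mul_le hx] with b hb
    simp [boundaryKernel, not_lt.2 hb.2]
  conc x hx := by
    refine tendsto_const_nhds.congr' ?_
    filter_upwards [eventually_two_mul_le hx] with b hb
    simp [boundaryKernel, not_lt.2 hb.2]
  tail R hR := by
    refine ⟨0, measurable_zero, by simp, ?_⟩
    filter_upwards [Ioo_mem_nhdsGT hR] with b hb x hx
    have : ¬ x < 2 * b := by linarith [hb.2]
    simp [boundaryKernel, this]

/-! ### One-dimensional bias -/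

/-- Taylor's formula with integral remainder, from the antiderivative (t-s)g'(s) + g(s). When t < x
the reversed orientation and the sign of t - s cancel, so |t - s| serves both cases. -/
theorem integral_peanoKernel_mul {g g' g'' : ℝ → ℝ} (hg : ∀ t, 0 < t → HasDerivAt g (g' t) t)
    (hg' : ∀ t, 0 < t → HasDerivAt g' (g'' t) t) (hc : ContinuousOn g'' (Ioi 0))
    {x t : ℝ} (hx : 0 < x) (ht : 0 < t) :
    ∫ s in Ioi 0, peanoKernel x t s * g'' s = g t - g x - g' x * (t - x) := by
  have hsub : uIcc x t ⊆ Ioi 0 := fun s hs => (lt_min hx ht).trans_le hs.1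
  have hd : ∀ s ∈ uIcc x t, HasDerivAt (fun s => (t - s) * g' s + g s) ((t - s) * g'' s) s := by
    intro s hs
    have hs0 := hsub hs
    have := (((hasDerivAt_id s).const_sub t).mul (hg' s hs0)).add (hg s hs0)
    refine this.congr_deriv ?_
    simp only [id_eq]; ring
  have hint : IntervalIntegrable (fun s => (t - s) * g'' s) volume x t :=
    ((continuous_const.sub continuous_id).continuousOn.mul (hc.mono hsub)).intervalIntegrable
  have h1 := intervalIntegral.integral_eq_sub_of_hasDerivAt hd hint
  have h2 : ∫ s in Ioi 0, peanoKernel x t s * g'' s =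
      ∫ s in Ioc (min x t) (max x t), |t - s| * g'' s := by
    have : ∀ s, peanoKernel x t s * g'' s =
        (Ioc (min x t) (max x t)).indicator (fun s => |t - s| * g'' s) s := by
      intro s
      by_cases hs : s ∈ Ioc (min x t) (max x t)
      · rw [indicator_of_mem hs, peanoKernel, if_pos (mem_Ioc.1 hs)]
      · rw [indicator_of_notMem hs, peanoKernel, if_neg (fun h : min x t < s ∧ s ≤ max x t => hs h), zero_mul]
    simp_rw [this]
    have hsub' : Ioc (min x t) (max x t) ⊆ Ioi 0 := fun s hs => (lt_min hx ht).trans hs.1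
    rw [setIntegral_indicator measurableSet_Ioc, inter_eq_right.2 hsub']
  have h3 : g t - g x - g' x * (t - x) = ∫ s in x..t, (t - s) * g'' s := by rw [h1]; ring
  rw [h2, h3]
  rcases le_total x t with h | h
  · rw [min_eq_left h, max_eq_right h, intervalIntegral.integral_of_le h]
    refine setIntegral_congr_fun measurableSet_Ioc fun s hs => ?_
    rw [abs_of_nonneg (by linarith [hs.2])]
  · rw [min_eq_right h, max_eq_left h, intervalIntegral.integral_of_ge h, ← integral_neg]
    refine setIntegral_congr_fun measurableSet_Ioc fun s hs => ?_
    rw [abs_of_nonpos (by linarith [hs.1])]; ring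

/-- Exact representation of the bias of the gamma kernel away from the boundary. -/
theorem integral_gammaKernel_mul_sub {g g' g'' : ℝ → ℝ} (hg : ∀ t, 0 < t → HasDerivAt g (g' t) t)
    (hg' : ∀ t, 0 < t → HasDerivAt g' (g'' t) t) (hc : ContinuousOn g'' (Ioi 0))
    (hm : Measurable g'') {x b : ℝ} (hb : 0 < b) (h : 2 * b ≤ x)
    (hi : IntegrableOn (fun t => gammaKernel x b t * g t) (Ioi 0))
    (hi2 : ∫⁻ s in Ioi 0, ‖gammaKernel x b s‖ₑ * ‖s * g'' s‖ₑ < ∞) :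
    (∫ t in Ioi 0, gammaKernel x b t * g t) - g x =
      b * ∫ s in Ioi 0, remainderKernel b x s * (s * g'' s) := by
  have hx : 0 < x := by linarith
  set F : ℝ → ℝ → ℝ := fun t s => gammaKernel x b t * (peanoKernel x t s * g'' s)
  have hFm : Measurable (Function.uncurry F) :=
    ((measurable_gammaKernel_right x b).comp measurable_fst).mul
      ((measurable_peanoKernel_prod x).mul (hm.comp measurable_snd))
  have hbs : ∀ s ∈ Ioi (0 : ℝ), ∫ t in Ioi 0, gammaKernel x b t * peanoKernel x t s =
      b * (s * remainderKernel b x s) := by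
    intro s hs
    rw [remainderKernel, if_pos h]
    have : s ≠ 0 := (mem_Ioi.1 hs).ne'
    field_simp
  -- Fubini is justified by the domination of the remainder kernel: integrating over t first leaves
  -- at most b∫K(x,s)|s g''(s)|ds.
  have hFi : Integrable (Function.uncurry F)
      ((volume.restrict (Ioi 0)).prod (volume.restrict (Ioi 0))) := by
    refine ⟨hFm.aestronglyMeasurable, ?_⟩
    rw [hasFiniteIntegral_iff_enorm, lintegral_prod_symm' _ hFm.enorm]
    calc _ ≤ ∫⁻ s in Ioi 0, ENNReal.ofReal b * (‖gammaKernel x b s‖ₑ * ‖s * g'' s‖ₑ) := by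
          refine setLIntegral_mono' measurableSet_Ioi fun s hs => ?_
          have hs0 : 0 < s := hs
          have e : ∀ t, ‖Function.uncurry F (t, s)‖ₑ = ENNReal.ofReal (gammaKernel x b t) *
              ENNReal.ofReal (peanoKernel x t s) * ‖g'' s‖ₑ := fun t => by
            simp only [Function.uncurry_apply_pair, F]
            rw [enorm_mul, enorm_mul, gammaKernel_enorm hb,
              Real.enorm_of_nonneg (peanoKernel_nonneg _ _ _), mul_assoc]
          simp_rw [e]
          rw [lintegral_mul_const' _ _ enorm_ne_top, ← ofReal_integral_peano hb,
            enorm_mul, Real.enorm_of_nonneg hs0.le, gammaKernel_enorm hb,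
            mul_left_comm (ENNReal.ofReal (gammaKernel x b s)), ← mul_assoc, ← mul_assoc]
          gcongr
          rw [← ENNReal.ofReal_mul hb.le, ← ENNReal.ofReal_mul (by positivity)]
          exact ENNReal.ofReal_le_ofReal (integral_peano_le hb h hs0)
      _ < ∞ := by
          rw [lintegral_const_mul' _ _ ENNReal.ofReal_ne_top]
          exact ENNReal.mul_lt_top ENNReal.ofReal_lt_top hi2
  have hswap := integral_integral_swap hFi
  have hL : ∫ t in Ioi 0, ∫ s in Ioi 0, F t s = (∫ t in Ioi 0, gammaKernel x b t * g t) - g x := by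
    have e : ∀ t ∈ Ioi (0 : ℝ), ∫ s in Ioi 0, F t s = gammaKernel x b t * g t -
        g x * gammaKernel x b t - g' x * ((t - x) * gammaKernel x b t) := by
      intro t ht
      simp only [F]
      rw [integral_const_mul, integral_peanoKernel_mul hg hg' hc hx ht]
      ring
    rw [setIntegral_congr_fun measurableSet_Ioi e]
    have j1 := (integrableOn_gammaKernel hb x).const_mul (g x)
    have i1 : IntegrableOn (fun t => t * gammaKernel x b t) (Ioi 0) :=
      integrableOn_mul_gammaPDFReal (shape_pos hb x) (by positivity)
    have j0 : IntegrableOn (fun t => (t - x) * gammaKernel x b t) (Ioi 0) :=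
      integrableOn_sub_mul_gammaPDFReal (shape_pos hb x) (show 0 < 1 / b by positivity) x
    have j2 := j0.const_mul (g' x)
    have j3 : IntegrableOn (fun t => gammaKernel x b t * g t - g x * gammaKernel x b t) (Ioi 0) :=
      hi.sub j1
    -- For x ≥ 2b the kernel is centred at x, so the first-order Taylor term drops out. This is what
    -- makes the bias of order b without a contribution from g'.
    have hz : ∫ t in Ioi 0, (t - x) * gammaKernel x b t = 0 := by
      have : ∀ t, (t - x) * gammaKernel x b t = t * gammaKernel x b t - x * gammaKernel x b t :=
        fun t => by ring
      simp_rw [this]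
      have m1 : ∫ t in Ioi 0, t * gammaKernel x b t = x :=
        (integral_mul_gammaPDFReal (shape_pos hb x) (by positivity)).trans (shape_div_of_le hb h)
      rw [integral_sub i1 ((integrableOn_gammaKernel hb x).const_mul x),
        integral_const_mul, integral_gammaKernel hb, mul_one]
      exact sub_eq_zero.2 m1
    rw [integral_sub j3 j2, integral_sub hi j1, integral_const_mul, integral_const_mul,
      integral_gammaKernel hb, hz]
    ring
  have hR : ∫ s in Ioi 0, ∫ t in Ioi 0, F t s = b * ∫ s in Ioi 0, remainderKernel b x s * (s * g'' s) := by
    rw [← integral_const_mul]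
    refine setIntegral_congr_fun measurableSet_Ioi fun s hs => ?_
    simp only [F]
    have : ∀ t, gammaKernel x b t * (peanoKernel x t s * g'' s) =
        gammaKernel x b t * peanoKernel x t s * g'' s := fun t => by ring
    simp_rw [this]
    rw [integral_mul_const, hbs s hs]
    ring
  rw [← hL, ← hR, hswap]

/-- Bound for the bias of the gamma kernel near the boundary. -/
theorem enorm_integral_gammaKernel_mul_sub_le {g g' : ℝ → ℝ}
    (hg : ∀ t, 0 < t → HasDerivAt g (g' t) t) (hc : ContinuousOn g' (Ioi 0))
    (hm : Measurable g') {x b : ℝ} (hb : 0 < b) (hx : 0 < x) (h : x < 2 * b)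
    (hi : IntegrableOn (fun t => gammaKernel x b t * g t) (Ioi 0)) :
    ‖(∫ t in Ioi 0, gammaKernel x b t * g t) - g x‖ₑ ≤
      ENNReal.ofReal b * ∫⁻ s in Ioi 0, ‖boundaryKernel b x s‖ₑ * ‖g' s‖ₑ := by
  have e0 : (∫ t in Ioi 0, gammaKernel x b t * g t) - g x =
      ∫ t in Ioi 0, gammaKernel x b t * (g t - g x) := by
    simp_rw [mul_sub]
    rw [integral_sub hi ((integrableOn_gammaKernel hb x).mul_const (g x)), integral_mul_const,
      integral_gammaKernel hb, one_mul]
  rw [e0]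
  -- A point s between x and t satisfies s ≤ x or s ≤ t. Bounding by the sum of both indicators
  -- avoids a case split, and the integral of the second one over t is the tail of the kernel.
  have hinc : ∀ t ∈ Ioi (0 : ℝ), ‖g t - g x‖ₑ ≤
      ∫⁻ s in Ioi 0, ((Iic x).indicator 1 s + (Ici s).indicator 1 t) * ‖g' s‖ₑ := by
    intro t ht
    have hsub : uIcc x t ⊆ Ioi 0 := fun s hs => (lt_min hx ht).trans_le hs.1
    have h1 := intervalIntegral.integral_eq_sub_of_hasDerivAt (fun s hs => hg s (hsub hs))
      (hc.mono hsub).intervalIntegrable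
    rw [← h1]
    calc _ ≤ ∫⁻ s in uIoc x t, ‖g' s‖ₑ := by
          rw [← ofReal_norm, intervalIntegral.norm_intervalIntegral_eq, ofReal_norm]
          exact enorm_integral_le_lintegral_enorm _
      _ ≤ ∫⁻ s in uIoc x t, ((Iic x).indicator 1 s + (Ici s).indicator 1 t) * ‖g' s‖ₑ := by
          refine setLIntegral_mono' measurableSet_uIoc fun s hs => ?_
          refine le_mul_of_one_le_left' ?_
          rcases le_max_iff.1 hs.2 with h | h
          · simp [h]
          · simp [h]
      _ ≤ _ := lintegral_mono_set fun s hs => (lt_min hx ht).trans hs.1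
  calc _ ≤ ∫⁻ t in Ioi 0, ENNReal.ofReal (gammaKernel x b t) *
        ∫⁻ s in Ioi 0, ((Iic x).indicator 1 s + (Ici s).indicator 1 t) * ‖g' s‖ₑ := by
        refine (enorm_integral_le_lintegral_enorm _).trans ?_
        refine setLIntegral_mono' measurableSet_Ioi fun t ht => ?_
        rw [enorm_mul, gammaKernel_enorm hb]
        gcongr
        exact hinc t ht
    _ = ∫⁻ s in Ioi 0, (∫⁻ t in Ioi 0, ENNReal.ofReal (gammaKernel x b t) *
        ((Iic x).indicator 1 s + (Ici s).indicator 1 t)) * ‖g' s‖ₑ := by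
        simp_rw [← lintegral_const_mul' _ _ ENNReal.ofReal_ne_top]
        rw [lintegral_lintegral_swap]
        · refine lintegral_congr fun s => ?_
          rw [← lintegral_mul_const' _ _ enorm_ne_top]
          simp_rw [mul_assoc]
        · refine Measurable.aemeasurable ?_
          exact (((measurable_gammaKernel_right x b).comp measurable_fst).ennreal_ofReal).mul
            ((((measurable_one.indicator measurableSet_Iic).comp measurable_snd).add
              (measurable_indicator_Ici_swap.comp measurable_swap)).mul
                (hm.enorm.comp measurable_snd))
    _ = _ := by
        rw [← lintegral_const_mul' _ _ ENNReal.ofReal_ne_top]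
        refine lintegral_congr fun s => ?_
        rw [← mul_assoc, enorm_boundaryKernel hb h, ← mul_assoc,
          ← ENNReal.ofReal_mul hb.le, mul_one_div_cancel hb.ne', ENNReal.ofReal_one, one_mul]
        congr 1
        simp_rw [mul_add]
        rw [lintegral_add_left' (by
          exact ((measurable_gammaKernel_right x b).ennreal_ofReal.mul_const _).aemeasurable),
          lintegral_mul_const _ (measurable_gammaKernel_right x b).ennreal_ofReal,
          lintegral_gammaKernel hb, one_mul]

/-! ### A Hardy inequality -/

/-- Otherwise g' would stay above a positive constant on (x, ∞), so g would grow at least linearly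
and could not be square integrable. This replaces a boundary condition for g' at infinity. -/
theorem le_lintegral_of_sq_integrable {g g' g'' : ℝ → ℝ} (hg : ∀ t, 0 < t → HasDerivAt g (g' t) t)
    (hg' : ∀ t, 0 < t → HasDerivAt g' (g'' t) t) (hm : Measurable g'')
    (hL : ∫⁻ t in Ioi 0, ‖g t‖ₑ ^ 2 < ∞) {x : ℝ} (hx : 0 < x) :
    ENNReal.ofReal (g' x) ≤ ∫⁻ s in Ioi x, ‖g'' s‖ₑ := by
  by_contra! hlt
  have hfin : ∫⁻ s in Ioi x, ‖g'' s‖ₑ < ∞ := hlt.trans ENNReal.ofReal_lt_top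
  set I := (∫⁻ s in Ioi x, ‖g'' s‖ₑ).toReal with hI
  have hIlt : I < g' x := by
    rw [← ENNReal.ofReal_toReal hfin.ne] at hlt
    exact (ENNReal.ofReal_lt_ofReal_iff_of_nonneg ENNReal.toReal_nonneg).1 hlt
  have hint : IntegrableOn g'' (Ioi x) := ⟨hm.aestronglyMeasurable, hfin⟩
  have hlow : ∀ y, x ≤ y → g' x - I ≤ g' y := by
    intro y hy
    have h1 := intervalIntegral.integral_eq_sub_of_hasDerivAt (f := g') (f' := g'') (a := x) (b := y)
      (fun s hs => hg' s (by rw [uIcc_of_le hy] at hs; linarith [hs.1]))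
      ((intervalIntegrable_iff_integrableOn_Ioc_of_le hy).2 (hint.mono_set Ioc_subset_Ioi_self))
    have h2 : ‖∫ s in x..y, g'' s‖ₑ ≤ ∫⁻ s in Ioi x, ‖g'' s‖ₑ := by
      rw [intervalIntegral.integral_of_le hy]
      exact (enorm_integral_le_lintegral_enorm _).trans (lintegral_mono_set Ioc_subset_Ioi_self)
    have h3 : |∫ s in x..y, g'' s| ≤ I := by
      have := ENNReal.toReal_mono hfin.ne h2
      rwa [toReal_enorm, Real.norm_eq_abs] at this
    rw [h1] at h3
    linarith [(abs_le.1 h3).1]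
  set ε := g' x - I
  have hε : 0 < ε := by simp only [ε]; linarith
  have hgrow : ∀ y, x ≤ y → ε * (y - x) ≤ g y - g x := by
    intro y hy
    refine Convex.mul_sub_le_image_sub_of_le_deriv (convex_Ici x) (f := g)
      (fun z hz => (hg z (hx.trans_le hz)).continuousAt.continuousWithinAt)
      (fun z hz => ?_) (fun z hz => ?_) x self_mem_Ici y hy hy
    · rw [interior_Ici] at hz
      exact (hg z (hx.trans hz)).differentiableAt.differentiableWithinAt
    · rw [interior_Ici] at hz
      rw [(hg z (hx.trans hz)).deriv]
      exact hlow z (le_of_lt hz)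
  set Y := max x (x + (1 - g x) / ε)
  have hY : ∀ y ∈ Ioi Y, 1 ≤ g y := by
    intro y hy
    have h1 : x < y := (le_max_left _ _).trans_lt hy
    have h2 : x + (1 - g x) / ε < y := (le_max_right _ _).trans_lt hy
    have h3 := hgrow y h1.le
    have h4 : (1 - g x) / ε ≤ y - x := by linarith
    rw [div_le_iff₀ hε] at h4
    linarith
  have : ∫⁻ t in Ioi Y, (1 : ℝ≥0∞) ≤ ∫⁻ t in Ioi 0, ‖g t‖ₑ ^ 2 := by
    refine (setLIntegral_mono' measurableSet_Ioi fun t ht => ?_).trans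
      (lintegral_mono_set (Ioi_subset_Ioi (hx.le.trans (le_max_left _ _))))
    have h1 := hY t ht
    rw [Real.enorm_of_nonneg (by linarith)]
    exact one_le_pow₀ (by rw [← ENNReal.ofReal_one]; exact ENNReal.ofReal_le_ofReal h1)
  rw [setLIntegral_const, Real.volume_Ioi, one_mul, top_le_iff] at this
  exact hL.ne this

theorem enorm_le_lintegral_of_sq_integrable {g g' g'' : ℝ → ℝ}
    (hg : ∀ t, 0 < t → HasDerivAt g (g' t) t)
    (hg' : ∀ t, 0 < t → HasDerivAt g' (g'' t) t) (hm : Measurable g'')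
    (hL : ∫⁻ t in Ioi 0, ‖g t‖ₑ ^ 2 < ∞) {x : ℝ} (hx : 0 < x) :
    ‖g' x‖ₑ ≤ ∫⁻ s in Ioi x, ‖g'' s‖ₑ := by
  rw [Real.enorm_eq_ofReal_abs]
  rcases abs_cases (g' x) with ⟨h, -⟩ | ⟨h, -⟩ <;> rw [h]
  · exact le_lintegral_of_sq_integrable hg hg' hm hL hx
  · have := le_lintegral_of_sq_integrable (g := fun t => -g t) (g' := fun t => -g' t)
      (g'' := fun t => -g'' t) (fun t ht => (hg t ht).neg) (fun t ht => (hg' t ht).neg) hm.neg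
      (by simpa only [enorm_neg] using hL) hx
    simpa only [enorm_neg] using this

theorem lintegral_rpow_Ioc {s : ℝ} (hs : 0 < s) :
    ∫⁻ x in Ioc 0 s, ENNReal.ofReal (x ^ (-(1 / 2) : ℝ)) = ENNReal.ofReal (2 * √s) := by
  have hi : IntervalIntegrable (fun x : ℝ => x ^ (-(1 / 2) : ℝ)) volume 0 s :=
    intervalIntegral.intervalIntegrable_rpow' (by norm_num)
  rw [← ofReal_integral_eq_lintegral_ofReal
    ((intervalIntegrable_iff_integrableOn_Ioc_of_le hs.le).1 hi)]
  · rw [← intervalIntegral.integral_of_le hs.le, integral_rpow (Or.inl (by norm_num))]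
    rw [show -(1 / 2) + 1 = (1 / 2 : ℝ) by norm_num, Real.zero_rpow (by norm_num),
      Real.sqrt_eq_rpow]
    congr 1
    ring
  · filter_upwards [ae_restrict_mem measurableSet_Ioc] with x hx
    exact Real.rpow_nonneg hx.1.le _

/-- A Hardy inequality: `∫ g'² ≤ 4 ∫ (s g'')² + ∫ g²` on the half line. -/
theorem lintegral_deriv_sq_le {g g' g'' : ℝ → ℝ} (hg : ∀ t, 0 < t → HasDerivAt g (g' t) t)
    (hg' : ∀ t, 0 < t → HasDerivAt g' (g'' t) t) (hm : Measurable g'') :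
    ∫⁻ x in Ioi 0, ‖g' x‖ₑ ^ 2 ≤
      4 * (∫⁻ s in Ioi 0, ‖s * g'' s‖ₑ ^ 2) + ∫⁻ t in Ioi 0, ‖g t‖ₑ ^ 2 := by
  by_cases hL : ∫⁻ t in Ioi 0, ‖g t‖ₑ ^ 2 < ∞
  swap
  · rw [not_lt, top_le_iff] at hL; simp [hL]
  -- The term ∫g² serves only to make the inequality trivial when g is not square integrable.
  refine le_add_right ?_
  -- Cauchy-Schwarz with the split s^(-3/2) · s^(3/2)(g'')². The constant 4 comes from ∫_x^∞
  -- s^(-3/2) ds = 2x^(-1/2) and, after Tonelli, ∫_0^s x^(-1/2) dx = 2√s.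
  set W : ℝ → ℝ≥0∞ := fun s => ENNReal.ofReal (s ^ (-(1 / 2) : ℝ)) * ‖s * g'' s‖ₑ ^ 2
  have hWm : Measurable W := by fun_prop
  have hpt : ∀ x ∈ Ioi (0 : ℝ), ‖g' x‖ₑ ^ 2 ≤
      ENNReal.ofReal (2 * x ^ (-(1 / 2) : ℝ)) * ∫⁻ s in Ioi x, W s := by
    intro x hx
    have hx0 : 0 < x := hx
    have h1 := enorm_le_lintegral_of_sq_integrable hg hg' hm hL hx
    have h2 := rpow_lintegral_mul_le (volume.restrict (Ioi x))
      (k := fun s => ENNReal.ofReal (s ^ (-(3 / 2) : ℝ))) (by fun_prop)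
      (a := fun s => s ^ (3 / 2 : ℝ) * g'' s) (by fun_prop) (p := 2) (by norm_num)
    have e1 : ∫⁻ s in Ioi x, ENNReal.ofReal (s ^ (-(3 / 2) : ℝ)) * ‖s ^ (3 / 2 : ℝ) * g'' s‖ₑ =
        ∫⁻ s in Ioi x, ‖g'' s‖ₑ := by
      refine setLIntegral_congr_fun measurableSet_Ioi fun s hs => ?_
      have hs0 : 0 < s := hx0.trans hs
      rw [enorm_mul, Real.enorm_of_nonneg (by positivity), ← mul_assoc,
        ← ENNReal.ofReal_mul (by positivity), ← Real.rpow_add hs0]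
      norm_num
    have e2 : ∫⁻ s in Ioi x, ENNReal.ofReal (s ^ (-(3 / 2) : ℝ)) *
        ‖s ^ (3 / 2 : ℝ) * g'' s‖ₑ ^ (2 : ℝ) = ∫⁻ s in Ioi x, W s := by
      refine setLIntegral_congr_fun measurableSet_Ioi fun s hs => ?_
      have hs0 : 0 < s := hx0.trans hs
      simp only [W]
      rw [show (2 : ℝ) = ((2 : ℕ) : ℝ) by norm_num, ENNReal.rpow_natCast, enorm_mul, enorm_mul,
        mul_pow, mul_pow, Real.enorm_of_nonneg (by positivity), Real.enorm_of_nonneg hs0.le,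
        ← mul_assoc, ← mul_assoc, ← ENNReal.ofReal_pow (by positivity),
        ← ENNReal.ofReal_pow (by positivity), ← ENNReal.ofReal_mul (by positivity),
        ← ENNReal.ofReal_mul (by positivity)]
      congr 2
      rw [← Real.rpow_natCast, ← Real.rpow_natCast, ← Real.rpow_mul hs0.le, ← Real.rpow_add hs0,
        ← Real.rpow_add hs0]
      norm_num
    have e3 : ∫⁻ s in Ioi x, ENNReal.ofReal (s ^ (-(3 / 2) : ℝ)) =
        ENNReal.ofReal (2 * x ^ (-(1 / 2) : ℝ)) := by
      rw [← ofReal_integral_eq_lintegral_ofReal (integrableOn_Ioi_rpow_of_lt (by norm_num) hx0),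
        integral_Ioi_rpow_of_lt (by norm_num) hx0]
      · congr 1
        norm_num
        ring
      · filter_upwards [ae_restrict_mem measurableSet_Ioi] with s hs
        exact Real.rpow_nonneg (hx0.trans hs).le _
    rw [e1, e2, e3] at h2
    norm_num at h2
    calc _ ≤ (∫⁻ s in Ioi x, ‖g'' s‖ₑ) ^ 2 := by gcongr
      _ ≤ _ := by norm_num; exact h2
  have hswap : ∀ (x s : ℝ), (Ioi x).indicator W s = (Iio s).indicator (fun _ => W s) x := by
    intro x s; simp [indicator_apply]
  calc _ ≤ ∫⁻ x in Ioi 0, ENNReal.ofReal (2 * x ^ (-(1 / 2) : ℝ)) * ∫⁻ s in Ioi x, W s :=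
        setLIntegral_mono' measurableSet_Ioi hpt
    _ = ∫⁻ x in Ioi 0, ∫⁻ s in Ioi 0, ENNReal.ofReal (2 * x ^ (-(1 / 2) : ℝ)) *
          (Iio s).indicator (fun _ => W s) x := by
        refine setLIntegral_congr_fun measurableSet_Ioi fun x hx => ?_
        rw [lintegral_const_mul' _ _ ENNReal.ofReal_ne_top]
        congr 1
        simp_rw [← hswap]
        rw [setLIntegral_indicator measurableSet_Ioi, inter_eq_left.2 (Ioi_subset_Ioi (le_of_lt hx))]
    _ = ∫⁻ s in Ioi 0, ∫⁻ x in Ioi 0, ENNReal.ofReal (2 * x ^ (-(1 / 2) : ℝ)) *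
          (Iio s).indicator (fun _ => W s) x := by
        rw [lintegral_lintegral_swap]
        refine Measurable.aemeasurable ?_
        have : (fun z : ℝ × ℝ => (Iio z.2).indicator (fun _ => W z.2) z.1) =
            fun z => if z.1 < z.2 then W z.2 else 0 := by
          ext z; simp [indicator_apply]
        refine Measurable.mul (by fun_prop) ?_
        rw [this]
        exact Measurable.ite (measurableSet_lt measurable_fst measurable_snd)
          (hWm.comp measurable_snd) measurable_const
    _ ≤ ∫⁻ s in Ioi 0, 4 * ‖s * g'' s‖ₑ ^ 2 := by
        refine setLIntegral_mono' measurableSet_Ioi fun s hs => ?_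
        have hs0 : 0 < s := hs
        have e : ∀ x, ENNReal.ofReal (2 * x ^ (-(1 / 2) : ℝ)) * (Iio s).indicator (fun _ => W s) x =
            (Iio s).indicator (fun x => ENNReal.ofReal (2 * x ^ (-(1 / 2) : ℝ)) * W s) x := by
          intro x; by_cases h : x ∈ Iio s <;> simp [h]
        simp_rw [e]
        rw [setLIntegral_indicator measurableSet_Iio]
        calc _ ≤ ∫⁻ x in Ioc 0 s, ENNReal.ofReal (2 * x ^ (-(1 / 2) : ℝ)) * W s :=
              lintegral_mono_set fun x hx => ⟨hx.2, le_of_lt hx.1⟩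
          _ = ENNReal.ofReal 2 * ENNReal.ofReal (2 * √s) * W s := by
              rw [lintegral_mul_const _ (by fun_prop)]
              simp_rw [ENNReal.ofReal_mul (show (0 : ℝ) ≤ 2 by norm_num)]
              rw [lintegral_const_mul' _ _ ENNReal.ofReal_ne_top, lintegral_rpow_Ioc hs0,
                ENNReal.ofReal_mul (show (0 : ℝ) ≤ 2 by norm_num)]
          _ = _ := by
              simp only [W]
              rw [← ENNReal.ofReal_mul (by norm_num), ← mul_assoc,
                ← ENNReal.ofReal_mul (by positivity)]
              have : 2 * (2 * √s) * s ^ (-(1 / 2) : ℝ) = 4 := by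
                rw [Real.sqrt_eq_rpow, mul_assoc, mul_assoc, ← Real.rpow_add hs0]
                norm_num
              rw [this]
              norm_num
    _ = _ := by rw [lintegral_const_mul _ (by fun_prop)]

section Iterated

variable {τ : ℕ}

/-! ### Iterated coordinate operators -/

/-- The operators with kernel `Q` on the coordinates of a list, composed. -/
noncomputable def iterOp (Q : ℝ → ℝ → ℝ) (l : List (Fin (τ + 1))) (u : (Fin (τ + 1) → ℝ) → ℝ) :
    (Fin (τ + 1) → ℝ) → ℝ :=
  l.foldr (coordOp Q) u

/-- The integral operator with an extended nonnegative kernel on the coordinate `j`. -/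
noncomputable def coordLint (K : ℝ → ℝ → ℝ≥0∞) (j : Fin (τ + 1))
    (A : (Fin (τ + 1) → ℝ) → ℝ≥0∞) (x : Fin (τ + 1) → ℝ) : ℝ≥0∞ :=
  ∫⁻ t in Ioi 0, K (x j) t * A (Function.update x j t)

variable {Q : ℝ → ℝ → ℝ} {C : ℝ≥0} {u : (Fin (τ + 1) → ℝ) → ℝ} {p : ℝ≥0∞}

theorem measurable_iterOp (hQ : Measurable (Function.uncurry Q)) (hu : Measurable u)
    (l : List (Fin (τ + 1))) : Measurable (iterOp Q l u) := by
  induction l with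
  | nil => exact hu
  | cons j l ih => exact measurable_coordOp hQ ih j

theorem memLp_iterOp (hQ : KernelBound Q C) (hu : Measurable u) (hp : 1 ≤ p) (hp' : p ≠ ∞)
    (hup : MemLp u p (orthantVolume τ)) (l : List (Fin (τ + 1))) :
    MemLp (iterOp Q l u) p (orthantVolume τ) := by
  induction l with
  | nil => exact hup
  | cons j l ih => exact memLp_coordOp hQ (measurable_iterOp hQ.meas hu l) hp hp' ih j

theorem eLpNorm_iterOp_le (hQ : KernelBound Q C) (hu : Measurable u) (hp : 1 ≤ p) (hp' : p ≠ ∞)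
    (l : List (Fin (τ + 1))) :
    eLpNorm (iterOp Q l u) p (orthantVolume τ) ≤
      (C : ℝ≥0∞) ^ l.length * eLpNorm u p (orthantVolume τ) := by
  induction l with
  | nil => simp [iterOp]
  | cons j l ih =>
    refine (eLpNorm_coordOp_le hQ (measurable_iterOp hQ.meas hu l) hp hp' j).trans ?_
    rw [List.length_cons, pow_succ', mul_assoc]
    gcongr

theorem iterOp_nonneg (hQ : ∀ x t, 0 ≤ Q x t) (hu : ∀ x, 0 ≤ u x) (l : List (Fin (τ + 1)))
    (x : Fin (τ + 1) → ℝ) : 0 ≤ iterOp Q l u x := by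
  induction l generalizing x with
  | nil => exact hu x
  | cons j l ih => exact integral_nonneg fun t => mul_nonneg (hQ _ _) (ih _)

/-- Iterated Tonelli. The list must have no repetition, so that each kernel still sees the original
coordinate of z and not an integration variable. -/
theorem foldr_coordLint {K : ℝ → ℝ → ℝ≥0∞} (hK : Measurable (Function.uncurry K))
    {A : (Fin (τ + 1) → ℝ) → ℝ≥0∞} (hA : Measurable A) {l : List (Fin (τ + 1))} (hl : l.Nodup)
    (z : Fin (τ + 1) → ℝ) :
    l.foldr (coordLint K) A z =
      (∫⋯∫⁻_l.toFinset, (fun y => (∏ i ∈ l.toFinset, K (z i) (y i)) * A y)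
        ∂fun _ => (volume.restrict (Ioi 0) : Measure ℝ)) z := by
  have hKz : ∀ a : ℝ, Measurable (K a) := fun a => hK.comp (measurable_const.prodMk measurable_id)
  induction l generalizing z with
  | nil => simp [lmarginal_empty]
  | cons j l ih =>
    rw [List.nodup_cons] at hl
    have hj : j ∉ l.toFinset := by simpa using hl.1
    have hmeas : ∀ s : Finset (Fin (τ + 1)), Measurable
        fun y : Fin (τ + 1) → ℝ => (∏ i ∈ s, K (z i) (y i)) * A y := fun s =>
      (Finset.measurable_prod _ fun i _ => (hKz _).comp (measurable_pi_apply i)).mul hA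
    rw [List.toFinset_cons, lmarginal_insert _ (hmeas _) hj, List.foldr_cons, coordLint]
    have hupd : ∀ t, Measurable fun y : ((i : l.toFinset) → ℝ) =>
      Function.updateFinset (Function.update z j t) l.toFinset y := fun t => measurable_updateFinset
    refine lintegral_congr fun t => ?_
    rw [ih hl.2, lmarginal, lmarginal, ← lintegral_const_mul _
      (by
        refine Measurable.mul ?_ (hA.comp measurable_updateFinset)
        exact Finset.measurable_prod _ fun i _ => (hKz _).comp
          ((measurable_pi_apply i).comp (hupd t)))]
    refine lintegral_congr fun y => ?_
    rw [Finset.prod_insert hj, ← mul_assoc]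
    congr 2
    · simp [Function.updateFinset, hl.1]
    · refine Finset.prod_congr rfl fun i hi => ?_
      rw [Function.update_of_ne (by rintro rfl; exact hj hi)]

/-- A Bochner integral defaults to 0 where integrability fails, so the iterated operator agrees with
the extended integral only almost everywhere. The L^p bounds on slices supply the integrability at
each stage. -/
theorem ofReal_iterOp (hQ : KernelBound Q C) (hQ0 : ∀ x t, 0 ≤ Q x t) (hu : Measurable u)
    (hu0 : ∀ x, 0 ≤ u x) (hp : 1 ≤ p) (hp' : p ≠ ∞) (hup : MemLp u p (orthantVolume τ))
    (l : List (Fin (τ + 1))) :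
    ∀ᵐ x ∂orthantVolume τ, ENNReal.ofReal (iterOp Q l u x) =
      l.foldr (coordLint fun x t => ENNReal.ofReal (Q x t)) (fun y => ENNReal.ofReal (u y)) x := by
  induction l with
  | nil => exact ae_of_all _ fun x => rfl
  | cons j l ih =>
    have hm := measurable_iterOp hQ.meas hu l
    filter_upwards [ae_ae_slice j ih, ae_coordAbs_lt_top hQ hm hp hp'
      (memLp_iterOp hQ hu hp hp' hup l) j] with x hx hfin
    have hi := integrable_of_coordAbs_lt_top hQ.meas hm hfin
    rw [List.foldr_cons, coordLint, show iterOp Q (j :: l) u = coordOp Q j (iterOp Q l u) from rfl,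
      coordOp, ofReal_integral_eq_lintegral_ofReal hi
      (ae_of_all _ fun t => mul_nonneg (hQ0 _ _) (iterOp_nonneg hQ0 hu0 _ _))]
    refine lintegral_congr_ae ?_
    filter_upwards [hx] with t ht
    rw [ENNReal.ofReal_mul (hQ0 _ _), ← ht]

/-- The iterated operator over all coordinates is the operator with the product kernel. -/
theorem ofReal_iterOp_finRange (hQ : KernelBound Q C) (hQ0 : ∀ x t, 0 ≤ Q x t) (hu : Measurable u)
    (hu0 : ∀ x, 0 ≤ u x) (hp : 1 ≤ p) (hp' : p ≠ ∞) (hup : MemLp u p (orthantVolume τ)) :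
    ∀ᵐ x ∂orthantVolume τ, ENNReal.ofReal (iterOp Q (List.finRange (τ + 1)) u x) =
      ∫⁻ t, ENNReal.ofReal ((∏ j, Q (x j) (t j)) * u t) ∂orthantVolume τ := by
  filter_upwards [ofReal_iterOp hQ hQ0 hu hu0 hp hp' hup (List.finRange (τ + 1))] with x hx
  have hK : Measurable (Function.uncurry fun x t => ENNReal.ofReal (Q x t)) := hQ.meas.ennreal_ofReal
  rw [hx, foldr_coordLint hK hu.ennreal_ofReal (List.nodup_finRange _),
    List.toFinset_finRange, lmarginal_univ, orthantVolume_eq_pi]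
  refine lintegral_congr fun t => ?_
  rw [ENNReal.ofReal_mul (Finset.prod_nonneg fun _ _ => hQ0 _ _),
    ENNReal.ofReal_prod_of_nonneg fun _ _ => hQ0 _ _]

theorem IsApproxIdentity.tendsto_iterOp {Q : ℝ → ℝ → ℝ → ℝ} {c : ℝ} (hQ : IsApproxIdentity Q c p)
    (hp : 1 ≤ p) (hp' : p ≠ ∞) (hu : Measurable u) (hup : MemLp u p (orthantVolume τ))
    (l : List (Fin (τ + 1))) :
    Tendsto (fun b => eLpNorm (iterOp (Q b) l u - fun x => c ^ l.length * u x) p (orthantVolume τ))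
      (𝓝[>] 0) (𝓝 0) := by
  obtain ⟨C, hC⟩ := hQ.bound
  induction l with
  | nil => simp [iterOp, show (fun x => u x) = u from rfl]
  | cons j l ih =>
    have := hQ.tendsto hp hp' (u := fun b => iterOp (Q b) l u)
      (fun b hb => measurable_iterOp (hC b hb).meas hu l)
      (fun b hb => memLp_iterOp (hC b hb) hu hp hp' hup l) (hu.const_mul _) (hup.const_mul _) ih j
    simp only [← mul_assoc, ← pow_succ'] at this
    exact this

end Iterated

/-! ### Slices of a twice continuously differentiable function -/

section Slices

variable {τ : ℕ} {f : (Fin (τ + 1) → ℝ) → ℝ}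

/-- The first partial derivative of `f` in the coordinate `j`, set to `0` outside the orthant. -/
noncomputable def firstPartial (f : (Fin (τ + 1) → ℝ) → ℝ) (j : Fin (τ + 1)) :
    (Fin (τ + 1) → ℝ) → ℝ :=
  (orthant τ).indicator fun x => fderiv ℝ f x (Pi.single j 1)

theorem update_mem_orthant {x : Fin (τ + 1) → ℝ} (hx : x ∈ orthant τ) (j : Fin (τ + 1)) {t : ℝ}
    (ht : 0 < t) : Function.update x j t ∈ orthant τ := by
  intro i
  rcases eq_or_ne i j with rfl | h
  · simpa using ht
  · simpa [h] using hx i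

open scoped Classical in
theorem measurable_indicator_of_continuousOn {g : (Fin (τ + 1) → ℝ) → ℝ}
    (hg : ContinuousOn g (orthant τ)) : Measurable ((orthant τ).indicator g) := by
  rw [← piecewise_eq_indicator]
  exact hg.measurable_piecewise continuousOn_const (measurableSet_orthant τ)

theorem continuousOn_fderiv_apply {g : (Fin (τ + 1) → ℝ) → ℝ} {n : WithTop ℕ∞}
    (hg : ContDiffOn ℝ (n + 1) g (orthant τ)) (j : Fin (τ + 1)) :
    ContDiffOn ℝ n (fun x => fderiv ℝ g x (Pi.single j 1)) (orthant τ) :=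
  (hg.fderiv_of_isOpen (isOpen_orthant τ) le_rfl).clm_apply contDiffOn_const

theorem hasDerivAt_update_slice {g : (Fin (τ + 1) → ℝ) → ℝ} (hg : ContDiffOn ℝ 1 g (orthant τ))
    {x : Fin (τ + 1) → ℝ} (hx : x ∈ orthant τ) (j : Fin (τ + 1)) {t : ℝ} (ht : 0 < t) :
    HasDerivAt (fun t => g (Function.update x j t))
      (fderiv ℝ g (Function.update x j t) (Pi.single j 1)) t := by
  have h1 : DifferentiableAt ℝ g (Function.update x j t) :=
    (hg.differentiableOn one_ne_zero).differentiableAt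
      ((isOpen_orthant τ).mem_nhds (update_mem_orthant hx j ht))
  exact h1.hasFDerivAt.comp_hasDerivAt t (hasDerivAt_update x j t)

theorem secondPartial_eq (hf : ContDiffOn ℝ 2 f (orthant τ)) {x : Fin (τ + 1) → ℝ}
    (hx : x ∈ orthant τ) (j : Fin (τ + 1)) :
    secondPartial f j x =
      fderiv ℝ (fun y => fderiv ℝ f y (Pi.single j 1)) x (Pi.single j 1) := by
  have h1 : ContDiffOn ℝ 1 (fun x => fderiv ℝ f x (Pi.single j 1)) (orthant τ) :=
    continuousOn_fderiv_apply (by simpa [one_add_one_eq_two] using hf) j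
  have h2 := hasDerivAt_update_slice h1 hx j (hx j)
  have h3 : deriv (fun t => f (Function.update x j t)) =ᶠ[𝓝 (x j)]
      fun t => fderiv ℝ f (Function.update x j t) (Pi.single j 1) := by
    filter_upwards [Ioi_mem_nhds (hx j)] with t ht
    exact (hasDerivAt_update_slice (hf.of_le one_le_two) hx j ht).deriv
  rw [secondPartial, iteratedDeriv_succ, iteratedDeriv_one, h3.deriv_eq, h2.deriv,
    Function.update_eq_self]

theorem continuousOn_secondPartial (hf : ContDiffOn ℝ 2 f (orthant τ)) (j : Fin (τ + 1)) :
    ContinuousOn (secondPartial f j) (orthant τ) := by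
  have h1 : ContDiffOn ℝ 1 (fun x => fderiv ℝ f x (Pi.single j 1)) (orthant τ) :=
    continuousOn_fderiv_apply (by simpa [one_add_one_eq_two] using hf) j
  have h2 : ContDiffOn ℝ 0 (fun x => fderiv ℝ (fun y => fderiv ℝ f y (Pi.single j 1)) x
    (Pi.single j 1)) (orthant τ) := continuousOn_fderiv_apply (by simpa using h1) j
  exact h2.continuousOn.congr fun x hx => secondPartial_eq hf hx j

/-- The density, cut off outside the orthant. -/
noncomputable def cutoff (g : (Fin (τ + 1) → ℝ) → ℝ) : (Fin (τ + 1) → ℝ) → ℝ :=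
  (orthant τ).indicator g

theorem cutoff_ae_eq (g : (Fin (τ + 1) → ℝ) → ℝ) : cutoff g =ᵐ[orthantVolume τ] g := by
  filter_upwards [ae_mem_orthant τ] with x hx using indicator_of_mem hx g

theorem measurable_cutoff (hf : ContDiffOn ℝ 2 f (orthant τ)) : Measurable (cutoff f) :=
  measurable_indicator_of_continuousOn hf.continuousOn

theorem measurable_firstPartial (hf : ContDiffOn ℝ 2 f (orthant τ)) (j : Fin (τ + 1)) :
    Measurable (firstPartial f j) :=
  measurable_indicator_of_continuousOn
    (continuousOn_fderiv_apply (n := 1) (by simpa [one_add_one_eq_two] using hf) j).continuousOn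

theorem measurable_cutoff_secondPartial (hf : ContDiffOn ℝ 2 f (orthant τ)) (j : Fin (τ + 1)) :
    Measurable (cutoff (secondPartial f j)) :=
  measurable_indicator_of_continuousOn (continuousOn_secondPartial hf j)

/-- The function `x_j ∂²f/∂x_j²`, set to `0` outside the orthant. -/
noncomputable def weightedSecondPartial (f : (Fin (τ + 1) → ℝ) → ℝ) (j : Fin (τ + 1)) :
    (Fin (τ + 1) → ℝ) → ℝ :=
  cutoff fun x => x j * secondPartial f j x

theorem measurable_weightedSecondPartial (hf : ContDiffOn ℝ 2 f (orthant τ)) (j : Fin (τ + 1)) :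
    Measurable (weightedSecondPartial f j) :=
  measurable_indicator_of_continuousOn
    ((continuous_apply j).continuousOn.mul (continuousOn_secondPartial hf j))

theorem hasDerivAt_cutoff_slice (hf : ContDiffOn ℝ 2 f (orthant τ)) {x : Fin (τ + 1) → ℝ}
    (hx : x ∈ orthant τ) (j : Fin (τ + 1)) {t : ℝ} (ht : 0 < t) :
    HasDerivAt (fun t => cutoff f (Function.update x j t))
      (firstPartial f j (Function.update x j t)) t := by
  rw [firstPartial, indicator_of_mem (update_mem_orthant hx j ht)]
  refine (hasDerivAt_update_slice (hf.of_le one_le_two) hx j ht).congr_of_eventuallyEq ?_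
  filter_upwards [Ioi_mem_nhds ht] with s hs
  exact indicator_of_mem (update_mem_orthant hx j hs) f

theorem hasDerivAt_firstPartial_slice (hf : ContDiffOn ℝ 2 f (orthant τ)) {x : Fin (τ + 1) → ℝ}
    (hx : x ∈ orthant τ) (j : Fin (τ + 1)) {t : ℝ} (ht : 0 < t) :
    HasDerivAt (fun t => firstPartial f j (Function.update x j t))
      (cutoff (secondPartial f j) (Function.update x j t)) t := by
  have hm := update_mem_orthant hx j ht
  rw [cutoff, indicator_of_mem hm, secondPartial_eq hf hm]
  refine (hasDerivAt_update_slice (continuousOn_fderiv_apply (n := 1)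
    (by simpa [one_add_one_eq_two] using hf) j) hx j ht).congr_of_eventuallyEq ?_
  filter_upwards [Ioi_mem_nhds ht] with s hs
  exact indicator_of_mem (update_mem_orthant hx j hs) _

theorem continuous_slice_of_continuousOn {g : (Fin (τ + 1) → ℝ) → ℝ}
    (hg : ContinuousOn g (orthant τ)) {x : Fin (τ + 1) → ℝ} (hx : x ∈ orthant τ)
    (j : Fin (τ + 1)) : ContinuousOn (fun t => cutoff g (Function.update x j t)) (Ioi 0) := by
  have h1 : ContinuousOn (fun t => g (Function.update x j t)) (Ioi 0) :=
    hg.comp (f := fun t => Function.update x j t)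
      (Continuous.update (f := fun _ : ℝ => x) continuous_const j continuous_id).continuousOn
      fun t ht => update_mem_orthant hx j ht
  exact h1.congr fun t ht => indicator_of_mem (update_mem_orthant hx j ht) g

theorem weightedSecondPartial_slice {x : Fin (τ + 1) → ℝ} (hx : x ∈ orthant τ) (j : Fin (τ + 1))
    {t : ℝ} (ht : 0 < t) : weightedSecondPartial f j (Function.update x j t) =
      t * cutoff (secondPartial f j) (Function.update x j t) := by
  have hm := update_mem_orthant hx j ht
  rw [weightedSecondPartial, cutoff, cutoff, indicator_of_mem hm, indicator_of_mem hm,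
    Function.update_self]

theorem lintegral_sq_lt_top {g : (Fin (τ + 1) → ℝ) → ℝ} (hg : MemLp g 2 (orthantVolume τ)) :
    ∫⁻ x, ‖g x‖ₑ ^ 2 ∂orthantVolume τ < ∞ := by
  have := lintegral_rpow_enorm_lt_top_of_eLpNorm_lt_top two_ne_zero ENNReal.ofNat_ne_top hg.2
  simpa using this

/-- The first partial derivatives are square integrable, by the Hardy inequality on slices. -/
theorem memLp_firstPartial (hf : ContDiffOn ℝ 2 f (orthant τ)) (hf2 : MemLp f 2 (orthantVolume τ))
    (j : Fin (τ + 1))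
    (hs : MemLp (fun x => x j * secondPartial f j x) 2 (orthantVolume τ)) :
    MemLp (firstPartial f j) 2 (orthantVolume τ) := by
  have hm0 := measurable_cutoff hf
  have hm1 := measurable_firstPartial hf j
  have hm2 := measurable_weightedSecondPartial hf j
  have hu := measurable_update_pair (τ := τ) j
  have l0 := lintegral_sq_lt_top (hf2.ae_eq (cutoff_ae_eq f).symm)
  have l2 : ∫⁻ x, ‖weightedSecondPartial f j x‖ₑ ^ 2 ∂orthantVolume τ < ∞ :=
    lintegral_sq_lt_top (hs.ae_eq (cutoff_ae_eq _).symm)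
  refine ⟨hm1.aestronglyMeasurable, ?_⟩
  rw [eLpNorm_lt_top_iff_lintegral_rpow_enorm_lt_top two_ne_zero ENNReal.ofNat_ne_top]
  simp only [ENNReal.toReal_ofNat, ENNReal.rpow_ofNat]
  rw [← lintegral_slices j (hm1.enorm.pow_const 2)]
  calc _ ≤ ∫⁻ x, (4 * (ENNReal.ofReal (Real.exp (-(x j))) *
        (∫⁻ t in Ioi 0, ‖weightedSecondPartial f j (Function.update x j t)‖ₑ ^ 2)) +
        ENNReal.ofReal (Real.exp (-(x j))) *
          (∫⁻ t in Ioi 0, ‖cutoff f (Function.update x j t)‖ₑ ^ 2)) ∂orthantVolume τ := by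
        refine lintegral_mono_ae ?_
        filter_upwards [ae_mem_orthant τ] with x hx
        rw [mul_left_comm, ← mul_add]
        gcongr
        have := lintegral_deriv_sq_le (fun t ht => hasDerivAt_cutoff_slice hf hx j ht)
          (fun t ht => hasDerivAt_firstPartial_slice hf hx j ht)
          ((measurable_cutoff_secondPartial hf j).comp (measurable_update x))
        refine this.trans_eq ?_
        congr 2
        refine setLIntegral_congr_fun measurableSet_Ioi fun t ht => ?_
        rw [weightedSecondPartial_slice hx j ht]
    _ < ∞ := by
        have m2 : Measurable fun x : Fin (τ + 1) → ℝ => ENNReal.ofReal (Real.exp (-(x j))) *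
            ∫⁻ t in Ioi 0, ‖weightedSecondPartial f j (Function.update x j t)‖ₑ ^ 2 := by
          refine Measurable.mul (by fun_prop) ?_
          exact ((hm2.enorm.pow_const 2).comp hu).lintegral_prod_right'
        rw [lintegral_add_left (m2.const_mul 4), lintegral_const_mul _ m2,
          lintegral_slices j (hm2.enorm.pow_const 2), lintegral_slices j (hm0.enorm.pow_const 2)]
        exact ENNReal.add_lt_top.2 ⟨ENNReal.mul_lt_top (by simp) l2, l0⟩

end Slices

section Bias

variable {τ : ℕ} {f : (Fin (τ + 1) → ℝ) → ℝ}

/-! ### The bias -/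

/-- The two regimes exclude each other. For x_j ≥ 2b the representation is exact and the left side
vanishes; for x_j < 2b the remainder kernel vanishes and the boundary estimate applies. -/
theorem enorm_coordOp_gammaKernel_sub_le (hf : ContDiffOn ℝ 2 f (orthant τ))
    (hf2 : MemLp f 2 (orthantVolume τ)) {j : Fin (τ + 1)}
    (hs : MemLp (fun x => x j * secondPartial f j x) 2 (orthantVolume τ)) {b : ℝ} (hb : 0 < b) :
    ∀ᵐ x ∂orthantVolume τ,
      ‖b⁻¹ * (coordOp (fun x t => gammaKernel x b t) j (cutoff f) x - cutoff f x) -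
        coordOp (remainderKernel b) j (weightedSecondPartial f j) x‖ₑ ≤
      ‖coordOp (boundaryKernel b) j (fun x => |firstPartial f j x|) x‖ₑ := by
  have hm0 := measurable_cutoff hf
  have hm1 := measurable_firstPartial hf j
  have hmw := measurable_weightedSecondPartial hf j
  have h0 : MemLp (cutoff f) 2 (orthantVolume τ) := hf2.ae_eq (cutoff_ae_eq f).symm
  have hw : MemLp (weightedSecondPartial f j) 2 (orthantVolume τ) := hs.ae_eq (cutoff_ae_eq _).symm
  have h1 := memLp_firstPartial hf hf2 j hs
  obtain ⟨C, hC⟩ := isApproxIdentity_boundaryKernel.bound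
  filter_upwards [ae_mem_orthant τ,
    ae_coordAbs_lt_top (kernelBound_gammaKernel hb) hm0 one_le_two ENNReal.ofNat_ne_top h0 j,
    ae_coordAbs_lt_top (kernelBound_gammaKernel hb) hmw one_le_two ENNReal.ofNat_ne_top hw j,
    ae_coordAbs_lt_top (hC b hb) hm1.abs one_le_two ENNReal.ofNat_ne_top h1.abs j]
    with x hx a0 aw a1
  have i0 := integrable_of_coordAbs_lt_top (kernelBound_gammaKernel hb).meas hm0 a0
  have hd := fun t (ht : 0 < t) => hasDerivAt_cutoff_slice hf hx j ht
  have hd2 := fun t (ht : 0 < t) => hasDerivAt_firstPartial_slice hf hx j ht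
  have hself : cutoff f (Function.update x j (x j)) = cutoff f x := by
    rw [Function.update_eq_self]
  rcases le_or_gt (2 * b) (x j) with h | h
  · have key := integral_gammaKernel_mul_sub hd hd2
      (continuous_slice_of_continuousOn (continuousOn_secondPartial hf j) hx j)
      ((measurable_cutoff_secondPartial hf j).comp (measurable_update x)) hb h i0 (by
        refine lt_of_eq_of_lt ?_ aw
        refine setLIntegral_congr_fun measurableSet_Ioi fun t ht => ?_
        rw [weightedSecondPartial_slice hx j ht])
    have e : coordOp (remainderKernel b) j (weightedSecondPartial f j) x =
        ∫ s in Ioi 0, remainderKernel b (x j) s *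
          (s * cutoff (secondPartial f j) (Function.update x j s)) := by
      refine setIntegral_congr_fun measurableSet_Ioi fun t ht => ?_
      rw [weightedSecondPartial_slice hx j ht]
    rw [hself] at key
    rw [e, coordOp, key, inv_mul_cancel_left₀ hb.ne', sub_self, enorm_zero]
    exact zero_le
  · have key := enorm_integral_gammaKernel_mul_sub_le hd
      (fun t ht => (hd2 t ht).continuousAt.continuousWithinAt)
      (hm1.comp (measurable_update x)) hb (hx j) h i0
    rw [hself] at key
    have e : coordOp (remainderKernel b) j (weightedSecondPartial f j) x = 0 := by
      rw [coordOp]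
      simp [remainderKernel, not_le.2 h]
    have ib := integrable_of_coordAbs_lt_top (hC b hb).meas hm1.abs a1
    have e2 : ‖coordOp (boundaryKernel b) j (fun x => |firstPartial f j x|) x‖ₑ =
        ∫⁻ s in Ioi 0, ‖boundaryKernel b (x j) s‖ₑ * ‖firstPartial f j (Function.update x j s)‖ₑ := by
      have hn : ∀ s, 0 ≤ boundaryKernel b (x j) s * |firstPartial f j (Function.update x j s)| :=
        fun s => mul_nonneg (boundaryKernel_nonneg hb _ _) (abs_nonneg _)
      rw [coordOp, Real.enorm_of_nonneg (integral_nonneg hn),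
        ofReal_integral_eq_lintegral_ofReal ib (ae_of_all _ hn)]
      refine lintegral_congr fun s => ?_
      rw [ENNReal.ofReal_mul (boundaryKernel_nonneg hb _ _),
        Real.enorm_of_nonneg (boundaryKernel_nonneg hb _ _), Real.enorm_eq_ofReal_abs]
    rw [e, sub_zero, e2, enorm_mul, Real.enorm_of_nonneg (inv_pos.2 hb).le]
    calc _ ≤ ENNReal.ofReal b⁻¹ * (ENNReal.ofReal b * ∫⁻ s in Ioi 0, ‖boundaryKernel b (x j) s‖ₑ *
          ‖firstPartial f j (Function.update x j s)‖ₑ) := by gcongr; exact key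
      _ = _ := by
          rw [← mul_assoc, ← ENNReal.ofReal_mul (inv_pos.2 hb).le, inv_mul_cancel₀ hb.ne',
            ENNReal.ofReal_one, one_mul]

theorem tendsto_bias_coord (hf : ContDiffOn ℝ 2 f (orthant τ))
    (hf2 : MemLp f 2 (orthantVolume τ)) (j : Fin (τ + 1))
    (hs : MemLp (fun x => x j * secondPartial f j x) 2 (orthantVolume τ)) :
    Tendsto (fun b => eLpNorm ((fun x => b⁻¹ * (coordOp (fun x t => gammaKernel x b t) j
      (cutoff f) x - cutoff f x)) - fun x => 1 / 2 * weightedSecondPartial f j x) 2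
        (orthantVolume τ)) (𝓝[>] 0) (𝓝 0) := by
  have hm0 := measurable_cutoff hf
  have hm1 := measurable_firstPartial hf j
  have hmw := measurable_weightedSecondPartial hf j
  have hw : MemLp (weightedSecondPartial f j) 2 (orthantVolume τ) := hs.ae_eq (cutoff_ae_eq _).symm
  have h1 := memLp_firstPartial hf hf2 j hs
  have t1 := isApproxIdentity_remainderKernel.tendsto_const one_le_two ENNReal.ofNat_ne_top hmw hw j
  have t2 := isApproxIdentity_boundaryKernel.tendsto_const one_le_two ENNReal.ofNat_ne_top
    hm1.abs h1.abs j
  have t3 := t2.add t1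
  rw [add_zero] at t3
  refine tendsto_of_tendsto_of_tendsto_of_le_of_le' tendsto_const_nhds t3
    (Eventually.of_forall fun _ => zero_le) ?_
  filter_upwards [eventually_mem_nhdsWithin] with b hb
  have hb0 : 0 < b := hb
  have hmT : Measurable fun x => b⁻¹ * (coordOp (fun x t => gammaKernel x b t) j
      (cutoff f) x - cutoff f x) :=
    ((measurable_coordOp (measurable_gammaKernel hb0) hm0 j).sub hm0).const_mul _
  have hmR := measurable_coordOp (measurable_remainderKernel hb0) hmw j
  calc _ = eLpNorm (((fun x => b⁻¹ * (coordOp (fun x t => gammaKernel x b t) j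
      (cutoff f) x - cutoff f x)) - coordOp (remainderKernel b) j (weightedSecondPartial f j)) +
      (coordOp (remainderKernel b) j (weightedSecondPartial f j) -
        fun x => 1 / 2 * weightedSecondPartial f j x)) 2 (orthantVolume τ) := by
        rw [sub_add_sub_cancel]
    _ ≤ _ := eLpNorm_add_le (hmT.sub hmR).aestronglyMeasurable
        (hmR.sub (hmw.const_mul _)).aestronglyMeasurable one_le_two
    _ ≤ _ := by
        gcongr
        refine eLpNorm_mono_enorm_ae ?_
        filter_upwards [enorm_coordOp_gammaKernel_sub_le hf hf2 hs hb0] with x hx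
        simpa using hx

/-- Telescoping: K₁⋯K_d f - f = K₁(K₂⋯K_d f - f) + (K₁f - f). The inner bias over b converges in L²
by induction, and an approximate identity applied to a convergent family preserves its limit, so no
derivative of a smoothed density is needed. -/
theorem tendsto_bias (hf : ContDiffOn ℝ 2 f (orthant τ)) (hf2 : MemLp f 2 (orthantVolume τ))
    (hs : ∀ j, MemLp (fun x => x j * secondPartial f j x) 2 (orthantVolume τ))
    (l : List (Fin (τ + 1))) :
    Tendsto (fun b => eLpNorm ((fun x => b⁻¹ * (iterOp (fun x t => gammaKernel x b t) l
      (cutoff f) x - cutoff f x)) - fun x => (l.map fun j => 1 / 2 * weightedSecondPartial f j x).sum)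
        2 (orthantVolume τ)) (𝓝[>] 0) (𝓝 0) := by
  have hm0 := measurable_cutoff hf
  have h0 : MemLp (cutoff f) 2 (orthantVolume τ) := hf2.ae_eq (cutoff_ae_eq f).symm
  have hmw := fun j => measurable_weightedSecondPartial hf j
  have hw : ∀ j, MemLp (weightedSecondPartial f j) 2 (orthantVolume τ) :=
    fun j => (hs j).ae_eq (cutoff_ae_eq _).symm
  have hmS : ∀ l : List (Fin (τ + 1)),
      Measurable fun x => (l.map fun j => 1 / 2 * weightedSecondPartial f j x).sum := by
    intro l
    induction l with
    | nil => simp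
    | cons j l ih =>
      simp only [List.map_cons, List.sum_cons]
      exact ((hmw j).const_mul _).add ih
  have hS : ∀ l : List (Fin (τ + 1)), MemLp (fun x =>
      (l.map fun j => 1 / 2 * weightedSecondPartial f j x).sum) 2 (orthantVolume τ) := by
    intro l
    induction l with
    | nil => simp
    | cons j l ih =>
      simp only [List.map_cons, List.sum_cons]
      exact ((hw j).const_mul _).add ih
  induction l with
  | nil => simp [iterOp]
  | cons j l ih =>
    set G : ℝ → (Fin (τ + 1) → ℝ) → ℝ := fun b x =>
      b⁻¹ * (iterOp (fun x t => gammaKernel x b t) l (cutoff f) x - cutoff f x) with hG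
    have hmI := fun b (hb : 0 < b) => measurable_iterOp (kernelBound_gammaKernel hb).meas hm0 l
    have hI := fun b (hb : 0 < b) => memLp_iterOp (kernelBound_gammaKernel hb) hm0 one_le_two
      ENNReal.ofNat_ne_top h0 l
    have hGm : ∀ b, 0 < b → Measurable (G b) := fun b hb => ((hmI b hb).sub hm0).const_mul _
    have hGL : ∀ b, 0 < b → MemLp (G b) 2 (orthantVolume τ) :=
      fun b hb => ((hI b hb).sub h0).const_mul _
    have t1 := isApproxIdentity_gammaKernel.tendsto one_le_two ENNReal.ofNat_ne_top hGm hGL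
      (hmS l) (hS l) ih j
    have t3 := t1.add (tendsto_bias_coord hf hf2 j (hs j))
    rw [add_zero] at t3
    refine tendsto_of_tendsto_of_tendsto_of_le_of_le' tendsto_const_nhds t3
      (Eventually.of_forall fun _ => zero_le) ?_
    filter_upwards [eventually_mem_nhdsWithin] with b hb
    have hb0 : 0 < b := hb
    have hae := coordOp_sub_ae (kernelBound_gammaKernel hb0) (hmI b hb0) hm0 one_le_two
      ENNReal.ofNat_ne_top (hI b hb0) h0 j
    have hsm : ∀ x, coordOp (fun x t => gammaKernel x b t) j (G b) x = b⁻¹ *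
        coordOp (fun x t => gammaKernel x b t) j
          (iterOp (fun x t => gammaKernel x b t) l (cutoff f) - cutoff f) x := by
      intro x
      rw [coordOp, coordOp, ← integral_const_mul]
      refine integral_congr_ae (ae_of_all _ fun t => ?_)
      simp only [hG, Pi.sub_apply]
      ring
    refine le_trans (le_of_eq ?_) (eLpNorm_add_le
      ((measurable_coordOp (measurable_gammaKernel hb0) (hGm b hb0) j).sub
        ((hmS l).const_mul 1)).aestronglyMeasurable
      ((((measurable_coordOp (measurable_gammaKernel hb0) hm0 j).sub hm0).const_mul _).sub
        ((hmw j).const_mul _)).aestronglyMeasurable one_le_two)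
    refine eLpNorm_congr_ae ?_
    filter_upwards [hae] with x hx
    simp only [Pi.add_apply, Pi.sub_apply] at hx ⊢
    rw [hsm, hx, List.map_cons, List.sum_cons,
      show iterOp (fun x t => gammaKernel x b t) (j :: l) (cutoff f) =
        coordOp (fun x t => gammaKernel x b t) j (iterOp (fun x t => gammaKernel x b t) l (cutoff f))
        from rfl]
    ring

theorem tendsto_integral_sq {α ι : Type*} [MeasurableSpace α] {μ : Measure α} {l : Filter ι}
    {A : ι → α → ℝ} {B : α → ℝ} (hA : ∀ᶠ i in l, MemLp (A i) 2 μ) (hB : MemLp B 2 μ)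
    (h : Tendsto (fun i => eLpNorm (A i - B) 2 μ) l (𝓝 0)) :
    Tendsto (fun i => ∫ x, A i x ^ 2 ∂μ) l (𝓝 (∫ x, B x ^ 2 ∂μ)) := by
  have e : ∀ F : α → ℝ, MemLp F 2 μ → ∫ x, F x ^ 2 ∂μ = (eLpNorm F 2 μ).toReal ^ 2 := by
    intro F hF
    rw [hF.eLpNorm_eq_integral_rpow_norm two_ne_zero ENNReal.ofNat_ne_top,
      ENNReal.toReal_ofReal (by positivity), ← Real.rpow_natCast, ← Real.rpow_mul (by positivity)]
    norm_num
  rw [e B hB]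
  have h1 : Tendsto (fun i => (eLpNorm (A i) 2 μ).toReal) l (𝓝 (eLpNorm B 2 μ).toReal) := by
    rw [tendsto_iff_norm_sub_tendsto_zero]
    have h2 := (ENNReal.continuousAt_toReal ENNReal.zero_ne_top).tendsto.comp h
    rw [ENNReal.toReal_zero] at h2
    refine squeeze_zero' (Eventually.of_forall fun _ => norm_nonneg _) ?_ h2
    filter_upwards [hA] with i hi
    have f1 := hi.2.ne
    have f2 := hB.2.ne
    have f3 := (hi.sub hB).2.ne
    have a1 : (eLpNorm (A i) 2 μ).toReal ≤ (eLpNorm (A i - B) 2 μ).toReal +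
        (eLpNorm B 2 μ).toReal := by
      rw [← ENNReal.toReal_add f3 f2]
      refine ENNReal.toReal_mono (ENNReal.add_ne_top.2 ⟨f3, f2⟩) ?_
      simpa using eLpNorm_add_le (hi.sub hB).1 hB.1 one_le_two
    have a2 : (eLpNorm B 2 μ).toReal ≤ (eLpNorm (A i - B) 2 μ).toReal +
        (eLpNorm (A i) 2 μ).toReal := by
      rw [← ENNReal.toReal_add f3 f1]
      refine ENNReal.toReal_mono (ENNReal.add_ne_top.2 ⟨f3, f1⟩) ?_
      rw [eLpNorm_sub_comm]
      simpa using eLpNorm_add_le (hB.sub hi).1 hi.1 one_le_two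
    rw [Real.norm_eq_abs, abs_le, Function.comp]
    constructor <;> linarith
  refine (h1.pow 2).congr' ?_
  filter_upwards [hA] with i hi using (e _ hi).symm

theorem biasConst_eq (f : (Fin (τ + 1) → ℝ) → ℝ) :
    ∫ x, (((List.finRange (τ + 1)).map fun j => 1 / 2 * weightedSecondPartial f j x).sum) ^ 2
      ∂orthantVolume τ = biasConst f / 4 := by
  rw [biasConst, ← integral_div]
  refine integral_congr_ae ?_
  filter_upwards [ae_mem_orthant τ] with x hx
  have : ((List.finRange (τ + 1)).map fun j => 1 / 2 * weightedSecondPartial f j x).sum =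
      1 / 2 * ∑ j, x j * secondPartial f j x := by
    rw [← List.ofFn_eq_map, List.sum_ofFn, Finset.mul_sum]
    refine Finset.sum_congr rfl fun j _ => ?_
    rw [weightedSecondPartial, cutoff, indicator_of_mem hx]
  rw [this]
  ring

/-- The mean of the gamma kernel estimator, as a function of the point. -/
noncomputable def smoothed (f : (Fin (τ + 1) → ℝ) → ℝ) (b : ℝ) : (Fin (τ + 1) → ℝ) → ℝ :=
  iterOp (fun x t => gammaKernel x b t) (List.finRange (τ + 1)) (cutoff f)

theorem memLp_smoothed (hf : ContDiffOn ℝ 2 f (orthant τ)) (hf2 : MemLp f 2 (orthantVolume τ))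
    {b : ℝ} (hb : 0 < b) : MemLp (smoothed f b) 2 (orthantVolume τ) :=
  memLp_iterOp (kernelBound_gammaKernel hb) (measurable_cutoff hf) one_le_two ENNReal.ofNat_ne_top
    (hf2.ae_eq (cutoff_ae_eq f).symm) _

/-- The integrated squared bias is asymptotic to `b² / 4` times `biasConst f`. -/
theorem tendsto_integral_sq_bias (hf : ContDiffOn ℝ 2 f (orthant τ))
    (hf2 : MemLp f 2 (orthantVolume τ))
    (hs : ∀ j, MemLp (fun x => x j * secondPartial f j x) 2 (orthantVolume τ)) :
    Tendsto (fun b => (∫ x, (smoothed f b x - f x) ^ 2 ∂orthantVolume τ) / b ^ 2) (𝓝[>] 0)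
      (𝓝 (biasConst f / 4)) := by
  have h0 : MemLp (cutoff f) 2 (orthantVolume τ) := hf2.ae_eq (cutoff_ae_eq f).symm
  have hS : MemLp (fun x => ((List.finRange (τ + 1)).map fun j =>
      1 / 2 * weightedSecondPartial f j x).sum) 2 (orthantVolume τ) := by
    induction List.finRange (τ + 1) with
    | nil => simp
    | cons j l ih =>
      simp only [List.map_cons, List.sum_cons]
      exact (((hs j).ae_eq (cutoff_ae_eq _).symm).const_mul (1 / 2 : ℝ)).add ih
  have := tendsto_integral_sq (l := 𝓝[>] (0 : ℝ)) (by
    filter_upwards [eventually_mem_nhdsWithin] with b hb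
    exact ((memLp_smoothed hf hf2 hb).sub h0).const_mul b⁻¹) hS
    (tendsto_bias hf hf2 hs (List.finRange (τ + 1)))
  rw [biasConst_eq] at this
  refine this.congr fun b => ?_
  rw [← integral_div]
  refine integral_congr_ae ?_
  filter_upwards [cutoff_ae_eq f] with x hx
  rw [← hx, div_eq_inv_mul, ← inv_pow, ← mul_pow]
  rfl

/-- The mean of the estimator is bounded in `L²`. -/
theorem exists_integral_sq_smoothed_le (hf : ContDiffOn ℝ 2 f (orthant τ))
    (hf2 : MemLp f 2 (orthantVolume τ)) :
    ∃ D : ℝ, ∀ b, 0 < b → ∫ x, smoothed f b x ^ 2 ∂orthantVolume τ ≤ D := by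
  have h0 : MemLp (cutoff f) 2 (orthantVolume τ) := hf2.ae_eq (cutoff_ae_eq f).symm
  refine ⟨(((8 : ℝ≥0) : ℝ≥0∞) ^ (List.finRange (τ + 1)).length *
    eLpNorm (cutoff f) 2 (orthantVolume τ)).toReal ^ 2, fun b hb => ?_⟩
  have hS := memLp_smoothed hf hf2 hb
  have e : ∫ x, smoothed f b x ^ 2 ∂orthantVolume τ =
      (eLpNorm (smoothed f b) 2 (orthantVolume τ)).toReal ^ 2 := by
    rw [hS.eLpNorm_eq_integral_rpow_norm two_ne_zero ENNReal.ofNat_ne_top,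
      ENNReal.toReal_ofReal (by positivity), ← Real.rpow_natCast, ← Real.rpow_mul (by positivity)]
    norm_num
  rw [e]
  gcongr
  · exact ENNReal.mul_ne_top (by simp) h0.2.ne
  · exact eLpNorm_iterOp_le (kernelBound_gammaKernel hb) (measurable_cutoff hf) one_le_two
      ENNReal.ofNat_ne_top _

end Bias

/-! ### Covariance inequalities -/

section Mixing

variable {E : Type*} [MeasurableSpace E] {π₁ π₂ : Measure (E × E)} {ν : Measure E} {α : ℝ}

/-- Two laws of pairs with the same marginals, which differ by at most `α` on rectangles. -/
structure MixingPair (π₁ π₂ : Measure (E × E)) (ν : Measure E) (α : ℝ) : Prop where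
  fst₁ : π₁.map Prod.fst = ν
  snd₁ : π₁.map Prod.snd = ν
  fst₂ : π₂.map Prod.fst = ν
  snd₂ : π₂.map Prod.snd = ν
  bound : ∀ A B : Set E, MeasurableSet A → MeasurableSet B →
    |π₁.real (A ×ˢ B) - π₂.real (A ×ˢ B)| ≤ α

theorem setIntegral_indicator_Iic {a : ℝ} (h0 : 0 ≤ a) (h1 : a ≤ 1) :
    ∫ u in Ioc (0 : ℝ) 1, (Iic a).indicator 1 u = a := by
  rw [setIntegral_indicator measurableSet_Iic, Ioc_inter_Iic, min_eq_right h1]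
  simp [h0]

/-- The layer cake formula for a product. -/
theorem integral_mul_eq_layercake (π : Measure (E × E)) [IsFiniteMeasure π] {φ : E → ℝ}
    (hφ : Measurable φ) (h0 : ∀ s, 0 ≤ φ s) (h1 : ∀ s, φ s ≤ 1) :
    ∫ z, φ z.1 * φ z.2 ∂π =
      ∫ u, π.real ({s | u.1 ≤ φ s} ×ˢ {t | u.2 ≤ φ t})
        ∂((volume.restrict (Ioc (0 : ℝ) 1)).prod (volume.restrict (Ioc (0 : ℝ) 1))) := by
  set ρ := volume.restrict (Ioc (0 : ℝ) 1)
  set S : Set ((E × E) × (ℝ × ℝ)) := {p | p.2.1 ≤ φ p.1.1 ∧ p.2.2 ≤ φ p.1.2}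
  have hS : MeasurableSet S :=
    (measurableSet_le (f := fun p : (E × E) × (ℝ × ℝ) => p.2.1) (g := fun p => φ p.1.1)
      (by fun_prop) (by fun_prop)).inter
    (measurableSet_le (f := fun p : (E × E) × (ℝ × ℝ) => p.2.2) (g := fun p => φ p.1.2)
      (by fun_prop) (by fun_prop))
  have hi : Integrable (Function.uncurry fun (z : E × E) (u : ℝ × ℝ) =>
      S.indicator (1 : (E × E) × (ℝ × ℝ) → ℝ) (z, u)) (π.prod (ρ.prod ρ)) :=
    (integrable_const (1 : ℝ)).indicator hS
  have hsw := integral_integral_swap hi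
  have e1 : ∀ z : E × E, ∫ u, S.indicator (1 : (E × E) × (ℝ × ℝ) → ℝ) (z, u) ∂(ρ.prod ρ) =
      φ z.1 * φ z.2 := by
    intro z
    have : ∀ u : ℝ × ℝ, S.indicator (1 : (E × E) × (ℝ × ℝ) → ℝ) (z, u) =
        (Iic (φ z.1)).indicator 1 u.1 * (Iic (φ z.2)).indicator 1 u.2 := by
      intro u
      by_cases h1 : u.1 ≤ φ z.1 <;> by_cases h2 : u.2 ≤ φ z.2 <;> simp [S, h1, h2]
    simp_rw [this]
    rw [integral_prod_mul, setIntegral_indicator_Iic (h0 _) (h1 _),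
      setIntegral_indicator_Iic (h0 _) (h1 _)]
  have e2 : ∀ u : ℝ × ℝ, ∫ z, S.indicator (1 : (E × E) × (ℝ × ℝ) → ℝ) (z, u) ∂π =
      π.real ({s | u.1 ≤ φ s} ×ˢ {t | u.2 ≤ φ t}) := by
    intro u
    have hm : MeasurableSet ({s | u.1 ≤ φ s} ×ˢ {t | u.2 ≤ φ t}) :=
      (measurableSet_le measurable_const hφ).prod (measurableSet_le measurable_const hφ)
    rw [← integral_indicator_one hm]
    rfl
  simp_rw [e1, e2] at hsw
  exact hsw

theorem integrable_comp_fst (h : π₁.map Prod.fst = ν) {F : E → ℝ}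
    (hF : Integrable F ν) : Integrable (fun z : E × E => F z.1) π₁ := by
  rw [← h] at hF
  exact hF.comp_measurable measurable_fst

theorem integrable_comp_snd (h : π₁.map Prod.snd = ν) {F : E → ℝ}
    (hF : Integrable F ν) : Integrable (fun z : E × E => F z.2) π₁ := by
  rw [← h] at hF
  exact hF.comp_measurable measurable_snd

theorem integral_comp_fst (h : π₁.map Prod.fst = ν) {F : E → ℝ} (hF : Measurable F) :
    ∫ z : E × E, F z.1 ∂π₁ = ∫ s, F s ∂ν := by
  rw [← h, integral_map measurable_fst.aemeasurable hF.aestronglyMeasurable]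

theorem integral_comp_snd (h : π₁.map Prod.snd = ν) {F : E → ℝ} (hF : Measurable F) :
    ∫ z : E × E, F z.2 ∂π₁ = ∫ s, F s ∂ν := by
  rw [← h, integral_map measurable_snd.aemeasurable hF.aestronglyMeasurable]

theorem MixingPair.isFiniteMeasure (h : MixingPair π₁ π₂ ν α) [IsFiniteMeasure ν] :
    IsFiniteMeasure π₁ ∧ IsFiniteMeasure π₂ := by
  constructor
  · refine ⟨?_⟩
    rw [← preimage_univ (f := (Prod.fst : E × E → E)), ← Measure.map_apply measurable_fst .univ,
      h.fst₁]
    exact measure_lt_top _ _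
  · refine ⟨?_⟩
    rw [← preimage_univ (f := (Prod.fst : E × E → E)), ← Measure.map_apply measurable_fst .univ,
      h.fst₂]
    exact measure_lt_top _ _

/-- The covariance inequality for functions with values in `[0, 1]`. -/
theorem MixingPair.abs_sub_le_of_unit (h : MixingPair π₁ π₂ ν α) [IsFiniteMeasure ν] {φ : E → ℝ}
    (hφ : Measurable φ) (h0 : ∀ s, 0 ≤ φ s) (h1 : ∀ s, φ s ≤ 1) :
    |∫ z, φ z.1 * φ z.2 ∂π₁ - ∫ z, φ z.1 * φ z.2 ∂π₂| ≤ α := by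
  obtain ⟨i1, i2⟩ := h.isFiniteMeasure
  rw [integral_mul_eq_layercake π₁ hφ h0 h1, integral_mul_eq_layercake π₂ hφ h0 h1]
  set ρ := volume.restrict (Ioc (0 : ℝ) 1)
  have : IsProbabilityMeasure ρ := ⟨by simp [ρ]⟩
  have hint : ∀ π : Measure (E × E), IsFiniteMeasure π → Integrable
      (fun u : ℝ × ℝ => π.real ({s | u.1 ≤ φ s} ×ˢ {t | u.2 ≤ φ t})) (ρ.prod ρ) := by
    intro π hπ
    have hm : Measurable fun u : ℝ × ℝ => π ({s | u.1 ≤ φ s} ×ˢ {t | u.2 ≤ φ t}) := by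
      have hS : MeasurableSet {p : (ℝ × ℝ) × (E × E) | p.1.1 ≤ φ p.2.1 ∧ p.1.2 ≤ φ p.2.2} :=
        (measurableSet_le (f := fun p : (ℝ × ℝ) × (E × E) => p.1.1) (g := fun p => φ p.2.1)
          (by fun_prop) (by fun_prop)).inter
        (measurableSet_le (f := fun p : (ℝ × ℝ) × (E × E) => p.1.2) (g := fun p => φ p.2.2)
          (by fun_prop) (by fun_prop))
      exact measurable_measure_prodMk_left hS
    refine Integrable.of_bound hm.ennreal_toReal.aestronglyMeasurable (π.real univ)
      (ae_of_all _ fun u => ?_)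
    rw [Real.norm_of_nonneg measureReal_nonneg]
    exact measureReal_mono (subset_univ _)
  -- At each pair of levels the laws are compared on a rectangle, where they differ by at most α;
  -- the square of levels has mass 1.
  rw [← integral_sub (hint π₁ i1) (hint π₂ i2), ← Real.norm_eq_abs]
  refine (norm_integral_le_of_norm_le_const (C := α) (ae_of_all _ fun u => ?_)).trans ?_
  · exact h.bound _ _ (measurableSet_le measurable_const hφ) (measurableSet_le measurable_const hφ)
  · simp

/-- The covariance inequality for functions with values in `[0, c]`. -/
theorem MixingPair.abs_sub_le_of_le (h : MixingPair π₁ π₂ ν α) [IsFiniteMeasure ν] {φ : E → ℝ}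
    (hφ : Measurable φ) {c : ℝ} (hc : 0 < c) (h0 : ∀ s, 0 ≤ φ s) (h1 : ∀ s, φ s ≤ c) :
    |∫ z, φ z.1 * φ z.2 ∂π₁ - ∫ z, φ z.1 * φ z.2 ∂π₂| ≤ c ^ 2 * α := by
  have := h.abs_sub_le_of_unit (hφ.div_const c) (fun s => div_nonneg (h0 s) hc.le)
    (fun s => (div_le_one hc).2 (h1 s))
  have e : ∀ z : E × E, φ z.1 * φ z.2 = c ^ 2 * (φ z.1 / c * (φ z.2 / c)) := fun z => by
    field_simp
  simp_rw [e]
  rw [integral_const_mul, integral_const_mul, ← mul_sub, abs_mul, abs_of_pos (by positivity)]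
  gcongr

/-- The covariance inequality for functions with values in `[-a, a]`. -/
theorem MixingPair.abs_sub_le_of_abs_le (h : MixingPair π₁ π₂ ν α) [IsFiniteMeasure ν] {φ : E → ℝ}
    (hφ : Measurable φ) {a : ℝ} (ha : 0 < a) (h1 : ∀ s, |φ s| ≤ a) :
    |∫ z, φ z.1 * φ z.2 ∂π₁ - ∫ z, φ z.1 * φ z.2 ∂π₂| ≤ 4 * a ^ 2 * α := by
  obtain ⟨i1, i2⟩ := h.isFiniteMeasure
  have hle : ∀ s, -a ≤ φ s ∧ φ s ≤ a := fun s => abs_le.1 (h1 s)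
  have key := h.abs_sub_le_of_le (φ := fun s => φ s + a) (hφ.add_const a) (c := 2 * a)
    (by positivity) (fun s => by linarith [(hle s).1]) (fun s => by linarith [(hle s).2])
  have hφi : Integrable φ ν := Integrable.of_bound hφ.aestronglyMeasurable a
    (ae_of_all _ fun s => h1 s)
  have e : ∀ π : Measure (E × E), IsFiniteMeasure π → π.map Prod.fst = ν → π.map Prod.snd = ν →
      ∫ z, (φ z.1 + a) * (φ z.2 + a) ∂π = (∫ z, φ z.1 * φ z.2 ∂π) + a * (∫ s, φ s ∂ν) +
        a * (∫ s, φ s ∂ν) + a ^ 2 * ν.real univ := by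
    intro π hπ hf hs
    have e1 : ∀ z : E × E, (φ z.1 + a) * (φ z.2 + a) =
        φ z.1 * φ z.2 + a * φ z.1 + a * φ z.2 + a ^ 2 := fun z => by ring
    simp_rw [e1]
    have j1 : Integrable (fun z : E × E => φ z.1 * φ z.2) π := by
      refine Integrable.of_bound ((hφ.comp measurable_fst).mul
        (hφ.comp measurable_snd)).aestronglyMeasurable (a * a) (ae_of_all _ fun z => ?_)
      rw [norm_mul]
      exact mul_le_mul (h1 _) (h1 _) (norm_nonneg _) ha.le
    have j2 : Integrable (fun z : E × E => a * φ z.1) π := (integrable_comp_fst hf hφi).const_mul a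
    have j3 : Integrable (fun z : E × E => a * φ z.2) π := (integrable_comp_snd hs hφi).const_mul a
    rw [integral_add _ (integrable_const _), integral_add _ j3, integral_add j1 j2,
      integral_const_mul, integral_const_mul, integral_comp_fst hf hφ, integral_comp_snd hs hφ]
    · have : ν.real univ = π.real univ := by
        rw [← hf, map_measureReal_apply measurable_fst .univ, preimage_univ]
      rw [integral_const, smul_eq_mul, this, mul_comm (a ^ 2)]
    · exact j1.add j2
    · exact (j1.add j2).add j3
  rw [e π₁ i1 h.fst₁ h.snd₁, e π₂ i2 h.fst₂ h.snd₂] at key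
  refine le_of_eq_of_le (congrArg _ ?_) (key.trans_eq ?_) <;> ring

/-- If both entries are within [-a, a] nothing changes. Otherwise clamping shrinks each factor
without changing its sign, so the error is at most |xy| ≤ m² with m the larger modulus, and m ≥ a
gives m² ≤ a^(2-p) m^p. -/
theorem abs_mul_sub_mul_clamp_le {a p : ℝ} (ha : 0 < a) (hp : 2 ≤ p) (x y : ℝ) :
    |x * y - max (-a) (min x a) * max (-a) (min y a)| ≤
      a ^ (2 - p) * (|x| ^ p + |y| ^ p) := by
  have hb : ∀ m : ℝ, a ≤ m → m ^ 2 ≤ a ^ (2 - p) * m ^ p := by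
    intro m hm
    have hm0 : 0 < m := ha.trans_le hm
    calc m ^ 2 = m ^ (2 - p) * m ^ p := by
          rw [← Real.rpow_add hm0]; norm_num
      _ ≤ _ := mul_le_mul_of_nonneg_right
          (Real.rpow_le_rpow_of_nonpos ha hm (sub_nonpos.2 hp)) (by positivity)
  have hcl : ∀ x : ℝ, |max (-a) (min x a)| ≤ |x| ∧ 0 ≤ x * max (-a) (min x a) := by
    intro x
    rcases le_total 0 x with h | h
    · have h2 : 0 ≤ min x a := le_min h ha.le
      rw [max_eq_right (by linarith), abs_of_nonneg h2, abs_of_nonneg h]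
      exact ⟨min_le_left _ _, mul_nonneg h h2⟩
    · have h2 : min x a = x := min_eq_left (by linarith)
      have h3 : max (-a) x ≤ 0 := max_le (by linarith) h
      rw [h2, abs_of_nonpos h3, abs_of_nonpos h]
      exact ⟨neg_le_neg (le_max_right _ _), mul_nonneg_of_nonpos_of_nonpos h h3⟩
  have hid : ∀ x : ℝ, |x| ≤ a → max (-a) (min x a) = x := by
    intro x hx
    rw [min_eq_left (abs_le.1 hx).2, max_eq_right (abs_le.1 hx).1]
  by_cases hxy : |x| ≤ a ∧ |y| ≤ a
  · rw [hid x hxy.1, hid y hxy.2, sub_self, abs_zero]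
    positivity
  obtain ⟨px, qx⟩ := hcl x
  obtain ⟨py, qy⟩ := hcl y
  set X := max (-a) (min x a)
  set Y := max (-a) (min y a)
  have h1 : |x * y - X * Y| ≤ |x * y| := by
    have h2 : |X * Y| ≤ |x * y| := by rw [abs_mul, abs_mul]; gcongr
    have h3 : 0 ≤ x * y * (X * Y) := by
      have := mul_nonneg qx qy
      linarith [show x * X * (y * Y) = x * y * (X * Y) by ring]
    rcases le_total 0 (x * y) with h | h
    · rw [abs_of_nonneg h] at h2 ⊢
      rcases h.eq_or_lt with h4 | h4
      · rw [← h4, abs_nonpos_iff] at h2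
        rw [← h4, h2, sub_self, abs_zero]
      · have := nonneg_of_mul_nonneg_right h3 h4
        rw [abs_of_nonneg this] at h2
        rw [abs_le]; constructor <;> linarith
    · rw [abs_of_nonpos h] at h2 ⊢
      rcases h.eq_or_lt with h4 | h4
      · rw [h4, neg_zero, abs_nonpos_iff] at h2
        rw [h4, h2, sub_self, abs_zero, neg_zero]
      · have := nonpos_of_mul_nonneg_right h3 h4
        rw [abs_of_nonpos this] at h2
        rw [abs_le]; constructor <;> linarith
  have hsq : ∀ u v : ℝ, |u| ≤ |v| → a ≤ |v| → |u| * |v| ≤ a ^ (2 - p) * (|u| ^ p + |v| ^ p) := by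
    intro u v huv hv
    calc |u| * |v| ≤ |v| ^ 2 := by rw [sq]; gcongr
      _ ≤ a ^ (2 - p) * |v| ^ p := hb _ hv
      _ ≤ _ := by
        gcongr
        exact le_add_of_nonneg_left (by positivity)
  refine h1.trans ?_
  rw [abs_mul]
  rcases le_total |x| |y| with h | h
  · exact hsq x y h (by by_contra! h5; exact hxy ⟨(h.trans_lt h5).le, h5.le⟩)
  · rw [mul_comm, add_comm]
    exact hsq y x h (by by_contra! h5; exact hxy ⟨h5.le, (h.trans_lt h5).le⟩)

/-- The covariance inequality for functions in `L^p`, `p ≥ 2`. -/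
theorem MixingPair.abs_sub_le_rpow (h : MixingPair π₁ π₂ ν α) [IsFiniteMeasure ν] {w : E → ℝ}
    (hw : Measurable w) {a p : ℝ} (ha : 0 < a) (hp : 2 ≤ p) (hw2 : Integrable (fun s => w s ^ 2) ν)
    (hwp : Integrable (fun s => |w s| ^ p) ν) :
    |∫ z, w z.1 * w z.2 ∂π₁ - ∫ z, w z.1 * w z.2 ∂π₂| ≤
      4 * a ^ 2 * α + 4 * a ^ (2 - p) * ∫ s, |w s| ^ p ∂ν := by
  obtain ⟨i1, i2⟩ := h.isFiniteMeasure
  set φ : E → ℝ := fun s => max (-a) (min (w s) a)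
  have hφ : Measurable φ := measurable_const.max (hw.min measurable_const)
  have hφa : ∀ s, |φ s| ≤ a := fun s =>
    abs_le.2 ⟨le_max_left _ _, max_le (by linarith) (min_le_right _ _)⟩
  have key := h.abs_sub_le_of_abs_le hφ ha hφa
  have e : ∀ π : Measure (E × E), IsFiniteMeasure π → π.map Prod.fst = ν → π.map Prod.snd = ν →
      |∫ z, w z.1 * w z.2 ∂π - ∫ z, φ z.1 * φ z.2 ∂π| ≤ 2 * a ^ (2 - p) * ∫ s, |w s| ^ p ∂ν := by
    intro π hπ hf hs
    have j1 : Integrable (fun z : E × E => φ z.1 * φ z.2) π := by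
      refine Integrable.of_bound ((hφ.comp measurable_fst).mul
        (hφ.comp measurable_snd)).aestronglyMeasurable (a * a) (ae_of_all _ fun z => ?_)
      rw [norm_mul]
      exact mul_le_mul (hφa _) (hφa _) (norm_nonneg _) ha.le
    have j2 : Integrable (fun z : E × E => w z.1 * w z.2) π := by
      refine Integrable.mono' ((integrable_comp_fst hf hw2).add (integrable_comp_snd hs hw2))
        ((hw.comp measurable_fst).mul (hw.comp measurable_snd)).aestronglyMeasurable
        (ae_of_all _ fun z => ?_)
      simp only [Pi.add_apply, Real.norm_eq_abs, abs_mul]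
      rw [← sq_abs (w z.1), ← sq_abs (w z.2)]
      nlinarith [sq_nonneg (|w z.1| - |w z.2|), sq_nonneg |w z.1|, sq_nonneg |w z.2|]
    have j3 : Integrable (fun z : E × E => a ^ (2 - p) * (|w z.1| ^ p + |w z.2| ^ p)) π :=
      ((integrable_comp_fst hf hwp).add (integrable_comp_snd hs hwp)).const_mul _
    rw [← integral_sub j2 j1, ← Real.norm_eq_abs]
    refine (norm_integral_le_of_norm_le j3 (ae_of_all _ fun z =>
      abs_mul_sub_mul_clamp_le ha hp _ _)).trans_eq ?_
    rw [integral_const_mul, integral_add (integrable_comp_fst hf hwp) (integrable_comp_snd hs hwp),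
      integral_comp_fst hf (F := fun s => |w s| ^ p) (by fun_prop),
      integral_comp_snd hs (F := fun s => |w s| ^ p) (by fun_prop)]
    ring
  have e1 := abs_le.1 (e π₁ i1 h.fst₁ h.snd₁)
  have e2 := abs_le.1 (e π₂ i2 h.fst₂ h.snd₂)
  have e3 := abs_le.1 key
  rw [abs_le]
  constructor <;> linarith

/-! ### Averages over random signs -/

/-- The average of `F (w ± ξ₁ ± ⋯ ± ξₙ)` over all choices of signs. -/
noncomputable def signAverage {V : Type*} [AddCommGroup V] : List V → (V → ℝ) → V → ℝ
  | [], F, w => F w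
  | ξ :: l, F, w => (signAverage l F (w + ξ) + signAverage l F (w - ξ)) / 2

/-- The predicate `W`, closed under sums and differences, carries the integrability that the
comparison needs at every signed sum. -/
theorem signAverage_mono {V : Type*} [AddCommGroup V] {F G : V → ℝ} {W : V → Prop}
    (hadd : ∀ u v, W u → W v → W (u + v)) (hsub : ∀ u v, W u → W v → W (u - v))
    (h : ∀ w, W w → F w ≤ G w) (l : List V) (hl : ∀ ξ ∈ l, W ξ) {w : V} (hw : W w) :
    signAverage l F w ≤ signAverage l G w := by
  induction l generalizing w with
  | nil => exact h w hw
  | cons ξ l ih =>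
    have hl' : ∀ ξ ∈ l, W ξ := fun ξ hξ => hl ξ (List.mem_cons_of_mem _ hξ)
    have hξ := hl ξ List.mem_cons_self
    have h1 := ih hl' (hadd _ _ hw hξ)
    have h2 := ih hl' (hsub _ _ hw hξ)
    simp only [signAverage]
    linarith

theorem signAverage_add {V : Type*} [AddCommGroup V] (F G : V → ℝ) (l : List V) (w : V) :
    signAverage l (fun w => F w + G w) w = signAverage l F w + signAverage l G w := by
  induction l generalizing w with
  | nil => rfl
  | cons ξ l ih => simp only [signAverage, ih]; ring

theorem signAverage_const_mul {V : Type*} [AddCommGroup V] (c : ℝ) (F : V → ℝ) (l : List V)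
    (w : V) : signAverage l (fun w => c * F w) w = c * signAverage l F w := by
  induction l generalizing w with
  | nil => rfl
  | cons ξ l ih => simp only [signAverage, ih]; ring

theorem signAverage_const {V : Type*} [AddCommGroup V] (c : ℝ) (l : List V) (w : V) :
    signAverage l (fun _ => c) w = c := by
  induction l generalizing w with
  | nil => rfl
  | cons ξ l ih => simp only [signAverage, ih]; ring

theorem signAverage_integral {V Z : Type*} [AddCommGroup V] [MeasurableSpace Z] (π : Measure Z)
    {G : V → Z → ℝ} {W : V → Prop}
    (hadd : ∀ u v, W u → W v → W (u + v)) (hsub : ∀ u v, W u → W v → W (u - v))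
    (hG : ∀ w, W w → Integrable (G w) π) (l : List V) (hl : ∀ ξ ∈ l, W ξ) {w : V} (hw : W w) :
    Integrable (fun z => signAverage l (fun w => G w z) w) π ∧
    signAverage l (fun w => ∫ z, G w z ∂π) w = ∫ z, signAverage l (fun w => G w z) w ∂π := by
  induction l generalizing w with
  | nil => exact ⟨hG w hw, rfl⟩
  | cons ξ l ih =>
    have hl' : ∀ ξ ∈ l, W ξ := fun ξ hξ => hl ξ (List.mem_cons_of_mem _ hξ)
    have hξ := hl ξ List.mem_cons_self
    obtain ⟨i1, e1⟩ := ih hl' (hadd _ _ hw hξ)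
    obtain ⟨i2, e2⟩ := ih hl' (hsub _ _ hw hξ)
    refine ⟨(i1.add i2).div_const 2, ?_⟩
    simp only [signAverage]
    rw [integral_div, integral_add i1 i2, e1, e2]

omit [MeasurableSpace E] in
-- Cross terms cancel over the signs, so a sum of products over the list is an average of products
-- of single scalar functions. This is how the scalar covariance inequality becomes one for inner
-- products.
theorem signAverage_mul (l : List (E → ℝ)) (w : E → ℝ) (s t : E) :
    signAverage l (fun w => w s * w t) w = w s * w t + (l.map fun ξ => ξ s * ξ t).sum := by
  induction l generalizing w with
  | nil => simp [signAverage]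
  | cons ξ l ih =>
    simp only [signAverage, ih, List.map_cons, List.sum_cons, Pi.add_apply, Pi.sub_apply]
    ring

omit [MeasurableSpace E] in
-- The average of (w ± ξ)⁴ is w⁴ + 6w²ξ² + ξ⁴, and the bound is stable under this recursion.
theorem signAverage_pow_four_le (l : List (E → ℝ)) (w : E → ℝ) (s : E) :
    signAverage l (fun w => w s ^ 4) w ≤ w s ^ 4 + 6 * w s ^ 2 * (l.map fun ξ => ξ s ^ 2).sum +
      3 * (l.map fun ξ => ξ s ^ 2).sum ^ 2 := by
  induction l generalizing w with
  | nil => simp [signAverage]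
  | cons ξ l ih =>
    have h1 := ih (w + ξ)
    have h2 := ih (w - ξ)
    simp only [signAverage, List.map_cons, List.sum_cons, Pi.add_apply, Pi.sub_apply] at h1 h2 ⊢
    nlinarith [sq_nonneg (ξ s ^ 2)]

/-- The quadratic term dominates for |x| ≤ r and the quartic one for |x| ≥ r. Second and fourth
moments of sign sums then control every order between. -/
theorem abs_rpow_le_interpolate {p r : ℝ} (hp : 2 ≤ p) (hp4 : p ≤ 4) (hr : 0 < r) (x : ℝ) :
    |x| ^ p ≤ r ^ (p - 2) * x ^ 2 + r ^ (p - 4) * x ^ 4 := by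
  rcases eq_or_ne x 0 with rfl | hx
  · rw [abs_zero, Real.zero_rpow (by linarith)]
    simp
  have hx0 : 0 < |x| := abs_pos.2 hx
  have e2 : x ^ 2 = |x| ^ (2 : ℝ) := by rw [Real.rpow_two, sq_abs]
  have e4 : x ^ 4 = |x| ^ (4 : ℝ) := by
    rw [show (4 : ℝ) = ((4 : ℕ) : ℝ) by norm_num, Real.rpow_natCast]
    exact (Even.pow_abs (by decide) x).symm
  rw [e2, e4]
  rcases le_total |x| r with h | h
  · refine le_add_of_le_of_nonneg ?_ (by positivity)
    calc |x| ^ p = |x| ^ (p - 2) * |x| ^ (2 : ℝ) := by rw [← Real.rpow_add hx0]; norm_num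
      _ ≤ _ := by
        gcongr
  · refine le_add_of_nonneg_of_le (by positivity) ?_
    calc |x| ^ p = |x| ^ (p - 4) * |x| ^ (4 : ℝ) := by rw [← Real.rpow_add hx0]; norm_num
      _ ≤ _ := mul_le_mul_of_nonneg_right
        (Real.rpow_le_rpow_of_nonpos hr h (sub_nonpos.2 hp4)) (by positivity)

omit [MeasurableSpace E] in
/-- Moments of random sign sums (a Khintchine inequality). -/
theorem signAverage_rpow_le (l : List (E → ℝ)) (s : E) {p r : ℝ} (hp : 2 ≤ p) (hp4 : p ≤ 4)
    (hr : 0 < r) (h : (l.map fun ξ => ξ s ^ 2).sum ≤ r ^ 2) :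
    signAverage l (fun w => |w s| ^ p) 0 ≤ 4 * r ^ p := by
  have h0 : 0 ≤ (l.map fun ξ => ξ s ^ 2).sum :=
    List.sum_nonneg (by simp only [List.mem_map]; rintro _ ⟨ξ, -, rfl⟩; positivity)
  have h1 : signAverage l (fun w => |w s| ^ p) 0 ≤ signAverage l
      (fun w => r ^ (p - 2) * (w s * w s) + r ^ (p - 4) * w s ^ 4) 0 :=
    signAverage_mono (W := fun _ => True) (fun _ _ _ _ => trivial) (fun _ _ _ _ => trivial)
      (fun w _ => by rw [← sq]; exact abs_rpow_le_interpolate hp hp4 hr (w s)) l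
      (fun _ _ => trivial) trivial
  rw [signAverage_add, signAverage_const_mul, signAverage_const_mul, signAverage_mul] at h1
  have h2 := signAverage_pow_four_le l 0 s
  simp only [Pi.zero_apply, mul_zero, zero_add] at h1
  simp only [← sq] at h1
  simp only [Pi.zero_apply, ne_eq, OfNat.ofNat_ne_zero, not_false_eq_true, zero_pow, mul_zero,
    zero_mul, zero_add] at h2
  calc _ ≤ r ^ (p - 2) * (l.map fun ξ => ξ s ^ 2).sum +
        r ^ (p - 4) * (3 * (l.map fun ξ => ξ s ^ 2).sum ^ 2) := h1.trans (by gcongr)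
    _ ≤ r ^ (p - 2) * r ^ 2 + r ^ (p - 4) * (3 * (r ^ 2) ^ 2) := by gcongr
    _ = 4 * r ^ p := by
      have e1 : r ^ (p - 2) * r ^ 2 = r ^ p := by
        rw [← Real.rpow_natCast, ← Real.rpow_add hr]; norm_num
      have e2 : r ^ (p - 4) * (r ^ 2) ^ 2 = r ^ p := by
        rw [← pow_mul, ← Real.rpow_natCast, ← Real.rpow_add hr]; norm_num
      linear_combination e1 + 3 * e2

/-- The covariance inequality for vectors of functions with a bound on their Euclidean length. -/
theorem MixingPair.abs_sub_le_list (h : MixingPair π₁ π₂ ν α) [IsProbabilityMeasure ν]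
    (l : List (E → ℝ)) (hl : ∀ ξ ∈ l, Measurable ξ) {R : E → ℝ} {a p : ℝ} (ha : 0 < a)
    (hp : 2 ≤ p) (hp4 : p ≤ 4) (hR : ∀ᵐ s ∂ν, 0 < R s)
    (hlR : ∀ᵐ s ∂ν, (l.map fun ξ => ξ s ^ 2).sum ≤ R s ^ 2)
    (hRp : Integrable (fun s => R s ^ p) ν) :
    |∫ z, (l.map fun ξ => ξ z.1 * ξ z.2).sum ∂π₁ - ∫ z, (l.map fun ξ => ξ z.1 * ξ z.2).sum ∂π₂| ≤
      4 * a ^ 2 * α + 16 * a ^ (2 - p) * ∫ s, R s ^ p ∂ν := by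
  obtain ⟨i1, i2⟩ := h.isFiniteMeasure
  -- The class to which the scalar inequality applies; membership in L^p makes it closed under sums
  -- and differences.
  set W : (E → ℝ) → Prop := fun w => Measurable w ∧ Integrable (fun s => |w s| ^ p) ν
  have hp0 : 0 < p := by linarith
  have hWL : ∀ w, W w ↔ Measurable w ∧ MemLp w (ENNReal.ofReal p) ν := by
    intro w
    refine and_congr_right fun hw => ?_
    rw [← integrable_norm_rpow_iff hw.aestronglyMeasurable (by simpa using hp0)
      ENNReal.ofReal_ne_top, ENNReal.toReal_ofReal hp0.le]
    rfl
  have hadd : ∀ u v, W u → W v → W (u + v) := fun u v hu hv => by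
    rw [hWL] at hu hv ⊢; exact ⟨hu.1.add hv.1, hu.2.add hv.2⟩
  have hsub : ∀ u v, W u → W v → W (u - v) := fun u v hu hv => by
    rw [hWL] at hu hv ⊢; exact ⟨hu.1.sub hv.1, hu.2.sub hv.2⟩
  have h0W : W 0 := (hWL 0).2 ⟨measurable_zero, MemLp.zero⟩
  have hlW : ∀ ξ ∈ l, W ξ := by
    intro ξ hξ
    refine ⟨hl ξ hξ, hRp.mono' ((hl ξ hξ).abs.pow_const p).aestronglyMeasurable ?_⟩
    filter_upwards [hR, hlR] with s h1 h2
    rw [Real.norm_of_nonneg (by positivity)]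
    refine Real.rpow_le_rpow (abs_nonneg _) (abs_le_of_sq_le_sq (le_trans ?_ h2) h1.le) hp0.le
    exact List.single_le_sum (by simp only [List.mem_map]; rintro _ ⟨η, -, rfl⟩; positivity) _
      (List.mem_map.2 ⟨ξ, hξ, rfl⟩)
  have hW2 : ∀ w, W w → Integrable (fun s => w s ^ 2) ν := by
    intro w hw
    have := ((hWL w).1 hw).2.mono_exponent (p := 2) (by
      rw [← ENNReal.ofReal_ofNat]; exact ENNReal.ofReal_le_ofReal hp)
    exact this.integrable_sq
  have hWi : ∀ π : Measure (E × E), IsFiniteMeasure π → π.map Prod.fst = ν → π.map Prod.snd = ν →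
      ∀ w, W w → Integrable (fun z : E × E => w z.1 * w z.2) π := by
    intro π hπ hf hs w hw
    refine Integrable.mono' ((integrable_comp_fst hf (hW2 w hw)).add
      (integrable_comp_snd hs (hW2 w hw)))
      ((hw.1.comp measurable_fst).mul (hw.1.comp measurable_snd)).aestronglyMeasurable
      (ae_of_all _ fun z => ?_)
    simp only [Pi.add_apply, Real.norm_eq_abs, abs_mul]
    rw [← sq_abs (w z.1), ← sq_abs (w z.2)]
    nlinarith [sq_nonneg (|w z.1| - |w z.2|), sq_nonneg |w z.1|, sq_nonneg |w z.2|]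
  have hπ : ∀ π : Measure (E × E), IsFiniteMeasure π → π.map Prod.fst = ν → π.map Prod.snd = ν →
      ∫ z, (l.map fun ξ => ξ z.1 * ξ z.2).sum ∂π =
        signAverage l (fun w => ∫ z, w z.1 * w z.2 ∂π) 0 := by
    intro π hπ hf hs
    rw [(signAverage_integral π hadd hsub (hWi π hπ hf hs) l hlW h0W).2]
    refine integral_congr_ae (ae_of_all _ fun z => ?_)
    simp only [signAverage_mul, Pi.zero_apply, mul_zero, zero_add]
  obtain ⟨j1, j2⟩ := signAverage_integral (G := fun w s => |w s| ^ p) ν hadd hsub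
    (fun w hw => hw.2) l hlW h0W
  have hmom : signAverage l (fun w => ∫ s, |w s| ^ p ∂ν) 0 ≤ 4 * ∫ s, R s ^ p ∂ν := by
    rw [j2, ← integral_const_mul]
    refine integral_mono_ae j1 (hRp.const_mul 4) ?_
    filter_upwards [hR, hlR] with s h1 h2
    exact signAverage_rpow_le l s hp hp4 h1 h2
  -- An absolute value does not commute with averaging over signs. The inequality is therefore
  -- averaged for each sign c = ±1 of the difference, where both sides are linear in the average.
  have hup : ∀ c : ℝ, |c| = 1 → c * ((∫ z, (l.map fun ξ => ξ z.1 * ξ z.2).sum ∂π₁) -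
      ∫ z, (l.map fun ξ => ξ z.1 * ξ z.2).sum ∂π₂) ≤
      4 * a ^ 2 * α + 16 * a ^ (2 - p) * ∫ s, R s ^ p ∂ν := by
    intro c hc
    rw [hπ π₁ i1 h.fst₁ h.snd₁, hπ π₂ i2 h.fst₂ h.snd₂]
    have hm : signAverage l (fun w => c * (∫ z, w z.1 * w z.2 ∂π₁) +
        (-c) * ∫ z, w z.1 * w z.2 ∂π₂) 0 ≤
        signAverage l (fun w => 4 * a ^ 2 * α + 4 * a ^ (2 - p) * ∫ s, |w s| ^ p ∂ν) 0 := by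
      refine signAverage_mono hadd hsub (fun w hw => ?_) l hlW h0W
      refine le_trans ?_ (h.abs_sub_le_rpow hw.1 ha hp (hW2 w hw) hw.2)
      rw [neg_mul, ← sub_eq_add_neg, ← mul_sub]
      exact (le_abs_self _).trans (by rw [abs_mul, hc, one_mul])
    rw [signAverage_add, signAverage_add, signAverage_const_mul, signAverage_const_mul,
      signAverage_const, signAverage_const_mul (4 * a ^ (2 - p))] at hm
    have : 4 * a ^ (2 - p) * signAverage l (fun w => ∫ s, |w s| ^ p ∂ν) 0 ≤
        4 * a ^ (2 - p) * (4 * ∫ s, R s ^ p ∂ν) := by gcongr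
    linarith
  rw [abs_le]
  have u1 := hup 1 (by simp)
  have u2 := hup (-1) (by simp)
  constructor <;> linarith

end Mixing

/-! ### A covariance inequality for kernels with values in a separable `L²` space -/

theorem inner_toLp {α : Type*} [MeasurableSpace α] {μ : Measure α} {u : α → ℝ} (hu : MemLp u 2 μ)
    (e : Lp ℝ 2 μ) : inner ℝ (hu.toLp u) e = ∫ x, u x * e x ∂μ := by
  rw [L2.inner_def]
  refine integral_congr_ae ?_
  filter_upwards [hu.coeFn_toLp] with x hx
  rw [hx, real_inner_eq_re_inner]
  simp [mul_comm]

/-- Orthonormal bases of the spans of initial segments of a dense sequence. Bessel's inequality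
gives the bound, and strong convergence of the projections gives the limit of the partial inner
products. Finite lists are what the sign averages act on. -/
theorem exists_lists_tendsto {α : Type*} [MeasurableSpace α] (μ : Measure α) [IsSeparable μ] :
    ∃ L : ℕ → List (α → ℝ), (∀ n, ∀ e ∈ L n, Measurable e ∧ MemLp e 2 μ) ∧
      ∀ u v : α → ℝ, MemLp u 2 μ → MemLp v 2 μ →
        (∀ n, ((L n).map fun e => (∫ x, u x * e x ∂μ) ^ 2).sum ≤ ∫ x, u x ^ 2 ∂μ) ∧
        Tendsto (fun n => ((L n).map fun e => (∫ x, u x * e x ∂μ) * ∫ x, v x * e x ∂μ).sum) atTop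
          (𝓝 (∫ x, u x * v x ∂μ)) := by
  have : Fact ((1 : ℝ≥0∞) ≤ 2) := ⟨one_le_two⟩
  have : Fact ((2 : ℝ≥0∞) ≠ ∞) := ⟨ENNReal.ofNat_ne_top⟩
  set H := Lp ℝ 2 μ
  set D := TopologicalSpace.denseSeq H
  set U : ℕ → Submodule ℝ H := fun n => Submodule.span ℝ (D '' Iio n) with hU
  have hfin : ∀ n, FiniteDimensional ℝ (U n) := fun n =>
    FiniteDimensional.span_of_finite ℝ ((finite_Iio n).image D)
  have hmono : Monotone U := fun m n hmn =>
    Submodule.span_mono (image_mono (Iio_subset_Iio hmn))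
  have htop : ⊤ ≤ (⨆ n, U n).topologicalClosure := by
    intro x _
    rw [← SetLike.mem_coe, Submodule.topologicalClosure_coe]
    refine closure_mono ?_ (TopologicalSpace.denseRange_denseSeq H x)
    rintro _ ⟨n, rfl⟩
    exact Submodule.mem_iSup_of_mem (n + 1) (Submodule.subset_span ⟨n, Nat.lt_succ_self n, rfl⟩)
  set B := fun n => stdOrthonormalBasis ℝ (U n)
  have hB : ∀ n, Orthonormal ℝ fun i => (B n i : H) := fun n =>
    (B n).orthonormal.comp_linearIsometry (U n).subtypeₗᵢ
  refine ⟨fun n => List.ofFn fun i => ((B n i : H) : α → ℝ), fun n e he => ?_,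
    fun u v hu hv => ⟨fun n => ?_, ?_⟩⟩
  · rw [List.mem_ofFn] at he
    obtain ⟨i, rfl⟩ := he
    exact ⟨(Lp.stronglyMeasurable _).measurable, Lp.memLp _⟩
  · rw [List.map_ofFn, List.sum_ofFn]
    have h1 := (hB n).sum_inner_products_le (hu.toLp u) (s := Finset.univ)
    have h2 : ‖hu.toLp u‖ ^ 2 = ∫ x, u x ^ 2 ∂μ := by
      rw [← real_inner_self_eq_norm_sq, inner_toLp hu]
      refine integral_congr_ae ?_
      filter_upwards [hu.coeFn_toLp] with x hx
      rw [hx, sq]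
    rw [h2] at h1
    refine le_trans (le_of_eq ?_) h1
    refine Finset.sum_congr rfl fun i _ => ?_
    rw [Real.norm_eq_abs, sq_abs, real_inner_comm, inner_toLp hu]
    rfl
  · have h1 := (Submodule.starProjection_tendsto_self U hmono (hu.toLp u) htop).inner
      (tendsto_const_nhds (x := hv.toLp v)) (𝕜 := ℝ)
    have h2 : inner ℝ (hu.toLp u) (hv.toLp v) = ∫ x, u x * v x ∂μ := by
      rw [inner_toLp hu]
      refine integral_congr_ae ?_
      filter_upwards [hv.coeFn_toLp] with x hx
      rw [hx]
    rw [h2] at h1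
    refine h1.congr fun n => ?_
    rw [List.map_ofFn, List.sum_ofFn]
    have h3 := (B n).sum_inner_mul_inner ((U n).orthogonalProjectionOnto (hu.toLp u))
      ((U n).orthogonalProjectionOnto (hv.toLp v))
    rw [Submodule.starProjection_apply, ← Submodule.inner_orthogonalProjectionOnto_eq_of_mem_left,
      ← h3]
    refine Finset.sum_congr rfl fun i _ => ?_
    rw [Submodule.inner_orthogonalProjectionOnto_eq_of_mem_right,
      Submodule.inner_orthogonalProjectionOnto_eq_of_mem_left, inner_toLp hu,
      real_inner_comm, inner_toLp hv]
    rfl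

section Kernel

variable {E : Type*} [MeasurableSpace E] {π₁ π₂ : Measure (E × E)} {ν : Measure E} {α : ℝ}
  {X : Type*} [MeasurableSpace X] {μ : Measure X} [SigmaFinite μ] {k : X → E → ℝ} {Ψ : E → ℝ}

/-- The product is at most the sum of the squares, whose integrals over x are bounded by Ψ at the
two ends; equal marginals finish. -/
theorem integrable_kernel_prod (hk : Measurable (Function.uncurry k)) (hk0 : ∀ x s, 0 ≤ k x s)
    (hΨ : ∀ᵐ s ∂ν, MemLp (fun x => k x s) 2 μ ∧ ∫ x, k x s ^ 2 ∂μ ≤ Ψ s)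
    (hΨi : Integrable Ψ ν) {π : Measure (E × E)} [IsFiniteMeasure π] (hf : π.map Prod.fst = ν)
    (hs : π.map Prod.snd = ν) :
    Integrable (fun q : X × (E × E) => k q.1 q.2.1 * k q.1 q.2.2) (μ.prod π) := by
  have hm : Measurable fun q : X × (E × E) => k q.1 q.2.1 * k q.1 q.2.2 :=
    (hk.comp (measurable_fst.prodMk (measurable_fst.comp measurable_snd))).mul
      (hk.comp (measurable_fst.prodMk (measurable_snd.comp measurable_snd)))
  have hΨ1 : ∀ᵐ z ∂π, MemLp (fun x => k x z.1) 2 μ ∧ ∫ x, k x z.1 ^ 2 ∂μ ≤ Ψ z.1 := by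
    rw [← hf] at hΨ; exact ae_of_ae_map measurable_fst.aemeasurable hΨ
  have hΨ2 : ∀ᵐ z ∂π, MemLp (fun x => k x z.2) 2 μ ∧ ∫ x, k x z.2 ^ 2 ∂μ ≤ Ψ z.2 := by
    rw [← hs] at hΨ; exact ae_of_ae_map measurable_snd.aemeasurable hΨ
  refine (integrable_prod_iff' hm.aestronglyMeasurable).2 ⟨?_, ?_⟩
  · filter_upwards [hΨ1, hΨ2] with z h1 h2
    exact h1.1.integrable_mul h2.1
  · refine Integrable.mono' ((integrable_comp_fst hf hΨi).add (integrable_comp_snd hs hΨi))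
      (hm.norm.stronglyMeasurable.integral_prod_left' (μ := μ)).aestronglyMeasurable ?_
    filter_upwards [hΨ1, hΨ2] with z h1 h2
    rw [Real.norm_of_nonneg (integral_nonneg fun _ => norm_nonneg _)]
    calc _ ≤ ∫ x, (k x z.1 ^ 2 + k x z.2 ^ 2) ∂μ := by
          refine integral_mono (h1.1.integrable_mul h2.1).norm
            (h1.1.integrable_sq.add h2.1.integrable_sq) fun x => ?_
          rw [Real.norm_of_nonneg (mul_nonneg (hk0 _ _) (hk0 _ _))]
          nlinarith [sq_nonneg (k x z.1 - k x z.2), sq_nonneg (k x z.1), sq_nonneg (k x z.2)]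
      _ = (∫ x, k x z.1 ^ 2 ∂μ) + ∫ x, k x z.2 ^ 2 ∂μ :=
          integral_add h1.1.integrable_sq h2.1.integrable_sq
      _ ≤ _ := add_le_add h1.2 h2.2

/-- The covariance inequality for a kernel `k`, integrated over the parameter. -/
theorem MixingPair.abs_integral_kernel_le (h : MixingPair π₁ π₂ ν α) [IsProbabilityMeasure ν]
    [IsSeparable μ] (hk : Measurable (Function.uncurry k)) (hk0 : ∀ x s, 0 ≤ k x s)
    (hΨ0 : ∀ᵐ s ∂ν, 0 < Ψ s)
    (hΨ : ∀ᵐ s ∂ν, MemLp (fun x => k x s) 2 μ ∧ ∫ x, k x s ^ 2 ∂μ ≤ Ψ s)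
    (hΨi : Integrable Ψ ν) {p : ℝ} (hp : 2 ≤ p) (hp4 : p ≤ 4)
    (hΨp : Integrable (fun s => Ψ s ^ (p / 2)) ν) {a : ℝ} (ha : 0 < a) :
    |(∫ x, ∫ z, k x z.1 * k x z.2 ∂π₁ ∂μ) - ∫ x, ∫ z, k x z.1 * k x z.2 ∂π₂ ∂μ| ≤
      4 * a ^ 2 * α + 16 * a ^ (2 - p) * ∫ s, Ψ s ^ (p / 2) ∂ν := by
  obtain ⟨i1, i2⟩ := h.isFiniteMeasure
  obtain ⟨L, hL, hL2⟩ := exists_lists_tendsto μ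
  set ξ : (X → ℝ) → E → ℝ := fun e s => ∫ x, k x s * e x ∂μ with hξ
  have hξm : ∀ e, Measurable e → Measurable (ξ e) := by
    intro e he
    have : Measurable (fun q : E × X => k q.2 q.1 * e q.2) :=
      (hk.comp measurable_swap).mul (he.comp measurable_snd)
    exact (this.stronglyMeasurable.integral_prod_right').measurable
  -- After Fubini the integrand is the L²(μ) inner product of the kernel at the two entries of z,
  -- the limit of the coordinate sums; Bessel and Ψ dominate these sums.
  have hlim : ∀ π : Measure (E × E), IsFiniteMeasure π → π.map Prod.fst = ν → π.map Prod.snd = ν →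
      Tendsto (fun n => ∫ z, (((L n).map ξ).map fun w => w z.1 * w z.2).sum ∂π) atTop
        (𝓝 (∫ x, ∫ z, k x z.1 * k x z.2 ∂π ∂μ)) := by
    intro π hπ hf hs
    have hΨ1 : ∀ᵐ z ∂π, MemLp (fun x => k x z.1) 2 μ ∧ ∫ x, k x z.1 ^ 2 ∂μ ≤ Ψ z.1 := by
      rw [← hf] at hΨ; exact ae_of_ae_map measurable_fst.aemeasurable hΨ
    have hΨ2 : ∀ᵐ z ∂π, MemLp (fun x => k x z.2) 2 μ ∧ ∫ x, k x z.2 ^ 2 ∂μ ≤ Ψ z.2 := by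
      rw [← hs] at hΨ; exact ae_of_ae_map measurable_snd.aemeasurable hΨ
    have hi := integrable_kernel_prod hk hk0 hΨ hΨi hf hs
    rw [integral_integral_swap (f := fun (x : X) (z : E × E) => k x z.1 * k x z.2) hi]
    refine tendsto_integral_of_dominated_convergence (fun z => Ψ z.1 + Ψ z.2) (fun n => ?_)
      ((integrable_comp_fst hf hΨi).add (integrable_comp_snd hs hΨi)) (fun n => ?_) ?_
    · refine Measurable.aestronglyMeasurable ?_
      have : ∀ l : List (X → ℝ), (∀ e ∈ l, Measurable e) →
          Measurable fun z : E × E => ((l.map ξ).map fun w => w z.1 * w z.2).sum := by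
        intro l
        induction l with
        | nil => intro _; simp
        | cons e l ih =>
          intro hl
          simp only [List.map_cons, List.sum_cons]
          have hm := hξm e (hl e List.mem_cons_self)
          exact ((hm.comp measurable_fst).mul (hm.comp measurable_snd)).add
            (ih fun e he => hl e (List.mem_cons_of_mem _ he))
      exact this _ fun e he => (hL n e he).1
    · filter_upwards [hΨ1, hΨ2] with z h1 h2
      have b1 := (hL2 _ _ h1.1 h1.1).1 n
      have b2 := (hL2 _ _ h2.1 h2.1).1 n
      have : ∀ l : List (X → ℝ), |((l.map ξ).map fun w => w z.1 * w z.2).sum| ≤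
          (l.map fun e => ξ e z.1 ^ 2).sum + (l.map fun e => ξ e z.2 ^ 2).sum := by
        intro l
        induction l with
        | nil => simp
        | cons e l ih =>
          simp only [List.map_cons, List.sum_cons]
          refine (abs_add_le _ _).trans ?_
          have : |ξ e z.1 * ξ e z.2| ≤ ξ e z.1 ^ 2 + ξ e z.2 ^ 2 := by
            rw [abs_mul, ← sq_abs (ξ e z.1), ← sq_abs (ξ e z.2)]
            nlinarith [sq_nonneg (|ξ e z.1| - |ξ e z.2|), sq_nonneg |ξ e z.1|,
              sq_nonneg |ξ e z.2|]
          linarith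
      rw [Real.norm_eq_abs]
      refine (this (L n)).trans (add_le_add (b1.trans h1.2) (b2.trans h2.2))
    · filter_upwards [hΨ1, hΨ2] with z h1 h2
      simp only [List.map_map]
      exact (hL2 _ _ h1.1 h2.1).2
  have hb : ∀ n, |∫ z, (((L n).map ξ).map fun w => w z.1 * w z.2).sum ∂π₁ -
      ∫ z, (((L n).map ξ).map fun w => w z.1 * w z.2).sum ∂π₂| ≤
      4 * a ^ 2 * α + 16 * a ^ (2 - p) * ∫ s, Ψ s ^ (p / 2) ∂ν := by
    intro n
    have e : ∀ᵐ s ∂ν, √(Ψ s) ^ p = Ψ s ^ (p / 2) := by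
      filter_upwards [hΨ0] with s hs
      rw [Real.sqrt_eq_rpow, ← Real.rpow_mul hs.le]
      congr 1
      ring
    rw [← integral_congr_ae e]
    -- The Euclidean length of the coordinates is at most √Ψ by Bessel, whatever the number of
    -- coordinates.
    refine h.abs_sub_le_list ((L n).map ξ) ?_ ha hp hp4 ?_ ?_ (hΨp.congr ?_)
    · intro w hw
      obtain ⟨e, he, rfl⟩ := List.mem_map.1 hw
      exact hξm e (hL n e he).1
    · filter_upwards [hΨ0] with s hs using Real.sqrt_pos.2 hs
    · filter_upwards [hΨ0, hΨ] with s hs h1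
      rw [Real.sq_sqrt hs.le, List.map_map]
      exact ((hL2 _ _ h1.1 h1.1).1 n).trans h1.2
    · filter_upwards [e] with s hs using hs.symm
  exact le_of_tendsto ((hlim π₁ i1 h.fst₁ h.snd₁).sub (hlim π₂ i2 h.fst₂ h.snd₂)).abs
    (Eventually.of_forall hb)

end Kernel

/-! ### The model -/

/-- A strictly stationary, strongly mixing sequence on the orthant with a smooth marginal density. -/
structure MixingModel {Ω : Type*} [MeasurableSpace Ω] (P : Measure Ω) (τ : ℕ)
    (X : ℕ → Ω → (Fin (τ + 1) → ℝ)) (f : (Fin (τ + 1) → ℝ) → ℝ)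
    (g : ℕ → (Fin (τ + 1) → ℝ) → (Fin (τ + 1) → ℝ) → ℝ) (κ M : ℝ) : Prop where
  meas : ∀ i, Measurable (X i)
  stationary : IsStationary P X
  nonneg : ∀ x ∈ orthant τ, 0 ≤ f x
  law : P.map (X 0) = (orthantVolume τ).withDensity (fun x => ENNReal.ofReal (f x))
  pos : 0 < κ
  lt_half : κ < 1 / 2
  mix : Summable (fun k : ℕ => (k : ℝ) * alphaMixing P X k ^ (2 * κ))
  joint_meas : ∀ k, 1 ≤ k → Measurable (Function.uncurry (g k))
  joint_nonneg : ∀ k, 1 ≤ k → ∀ x ∈ orthant τ, ∀ y ∈ orthant τ, 0 ≤ g k x y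
  joint_law : ∀ k, 1 ≤ k → P.map (fun ω => (X 0 ω, X k ω)) =
      ((orthantVolume τ).prod (orthantVolume τ)).withDensity
        (fun p => ENNReal.ofReal (g k p.1 p.2))
  joint_bound : ∀ k, 1 ≤ k → ∀ x ∈ orthant τ, ∀ y ∈ orthant τ, |g k x y - f x * f y| ≤ M
  smooth : ContDiffOn ℝ 2 f (orthant τ)
  memLp : MemLp f 2 (orthantVolume τ)
  bias_memLp : ∀ j, MemLp (fun x => x j * secondPartial f j x) 2 (orthantVolume τ)
  bias_pos : 0 < biasConst f
  moment : Integrable (fun x => (∏ j, x j ^ (-(κ + 1 / 2))) * f x) (orthantVolume τ)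

namespace MixingModel

variable {Ω : Type*} [MeasurableSpace Ω] {P : Measure Ω} {τ : ℕ}
  {X : ℕ → Ω → (Fin (τ + 1) → ℝ)} {f : (Fin (τ + 1) → ℝ) → ℝ}
  {g : ℕ → (Fin (τ + 1) → ℝ) → (Fin (τ + 1) → ℝ) → ℝ} {κ M : ℝ}

theorem map_shift {E : Type*} [MeasurableSpace E] {Y : ℕ → Ω → E} (hY : ∀ i, Measurable (Y i))
    (h : IsStationary P Y) (i k : ℕ) :
    P.map (fun ω => (Y i ω, Y (i + k) ω)) = P.map (fun ω => (Y 0 ω, Y k ω)) := by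
  have h1 := congrArg (Measure.map fun y : ℕ → E => (y 0, y k)) (h i)
  rw [Measure.map_map (by fun_prop) (measurable_pi_lambda _ fun s => hY _),
    Measure.map_map (by fun_prop) (measurable_pi_lambda _ fun s => hY _)] at h1
  simpa [Function.comp_def, add_comm] using h1

variable [IsProbabilityMeasure P] (S : MixingModel P τ X f g κ M)
include S

omit [IsProbabilityMeasure P] in
theorem map_eq (i : ℕ) : P.map (X i) = P.map (X 0) := by
  have h := congrArg (Measure.map Prod.fst) (map_shift S.meas S.stationary i 0)
  rwa [Measure.map_map measurable_fst ((S.meas i).prodMk (S.meas (i + 0))),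
    Measure.map_map measurable_fst ((S.meas 0).prodMk (S.meas 0))] at h

theorem isProbabilityMeasure_map : IsProbabilityMeasure (P.map (X 0)) :=
  Measure.isProbabilityMeasure_map (S.meas 0).aemeasurable

omit S in
theorem bddAbove_mixing {E : Type*} [MeasurableSpace E] (Y : ℕ → Ω → E) (k : ℕ) :
    BddAbove {r : ℝ | ∃ (t : ℕ) (A B : Set Ω),
      MeasurableSet[⨆ s ∈ Set.Iic t, MeasurableSpace.comap (Y s) inferInstance] A ∧
      MeasurableSet[⨆ s ∈ Set.Ici (t + k), MeasurableSpace.comap (Y s) inferInstance] B ∧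
      r = |P.real (A ∩ B) - P.real A * P.real B|} := by
  refine ⟨1, ?_⟩
  rintro r ⟨t, A, B, -, -, rfl⟩
  have h1 : P.real (A ∩ B) ≤ 1 := measureReal_le_one
  have h2 : P.real A ≤ 1 := measureReal_le_one
  have h3 : P.real B ≤ 1 := measureReal_le_one
  have h4 : 0 ≤ P.real (A ∩ B) := measureReal_nonneg
  have h5 : 0 ≤ P.real A := measureReal_nonneg
  have h6 : 0 ≤ P.real B := measureReal_nonneg
  rw [abs_le]
  constructor <;> nlinarith [mul_nonneg h5 h6, mul_le_one₀ h2 h6 h3]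

omit S in
theorem alphaMixing_nonneg {E : Type*} [MeasurableSpace E] (Y : ℕ → Ω → E) (k : ℕ) :
    0 ≤ alphaMixing P Y k := by
  refine le_csSup_of_le (bddAbove_mixing Y k) ⟨0, ∅, ∅, ?_, ?_, rfl⟩ (abs_nonneg _)
  · exact MeasurableSpace.measurableSet_empty _
  · exact MeasurableSpace.measurableSet_empty _

omit S in
-- A longer gap shrinks the σ-algebra of the future.
theorem alphaMixing_antitone {E : Type*} [MeasurableSpace E] (Y : ℕ → Ω → E) :
    Antitone (alphaMixing P Y) := by
  intro m n hmn
  refine csSup_le_csSup (bddAbove_mixing Y m) ⟨_, 0, ∅, ∅, ?_, ?_, rfl⟩ ?_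
  · exact MeasurableSpace.measurableSet_empty _
  · exact MeasurableSpace.measurableSet_empty _
  · rintro r ⟨t, A, B, hA, hB, rfl⟩
    refine ⟨t, A, B, hA, ?_, rfl⟩
    exact (biSup_mono fun s hs => (Ici_subset_Ici.2 (by omega) : Ici (t + n) ⊆ Ici (t + m)) hs :
      (⨆ s ∈ Set.Ici (t + n), MeasurableSpace.comap (Y s) inferInstance) ≤
        ⨆ s ∈ Set.Ici (t + m), MeasurableSpace.comap (Y s) inferInstance) B hB

omit S in
theorem abs_sub_le_alphaMixing {E : Type*} [MeasurableSpace E] (Y : ℕ → Ω → E) (k : ℕ)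
    {A B : Set E} (hA : MeasurableSet A) (hB : MeasurableSet B) :
    |P.real (Y 0 ⁻¹' A ∩ Y k ⁻¹' B) - P.real (Y 0 ⁻¹' A) * P.real (Y k ⁻¹' B)| ≤
      alphaMixing P Y k := by
  refine le_csSup (bddAbove_mixing Y k) ⟨0, _, _, ?_, ?_, rfl⟩
  · exact (le_biSup (fun s => MeasurableSpace.comap (Y s) inferInstance) (mem_Iic.2 le_rfl) :
      MeasurableSpace.comap (Y 0) inferInstance ≤ _) _ ⟨A, hA, rfl⟩
  · exact (le_biSup (fun s => MeasurableSpace.comap (Y s) inferInstance)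
      (show k ∈ Ici (0 + k) by simp) :
      MeasurableSpace.comap (Y k) inferInstance ≤ _) _ ⟨B, hB, rfl⟩

/-- The law of the pair of observations at lag `k`, against the product law. -/
theorem mixingPair (k : ℕ) : MixingPair (P.map fun ω => (X 0 ω, X k ω))
    ((P.map (X 0)).prod (P.map (X 0))) (P.map (X 0)) (alphaMixing P X k) := by
  have := S.isProbabilityMeasure_map
  have hm := (S.meas 0).prodMk (S.meas k)
  refine ⟨?_, ?_, ?_, ?_, fun A B hA hB => ?_⟩
  · rw [Measure.map_map measurable_fst hm]; rfl
  · rw [Measure.map_map measurable_snd hm]; exact S.map_eq k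
  · rw [Measure.map_fst_prod, measure_univ, one_smul]
  · rw [Measure.map_snd_prod, measure_univ, one_smul]
  · have e1 : (P.map (X 0)).real B = P.real (X k ⁻¹' B) := by
      rw [← S.map_eq k, map_measureReal_apply (S.meas k) hB]
    rw [map_measureReal_apply hm (hA.prod hB), measureReal_prod_prod, e1,
      map_measureReal_apply (S.meas 0) hA]
    exact abs_sub_le_alphaMixing X k hA hB

/-- Monotonicity of α turns summability into a rate: α(n)^(2κ) · n(n+1)/2 is at most the sum of
kα(k)^(2κ) over k ≤ n. -/
theorem exists_alphaMixing_le : ∃ A : ℝ, 0 < A ∧ ∀ k : ℕ, 1 ≤ k →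
    alphaMixing P X k ≤ A * (k : ℝ) ^ (-(1 / κ)) := by
  have hκ := S.pos
  set T := ∑' k : ℕ, (k : ℝ) * alphaMixing P X k ^ (2 * κ)
  have h0 : ∀ k : ℕ, 0 ≤ (k : ℝ) * alphaMixing P X k ^ (2 * κ) := fun k =>
    mul_nonneg k.cast_nonneg (Real.rpow_nonneg (alphaMixing_nonneg X k) _)
  have hT : 0 ≤ T := tsum_nonneg h0
  refine ⟨(2 * T + 1) ^ (1 / (2 * κ)), by positivity, fun n hn => ?_⟩
  have hn0 : (0 : ℝ) < n := by exact_mod_cast hn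
  have ha := alphaMixing_nonneg (P := P) X n
  have h1 : alphaMixing P X n ^ (2 * κ) * (n : ℝ) ^ 2 ≤ 2 * T + 1 := by
    have h2 := S.mix.sum_le_tsum (Finset.range (n + 1)) fun k _ => h0 k
    have h3 : ∑ k ∈ Finset.range (n + 1), (k : ℝ) * alphaMixing P X n ^ (2 * κ) ≤
        ∑ k ∈ Finset.range (n + 1), (k : ℝ) * alphaMixing P X k ^ (2 * κ) := by
      refine Finset.sum_le_sum fun k hk => ?_
      have : alphaMixing P X n ≤ alphaMixing P X k :=
        alphaMixing_antitone X (by simpa [Nat.lt_succ_iff] using hk)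
      gcongr
    have h4 : ∑ k ∈ Finset.range (n + 1), (k : ℝ) = n * (n + 1) / 2 := by
      clear * -
      induction n with
      | zero => simp
      | succ n ih => rw [Finset.sum_range_succ, ih]; push_cast; ring
    rw [← Finset.sum_mul, h4] at h3
    have h5 : 0 ≤ alphaMixing P X n ^ (2 * κ) := Real.rpow_nonneg ha _
    nlinarith
  have h6 : alphaMixing P X n ^ (2 * κ) ≤ (2 * T + 1) * (n : ℝ) ^ (-2 : ℝ) := by
    rw [Real.rpow_neg hn0.le, Real.rpow_two, ← div_eq_mul_inv, le_div_iff₀ (by positivity)]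
    exact h1
  have h7 := Real.rpow_le_rpow (Real.rpow_nonneg ha _) h6 (show 0 ≤ 1 / (2 * κ) by positivity)
  rw [← Real.rpow_mul ha, Real.mul_rpow (by positivity) (by positivity),
    ← Real.rpow_mul hn0.le] at h7
  have e1 : 2 * κ * (1 / (2 * κ)) = 1 := by field_simp
  have e2 : -2 * (1 / (2 * κ)) = -(1 / κ) := by field_simp
  rwa [e1, e2, Real.rpow_one] at h7

omit [IsProbabilityMeasure P] in
theorem aemeasurable_density : AEMeasurable f (orthantVolume τ) :=
  (measurable_cutoff S.smooth).aemeasurable.congr (cutoff_ae_eq f)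

omit [IsProbabilityMeasure P] in
theorem integral_map_eq (φ : (Fin (τ + 1) → ℝ) → ℝ) :
    ∫ s, φ s ∂P.map (X 0) = ∫ t, φ t * f t ∂orthantVolume τ := by
  rw [S.law, integral_withDensity_eq_integral_toReal_smul₀ S.aemeasurable_density.ennreal_ofReal
    (ae_of_all _ fun _ => ENNReal.ofReal_lt_top)]
  refine integral_congr_ae ?_
  filter_upwards [ae_mem_orthant τ] with x hx
  rw [ENNReal.toReal_ofReal (S.nonneg x hx), smul_eq_mul, mul_comm]

omit [IsProbabilityMeasure P] in
theorem integrable_map_iff {φ : (Fin (τ + 1) → ℝ) → ℝ} :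
    Integrable φ (P.map (X 0)) ↔ Integrable (fun t => φ t * f t) (orthantVolume τ) := by
  rw [S.law, integrable_withDensity_iff_integrable_smul₀' S.aemeasurable_density.ennreal_ofReal
    (ae_of_all _ fun _ => ENNReal.ofReal_lt_top)]
  refine integrable_congr ?_
  filter_upwards [ae_mem_orthant τ] with x hx
  rw [ENNReal.toReal_ofReal (S.nonneg x hx), smul_eq_mul, mul_comm]

omit [IsProbabilityMeasure P] in
theorem ae_map_mem_orthant : ∀ᵐ s ∂P.map (X 0), s ∈ orthant τ := by
  rw [S.law]
  exact (withDensity_absolutelyContinuous _ _).ae_le (ae_mem_orthant τ)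

theorem integrable_density : Integrable f (orthantVolume τ) := by
  have := S.isProbabilityMeasure_map
  have h := S.integrable_map_iff.1 (integrable_const (1 : ℝ))
  simpa using h

theorem integral_density : ∫ x, f x ∂orthantVolume τ = 1 := by
  have := S.isProbabilityMeasure_map
  have h := S.integral_map_eq fun _ => 1
  simpa using h.symm

end MixingModel

/-! ### The product kernel -/

section ProductKernel

variable {τ : ℕ} {b : ℝ}

theorem measurable_productKernel (hb : 0 < b) :
    Measurable (Function.uncurry fun x t : Fin (τ + 1) → ℝ => productKernel b x t) := by
  unfold productKernel Function.uncurry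
  refine Finset.measurable_fun_prod _ fun j _ => ?_
  have h1 : Measurable fun z : (Fin (τ + 1) → ℝ) × (Fin (τ + 1) → ℝ) => (z.1 j, z.2 j) := by fun_prop
  exact (measurable_gammaKernel hb).comp h1

theorem measurable_productKernel_right (hb : 0 < b) (x : Fin (τ + 1) → ℝ) :
    Measurable (productKernel b x) :=
  (measurable_productKernel hb).comp (measurable_const.prodMk measurable_id)

theorem productKernel_nonneg (hb : 0 < b) (x t : Fin (τ + 1) → ℝ) : 0 ≤ productKernel b x t :=
  Finset.prod_nonneg fun _ _ => gammaKernel_nonneg hb _ _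

/-- An upper bound for the product kernel at the point `x`. -/
noncomputable def kernelSup (b : ℝ) (x : Fin (τ + 1) → ℝ) : ℝ :=
  ∏ j, 1 / (b * √(shape (x j) b - 1))

theorem kernelSup_pos (hb : 0 < b) {x : Fin (τ + 1) → ℝ} (hx : x ∈ orthant τ) :
    0 < kernelSup b x := by
  refine Finset.prod_pos fun j _ => ?_
  have : 0 < √(shape (x j) b - 1) := Real.sqrt_pos.2 (sub_pos.2 (one_lt_shape hb (hx j)))
  positivity

theorem productKernel_le (hb : 0 < b) {x : Fin (τ + 1) → ℝ} (hx : x ∈ orthant τ)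
    (t : Fin (τ + 1) → ℝ) : productKernel b x t ≤ kernelSup b x :=
  Finset.prod_le_prod (fun _ _ => gammaKernel_nonneg hb _ _) fun j _ => gammaKernel_le hb (hx j) _

theorem integral_productKernel (hb : 0 < b) (x : Fin (τ + 1) → ℝ) :
    ∫ t, productKernel b x t ∂orthantVolume τ = 1 := by
  unfold productKernel
  rw [orthantVolume_eq_pi, integral_fintype_prod_eq_prod (fun j => gammaKernel (x j) b)]
  exact Finset.prod_eq_one fun j _ => integral_gammaKernel hb _

theorem integrable_productKernel (hb : 0 < b) (x : Fin (τ + 1) → ℝ) :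
    Integrable (productKernel b x) (orthantVolume τ) := by
  rw [orthantVolume_eq_pi]
  exact Integrable.fintype_prod (f := fun j => gammaKernel (x j) b)
    fun j => integrableOn_gammaKernel hb _

/-- K² is the kernel `sqKernel` divided by √(bt), and 12 is its column bound. -/
theorem integrableOn_gammaKernel_sq_left (hb : 0 < b) {t : ℝ} (ht : 0 < t) :
    IntegrableOn (fun x => gammaKernel x b t ^ 2) (Ioi 0) ∧
      ∫ x in Ioi 0, gammaKernel x b t ^ 2 ≤ 12 * (b * t) ^ (-(1 / 2) : ℝ) := by
  have hm : Measurable fun x => gammaKernel x b t :=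
    (measurable_gammaKernel hb).comp (measurable_id.prodMk measurable_const)
  have hs : 0 < √b * √t := mul_pos (Real.sqrt_pos.2 hb) (Real.sqrt_pos.2 ht)
  have e : ∀ x, gammaKernel x b t ^ 2 = (√b * √t)⁻¹ * sqKernel b x t := by
    intro x
    unfold sqKernel
    field_simp
  have hc : (√b * √t)⁻¹ = (b * t) ^ (-(1 / 2) : ℝ) := by
    rw [← Real.sqrt_mul hb.le, Real.sqrt_eq_rpow, ← Real.rpow_neg (by positivity)]
  have key : ∫⁻ x in Ioi 0, ENNReal.ofReal (gammaKernel x b t ^ 2) ≤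
      ENNReal.ofReal (12 * (b * t) ^ (-(1 / 2) : ℝ)) := by
    simp_rw [e, ENNReal.ofReal_mul (inv_pos.2 hs).le]
    rw [lintegral_const_mul' _ _ ENNReal.ofReal_ne_top, mul_comm 12,
      ENNReal.ofReal_mul (by positivity), hc]
    gcongr
    simpa using lintegral_sqKernel_left_le hb ht
  have hi : IntegrableOn (fun x => gammaKernel x b t ^ 2) (Ioi 0) :=
    (lintegral_ofReal_ne_top_iff_integrable (hm.pow_const 2).aestronglyMeasurable
      (ae_of_all _ fun x => sq_nonneg _)).1 (key.trans_lt ENNReal.ofReal_lt_top).ne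
  refine ⟨hi, ?_⟩
  rw [← ofReal_integral_eq_lintegral_ofReal hi (ae_of_all _ fun x => sq_nonneg _)] at key
  exact (ENNReal.ofReal_le_ofReal_iff (by positivity)).1 key

/-- A bound for the integral of the squared product kernel over the points `x`. -/
noncomputable def kernelEnergy (b : ℝ) (t : Fin (τ + 1) → ℝ) : ℝ :=
  ∏ j, (12 * (b * t j) ^ (-(1 / 2) : ℝ))

theorem kernelEnergy_pos (hb : 0 < b) {t : Fin (τ + 1) → ℝ} (ht : t ∈ orthant τ) :
    0 < kernelEnergy b t :=
  Finset.prod_pos fun j _ => by have := ht j; positivity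

theorem memLp_productKernel_left (hb : 0 < b) {t : Fin (τ + 1) → ℝ} (ht : t ∈ orthant τ) :
    MemLp (fun x => productKernel b x t) 2 (orthantVolume τ) ∧
      ∫ x, productKernel b x t ^ 2 ∂orthantVolume τ ≤ kernelEnergy b t := by
  have hm : Measurable fun x => productKernel b x t :=
    (measurable_productKernel hb).comp (measurable_id.prodMk measurable_const)
  have e : ∀ x : Fin (τ + 1) → ℝ, productKernel b x t ^ 2 = ∏ j, gammaKernel (x j) b (t j) ^ 2 :=
    fun x => (Finset.prod_pow _ _ _).symm
  constructor
  · rw [memLp_two_iff_integrable_sq hm.aestronglyMeasurable]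
    simp_rw [e]
    rw [orthantVolume_eq_pi]
    exact Integrable.fintype_prod (f := fun j x => gammaKernel x b (t j) ^ 2)
      fun j => (integrableOn_gammaKernel_sq_left hb (ht j)).1
  · simp_rw [e]
    rw [orthantVolume_eq_pi, integral_fintype_prod_eq_prod (fun j x => gammaKernel x b (t j) ^ 2)]
    exact Finset.prod_le_prod (fun j _ => integral_nonneg fun _ => sq_nonneg _)
      fun j _ => (integrableOn_gammaKernel_sq_left hb (ht j)).2

/-- For q = 1 + 2κ the weights become x_j^(-(κ+1/2)), those of the moment hypothesis; for q = 1 they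
are those of `weightedDensity`. -/
theorem kernelEnergy_rpow (hb : 0 < b) {t : Fin (τ + 1) → ℝ} (ht : t ∈ orthant τ) (q : ℝ) :
    kernelEnergy b t ^ q = (12 * b ^ (-(1 / 2) : ℝ)) ^ (q * (τ + 1)) * ∏ j, t j ^ (-(q / 2)) := by
  have hb2 : 0 < 12 * b ^ (-(1 / 2) : ℝ) := by positivity
  unfold kernelEnergy
  rw [← Real.finsetProd_rpow _ _ fun j _ => by have := (ht j).le; positivity]
  have : ∀ j, (12 * (b * t j) ^ (-(1 / 2) : ℝ)) ^ q =
      (12 * b ^ (-(1 / 2) : ℝ)) ^ q * t j ^ (-(q / 2)) := by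
    intro j
    rw [Real.mul_rpow hb.le (ht j).le, ← mul_assoc, Real.mul_rpow hb2.le (by have := (ht j).le; positivity),
      ← Real.rpow_mul (ht j).le]
    congr 2
    ring
  simp_rw [this]
  rw [Finset.prod_mul_distrib, Finset.prod_const, Finset.card_univ, Fintype.card_fin,
    Real.rpow_mul hb2.le]
  congr 1
  rw [← Real.rpow_natCast]
  push_cast
  rfl

end ProductKernel

/-! ### Moments of the kernel -/

section Moments

variable {τ : ℕ} {f : (Fin (τ + 1) → ℝ) → ℝ}

/-- The mean of the kernel at the point `x` under the law `ν`. -/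
noncomputable def kernelMean (ν : Measure (Fin (τ + 1) → ℝ)) (b : ℝ) (x : Fin (τ + 1) → ℝ) : ℝ :=
  ∫ s, productKernel b x s ∂ν

/-- The second moment of the kernel at the point `x` under the law `ν`. -/
noncomputable def kernelSq (ν : Measure (Fin (τ + 1) → ℝ)) (b : ℝ) (x : Fin (τ + 1) → ℝ) : ℝ :=
  ∫ s, productKernel b x s ^ 2 ∂ν

/-- The mixed moment of the kernel at the point `x` under the law `π` of a pair. -/
noncomputable def kernelPair (π : Measure ((Fin (τ + 1) → ℝ) × (Fin (τ + 1) → ℝ))) (b : ℝ)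
    (x : Fin (τ + 1) → ℝ) : ℝ :=
  ∫ z, productKernel b x z.1 * productKernel b x z.2 ∂π

/-- The density weighted by `∏ x_j^(-1/2)`, set to `0` outside the orthant. -/
noncomputable def weightedDensity (f : (Fin (τ + 1) → ℝ) → ℝ) : (Fin (τ + 1) → ℝ) → ℝ :=
  cutoff fun x => (∏ j, x j ^ (-(1 / 2) : ℝ)) * f x

theorem measurable_weightedDensity (hf : ContDiffOn ℝ 2 f (orthant τ)) :
    Measurable (weightedDensity f) := by
  refine measurable_indicator_of_continuousOn (ContinuousOn.mul ?_ hf.continuousOn)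
  exact continuousOn_finsetProd _ fun j _ =>
    (continuous_apply j).continuousOn.rpow_const fun x hx => Or.inl (hx j).ne'

theorem weightedDensity_nonneg (hf0 : ∀ x ∈ orthant τ, 0 ≤ f x) (x : Fin (τ + 1) → ℝ) :
    0 ≤ weightedDensity f x := by
  unfold weightedDensity cutoff
  refine indicator_nonneg (fun x hx => mul_nonneg (Finset.prod_nonneg fun j _ => ?_) (hf0 x hx)) x
  exact Real.rpow_nonneg (hx j).le _

theorem cutoff_nonneg (hf0 : ∀ x ∈ orthant τ, 0 ≤ f x) (x : Fin (τ + 1) → ℝ) : 0 ≤ cutoff f x :=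
  indicator_nonneg hf0 x

/-- With y = ∏ x_j⁻¹ one has y^(1/2) ≤ 1 + y^(κ+1/2), by separating y ≤ 1 and y ≥ 1. -/
theorem integrable_weightedDensity (hf : ContDiffOn ℝ 2 f (orthant τ))
    (hfi : Integrable f (orthantVolume τ)) {κ : ℝ} (hκ : 0 < κ)
    (hm : Integrable (fun x => (∏ j, x j ^ (-(κ + 1 / 2))) * f x) (orthantVolume τ)) :
    Integrable (weightedDensity f) (orthantVolume τ) := by
  refine Integrable.mono' (hfi.norm.add hm.norm)
    (measurable_weightedDensity hf).aestronglyMeasurable ?_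
  filter_upwards [ae_mem_orthant τ] with x hx
  rw [weightedDensity, cutoff, indicator_of_mem hx, Pi.add_apply, norm_mul, norm_mul, ← one_add_mul]
  gcongr
  have h1 : ∀ q : ℝ, ∏ j, x j ^ (-q) = (∏ j, (x j)⁻¹) ^ q := by
    intro q
    rw [← Real.finsetProd_rpow _ _ fun j _ => (inv_pos.2 (hx j)).le]
    refine Finset.prod_congr rfl fun j _ => ?_
    rw [Real.inv_rpow (hx j).le, Real.rpow_neg (hx j).le]
  have hy : 0 < ∏ j, (x j)⁻¹ := Finset.prod_pos fun j _ => inv_pos.2 (hx j)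
  rw [h1, h1, Real.norm_of_nonneg (by positivity), Real.norm_of_nonneg (by positivity)]
  rcases le_total (∏ j, (x j)⁻¹) 1 with h | h
  · have := Real.rpow_le_one hy.le h (show (0 : ℝ) ≤ 1 / 2 by norm_num)
    have h2 : 0 ≤ (∏ j, (x j)⁻¹) ^ (κ + 1 / 2) := by positivity
    linarith
  · have := Real.rpow_le_rpow_of_exponent_le h (show (1 / 2 : ℝ) ≤ κ + 1 / 2 by linarith)
    linarith

theorem integral_weightedDensity (f : (Fin (τ + 1) → ℝ) → ℝ) :
    ∫ x, (1 / (2 * √Real.pi)) ^ (τ + 1) * weightedDensity f x ∂orthantVolume τ =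
      varianceConst f := by
  rw [varianceConst]
  refine integral_congr_ae ?_
  filter_upwards [ae_mem_orthant τ] with x hx
  rw [weightedDensity, cutoff, indicator_of_mem hx, ← mul_assoc]
  congr 1
  rw [Finset.prod_div_distrib, Finset.prod_const, Finset.card_univ, Fintype.card_fin, one_div,
    inv_pow]
  field_simp

end Moments

namespace MixingModel

variable {Ω : Type*} [MeasurableSpace Ω] {P : Measure Ω} {τ : ℕ}
  {X : ℕ → Ω → (Fin (τ + 1) → ℝ)} {f : (Fin (τ + 1) → ℝ) → ℝ}
  {g : ℕ → (Fin (τ + 1) → ℝ) → (Fin (τ + 1) → ℝ) → ℝ} {κ M : ℝ}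
  [IsProbabilityMeasure P] (S : MixingModel P τ X f g κ M) {b : ℝ}
include S

omit [IsProbabilityMeasure P] in
theorem kernelMean_ae_eq (hb : 0 < b) :
    kernelMean (P.map (X 0)) b =ᵐ[orthantVolume τ] smoothed f b := by
  have h := ofReal_iterOp_finRange (kernelBound_gammaKernel hb) (fun x t => gammaKernel_nonneg hb x t)
    (measurable_cutoff S.smooth) (cutoff_nonneg S.nonneg) one_le_two ENNReal.ofNat_ne_top
    (S.memLp.ae_eq (cutoff_ae_eq f).symm)
  filter_upwards [h, ae_mem_orthant τ] with x hx hxo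
  have h0 : 0 ≤ smoothed f b x :=
    iterOp_nonneg (fun x t => gammaKernel_nonneg hb x t) (cutoff_nonneg S.nonneg) _ x
  have hn : ∀ t, 0 ≤ productKernel b x t * cutoff f t := fun t =>
    mul_nonneg (productKernel_nonneg hb x t) (cutoff_nonneg S.nonneg t)
  rw [kernelMean, S.integral_map_eq, ← ENNReal.toReal_ofReal h0, smoothed, hx,
    integral_congr_ae (g := fun t => productKernel b x t * cutoff f t),
    integral_eq_lintegral_of_nonneg_ae (ae_of_all _ hn)]
  · rfl
  · exact ((measurable_productKernel_right hb x).mul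
      (measurable_cutoff S.smooth)).aestronglyMeasurable
  · filter_upwards [cutoff_ae_eq f] with t ht
    rw [ht]

theorem integrable_weight : Integrable (weightedDensity f) (orthantVolume τ) :=
  integrable_weightedDensity S.smooth S.integrable_density S.pos S.moment

/-- Each coordinate receives one factor √b √t_j, and the weights t_j^(-1/2) of `weightedDensity`
cancel the √t_j. The scaled second moment thus becomes an iterated approximate identity acting on an
L¹ function. -/
theorem kernelSq_ae_eq (hb : 0 < b) :
    (fun x => √b ^ (τ + 1) * kernelSq (P.map (X 0)) b x) =ᵐ[orthantVolume τ]
      iterOp (sqKernel b) (List.finRange (τ + 1)) (weightedDensity f) := by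
  have h := ofReal_iterOp_finRange (kernelBound_sqKernel hb) (fun x t => sqKernel_nonneg b x t)
    (measurable_weightedDensity S.smooth) (weightedDensity_nonneg S.nonneg) le_rfl
    ENNReal.one_ne_top (memLp_one_iff_integrable.2 S.integrable_weight)
  filter_upwards [h, ae_mem_orthant τ] with x hx hxo
  have h0 : 0 ≤ iterOp (sqKernel b) (List.finRange (τ + 1)) (weightedDensity f) x :=
    iterOp_nonneg (fun x t => sqKernel_nonneg b x t) (weightedDensity_nonneg S.nonneg) _ x
  have hn : ∀ t, 0 ≤ (∏ j, sqKernel b (x j) (t j)) * weightedDensity f t := fun t =>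
    mul_nonneg (Finset.prod_nonneg fun j _ => sqKernel_nonneg _ _ _)
      (weightedDensity_nonneg S.nonneg t)
  rw [kernelSq, S.integral_map_eq, ← integral_const_mul, ← ENNReal.toReal_ofReal h0, hx,
    integral_congr_ae (g := fun t => (∏ j, sqKernel b (x j) (t j)) * weightedDensity f t),
    integral_eq_lintegral_of_nonneg_ae (ae_of_all _ hn)]
  · refine Measurable.aestronglyMeasurable (Measurable.mul ?_ (measurable_weightedDensity S.smooth))
    refine Finset.measurable_prod _ fun j _ => ?_
    have h1 : Measurable fun z : (Fin (τ + 1) → ℝ) => (x j, z j) := by fun_prop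
    exact (measurable_sqKernel hb).comp h1
  · filter_upwards [ae_mem_orthant τ] with t ht
    rw [weightedDensity, cutoff, indicator_of_mem ht, productKernel, ← mul_assoc, ← mul_assoc,
      ← Finset.prod_mul_distrib, ← Finset.prod_pow]
    congr 1
    have : √b ^ (τ + 1) = ∏ _j : Fin (τ + 1), √b := by simp
    rw [this, ← Finset.prod_mul_distrib]
    refine Finset.prod_congr rfl fun j _ => ?_
    have e : √(t j) * t j ^ (-(1 / 2) : ℝ) = 1 := by
      rw [Real.sqrt_eq_rpow, ← Real.rpow_add (ht j)]; norm_num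
    rw [sqKernel, mul_assoc, e, mul_one]

theorem tendsto_kernelSq : Tendsto (fun b => eLpNorm
    ((fun x => √b ^ (τ + 1) * kernelSq (P.map (X 0)) b x) -
      fun x => (1 / (2 * √Real.pi)) ^ (τ + 1) * weightedDensity f x) 1 (orthantVolume τ))
    (𝓝[>] 0) (𝓝 0) := by
  have := isApproxIdentity_sqKernel.tendsto_iterOp le_rfl ENNReal.one_ne_top
    (measurable_weightedDensity S.smooth) (memLp_one_iff_integrable.2 S.integrable_weight)
    (List.finRange (τ + 1))
  rw [List.length_finRange] at this
  refine this.congr' ?_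
  filter_upwards [eventually_mem_nhdsWithin] with b hb
  exact eLpNorm_congr_ae ((S.kernelSq_ae_eq hb).symm.sub (ae_eq_refl _))

theorem integrable_kernelSq (hb : 0 < b) :
    Integrable (kernelSq (P.map (X 0)) b) (orthantVolume τ) := by
  have h1 := (memLp_one_iff_integrable.1 (memLp_iterOp (kernelBound_sqKernel hb)
    (measurable_weightedDensity S.smooth) le_rfl ENNReal.one_ne_top
    (memLp_one_iff_integrable.2 S.integrable_weight) (List.finRange (τ + 1)))).congr
    (S.kernelSq_ae_eq hb).symm
  have h2 := h1.const_mul (√b ^ (τ + 1))⁻¹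
  refine h2.congr (ae_of_all _ fun x => ?_)
  have : √b ^ (τ + 1) ≠ 0 := pow_ne_zero _ (Real.sqrt_pos.2 hb).ne'
  field_simp

omit [IsProbabilityMeasure P] in
theorem memLp_kernelMean (hb : 0 < b) :
    MemLp (kernelMean (P.map (X 0)) b) 2 (orthantVolume τ) :=
  (memLp_smoothed S.smooth S.memLp hb).ae_eq (S.kernelMean_ae_eq hb).symm

end MixingModel

/-! ### Covariances at a given lag -/

/-- The covariance of the kernel at the point `x`, at lag `k`. -/
noncomputable def lagCov {Ω : Type*} [MeasurableSpace Ω] {τ : ℕ} (P : Measure Ω)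
    (X : ℕ → Ω → (Fin (τ + 1) → ℝ)) (b : ℝ) (k : ℕ) (x : Fin (τ + 1) → ℝ) : ℝ :=
  kernelPair (P.map fun ω => (X 0 ω, X k ω)) b x - kernelMean (P.map (X 0)) b x ^ 2

section Measurability

variable {τ : ℕ} {b : ℝ}

theorem measurable_kernelMean (hb : 0 < b) (ν : Measure (Fin (τ + 1) → ℝ)) [SFinite ν] :
    Measurable (kernelMean ν b) :=
  (measurable_productKernel hb).stronglyMeasurable.integral_prod_right'.measurable

theorem measurable_kernelPair (hb : 0 < b) (π : Measure ((Fin (τ + 1) → ℝ) × (Fin (τ + 1) → ℝ)))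
    [SFinite π] : Measurable (kernelPair π b) := by
  have hm : Measurable fun q : (Fin (τ + 1) → ℝ) × ((Fin (τ + 1) → ℝ) × (Fin (τ + 1) → ℝ)) =>
      productKernel b q.1 q.2.1 * productKernel b q.1 q.2.2 :=
    ((measurable_productKernel hb).comp
      (measurable_fst.prodMk (measurable_fst.comp measurable_snd))).mul
    ((measurable_productKernel hb).comp
      (measurable_fst.prodMk (measurable_snd.comp measurable_snd)))
  exact hm.stronglyMeasurable.integral_prod_right'.measurable

theorem memLp_productKernel (hb : 0 < b) {x : Fin (τ + 1) → ℝ} (hx : x ∈ orthant τ)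
    (ν : Measure (Fin (τ + 1) → ℝ)) [IsFiniteMeasure ν] (p : ℝ≥0∞) :
    MemLp (productKernel b x) p ν :=
  MemLp.of_bound (measurable_productKernel_right hb x).aestronglyMeasurable (kernelSup b x)
    (ae_of_all _ fun t => by
      rw [Real.norm_of_nonneg (productKernel_nonneg hb x t)]; exact productKernel_le hb hx t)

theorem kernelPair_nonneg (hb : 0 < b) (π : Measure ((Fin (τ + 1) → ℝ) × (Fin (τ + 1) → ℝ)))
    (x : Fin (τ + 1) → ℝ) : 0 ≤ kernelPair π b x :=
  integral_nonneg fun _ => mul_nonneg (productKernel_nonneg hb _ _) (productKernel_nonneg hb _ _)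

theorem kernelMean_nonneg (hb : 0 < b) (ν : Measure (Fin (τ + 1) → ℝ)) (x : Fin (τ + 1) → ℝ) :
    0 ≤ kernelMean ν b x :=
  integral_nonneg fun _ => productKernel_nonneg hb _ _

theorem sq_kernelMean_le (hb : 0 < b) {x : Fin (τ + 1) → ℝ} (hx : x ∈ orthant τ)
    (ν : Measure (Fin (τ + 1) → ℝ)) [IsProbabilityMeasure ν] :
    kernelMean ν b x ^ 2 ≤ kernelSq ν b x := by
  have h := variance_eq_sub (memLp_productKernel hb hx ν 2)
  have h2 := variance_nonneg (productKernel b x) ν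
  rw [h] at h2
  simpa [kernelMean, kernelSq] using h2

theorem kernelPair_le (hb : 0 < b) {x : Fin (τ + 1) → ℝ} (hx : x ∈ orthant τ)
    {ν : Measure (Fin (τ + 1) → ℝ)} [IsFiniteMeasure ν]
    {π : Measure ((Fin (τ + 1) → ℝ) × (Fin (τ + 1) → ℝ))} (hf : π.map Prod.fst = ν)
    (hs : π.map Prod.snd = ν) : kernelPair π b x ≤ kernelSq ν b x := by
  have hi := (memLp_productKernel hb hx ν 2).integrable_sq
  have hm := (measurable_productKernel_right hb x).pow_const 2
  calc kernelPair π b x ≤ ∫ z, (1 / 2 * productKernel b x z.1 ^ 2 +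
        1 / 2 * productKernel b x z.2 ^ 2) ∂π := by
        refine integral_mono_of_nonneg (ae_of_all _ fun z => mul_nonneg (productKernel_nonneg hb _ _)
          (productKernel_nonneg hb _ _)) (((integrable_comp_fst hf hi).const_mul _).add
          ((integrable_comp_snd hs hi).const_mul _)) (ae_of_all _ fun z => ?_)
        nlinarith [sq_nonneg (productKernel b x z.1 - productKernel b x z.2)]
    _ = kernelSq ν b x := by
        rw [integral_add ((integrable_comp_fst hf hi).const_mul _)
          ((integrable_comp_snd hs hi).const_mul _), integral_const_mul, integral_const_mul,
          integral_comp_fst hf hm, integral_comp_snd hs hm, kernelSq]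
        ring

end Measurability

namespace MixingModel

variable {Ω : Type*} [MeasurableSpace Ω] {P : Measure Ω} {τ : ℕ}
  {X : ℕ → Ω → (Fin (τ + 1) → ℝ)} {f : (Fin (τ + 1) → ℝ) → ℝ}
  {g : ℕ → (Fin (τ + 1) → ℝ) → (Fin (τ + 1) → ℝ) → ℝ} {κ M : ℝ}
  [IsProbabilityMeasure P] (S : MixingModel P τ X f g κ M) {b : ℝ}
include S

theorem measurable_lagCov (hb : 0 < b) (k : ℕ) : Measurable (lagCov P X b k) := by
  have := S.isProbabilityMeasure_map
  have : IsProbabilityMeasure (P.map fun ω => (X 0 ω, X k ω)) :=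
    Measure.isProbabilityMeasure_map ((S.meas 0).prodMk (S.meas k)).aemeasurable
  exact (measurable_kernelPair hb _).sub ((measurable_kernelMean hb _).pow_const 2)

/-- The mixed moment and the squared mean both lie between 0 and the second moment. -/
theorem abs_lagCov_le_kernelSq (hb : 0 < b) (k : ℕ) {x : Fin (τ + 1) → ℝ} (hx : x ∈ orthant τ) :
    |lagCov P X b k x| ≤ kernelSq (P.map (X 0)) b x := by
  have := S.isProbabilityMeasure_map
  have h := S.mixingPair k
  have h1 := kernelPair_le hb hx h.fst₁ h.snd₁
  have h2 := kernelPair_nonneg hb (P.map fun ω => (X 0 ω, X k ω)) x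
  have h3 := sq_kernelMean_le hb hx (P.map (X 0))
  have h4 := sq_nonneg (kernelMean (P.map (X 0)) b x)
  rw [lagCov, abs_le]
  constructor <;> linarith

theorem integrable_lagCov (hb : 0 < b) (k : ℕ) :
    Integrable (lagCov P X b k) (orthantVolume τ) := by
  refine (S.integrable_kernelSq hb).mono' (S.measurable_lagCov hb k).aestronglyMeasurable ?_
  filter_upwards [ae_mem_orthant τ] with x hx
  exact S.abs_lagCov_le_kernelSq hb k hx

theorem abs_lagCov_le_mixing (hb : 0 < b) (k : ℕ) {x : Fin (τ + 1) → ℝ} (hx : x ∈ orthant τ) :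
    |lagCov P X b k x| ≤ kernelSup b x ^ 2 * alphaMixing P X k := by
  have := S.isProbabilityMeasure_map
  have h := (S.mixingPair k).abs_sub_le_of_le (measurable_productKernel_right hb x)
    (kernelSup_pos hb hx) (productKernel_nonneg hb x) (productKernel_le hb hx)
  rwa [integral_prod_mul, ← sq] at h

/-- The product kernel is a probability density in its second argument, so a uniform bound on the
joint density minus the product density passes to the covariance without any power of b. -/
theorem abs_lagCov_le_const (hb : 0 < b) {k : ℕ} (hk : 1 ≤ k) {x : Fin (τ + 1) → ℝ}
    (hx : x ∈ orthant τ) : |lagCov P X b k x| ≤ M := by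
  set μ := orthantVolume τ
  have hν := S.isProbabilityMeasure_map
  have hπ : IsProbabilityMeasure (P.map fun ω => (X 0 ω, X k ω)) :=
    Measure.isProbabilityMeasure_map ((S.meas 0).prodMk (S.meas k)).aemeasurable
  have hKm := measurable_productKernel_right hb x
  have hKK : Measurable fun z : (Fin (τ + 1) → ℝ) × (Fin (τ + 1) → ℝ) =>
      productKernel b x z.1 * productKernel b x z.2 :=
    (hKm.comp measurable_fst).mul (hKm.comp measurable_snd)
  have hgm : Measurable fun p : (Fin (τ + 1) → ℝ) × (Fin (τ + 1) → ℝ) => g k p.1 p.2 :=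
    S.joint_meas k hk
  have hae : ∀ᵐ z ∂μ.prod μ, z.1 ∈ orthant τ ∧ z.2 ∈ orthant τ :=
    (Measure.quasiMeasurePreserving_fst.ae (ae_mem_orthant τ)).and
      (Measure.quasiMeasurePreserving_snd.ae (ae_mem_orthant τ))
  have e1 : kernelPair (P.map fun ω => (X 0 ω, X k ω)) b x =
      ∫ z, productKernel b x z.1 * productKernel b x z.2 * g k z.1 z.2 ∂μ.prod μ := by
    rw [kernelPair, S.joint_law k hk, integral_withDensity_eq_integral_toReal_smul
      hgm.ennreal_ofReal (ae_of_all _ fun _ => ENNReal.ofReal_lt_top)]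
    refine integral_congr_ae ?_
    filter_upwards [hae] with z hz
    rw [ENNReal.toReal_ofReal (S.joint_nonneg k hk _ hz.1 _ hz.2), smul_eq_mul, mul_comm]
  have i1 : Integrable (fun z : (Fin (τ + 1) → ℝ) × (Fin (τ + 1) → ℝ) =>
      productKernel b x z.1 * productKernel b x z.2 * g k z.1 z.2) (μ.prod μ) := by
    have h1 : Integrable (fun z : (Fin (τ + 1) → ℝ) × (Fin (τ + 1) → ℝ) =>
        productKernel b x z.1 * productKernel b x z.2) (P.map fun ω => (X 0 ω, X k ω)) := by
      refine Integrable.of_bound hKK.aestronglyMeasurable (kernelSup b x * kernelSup b x)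
        (ae_of_all _ fun z => ?_)
      rw [Real.norm_of_nonneg (mul_nonneg (productKernel_nonneg hb _ _)
        (productKernel_nonneg hb _ _))]
      exact mul_le_mul (productKernel_le hb hx _) (productKernel_le hb hx _)
        (productKernel_nonneg hb _ _) (kernelSup_pos hb hx).le
    rw [S.joint_law k hk, integrable_withDensity_iff_integrable_smul' hgm.ennreal_ofReal
      (ae_of_all _ fun _ => ENNReal.ofReal_lt_top)] at h1
    refine h1.congr ?_
    filter_upwards [hae] with z hz
    rw [ENNReal.toReal_ofReal (S.joint_nonneg k hk _ hz.1 _ hz.2), smul_eq_mul, mul_comm]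
  have i2 : Integrable (fun z : (Fin (τ + 1) → ℝ) × (Fin (τ + 1) → ℝ) =>
      (productKernel b x z.1 * f z.1) * (productKernel b x z.2 * f z.2)) (μ.prod μ) := by
    have h1 := S.integrable_map_iff.1 ((memLp_productKernel hb hx (P.map (X 0)) 1).integrable le_rfl)
    exact h1.mul_prod h1
  have i3 : Integrable (fun z : (Fin (τ + 1) → ℝ) × (Fin (τ + 1) → ℝ) =>
      productKernel b x z.1 * productKernel b x z.2 * M) (μ.prod μ) :=
    ((integrable_productKernel hb x).mul_prod (integrable_productKernel hb x)).mul_const M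
  have e2 : kernelMean (P.map (X 0)) b x ^ 2 = ∫ z, (productKernel b x z.1 * f z.1) *
      (productKernel b x z.2 * f z.2) ∂μ.prod μ := by
    rw [integral_prod_mul (fun s => productKernel b x s * f s) (fun s => productKernel b x s * f s),
      kernelMean, S.integral_map_eq, sq]
  have e3 : ∫ z, productKernel b x z.1 * productKernel b x z.2 * M ∂μ.prod μ = M := by
    rw [integral_mul_const, integral_prod_mul, integral_productKernel hb, one_mul, one_mul]
  rw [lagCov, e1, e2, ← integral_sub i1 i2, ← Real.norm_eq_abs]
  refine (norm_integral_le_of_norm_le i3 ?_).trans_eq e3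
  filter_upwards [hae] with z hz
  have h1 := S.joint_bound k hk _ hz.1 _ hz.2
  have hn := mul_nonneg (productKernel_nonneg hb x z.1) (productKernel_nonneg hb x z.2)
  have e4 : productKernel b x z.1 * productKernel b x z.2 * g k z.1 z.2 -
      productKernel b x z.1 * f z.1 * (productKernel b x z.2 * f z.2) =
      productKernel b x z.1 * productKernel b x z.2 * (g k z.1 z.2 - f z.1 * f z.2) := by ring
  rw [e4, norm_mul, Real.norm_of_nonneg hn]
  gcongr
  exact h1

/-- The integrated covariance at a fixed lag is negligible against the variance. -/
theorem tendsto_integral_lagCov {k : ℕ} (hk : 1 ≤ k) :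
    Tendsto (fun b => √b ^ (τ + 1) * |∫ x, lagCov P X b k x ∂orthantVolume τ|) (𝓝[>] 0) (𝓝 0) := by
  set c : ℝ := (1 / (2 * √Real.pi)) ^ (τ + 1)
  set w := weightedDensity f
  have hc : 0 ≤ c := by positivity
  have hwi : Integrable (fun x => c * w x) (orthantVolume τ) := S.integrable_weight.const_mul c
  have hw0 : ∀ x, 0 ≤ c * w x := fun x => mul_nonneg hc (weightedDensity_nonneg S.nonneg x)
  have hwm : Measurable w := measurable_weightedDensity S.smooth
  have hpow : Tendsto (fun b : ℝ => √b ^ (τ + 1)) (𝓝[>] 0) (𝓝 0) := by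
    have : Continuous fun b : ℝ => √b ^ (τ + 1) := by fun_prop
    have h := this.tendsto 0
    simp only [Real.sqrt_zero, ne_eq, Nat.add_eq_zero_iff, one_ne_zero, and_false,
      not_false_eq_true, zero_pow] at h
    exact h.mono_left nhdsWithin_le_nhds
  -- The scaled covariance is at most b^(d/2)M and at most the scaled second moment. Replacing the
  -- latter by its limit costs an L¹ distance that tends to 0; the minimum that remains is dominated
  -- by the limit and tends pointwise to 0.
  have hmin : Tendsto (fun b => ∫ x, min (√b ^ (τ + 1) * |M|) (c * w x) ∂orthantVolume τ) (𝓝[>] 0)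
      (𝓝 0) := by
    have := tendsto_integral_filter_of_dominated_convergence (μ := orthantVolume τ)
      (l := 𝓝[>] (0 : ℝ)) (F := fun b x => min (√b ^ (τ + 1) * |M|) (c * w x)) (f := fun _ => 0)
      (fun x => c * w x) (Eventually.of_forall fun b =>
        (measurable_const.min (hwm.const_mul c)).aestronglyMeasurable)
      (Eventually.of_forall fun b => ae_of_all _ fun x => by
        rw [Real.norm_of_nonneg (le_min (by positivity) (hw0 x))]; exact min_le_right _ _)
      hwi (ae_of_all _ fun x => by
        have h := (hpow.mul_const |M|).min (tendsto_const_nhds (x := c * w x))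
        rwa [zero_mul, min_eq_left (hw0 x)] at h)
    simpa using this
  have hL := (ENNReal.tendsto_toReal ENNReal.zero_ne_top).comp S.tendsto_kernelSq
  have hsum := hL.add hmin
  simp only [ENNReal.toReal_zero, add_zero] at hsum
  refine squeeze_zero' ?_ ?_ hsum
  · filter_upwards with b using by positivity
  · filter_upwards [eventually_mem_nhdsWithin] with b hb
    have hb0 : 0 < b := hb
    have hD : Integrable (fun x => √b ^ (τ + 1) * kernelSq (P.map (X 0)) b x - c * w x)
        (orthantVolume τ) := ((S.integrable_kernelSq hb0).const_mul _).sub hwi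
    have hmi : Integrable (fun x => min (√b ^ (τ + 1) * |M|) (c * w x)) (orthantVolume τ) := by
      refine hwi.mono' (measurable_const.min (hwm.const_mul c)).aestronglyMeasurable
        (ae_of_all _ fun x => ?_)
      rw [Real.norm_of_nonneg (le_min (by positivity) (hw0 x))]
      exact min_le_right _ _
    have e : (eLpNorm ((fun x => √b ^ (τ + 1) * kernelSq (P.map (X 0)) b x) -
        fun x => c * w x) 1 (orthantVolume τ)).toReal =
        ∫ x, ‖√b ^ (τ + 1) * kernelSq (P.map (X 0)) b x - c * w x‖ ∂orthantVolume τ := by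
      rw [eLpNorm_one_eq_lintegral_enorm, integral_norm_eq_lintegral_enorm hD.1]
      rfl
    rw [Function.comp, e, ← integral_add hD.norm hmi]
    have e2 : √b ^ (τ + 1) * |∫ x, lagCov P X b k x ∂orthantVolume τ| =
        ‖∫ x, √b ^ (τ + 1) * lagCov P X b k x ∂orthantVolume τ‖ := by
      rw [integral_const_mul, norm_mul, Real.norm_of_nonneg (by positivity), Real.norm_eq_abs]
    rw [e2]
    refine norm_integral_le_of_norm_le (hD.norm.add hmi) ?_
    filter_upwards [ae_mem_orthant τ] with x hx
    rw [norm_mul, Real.norm_of_nonneg (by positivity), Real.norm_eq_abs, Real.norm_eq_abs]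
    have h1 : √b ^ (τ + 1) * |lagCov P X b k x| ≤ √b ^ (τ + 1) * |M| :=
      mul_le_mul_of_nonneg_left ((S.abs_lagCov_le_const hb0 hk hx).trans (le_abs_self M))
        (by positivity)
    have h2 : √b ^ (τ + 1) * |lagCov P X b k x| ≤ √b ^ (τ + 1) * kernelSq (P.map (X 0)) b x := by
      gcongr
      exact S.abs_lagCov_le_kernelSq hb0 k hx
    have h3 := le_abs_self (√b ^ (τ + 1) * kernelSq (P.map (X 0)) b x - c * w x)
    have h4 := abs_nonneg (√b ^ (τ + 1) * kernelSq (P.map (X 0)) b x - c * w x)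
    rcases le_total (√b ^ (τ + 1) * |M|) (c * w x) with h | h
    · rw [min_eq_left h]; linarith
    · rw [min_eq_right h]; linarith

theorem integrable_kernelEnergy (hb : 0 < b) : Integrable (kernelEnergy b) (P.map (X 0)) := by
  rw [S.integrable_map_iff]
  refine (S.integrable_weight.const_mul ((12 * b ^ (-(1 / 2) : ℝ)) ^ (1 * ((τ : ℝ) + 1)))).congr ?_
  filter_upwards [ae_mem_orthant τ] with t ht
  rw [weightedDensity, cutoff, indicator_of_mem ht, ← Real.rpow_one (kernelEnergy b t),
    kernelEnergy_rpow hb ht, mul_assoc]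

omit [IsProbabilityMeasure P] in
-- Here (2+4κ)/2 = 1 + 2κ, and half of that is κ + 1/2. The moment order 2 + 4κ is thus the one that
-- the moment hypothesis provides.
theorem integral_kernelEnergy_rpow (hb : 0 < b) :
    Integrable (fun t => kernelEnergy b t ^ ((2 + 4 * κ) / 2)) (P.map (X 0)) ∧
    ∫ t, kernelEnergy b t ^ ((2 + 4 * κ) / 2) ∂P.map (X 0) =
      (12 * b ^ (-(1 / 2) : ℝ)) ^ ((2 + 4 * κ) / 2 * ((τ : ℝ) + 1)) *
        ∫ x, (∏ j, x j ^ (-(κ + 1 / 2))) * f x ∂orthantVolume τ := by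
  have e : (fun t => kernelEnergy b t ^ ((2 + 4 * κ) / 2) * f t) =ᵐ[orthantVolume τ] fun t =>
      (12 * b ^ (-(1 / 2) : ℝ)) ^ ((2 + 4 * κ) / 2 * ((τ : ℝ) + 1)) *
        ((∏ j, t j ^ (-(κ + 1 / 2))) * f t) := by
    filter_upwards [ae_mem_orthant τ] with t ht
    rw [kernelEnergy_rpow hb ht, mul_assoc, show (2 + 4 * κ) / 2 / 2 = κ + 1 / 2 by ring]
  constructor
  · rw [S.integrable_map_iff]
    exact (S.moment.const_mul _).congr e.symm
  · rw [S.integral_map_eq, integral_congr_ae e, integral_const_mul]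

/-- The L²(dx)-valued covariance inequality with p = 2 + 4κ and a² = y/s, s = b^(d/2). The moment of
order p scales like s^(-(1+2κ)) and a^(2-p) like s^(2κ), so both terms carry exactly s⁻¹ and the
scaled bound is free of b. -/
theorem abs_integral_lagCov_le (hb : 0 < b) (k : ℕ) {y : ℝ} (hy : 0 < y) :
    √b ^ (τ + 1) * |∫ x, lagCov P X b k x ∂orthantVolume τ| ≤ 4 * y * alphaMixing P X k +
      16 * (12 : ℝ) ^ ((2 + 4 * κ) / 2 * ((τ : ℝ) + 1)) *
        (∫ x, (∏ j, x j ^ (-(κ + 1 / 2))) * f x ∂orthantVolume τ) * y ^ (-(2 * κ)) := by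
  have hν := S.isProbabilityMeasure_map
  have hπ : IsProbabilityMeasure (P.map fun ω => (X 0 ω, X k ω)) :=
    Measure.isProbabilityMeasure_map ((S.meas 0).prodMk (S.meas k)).aemeasurable
  have hκ := S.pos
  have hκ2 := S.lt_half
  have h := S.mixingPair k
  have hk := measurable_productKernel (τ := τ) hb
  have hΨ : ∀ᵐ s ∂P.map (X 0), MemLp (fun x => productKernel b x s) 2 (orthantVolume τ) ∧
      ∫ x, productKernel b x s ^ 2 ∂orthantVolume τ ≤ kernelEnergy b s := by
    filter_upwards [S.ae_map_mem_orthant] with s hs using memLp_productKernel_left hb hs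
  set s : ℝ := √b ^ (τ + 1) with hs_def
  have hs : 0 < s := pow_pos (Real.sqrt_pos.2 hb) _
  obtain ⟨j1, j2⟩ := S.integral_kernelEnergy_rpow hb
  have key := h.abs_integral_kernel_le (a := √(y / s)) (p := 2 + 4 * κ) hk (productKernel_nonneg hb)
    (by filter_upwards [S.ae_map_mem_orthant] with s hs using kernelEnergy_pos hb hs)
    hΨ (S.integrable_kernelEnergy hb) (by linarith) (by linarith) j1 (Real.sqrt_pos.2 (by positivity))
  have p1 := (integrable_kernel_prod hk (productKernel_nonneg hb) hΨ (S.integrable_kernelEnergy hb)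
    h.fst₁ h.snd₁).integral_prod_left
  have p2 := (integrable_kernel_prod hk (productKernel_nonneg hb) hΨ (S.integrable_kernelEnergy hb)
    h.fst₂ h.snd₂).integral_prod_left
  rw [← integral_sub p1 p2] at key
  have e1 : ∀ x, (∫ z, productKernel b x z.1 * productKernel b x z.2 ∂P.map fun ω => (X 0 ω, X k ω)) -
      ∫ z, productKernel b x z.1 * productKernel b x z.2 ∂(P.map (X 0)).prod (P.map (X 0)) =
      lagCov P X b k x := by
    intro x
    rw [integral_prod_mul, ← sq]
    rfl
  simp_rw [e1] at key
  rw [j2] at key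
  have hys : 0 < y / s := by positivity
  have e2 : √(y / s) ^ (2 - (2 + 4 * κ)) = y ^ (-(2 * κ)) * s ^ (2 * κ) := by
    rw [Real.sqrt_eq_rpow, ← Real.rpow_mul hys.le,
      show (1 / 2 : ℝ) * (2 - (2 + 4 * κ)) = -(2 * κ) by ring, Real.div_rpow hy.le hs.le,
      Real.rpow_neg hs.le, div_inv_eq_mul]
  have e3 : (12 * b ^ (-(1 / 2) : ℝ)) ^ ((2 + 4 * κ) / 2 * ((τ : ℝ) + 1)) =
      (12 : ℝ) ^ ((2 + 4 * κ) / 2 * ((τ : ℝ) + 1)) * s ^ (-(1 + 2 * κ)) := by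
    rw [Real.mul_rpow (by norm_num) (by positivity), hs_def, ← Real.rpow_natCast √b,
      Real.sqrt_eq_rpow, ← Real.rpow_mul hb.le, ← Real.rpow_mul hb.le, ← Real.rpow_mul hb.le]
    congr 2
    push_cast
    ring
  rw [Real.sq_sqrt hys.le, e2, e3] at key
  have e4 : s ^ (2 * κ) * s ^ (-(1 + 2 * κ)) = s⁻¹ := by
    rw [← Real.rpow_add hs, show 2 * κ + -(1 + 2 * κ) = -1 by ring, Real.rpow_neg_one]
  calc _ ≤ s * (4 * (y / s) * alphaMixing P X k + 16 * (y ^ (-(2 * κ)) * s ^ (2 * κ)) *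
        ((12 : ℝ) ^ ((2 + 4 * κ) / 2 * ((τ : ℝ) + 1)) * s ^ (-(1 + 2 * κ)) *
          ∫ x, (∏ j, x j ^ (-(κ + 1 / 2))) * f x ∂orthantVolume τ)) := by gcongr
    _ = (s * s⁻¹) * (4 * y * alphaMixing P X k) + s * (s ^ (2 * κ) * s ^ (-(1 + 2 * κ))) *
        (16 * (12 : ℝ) ^ ((2 + 4 * κ) / 2 * ((τ : ℝ) + 1)) *
        (∫ x, (∏ j, x j ^ (-(κ + 1 / 2))) * f x ∂orthantVolume τ) * y ^ (-(2 * κ))) := by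
        ring
    _ = _ := by rw [e4, mul_inv_cancel₀ hs.ne', one_mul, one_mul]

theorem exists_abs_integral_lagCov_le : ∃ C : ℝ, ∀ b, 0 < b → ∀ k : ℕ, 1 ≤ k →
    √b ^ (τ + 1) * |∫ x, lagCov P X b k x ∂orthantVolume τ| ≤
      C * (k : ℝ) ^ (-(2 / (1 + 2 * κ))) := by
  have hκ := S.pos
  obtain ⟨A, hA, hAk⟩ := S.exists_alphaMixing_le
  set B := 16 * (12 : ℝ) ^ ((2 + 4 * κ) / 2 * ((τ : ℝ) + 1)) *
        (∫ x, (∏ j, x j ^ (-(κ + 1 / 2))) * f x ∂orthantVolume τ)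
  refine ⟨4 * A + B, fun b hb k hk => ?_⟩
  have hk0 : (0 : ℝ) < k := by exact_mod_cast hk
  -- This exponent balances the two terms: it makes y k^(-1/κ) = y^(-2κ).
  set y := (k : ℝ) ^ (1 / (κ * (1 + 2 * κ)))
  have hy : 0 < y := by positivity
  refine (S.abs_integral_lagCov_le hb k hy).trans ?_
  have e1 : y ^ (-(2 * κ)) = (k : ℝ) ^ (-(2 / (1 + 2 * κ))) := by
    rw [← Real.rpow_mul hk0.le]
    congr 1
    field_simp
  have e2 : y * (k : ℝ) ^ (-(1 / κ)) = (k : ℝ) ^ (-(2 / (1 + 2 * κ))) := by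
    rw [← Real.rpow_add hk0]
    congr 1
    field_simp
    ring
  rw [e1, add_mul]
  refine add_le_add ?_ le_rfl
  calc 4 * y * alphaMixing P X k ≤ 4 * y * (A * (k : ℝ) ^ (-(1 / κ))) := by
        gcongr
        exact hAk k hk
    _ = 4 * A * (y * (k : ℝ) ^ (-(1 / κ))) := by ring
    _ = _ := by rw [e2]

/-- The integrated covariances are summable over the lags, uniformly in the bandwidth, and their
sum is negligible against the variance. -/
theorem tendsto_tsum_lagCov :
    (∀ b, 0 < b → Summable fun k => √b ^ (τ + 1) * |∫ x, lagCov P X b (k + 1) x ∂orthantVolume τ|) ∧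
    Tendsto (fun b => ∑' k, √b ^ (τ + 1) * |∫ x, lagCov P X b (k + 1) x ∂orthantVolume τ|)
      (𝓝[>] 0) (𝓝 0) := by
  have hκ := S.pos
  have hκ2 := S.lt_half
  obtain ⟨C, hC⟩ := S.exists_abs_integral_lagCov_le
  have hsum : Summable fun k : ℕ => C * ((k + 1 : ℕ) : ℝ) ^ (-(2 / (1 + 2 * κ))) := by
    refine Summable.mul_left C ((summable_nat_add_iff 1).2 (Real.summable_nat_rpow.2 ?_))
    -- Summability asks for 2/(1+2κ) > 1, that is κ < 1/2.
    rw [neg_lt_neg_iff, lt_div_iff₀ (by linarith)]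
    linarith
  constructor
  · intro b hb
    refine hsum.of_nonneg_of_le (fun k => by positivity) fun k => hC b hb (k + 1) (by omega)
  · have := tendsto_tsum_of_dominated_convergence (𝓕 := 𝓝[>] (0 : ℝ))
      (f := fun b k => √b ^ (τ + 1) * |∫ x, lagCov P X b (k + 1) x ∂orthantVolume τ|)
      (g := fun _ => 0) hsum (fun k => S.tendsto_integral_lagCov (by omega)) (by
        filter_upwards [eventually_mem_nhdsWithin] with b hb k
        rw [Real.norm_of_nonneg (by positivity)]
        exact hC b hb (k + 1) (by omega))
    simpa using this

end MixingModel

/-! ### The variance of the estimator -/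

/-- For fixed i each lag occurs at most twice, once on each side. -/
theorem sum_erase_dist_le {a : ℕ → ℝ} (ha : ∀ k, 0 ≤ a k) {n i : ℕ} (hi : i < n) :
    ∑ k ∈ (Finset.range n).erase i, a (Nat.dist i k) ≤ 2 * ∑ k ∈ Finset.range n, a (k + 1) := by
  have hsplit : (Finset.range n).erase i = Finset.range i ∪ Finset.Ico (i + 1) n := by
    ext k
    simp only [Finset.mem_erase, Finset.mem_range, Finset.mem_union, Finset.mem_Ico]
    omega
  have hdisj : Disjoint (Finset.range i) (Finset.Ico (i + 1) n) := by
    rw [Finset.disjoint_left]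
    intro k
    simp only [Finset.mem_range, Finset.mem_Ico]
    omega
  have h1 : ∑ k ∈ Finset.range i, a (Nat.dist i k) = ∑ k ∈ Finset.range i, a (k + 1) := by
    rw [← Finset.sum_range_reflect (fun k => a (k + 1))]
    refine Finset.sum_congr rfl fun k hk => ?_
    rw [Finset.mem_range] at hk
    congr 1
    rw [Nat.dist_eq_sub_of_le_right hk.le]
    omega
  have h2 : ∑ k ∈ Finset.Ico (i + 1) n, a (Nat.dist i k) =
      ∑ k ∈ Finset.range (n - (i + 1)), a (k + 1) := by
    rw [Finset.sum_Ico_eq_sum_range]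
    refine Finset.sum_congr rfl fun k _ => ?_
    congr 1
    rw [Nat.dist_eq_sub_of_le (by omega)]
    omega
  have h3 : ∀ m, m ≤ n → ∑ k ∈ Finset.range m, a (k + 1) ≤ ∑ k ∈ Finset.range n, a (k + 1) :=
    fun m hm => Finset.sum_le_sum_of_subset_of_nonneg (Finset.range_subset_range.2 hm)
      fun k _ _ => ha _
  rw [hsplit, Finset.sum_union hdisj, h1, h2, two_mul]
  exact add_le_add (h3 _ hi.le) (h3 _ (by omega))

theorem abs_sum_sum_erase_dist_le (c : ℕ → ℝ) (n : ℕ) :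
    |∑ i ∈ Finset.range n, ∑ k ∈ (Finset.range n).erase i, c (Nat.dist i k)| ≤
      n * (2 * ∑ k ∈ Finset.range n, |c (k + 1)|) := by
  calc _ ≤ ∑ i ∈ Finset.range n, 2 * ∑ k ∈ Finset.range n, |c (k + 1)| := by
        refine (Finset.abs_sum_le_sum_abs _ _).trans (Finset.sum_le_sum fun i hi => ?_)
        exact (Finset.abs_sum_le_sum_abs _ _).trans
          (sum_erase_dist_le (a := fun k => |c k|) (fun k => abs_nonneg _) (Finset.mem_range.1 hi))
    _ = _ := by simp

namespace MixingModel

variable {Ω : Type*} [MeasurableSpace Ω] {P : Measure Ω} {τ : ℕ}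
  {X : ℕ → Ω → (Fin (τ + 1) → ℝ)} {f : (Fin (τ + 1) → ℝ) → ℝ}
  {g : ℕ → (Fin (τ + 1) → ℝ) → (Fin (τ + 1) → ℝ) → ℝ} {κ M : ℝ}
  [IsProbabilityMeasure P] (S : MixingModel P τ X f g κ M) {b : ℝ}
include S

theorem memLp_productKernel_comp (hb : 0 < b) {x : Fin (τ + 1) → ℝ} (hx : x ∈ orthant τ) (i : ℕ) :
    MemLp (fun ω => productKernel b x (X i ω)) 2 P :=
  MemLp.of_bound ((measurable_productKernel_right hb x).comp (S.meas i)).aestronglyMeasurable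
    (kernelSup b x) (ae_of_all _ fun ω => by
      rw [Real.norm_of_nonneg (productKernel_nonneg hb x _)]; exact productKernel_le hb hx _)

omit [IsProbabilityMeasure P] in
theorem integral_productKernel_comp (hb : 0 < b) (x : Fin (τ + 1) → ℝ) (i : ℕ) :
    ∫ ω, productKernel b x (X i ω) ∂P = kernelMean (P.map (X 0)) b x := by
  rw [kernelMean, ← S.map_eq i, integral_map (S.meas i).aemeasurable
    (measurable_productKernel_right hb x).aestronglyMeasurable]

theorem variance_productKernel (hb : 0 < b) {x : Fin (τ + 1) → ℝ} (hx : x ∈ orthant τ) (i : ℕ) :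
    variance (fun ω => productKernel b x (X i ω)) P =
      kernelSq (P.map (X 0)) b x - kernelMean (P.map (X 0)) b x ^ 2 := by
  rw [variance_eq_sub (S.memLp_productKernel_comp hb hx i), S.integral_productKernel_comp hb,
    kernelSq, ← S.map_eq i, integral_map (S.meas i).aemeasurable
    ((measurable_productKernel_right hb x).pow_const 2).aestronglyMeasurable]
  rfl

theorem covariance_productKernel_lag (hb : 0 < b) {x : Fin (τ + 1) → ℝ} (hx : x ∈ orthant τ)
    (i k : ℕ) : covariance (fun ω => productKernel b x (X i ω))
      (fun ω => productKernel b x (X (i + k) ω)) P = lagCov P X b k x := by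
  have hm := measurable_productKernel_right hb x
  have hKK : Measurable fun z : (Fin (τ + 1) → ℝ) × (Fin (τ + 1) → ℝ) =>
      productKernel b x z.1 * productKernel b x z.2 :=
    (hm.comp measurable_fst).mul (hm.comp measurable_snd)
  rw [covariance_eq_sub (S.memLp_productKernel_comp hb hx i) (S.memLp_productKernel_comp hb hx _),
    S.integral_productKernel_comp hb, S.integral_productKernel_comp hb, lagCov, kernelPair,
    ← map_shift S.meas S.stationary i k,
    integral_map ((S.meas i).prodMk (S.meas _)).aemeasurable hKK.aestronglyMeasurable, ← sq]
  rfl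

theorem covariance_productKernel (hb : 0 < b) {x : Fin (τ + 1) → ℝ} (hx : x ∈ orthant τ)
    (i k : ℕ) : covariance (fun ω => productKernel b x (X i ω))
      (fun ω => productKernel b x (X k ω)) P = lagCov P X b (Nat.dist i k) x := by
  rcases le_total i k with h | h
  · obtain ⟨m, rfl⟩ := Nat.exists_eq_add_of_le h
    rw [S.covariance_productKernel_lag hb hx, Nat.dist_eq_sub_of_le h, Nat.add_sub_cancel_left]
  · obtain ⟨m, rfl⟩ := Nat.exists_eq_add_of_le h
    rw [covariance_comm, S.covariance_productKernel_lag hb hx, Nat.dist_eq_sub_of_le_right h,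
      Nat.add_sub_cancel_left]

theorem varTerm_eq (hb : 0 < b) {x : Fin (τ + 1) → ℝ} (hx : x ∈ orthant τ) (n : ℕ) :
    varTerm P X n b x =
      1 / n * (kernelSq (P.map (X 0)) b x - kernelMean (P.map (X 0)) b x ^ 2) := by
  rw [varTerm, Finset.sum_congr rfl fun i _ => S.variance_productKernel hb hx i, Finset.sum_const,
    Finset.card_range, nsmul_eq_mul]
  rcases eq_or_ne n 0 with rfl | hn
  · simp
  · have : (n : ℝ) ≠ 0 := by exact_mod_cast hn
    field_simp

theorem covTerm_eq (hb : 0 < b) {x : Fin (τ + 1) → ℝ} (hx : x ∈ orthant τ) (n : ℕ) :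
    covTerm P X n b x = 1 / (n : ℝ) ^ 2 * ∑ i ∈ Finset.range n, ∑ k ∈ (Finset.range n).erase i,
      lagCov P X b (Nat.dist i k) x := by
  rw [covTerm]
  congr 1
  exact Finset.sum_congr rfl fun i _ => Finset.sum_congr rfl fun k _ =>
    S.covariance_productKernel hb hx i k

theorem covTerm_ae_eq (hb : 0 < b) (n : ℕ) : covTerm P X n b =ᵐ[orthantVolume τ] fun x =>
    1 / (n : ℝ) ^ 2 * ∑ i ∈ Finset.range n, ∑ k ∈ (Finset.range n).erase i,
      lagCov P X b (Nat.dist i k) x := by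
  filter_upwards [ae_mem_orthant τ] with x hx using S.covTerm_eq hb hx n

theorem varTerm_ae_eq (hb : 0 < b) (n : ℕ) : varTerm P X n b =ᵐ[orthantVolume τ] fun x =>
    1 / n * (kernelSq (P.map (X 0)) b x - kernelMean (P.map (X 0)) b x ^ 2) := by
  filter_upwards [ae_mem_orthant τ] with x hx using S.varTerm_eq hb hx n

theorem integrable_covTerm (hb : 0 < b) (n : ℕ) :
    Integrable (covTerm P X n b) (orthantVolume τ) := by
  refine Integrable.congr (Integrable.const_mul ?_ _) (S.covTerm_ae_eq hb n).symm
  exact integrable_finsetSum _ fun i _ => integrable_finsetSum _ fun k _ =>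
    S.integrable_lagCov hb _

theorem integrable_kernelVar (hb : 0 < b) : Integrable (fun x =>
    kernelSq (P.map (X 0)) b x - kernelMean (P.map (X 0)) b x ^ 2) (orthantVolume τ) :=
  (S.integrable_kernelSq hb).sub (S.memLp_kernelMean hb).integrable_sq

theorem integrable_varTerm (hb : 0 < b) (n : ℕ) :
    Integrable (varTerm P X n b) (orthantVolume τ) :=
  Integrable.congr ((S.integrable_kernelVar hb).const_mul _) (S.varTerm_ae_eq hb n).symm

/-- By stationarity the double sum depends only on lags; n rows, each at most twice the sum over
lags, divided by n², leave the factor 1/n. The bound is uniform in n. -/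
theorem abs_integral_covTerm_le (hb : 0 < b) {n : ℕ} (hn : n ≠ 0) :
    n * √b ^ (τ + 1) * |∫ x, covTerm P X n b x ∂orthantVolume τ| ≤
      2 * ∑' k, √b ^ (τ + 1) * |∫ x, lagCov P X b (k + 1) x ∂orthantVolume τ| := by
  have hn0 : (0 : ℝ) < n := by exact_mod_cast Nat.pos_of_ne_zero hn
  have hs : 0 < √b ^ (τ + 1) := pow_pos (Real.sqrt_pos.2 hb) _
  have e : ∫ x, covTerm P X n b x ∂orthantVolume τ = 1 / (n : ℝ) ^ 2 * ∑ i ∈ Finset.range n,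
      ∑ k ∈ (Finset.range n).erase i, ∫ x, lagCov P X b (Nat.dist i k) x ∂orthantVolume τ := by
    rw [integral_congr_ae (S.covTerm_ae_eq hb n), integral_const_mul, integral_finsetSum]
    · congr 1
      refine Finset.sum_congr rfl fun i _ => ?_
      rw [integral_finsetSum]
      exact fun k _ => S.integrable_lagCov hb _
    · exact fun i _ => integrable_finsetSum _ fun k _ => S.integrable_lagCov hb _
  have h1 := abs_sum_sum_erase_dist_le
    (fun k => ∫ x, lagCov P X b k x ∂orthantVolume τ) n
  have h2 := (S.tendsto_tsum_lagCov.1 b hb).sum_le_tsum (Finset.range n) fun k _ => by positivity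
  rw [← Finset.mul_sum] at h2
  rw [e, abs_mul, abs_of_pos (by positivity : (0 : ℝ) < 1 / (n : ℝ) ^ 2)]
  calc _ ≤ n * √b ^ (τ + 1) * (1 / (n : ℝ) ^ 2 * (n * (2 * ∑ k ∈ Finset.range n,
        |∫ x, lagCov P X b (k + 1) x ∂orthantVolume τ|))) := by gcongr
    _ = 2 * (√b ^ (τ + 1) * ∑ k ∈ Finset.range n,
        |∫ x, lagCov P X b (k + 1) x ∂orthantVolume τ|) := by field_simp
    _ ≤ _ := by gcongr

theorem integral_varTerm (hb : 0 < b) (n : ℕ) : ∫ x, varTerm P X n b x ∂orthantVolume τ =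
    1 / n * ∫ x, (kernelSq (P.map (X 0)) b x - kernelMean (P.map (X 0)) b x ^ 2)
      ∂orthantVolume τ := by
  rw [integral_congr_ae (S.varTerm_ae_eq hb n), integral_const_mul]

omit S [IsProbabilityMeasure P] in
theorem tendsto_sqrt_pow (d : ℕ) : Tendsto (fun b : ℝ => √b ^ (d + 1)) (𝓝[>] 0) (𝓝 0) := by
  have : Continuous fun b : ℝ => √b ^ (d + 1) := by fun_prop
  have h := this.tendsto 0
  simp only [Real.sqrt_zero, ne_eq, Nat.add_eq_zero_iff, one_ne_zero, and_false,
    not_false_eq_true, zero_pow] at h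
  exact h.mono_left nhdsWithin_le_nhds

/-- The integrated variance of the kernel is asymptotic to `varianceConst f` times `b^(-d/2)`. -/
theorem tendsto_integral_kernelVar : Tendsto (fun b => √b ^ (τ + 1) *
    ∫ x, (kernelSq (P.map (X 0)) b x - kernelMean (P.map (X 0)) b x ^ 2) ∂orthantVolume τ)
    (𝓝[>] 0) (𝓝 (varianceConst f)) := by
  have h1 : Tendsto (fun b => ∫ x, √b ^ (τ + 1) * kernelSq (P.map (X 0)) b x ∂orthantVolume τ)
      (𝓝[>] 0) (𝓝 (varianceConst f)) := by
    rw [← integral_weightedDensity]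
    refine tendsto_integral_of_L1' _ (S.integrable_weight.const_mul _).aestronglyMeasurable ?_ S.tendsto_kernelSq
    filter_upwards [eventually_mem_nhdsWithin] with b hb
    exact (S.integrable_kernelSq hb).const_mul _
  -- The integral of the squared mean is bounded in b, so scaling by b^(d/2) removes it.
  obtain ⟨D, hD⟩ := exists_integral_sq_smoothed_le S.smooth S.memLp
  have hD' : ∀ b, 0 < b → ∫ x, kernelMean (P.map (X 0)) b x ^ 2 ∂orthantVolume τ ≤ D := by
    intro b hb
    refine le_of_eq_of_le (integral_congr_ae ?_) (hD b hb)
    filter_upwards [S.kernelMean_ae_eq hb] with x hx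
    rw [hx]
  have h2 : Tendsto (fun b => √b ^ (τ + 1) *
      ∫ x, kernelMean (P.map (X 0)) b x ^ 2 ∂orthantVolume τ) (𝓝[>] 0) (𝓝 0) := by
    have h3 := (tendsto_sqrt_pow τ).mul_const D
    rw [zero_mul] at h3
    refine squeeze_zero' (Eventually.of_forall fun b => mul_nonneg (by positivity)
      (integral_nonneg fun _ => sq_nonneg _)) ?_ h3
    filter_upwards [eventually_mem_nhdsWithin] with b hb
    gcongr
    exact hD' b hb
  have h4 := h1.sub h2
  rw [sub_zero] at h4
  refine h4.congr' ?_
  filter_upwards [eventually_mem_nhdsWithin] with b hb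
  rw [integral_sub (S.integrable_kernelSq hb) (S.memLp_kernelMean hb).integrable_sq,
    integral_const_mul, mul_sub]

/-- Otherwise the nonnegative weighted density, and with it f, would vanish almost everywhere,
against total mass 1. -/
theorem varianceConst_pos : 0 < varianceConst f := by
  rw [← integral_weightedDensity]
  have hc : (0 : ℝ) < (1 / (2 * √Real.pi)) ^ (τ + 1) := by
    have := Real.sqrt_pos.2 Real.pi_pos
    positivity
  rw [integral_const_mul]
  refine mul_pos hc ?_
  rw [integral_pos_iff_support_of_nonneg (weightedDensity_nonneg S.nonneg) S.integrable_weight,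
    pos_iff_ne_zero]
  intro h0
  have h1 : f =ᵐ[orthantVolume τ] 0 := by
    have h2 : ∀ᵐ x ∂orthantVolume τ, weightedDensity f x = 0 := by
      rw [ae_iff]; exact h0
    filter_upwards [h2, ae_mem_orthant τ] with x hx hxo
    rw [weightedDensity, cutoff, indicator_of_mem hxo] at hx
    refine (mul_eq_zero.1 hx).resolve_left (Finset.prod_pos fun j _ => ?_).ne'
    have := hxo j
    positivity
  have h3 := S.integral_density
  rw [integral_congr_ae h1] at h3
  simp at h3

/-! ### The mean integrated squared error -/

omit [IsProbabilityMeasure P] in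
theorem measurable_estimator (hb : 0 < b) (n : ℕ) :
    Measurable fun q : Ω × (Fin (τ + 1) → ℝ) => estimator X n b q.2 q.1 := by
  unfold estimator
  refine Measurable.const_mul (Finset.measurable_fun_sum _ fun i _ => ?_) _
  exact (measurable_productKernel hb).comp (measurable_snd.prodMk ((S.meas i).comp measurable_fst))

theorem variance_estimator (hb : 0 < b) {x : Fin (τ + 1) → ℝ} (hx : x ∈ orthant τ) (n : ℕ) :
    variance (estimator X n b x) P = varTerm P X n b x + covTerm P X n b x := by
  have hL := S.memLp_productKernel_comp hb hx
  unfold estimator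
  rw [variance_const_mul, variance_fun_sum' fun i _ => hL i, varTerm, covTerm, ← mul_add,
    ← Finset.sum_add_distrib, one_div, one_div, inv_pow]
  congr 1
  refine Finset.sum_congr rfl fun i hi => ?_
  rw [← Finset.add_sum_erase _ _ hi, covariance_self (hL i).1.aemeasurable]

theorem lintegral_sq_error (hb : 0 < b) {n : ℕ} (hn : n ≠ 0) {x : Fin (τ + 1) → ℝ}
    (hx : x ∈ orthant τ) :
    ∫⁻ ω, ENNReal.ofReal ((f x - estimator X n b x ω) ^ 2) ∂P =
      ENNReal.ofReal ((kernelMean (P.map (X 0)) b x - f x) ^ 2 +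
        (varTerm P X n b x + covTerm P X n b x)) := by
  have hn0 : (n : ℝ) ≠ 0 := by exact_mod_cast hn
  have hL := S.memLp_productKernel_comp hb hx
  have hE : MemLp (estimator X n b x) 2 P := (memLp_finsetSum _ fun i _ => hL i).const_mul _
  have hmean : ∫ ω, estimator X n b x ω ∂P = kernelMean (P.map (X 0)) b x := by
    unfold estimator
    rw [integral_const_mul, integral_finsetSum _ fun i _ => (hL i).integrable one_le_two,
      Finset.sum_congr rfl fun i _ => S.integral_productKernel_comp hb x i, Finset.sum_const,
      Finset.card_range, nsmul_eq_mul]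
    field_simp
  have hv2 := variance_eq_sub hE
  rw [hmean, S.variance_estimator hb hx] at hv2
  have hi : Integrable (fun ω => (f x - estimator X n b x ω) ^ 2) P :=
    ((memLp_const (f x)).sub hE).integrable_sq
  rw [← ofReal_integral_eq_lintegral_ofReal hi (ae_of_all _ fun ω => sq_nonneg _)]
  congr 1
  have e : ∀ ω, (f x - estimator X n b x ω) ^ 2 = f x ^ 2 - 2 * f x * estimator X n b x ω +
      estimator X n b x ω ^ 2 := fun ω => by ring
  have j1 : Integrable (fun ω => 2 * f x * estimator X n b x ω) P :=
    (hE.integrable one_le_two).const_mul _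
  have j0 : Integrable (fun ω => f x ^ 2 - 2 * f x * estimator X n b x ω) P :=
    (integrable_const _).sub j1
  simp_rw [e]
  rw [integral_add j0 hE.integrable_sq, integral_sub (integrable_const _) j1,
    integral_const_mul, hmean, hv2]
  simp
  ring

/-- The decomposition of the mean integrated squared error. -/
theorem mise_eq (hb : 0 < b) {n : ℕ} (hn : n ≠ 0) :
    mise P X f n b = ENNReal.ofReal ((∫ x, (smoothed f b x - f x) ^ 2 ∂orthantVolume τ) +
      ((∫ x, varTerm P X n b x ∂orthantVolume τ) + ∫ x, covTerm P X n b x ∂orthantVolume τ)) := by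
  have hm : Measurable fun q : Ω × (Fin (τ + 1) → ℝ) =>
      ENNReal.ofReal ((cutoff f q.2 - estimator X n b q.2 q.1) ^ 2) :=
    ((((measurable_cutoff S.smooth).comp measurable_snd).sub
      (S.measurable_estimator hb n)).pow_const 2).ennreal_ofReal
  -- The cutoff supplies joint measurability for Tonelli, since nothing is assumed about f outside
  -- the orthant.
  have e1 : mise P X f n b =
      ∫⁻ ω, ∫⁻ x, ENNReal.ofReal ((cutoff f x - estimator X n b x ω) ^ 2) ∂orthantVolume τ ∂P := by
    refine lintegral_congr fun ω => lintegral_congr_ae ?_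
    filter_upwards [cutoff_ae_eq f] with x hx
    rw [hx]
  have i1 : Integrable (fun x => (kernelMean (P.map (X 0)) b x - f x) ^ 2) (orthantVolume τ) :=
    ((S.memLp_kernelMean hb).sub S.memLp).integrable_sq
  have i2 : Integrable (fun x => varTerm P X n b x + covTerm P X n b x) (orthantVolume τ) :=
    (S.integrable_varTerm hb n).add (S.integrable_covTerm hb n)
  have i12 : Integrable (fun x => (kernelMean (P.map (X 0)) b x - f x) ^ 2 +
      (varTerm P X n b x + covTerm P X n b x)) (orthantVolume τ) := i1.add i2
  have hae : ∀ᵐ x ∂orthantVolume τ,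
      ∫⁻ ω, ENNReal.ofReal ((cutoff f x - estimator X n b x ω) ^ 2) ∂P =
        ENNReal.ofReal ((kernelMean (P.map (X 0)) b x - f x) ^ 2 +
          (varTerm P X n b x + covTerm P X n b x)) := by
    filter_upwards [ae_mem_orthant τ, cutoff_ae_eq f] with x hx hc
    rw [hc]
    exact S.lintegral_sq_error hb hn hx
  have hnn : ∀ᵐ x ∂orthantVolume τ, 0 ≤ (kernelMean (P.map (X 0)) b x - f x) ^ 2 +
      (varTerm P X n b x + covTerm P X n b x) := by
    filter_upwards [ae_mem_orthant τ] with x hx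
    rw [← S.variance_estimator hb hx]
    exact add_nonneg (sq_nonneg _) (variance_nonneg _ _)
  rw [e1, lintegral_lintegral_swap hm.aemeasurable, lintegral_congr_ae hae,
    ← ofReal_integral_eq_lintegral_ofReal i12 hnn]
  congr 1
  rw [integral_add i1 i2]
  congr 1
  · refine integral_congr_ae ?_
    filter_upwards [S.kernelMean_ae_eq hb] with x hx
    rw [hx]
  · exact integral_add (S.integrable_varTerm hb n) (S.integrable_covTerm hb n)

end MixingModel

/-! ### Negligibility of the covariance term -/

/-- On the common scale n b^(d/2) the covariance is bounded by 2T(b) with T → 0 and the variance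
stays above w > 0. Neither bound depends on n, so no rate relating b_n and n is needed. -/
theorem isLittleO_of_scaled {c v b : ℕ → ℝ} (hb : ∀ n, 0 < b n) (hb0 : Tendsto b atTop (𝓝 0))
    {τ : ℕ} {T W : ℝ → ℝ} (hT : Tendsto T (𝓝[>] 0) (𝓝 0)) {w : ℝ} (hw : 0 < w)
    (hW : ∀ᶠ b in 𝓝[>] 0, w ≤ W b)
    (hc : ∀ n : ℕ, n ≠ 0 → n * √(b n) ^ (τ + 1) * |c n| ≤ 2 * T (b n))
    (hv : ∀ n : ℕ, n ≠ 0 → n * √(b n) ^ (τ + 1) * v n = W (b n)) : c =o[atTop] v := by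
  have hb' : Tendsto b atTop (𝓝[>] 0) :=
    tendsto_nhdsWithin_iff.2 ⟨hb0, Eventually.of_forall hb⟩
  refine isLittleO_iff.2 fun ε hε => ?_
  have hT' := (hT.comp hb').eventually (gt_mem_nhds (show 0 < ε * w / 2 by positivity))
  filter_upwards [hT', hb'.eventually hW, eventually_ne_atTop 0] with n h1 h2 hn
  have hn0 : (0 : ℝ) < n := by exact_mod_cast Nat.pos_of_ne_zero hn
  have hs : 0 < n * √(b n) ^ (τ + 1) := mul_pos hn0 (pow_pos (Real.sqrt_pos.2 (hb n)) _)
  have h3 := hc n hn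
  have h4 := hv n hn
  rw [Function.comp] at h1
  rw [Real.norm_eq_abs, Real.norm_eq_abs]
  refine le_of_mul_le_mul_left ?_ hs
  calc _ ≤ ε * w := by linarith
    _ ≤ ε * (n * √(b n) ^ (τ + 1) * v n) := by rw [h4]; gcongr
    _ ≤ ε * (n * √(b n) ^ (τ + 1) * |v n|) := by gcongr; exact le_abs_self _
    _ = _ := by ring

/-! ### Estimates at a fixed point of the orthant -/

section Pointwise

variable {τ : ℕ} {x : Fin (τ + 1) → ℝ}

theorem eventually_two_mul_le_coord (hx : x ∈ orthant τ) :
    ∀ᶠ b in 𝓝[>] (0 : ℝ), ∀ j, 2 * b ≤ x j :=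
  eventually_all.2 fun j => (eventually_two_mul_le (hx j)).mono fun _ h => h.2

/-- For 2b ≤ x_j one has b²(x_j/b - 1) = bx_j - b² ≥ bx_j/2, so the sup bound is of order b^(-d/2).
-/
theorem sqrt_pow_mul_kernelSup_le {b : ℝ} (hb : 0 < b) (hx : x ∈ orthant τ)
    (h : ∀ j, 2 * b ≤ x j) : √b ^ (τ + 1) * kernelSup b x ≤ ∏ j, 1 / √(x j / 2) := by
  have e : √b ^ (τ + 1) = ∏ _j : Fin (τ + 1), √b := by simp
  rw [kernelSup, e, ← Finset.prod_mul_distrib]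
  refine Finset.prod_le_prod (fun j _ => by positivity) fun j _ => ?_
  have hxj := hx j
  rw [shape_of_le (h j)]
  have h1 : √(x j / 2) * √b ≤ b * √(x j / b - 1) := by
    rw [← Real.sqrt_mul (by positivity), ← Real.sqrt_sq hb.le, ← Real.sqrt_mul (sq_nonneg b),
      Real.sqrt_sq hb.le]
    refine Real.sqrt_le_sqrt ?_
    have e2 : b ^ 2 * (x j / b - 1) = b * x j - b ^ 2 := by field_simp
    rw [e2]
    nlinarith [h j]
  have h2 : 0 < √(x j / 2) := Real.sqrt_pos.2 (by positivity)
  have h3 : 0 < √b := Real.sqrt_pos.2 hb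
  rw [mul_one_div, div_le_div_iff₀ ((mul_pos h2 h3).trans_le h1) h2]
  linarith

theorem integral_sub_sq_mul_productKernel {b : ℝ} (hb : 0 < b) {j : Fin (τ + 1)}
    (h : 2 * b ≤ x j) :
    Integrable (fun t => (t j - x j) ^ 2 * productKernel b x t) (orthantVolume τ) ∧
    ∫ t, (t j - x j) ^ 2 * productKernel b x t ∂orthantVolume τ = b * x j := by
  set φ : Fin (τ + 1) → ℝ → ℝ := fun i s =>
    (if i = j then (s - x j) ^ 2 else 1) * gammaKernel (x i) b s
  have e : (fun t : Fin (τ + 1) → ℝ => (t j - x j) ^ 2 * productKernel b x t) =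
      fun t => ∏ i, φ i (t i) := by
    ext t
    rw [productKernel, Finset.prod_mul_distrib, Finset.prod_ite_eq' Finset.univ j
      (fun i => (t i - x j) ^ 2), if_pos (Finset.mem_univ j)]
  have hφ : ∀ i, IntegrableOn (φ i) (Ioi 0) ∧
      ∫ s in Ioi 0, φ i s = if i = j then b * x j else 1 := by
    intro i
    by_cases hi : i = j
    · subst hi
      simp only [φ, if_true]
      exact ⟨integrableOn_sub_sq_mul_gammaKernel hb _ _, integral_sub_sq_mul_gammaKernel hb h⟩
    · simp only [φ, if_neg hi, one_mul]
      exact ⟨integrableOn_gammaKernel hb _, integral_gammaKernel hb _⟩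
  rw [e, orthantVolume_eq_pi]
  refine ⟨Integrable.fintype_prod fun i => (hφ i).1, ?_⟩
  rw [integral_fintype_prod_eq_prod, Finset.prod_congr rfl fun i _ => (hφ i).2]
  simp

end Pointwise

namespace MixingModel

variable {Ω : Type*} [MeasurableSpace Ω] {P : Measure Ω} {τ : ℕ}
  {X : ℕ → Ω → (Fin (τ + 1) → ℝ)} {f : (Fin (τ + 1) → ℝ) → ℝ}
  {g : ℕ → (Fin (τ + 1) → ℝ) → (Fin (τ + 1) → ℝ) → ℝ} {κ M : ℝ}
  [IsProbabilityMeasure P] (S : MixingModel P τ X f g κ M) {b : ℝ} {x : Fin (τ + 1) → ℝ}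
include S

/-- Pointwise lower bound for the second moment of the kernel. -/
theorem exists_le_kernelSq (hx : x ∈ orthant τ) (hfx : 0 < f x) :
    ∃ c > 0, ∀ᶠ b in 𝓝[>] (0 : ℝ), c ≤ √b ^ (τ + 1) * kernelSq (P.map (X 0)) b x := by
  -- The second moment of the kernel about x, summed over coordinates, is bC/2. By Chebyshev at
  -- least half of the mass lies in the sup-norm ball of radius √(Cb).
  set C : ℝ := 2 * ∑ j, x j
  have hC : 0 < C := mul_pos two_pos (Finset.sum_pos (fun j _ => hx j) Finset.univ_nonempty)
  set w : ℝ := (2 * √C) ^ (τ + 1)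
  have hw : 0 < w := pow_pos (mul_pos two_pos (Real.sqrt_pos.2 hC)) _
  have hev : ∀ᶠ t in 𝓝 x, f x / 2 ≤ f t := by
    have h1 := ((S.smooth.continuousOn x hx).continuousAt ((isOpen_orthant τ).mem_nhds hx))
    filter_upwards [h1.eventually (lt_mem_nhds (half_lt_self hfx))] with t ht using ht.le
  obtain ⟨η, hη, hball⟩ := Metric.eventually_nhds_iff.1 hev
  have hr : ∀ᶠ b in 𝓝[>] (0 : ℝ), √(C * b) < η := by
    have h1 : Tendsto (fun b : ℝ => √(C * b)) (𝓝 0) (𝓝 0) := by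
      have : Continuous fun b : ℝ => √(C * b) := by fun_prop
      simpa using this.tendsto 0
    exact (h1.eventually (gt_mem_nhds hη)).filter_mono nhdsWithin_le_nhds
  refine ⟨f x / (8 * w), by positivity, ?_⟩
  filter_upwards [hr, eventually_two_mul_le_coord hx, eventually_mem_nhdsWithin] with b hb1 hb2 hb
  have hb0 : 0 < b := hb
  have hs : 0 < √b ^ (τ + 1) := pow_pos (Real.sqrt_pos.2 hb0) _
  set r := √(C * b)
  have hr0 : 0 < r := Real.sqrt_pos.2 (by positivity)
  set B := Metric.closedBall x r
  set v := w * √b ^ (τ + 1)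
  have hv : 0 < v := by positivity
  have hvol : (orthantVolume τ).real B ≤ v := by
    have h1 : orthantVolume τ B ≤ ENNReal.ofReal v := by
      refine (Measure.restrict_apply_le _ _).trans_eq ?_
      rw [Real.volume_pi_closedBall _ hr0.le, Fintype.card_fin]
      simp only [v, w, r]
      rw [← mul_pow, mul_assoc 2 (√C), ← Real.sqrt_mul hC.le]
    exact ENNReal.toReal_le_of_le_ofReal hv.le h1
  have hBfin : orthantVolume τ B ≠ ∞ := by
    refine ((Measure.restrict_apply_le _ _).trans_lt ?_).ne
    exact measure_closedBall_lt_top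
  -- Cauchy-Schwarz on the ball in linear form, K² ≥ 2θK - θ²; with mass 1/2 and volume at most v
  -- this θ is optimal and yields 1/(4v). Outside the ball the Chebyshev correction makes the linear
  -- minorant nonpositive.
  set θ : ℝ := 1 / (2 * v)
  have hθ : 0 < θ := by positivity
  have iB : Integrable (B.indicator fun _ => (1 : ℝ)) (orthantVolume τ) :=
    (integrable_indicator_iff Metric.isClosed_closedBall.measurableSet).2
      (integrableOn_const hBfin)
  have iK := integrable_productKernel hb0 x
  have iS : Integrable (fun t => ∑ j, (t j - x j) ^ 2 * productKernel b x t) (orthantVolume τ) :=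
    integrable_finsetSum _ fun j _ => (integral_sub_sq_mul_productKernel hb0 (hb2 j)).1
  have eS : ∫ t, ∑ j, (t j - x j) ^ 2 * productKernel b x t ∂orthantVolume τ = b * (C / 2) := by
    rw [integral_finsetSum _ fun j _ => (integral_sub_sq_mul_productKernel hb0 (hb2 j)).1,
      Finset.sum_congr rfl fun j _ => (integral_sub_sq_mul_productKernel hb0 (hb2 j)).2,
      ← Finset.mul_sum, mul_div_cancel_left₀ _ two_ne_zero]
  have iL1 : Integrable (fun t => productKernel b x t -
      (C * b)⁻¹ * ∑ j, (t j - x j) ^ 2 * productKernel b x t) (orthantVolume τ) :=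
    iK.sub (iS.const_mul _)
  have iL : Integrable (fun t => 2 * θ * (productKernel b x t -
      (C * b)⁻¹ * ∑ j, (t j - x j) ^ 2 * productKernel b x t) -
      θ ^ 2 * B.indicator (fun _ => (1 : ℝ)) t) (orthantVolume τ) :=
    (iL1.const_mul _).sub (iB.const_mul _)
  have hν := S.isProbabilityMeasure_map
  have iq : Integrable (fun t => productKernel b x t ^ 2 * f t) (orthantVolume τ) :=
    S.integrable_map_iff.1 (memLp_productKernel hb0 hx (P.map (X 0)) 2).integrable_sq
  have hle : f x / 2 * ∫ t, (2 * θ * (productKernel b x t -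
      (C * b)⁻¹ * ∑ j, (t j - x j) ^ 2 * productKernel b x t) -
      θ ^ 2 * B.indicator (fun _ => (1 : ℝ)) t) ∂orthantVolume τ ≤
      kernelSq (P.map (X 0)) b x := by
    rw [kernelSq, S.integral_map_eq, ← integral_const_mul]
    refine integral_mono_ae (iL.const_mul _) iq ?_
    filter_upwards [ae_mem_orthant τ] with t ht
    have hK := productKernel_nonneg hb0 x t
    have hft := S.nonneg t ht
    rw [← Finset.sum_mul]
    by_cases htB : t ∈ B
    · rw [indicator_of_mem htB]
      have h1 := hball ((Metric.mem_closedBall.1 htB).trans_lt hb1)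
      have h2 : 0 ≤ θ * ((C * b)⁻¹ * ((∑ j, (t j - x j) ^ 2) * productKernel b x t)) := by
        have : 0 ≤ ∑ j, (t j - x j) ^ 2 := Finset.sum_nonneg fun _ _ => sq_nonneg _
        positivity
      calc _ ≤ f x / 2 * productKernel b x t ^ 2 := by
            gcongr
            nlinarith [sq_nonneg (productKernel b x t - θ)]
        _ ≤ _ := by rw [mul_comm]; gcongr
    · rw [indicator_of_notMem htB]
      have h1 : C * b ≤ ∑ j, (t j - x j) ^ 2 := by
        have h2 : ∃ j, r < |t j - x j| := by
          by_contra! hcon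
          exact htB (Metric.mem_closedBall.2 ((dist_pi_le_iff hr0.le).2 hcon))
        obtain ⟨j, hj⟩ := h2
        calc C * b = r ^ 2 := (Real.sq_sqrt (by positivity)).symm
          _ ≤ |t j - x j| ^ 2 := by gcongr
          _ = (t j - x j) ^ 2 := sq_abs _
          _ ≤ _ := Finset.single_le_sum (f := fun j => (t j - x j) ^ 2)
              (fun _ _ => sq_nonneg _) (Finset.mem_univ j)
      have h3 : 1 ≤ (C * b)⁻¹ * ∑ j, (t j - x j) ^ 2 := by
        rw [inv_mul_eq_div, le_div_iff₀ (by positivity)]; linarith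
      have h4 : productKernel b x t - (C * b)⁻¹ * ((∑ j, (t j - x j) ^ 2) * productKernel b x t) ≤
          0 := by nlinarith
      have h5 : f x / 2 * (2 * θ * (productKernel b x t -
          (C * b)⁻¹ * ((∑ j, (t j - x j) ^ 2) * productKernel b x t)) - θ ^ 2 * 0) ≤ 0 := by
        refine mul_nonpos_of_nonneg_of_nonpos (by positivity) ?_
        rw [mul_zero, sub_zero]
        exact mul_nonpos_of_nonneg_of_nonpos (by positivity) h4
      exact h5.trans (by positivity)
  rw [integral_sub (iL1.const_mul _) (iB.const_mul _), integral_const_mul, integral_const_mul,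
    integral_sub iK (iS.const_mul _), integral_const_mul, eS, integral_productKernel hb0,
    integral_indicator_const _ Metric.isClosed_closedBall.measurableSet, smul_eq_mul, mul_one] at hle
  have e1 : (C * b)⁻¹ * (b * (C / 2)) = 1 / 2 := by field_simp
  rw [e1] at hle
  have h6 : 1 / (4 * v) ≤ 2 * θ * (1 - 1 / 2) - θ ^ 2 * (orthantVolume τ).real B := by
    have h7 : θ ^ 2 * (orthantVolume τ).real B ≤ θ ^ 2 * v := by gcongr
    have h8 : 2 * θ * (1 - 1 / 2) - θ ^ 2 * v = 1 / (4 * v) := by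
      simp only [θ]
      field_simp
      norm_num
    linarith
  calc f x / (8 * w) = √b ^ (τ + 1) * (f x / 2 * (1 / (4 * v))) := by
        simp only [v]
        field_simp
        norm_num
    _ ≤ _ := by
        gcongr
        exact (mul_le_mul_of_nonneg_left h6 (by positivity)).trans hle

/-- Pointwise, the squared mean is negligible against the second moment of the kernel. -/
theorem tendsto_sq_kernelMean (hx : x ∈ orthant τ) :
    Tendsto (fun b => √b ^ (τ + 1) * kernelMean (P.map (X 0)) b x ^ 2) (𝓝[>] 0) (𝓝 0) := by
  set C := ∏ j, 1 / √(x j / 2)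
  have hC : 0 ≤ C := Finset.prod_nonneg fun _ _ => by positivity
  have hf2 : Integrable (fun t => f t ^ 2) (orthantVolume τ) := S.memLp.integrable_sq
  have hcm := measurable_cutoff S.smooth
  -- The L² mass of f above the level N, which tends to 0 because f is square integrable.
  set D : ℕ → ℝ := fun N => ∫ t, {t | (N : ℝ) < cutoff f t}.indicator (fun t => f t ^ 2) t
    ∂orthantVolume τ
  have hset : ∀ N : ℕ, MeasurableSet {t | (N : ℝ) < cutoff f t} := fun N =>
    measurableSet_lt measurable_const hcm
  have hD : Tendsto D atTop (𝓝 0) := by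
    have h := tendsto_integral_of_dominated_convergence (μ := orthantVolume τ)
      (F := fun (N : ℕ) t => {t | (N : ℝ) < cutoff f t}.indicator (fun t => f t ^ 2) t)
      (f := fun _ => 0) (fun t => f t ^ 2) (fun N => hf2.1.indicator (hset N)) hf2
      (fun N => ae_of_all _ fun t => by
        rw [Real.norm_of_nonneg (indicator_nonneg (fun _ _ => sq_nonneg _) _)]
        exact indicator_le_self' (fun _ _ => sq_nonneg _) t)
      (ae_of_all _ fun t => by
        refine tendsto_const_nhds.congr' ?_
        filter_upwards [eventually_ge_atTop ⌈cutoff f t⌉₊] with N hN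
        rw [indicator_of_notMem]
        have h1 : (⌈cutoff f t⌉₊ : ℝ) ≤ N := by exact_mod_cast hN
        exact not_lt.2 ((Nat.le_ceil (cutoff f t)).trans h1))
    simpa using h
  -- Where f ≤ N the mean is at most N. Where f > N, Kf ≤ (εσ/2)K² + f²/(2εσ) with σ² = b^(d/2), and
  -- one factor K is replaced by its supremum, which is of order σ⁻².
  have key : ∀ N : ℕ, ∀ ε > 0, ∀ b, 0 < b → (∀ j, 2 * b ≤ x j) →
      √(√b ^ (τ + 1)) * kernelMean (P.map (X 0)) b x ≤
        √(√b ^ (τ + 1)) * N + (ε * C + D N / ε) / 2 := by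
    intro N ε hε b hb hb2
    have hs : 0 < √b ^ (τ + 1) := pow_pos (Real.sqrt_pos.2 hb) _
    set σ := √(√b ^ (τ + 1))
    have hσ : 0 < σ := Real.sqrt_pos.2 hs
    have hσ2 : σ ^ 2 = √b ^ (τ + 1) := Real.sq_sqrt hs.le
    have hν := S.isProbabilityMeasure_map
    have iK := integrable_productKernel hb x
    have hi : Integrable (fun t => {t | (N : ℝ) < cutoff f t}.indicator (fun t => f t ^ 2) t)
      (orthantVolume τ) := hf2.indicator (hset N)
    have i1 : Integrable (fun t => (N + ε * σ * kernelSup b x / 2) * productKernel b x t)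
      (orthantVolume τ) := iK.const_mul _
    have i2 : Integrable (fun t => 1 / (2 * ε * σ) *
      {t | (N : ℝ) < cutoff f t}.indicator (fun t => f t ^ 2) t) (orthantVolume τ) := hi.const_mul _
    have hm : kernelMean (P.map (X 0)) b x ≤ (N + ε * σ * kernelSup b x / 2) +
        1 / (2 * ε * σ) * D N := by
      have e1 : ∫ t, ((N + ε * σ * kernelSup b x / 2) * productKernel b x t + 1 / (2 * ε * σ) *
          {t | (N : ℝ) < cutoff f t}.indicator (fun t => f t ^ 2) t) ∂orthantVolume τ =
          (N + ε * σ * kernelSup b x / 2) + 1 / (2 * ε * σ) * D N := by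
        rw [integral_add i1 i2, integral_const_mul, integral_const_mul, integral_productKernel hb,
          mul_one]
      rw [← e1, kernelMean, S.integral_map_eq]
      refine integral_mono_ae (S.integrable_map_iff.1
        ((memLp_productKernel hb hx (P.map (X 0)) 1).integrable le_rfl)) (i1.add i2) ?_
      filter_upwards [ae_mem_orthant τ] with t ht
      have hK := productKernel_nonneg hb x t
      have hKs := productKernel_le hb hx t
      have hsup := (kernelSup_pos hb hx).le
      by_cases htN : (N : ℝ) < cutoff f t
      · rw [indicator_of_mem (show t ∈ {t | (N : ℝ) < cutoff f t} from htN)]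
        have h1 : productKernel b x t * f t ≤
            ε * σ / 2 * productKernel b x t ^ 2 + 1 / (2 * ε * σ) * f t ^ 2 := by
          have h2 : ε * σ / 2 * productKernel b x t ^ 2 + 1 / (2 * ε * σ) * f t ^ 2 -
              productKernel b x t * f t =
              (ε * σ * productKernel b x t - f t) ^ 2 / (2 * ε * σ) := by
            field_simp
            ring
          have h3 : 0 ≤ (ε * σ * productKernel b x t - f t) ^ 2 / (2 * ε * σ) := by positivity
          linarith
        have h4 : ε * σ / 2 * productKernel b x t ^ 2 ≤
            ε * σ * kernelSup b x / 2 * productKernel b x t := by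
          have h5 : productKernel b x t * productKernel b x t ≤
              kernelSup b x * productKernel b x t := by gcongr
          have h6 : 0 ≤ ε * σ / 2 := by positivity
          nlinarith [mul_le_mul_of_nonneg_left h5 h6]
        have h7 : 0 ≤ (N : ℝ) * productKernel b x t := by positivity
        linarith
      · rw [indicator_of_notMem (show t ∉ {t | (N : ℝ) < cutoff f t} from htN), mul_zero, add_zero]
        rw [cutoff, indicator_of_mem ht, not_lt] at htN
        rw [mul_comm]
        refine mul_le_mul_of_nonneg_right (htN.trans (le_add_of_nonneg_right (by positivity))) hK
    have h8 : σ * (ε * σ * kernelSup b x / 2) ≤ ε * C / 2 := by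
      have h9 := sqrt_pow_mul_kernelSup_le hb hx hb2
      rw [← hσ2] at h9
      nlinarith
    calc _ ≤ σ * ((N + ε * σ * kernelSup b x / 2) + 1 / (2 * ε * σ) * D N) := by gcongr
      _ = σ * N + σ * (ε * σ * kernelSup b x / 2) + D N / ε / 2 := by field_simp
      _ ≤ _ := by linarith
  have hσ0 : Tendsto (fun b : ℝ => √(√b ^ (τ + 1))) (𝓝[>] 0) (𝓝 0) := by
    have := (Real.continuous_sqrt.tendsto 0).comp (tendsto_sqrt_pow τ)
    rwa [Real.sqrt_zero] at this
  have hlim : Tendsto (fun b => √(√b ^ (τ + 1)) * kernelMean (P.map (X 0)) b x) (𝓝[>] 0) (𝓝 0) := by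
    refine tendsto_order.2 ⟨fun a ha => ?_, fun a ha => ?_⟩
    · filter_upwards [eventually_mem_nhdsWithin] with b hb
      exact ha.trans_le (mul_nonneg (Real.sqrt_nonneg _) (kernelMean_nonneg hb _ _))
    -- Order of choice: ε from a, then N with D(N) < ε², and finally b small enough that σN < a/2.
    · set ε := a / (C + 1)
      have hε : 0 < ε := by positivity
      obtain ⟨N, hN⟩ := (hD.eventually (gt_mem_nhds (show 0 < ε ^ 2 by positivity))).exists
      have h1 := (hσ0.mul_const (N : ℝ)).eventually
        (gt_mem_nhds (show 0 * (N : ℝ) < a / 2 by rw [zero_mul]; positivity))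
      filter_upwards [h1, eventually_two_mul_le_coord hx, eventually_mem_nhdsWithin] with b hb1 hb2 hb
      refine (key N ε hε b hb hb2).trans_lt ?_
      have h2 : D N / ε ≤ ε := by rw [div_le_iff₀ hε]; nlinarith
      have h3 : ε * C + ε = a := by simp only [ε]; field_simp
      linarith
  have := hlim.pow 2
  rw [zero_pow two_ne_zero] at this
  refine this.congr fun b => ?_
  rw [mul_pow, Real.sq_sqrt (by positivity)]

/-- Pointwise, the covariances are summable over the lags and negligible against the variance. -/
theorem tendsto_tsum_abs_lagCov (hx : x ∈ orthant τ) :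
    (∀ b, 0 < b → Summable fun k => √b ^ (τ + 1) * |lagCov P X b (k + 1) x|) ∧
    Tendsto (fun b => ∑' k, √b ^ (τ + 1) * |lagCov P X b (k + 1) x|) (𝓝[>] 0) (𝓝 0) := by
  obtain ⟨A, hA, hAk⟩ := S.exists_alphaMixing_le
  have hκ := S.pos
  have hκ2 := S.lt_half
  have hM : 0 ≤ M := (abs_nonneg _).trans (S.joint_bound 1 le_rfl x hx x hx)
  -- The exponent 1/(2κ) exceeds 1 because κ < 1/2.
  have hsum1 : Summable fun k : ℕ => ((k + 1 : ℕ) : ℝ) ^ (-(1 / (2 * κ))) := by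
    refine (summable_nat_add_iff 1).2 (Real.summable_nat_rpow.2 ?_)
    rw [neg_lt_neg_iff, lt_div_iff₀ (by positivity)]
    linarith
  have hbound : ∀ b, 0 < b → ∀ k : ℕ, √b ^ (τ + 1) * |lagCov P X b (k + 1) x| ≤
      √b ^ (τ + 1) * kernelSup b x * √(M * A) * ((k + 1 : ℕ) : ℝ) ^ (-(1 / (2 * κ))) := by
    intro b hb k
    have hk0 : (0 : ℝ) < ((k + 1 : ℕ) : ℝ) := by positivity
    have h1 := S.abs_lagCov_le_const hb (Nat.le_add_left 1 k) hx
    have h2 := S.abs_lagCov_le_mixing hb (k + 1) hx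
    have h3 := hAk (k + 1) (Nat.le_add_left 1 k)
    have hsup := (kernelSup_pos hb hx).le
    -- Geometric mean of the density bound M and the mixing bound: the square root halves the decay
    -- exponent 1/κ and leaves a single factor sup K, which the scaling b^(d/2) absorbs.
    have h4 : |lagCov P X b (k + 1) x| ≤
        kernelSup b x * √(M * A) * ((k + 1 : ℕ) : ℝ) ^ (-(1 / (2 * κ))) := by
      refine abs_le_of_sq_le_sq ?_ (by positivity)
      · have e : (kernelSup b x * √(M * A) * ((k + 1 : ℕ) : ℝ) ^ (-(1 / (2 * κ)))) ^ 2 =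
            M * (kernelSup b x ^ 2 * (A * ((k + 1 : ℕ) : ℝ) ^ (-(1 / κ)))) := by
          rw [mul_pow, mul_pow, Real.sq_sqrt (by positivity), ← Real.rpow_natCast
            (((k + 1 : ℕ) : ℝ) ^ (-(1 / (2 * κ)))), ← Real.rpow_mul hk0.le]
          have : -(1 / (2 * κ)) * ((2 : ℕ) : ℝ) = -(1 / κ) := by
            push_cast
            field_simp
          rw [this]
          ring
        rw [e, ← sq_abs, sq]
        exact mul_le_mul h1 (h2.trans (by gcongr)) (abs_nonneg _) hM
    calc _ ≤ √b ^ (τ + 1) * (kernelSup b x * √(M * A) * ((k + 1 : ℕ) : ℝ) ^ (-(1 / (2 * κ)))) := by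
          gcongr
      _ = _ := by ring
  refine ⟨fun b hb => Summable.of_nonneg_of_le (fun k => by positivity) (hbound b hb)
    (hsum1.mul_left _), ?_⟩
  have h := tendsto_tsum_of_dominated_convergence (𝓕 := 𝓝[>] (0 : ℝ))
    (f := fun b k => √b ^ (τ + 1) * |lagCov P X b (k + 1) x|) (g := fun _ => 0)
    (bound := fun k => (∏ j, 1 / √(x j / 2)) * √(M * A) * ((k + 1 : ℕ) : ℝ) ^ (-(1 / (2 * κ))))
    (hsum1.mul_left _) (fun k => ?_) ?_
  · simpa using h
  · have h1 := (tendsto_sqrt_pow τ).mul_const M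
    rw [zero_mul] at h1
    refine squeeze_zero' (Eventually.of_forall fun b => by positivity) ?_ h1
    filter_upwards [eventually_mem_nhdsWithin] with b hb
    gcongr
    exact S.abs_lagCov_le_const hb (Nat.le_add_left 1 k) hx
  · filter_upwards [eventually_two_mul_le_coord hx, eventually_mem_nhdsWithin] with b hb2 hb k
    rw [Real.norm_of_nonneg (by positivity)]
    refine (hbound b hb k).trans ?_
    gcongr
    exact sqrt_pow_mul_kernelSup_le hb hx hb2

theorem isLittleO_covTerm (hx : x ∈ orthant τ) (hfx : 0 < f x) {b : ℕ → ℝ} (hb : ∀ n, 0 < b n)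
    (hb0 : Tendsto b atTop (𝓝 0)) :
    (fun n => covTerm P X n (b n) x) =o[atTop] fun n => varTerm P X n (b n) x := by
  obtain ⟨c, hc, hq⟩ := S.exists_le_kernelSq hx hfx
  have hm := (S.tendsto_sq_kernelMean hx).eventually (gt_mem_nhds (half_pos hc))
  obtain ⟨hs, ht⟩ := S.tendsto_tsum_abs_lagCov hx
  refine isLittleO_of_scaled (τ := τ) hb hb0 ht (half_pos hc) (W := fun b => √b ^ (τ + 1) *
    (kernelSq (P.map (X 0)) b x - kernelMean (P.map (X 0)) b x ^ 2)) ?_ ?_ ?_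
  · filter_upwards [hq, hm] with b h1 h2
    rw [mul_sub]
    linarith
  · intro n hn
    have hn0 : (0 : ℝ) < n := by exact_mod_cast Nat.pos_of_ne_zero hn
    have h1 := abs_sum_sum_erase_dist_le (fun k => lagCov P X (b n) k x) n
    have h2 := (hs _ (hb n)).sum_le_tsum (Finset.range n) fun k _ => by positivity
    rw [← Finset.mul_sum] at h2
    rw [S.covTerm_eq (hb n) hx, abs_mul, abs_of_pos (by positivity : (0 : ℝ) < 1 / (n : ℝ) ^ 2)]
    calc _ ≤ n * √(b n) ^ (τ + 1) * (1 / (n : ℝ) ^ 2 * (n * (2 * ∑ k ∈ Finset.range n,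
          |lagCov P X (b n) (k + 1) x|))) := by gcongr
      _ = 2 * (√(b n) ^ (τ + 1) * ∑ k ∈ Finset.range n, |lagCov P X (b n) (k + 1) x|) := by
          field_simp
      _ ≤ _ := by gcongr
  · intro n hn
    have hn0 : (n : ℝ) ≠ 0 := by exact_mod_cast hn
    rw [S.varTerm_eq (hb n) hx]
    field_simp

theorem isLittleO_integral_covTerm {b : ℕ → ℝ} (hb : ∀ n, 0 < b n) (hb0 : Tendsto b atTop (𝓝 0)) :
    (fun n => ∫ x, covTerm P X n (b n) x ∂orthantVolume τ) =o[atTop]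
      fun n => ∫ x, varTerm P X n (b n) x ∂orthantVolume τ := by
  have hv := S.varianceConst_pos
  refine isLittleO_of_scaled hb hb0 S.tendsto_tsum_lagCov.2 (half_pos hv) (W := fun b =>
    √b ^ (τ + 1) * ∫ x, (kernelSq (P.map (X 0)) b x - kernelMean (P.map (X 0)) b x ^ 2)
      ∂orthantVolume τ) ?_ (fun n hn => S.abs_integral_covTerm_le (hb n) hn) fun n hn => ?_
  · filter_upwards [S.tendsto_integral_kernelVar.eventually (lt_mem_nhds (half_lt_self hv))] with b h
      using h.le
  · have hn0 : (n : ℝ) ≠ 0 := by exact_mod_cast hn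
    rw [S.integral_varTerm (hb n)]
    field_simp

end MixingModel

/-! ### Minimization of an asymptotic bias-variance trade-off -/

section TradeOff

/-- In t = log r the right side is exp(2t)/4 + exp(-dt/2)/d, whose linear terms cancel. The
exponential with nonnegative argument is expanded to second order, the other to first; d ≥ 1 covers
the case t ≤ 0. -/
theorem le_trade_off {d r : ℝ} (hd : 1 ≤ d) (hr : 0 < r) :
    1 / 4 + 1 / d + Real.log r ^ 2 / 8 ≤ r ^ 2 / 4 + r ^ (-(d / 2)) / d := by
  have hd0 : 0 < d := by linarith
  set t := Real.log r
  have e1 : r ^ 2 = Real.exp (2 * t) := by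
    rw [two_mul, Real.exp_add, Real.exp_log hr, sq]
  have e2 : r ^ (-(d / 2)) = Real.exp (-(d / 2) * t) := by
    rw [Real.rpow_def_of_pos hr, mul_comm]
  rw [e1, e2]
  have a1 := Real.add_one_le_exp (2 * t)
  have a2 := Real.add_one_le_exp (-(d / 2) * t)
  rcases le_total 0 t with ht | ht
  · have h1 := Real.quadratic_le_exp_of_nonneg (show 0 ≤ 2 * t by positivity)
    have h2 : (-(d / 2) * t + 1) / d ≤ Real.exp (-(d / 2) * t) / d := by gcongr
    have h3 : (-(d / 2) * t + 1) / d = 1 / d - t / 2 := by field_simp; ring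
    nlinarith [sq_nonneg t]
  · have h1 := Real.quadratic_le_exp_of_nonneg (show 0 ≤ -(d / 2) * t by nlinarith)
    have h2 : (1 + -(d / 2) * t + (-(d / 2) * t) ^ 2 / 2) / d ≤ Real.exp (-(d / 2) * t) / d := by
      gcongr
    have h3 : (1 + -(d / 2) * t + (-(d / 2) * t) ^ 2 / 2) / d = 1 / d - t / 2 + d * t ^ 2 / 8 := by
      field_simp
      ring
    nlinarith [mul_le_mul_of_nonneg_right hd (sq_nonneg t)]

/-- The main part of a bias-variance trade-off, in terms of the ratio to the optimum. -/
theorem trade_off_eq {β v d n b b₀ : ℝ} (hd : 0 < d) (hn : 0 < n) (hb : 0 < b)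
    (hb₀ : 0 < b₀) (h : b₀ ^ 2 * b₀ ^ (d / 2) = d * v / β / n) (hβ : 0 < β) :
    β / 4 * b ^ 2 + v / (n * b ^ (d / 2)) =
      β * b₀ ^ 2 * ((b / b₀) ^ 2 / 4 + (b / b₀) ^ (-(d / 2)) / d) := by
  have h1 : 0 < b₀ ^ (d / 2) := Real.rpow_pos_of_pos hb₀ _
  have h2 : 0 < b ^ (d / 2) := Real.rpow_pos_of_pos hb _
  have e1 : (b / b₀) ^ (-(d / 2)) = b₀ ^ (d / 2) / b ^ (d / 2) := by
    rw [Real.rpow_neg (by positivity), Real.div_rpow hb.le hb₀.le, inv_div]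
  have e2 : v = β * b₀ ^ 2 * b₀ ^ (d / 2) * n / d := by
    rw [mul_assoc β, h]
    field_simp
  rw [e1, e2]
  field_simp

variable {B W T : ℝ → ℝ} {R F : ℕ → ℝ → ℝ} {β v d : ℝ} {b₀ : ℕ → ℝ}

/-- The risk is asymptotic to the main part of the trade-off, uniformly in the sample size. -/
theorem eventually_trade_off (hβ : 0 < β) (hv : 0 < v)
    (hB : Tendsto (fun b => B b / b ^ 2) (𝓝[>] 0) (𝓝 (β / 4))) (hW : Tendsto W (𝓝[>] 0) (𝓝 v))
    (hT : Tendsto T (𝓝[>] 0) (𝓝 0)) (hR : ∀ n ≠ 0, ∀ b, 0 < b → |R n b| ≤ T b)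
    (hF : ∀ n ≠ 0, ∀ b, 0 < b → F n b = B b + (W b + R n b) / (n * b ^ (d / 2)))
    {ε : ℝ} (hε : 0 < ε) : ∀ᶠ b in 𝓝[>] 0, ∀ n ≠ 0,
      (1 - ε) * (β / 4 * b ^ 2 + v / (n * b ^ (d / 2))) ≤ F n b ∧
      F n b ≤ (1 + ε) * (β / 4 * b ^ 2 + v / (n * b ^ (d / 2))) := by
  have h1 := hB.eventually (Icc_mem_nhds (show (1 - ε) * (β / 4) < β / 4 by nlinarith)
    (show β / 4 < (1 + ε) * (β / 4) by nlinarith))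
  have h2 := hW.eventually (Icc_mem_nhds (show (1 - ε / 2) * v < v by nlinarith)
    (show v < (1 + ε / 2) * v by nlinarith))
  have h3 := hT.eventually (gt_mem_nhds (show 0 < ε / 2 * v by positivity))
  filter_upwards [h1, h2, h3, eventually_mem_nhdsWithin] with b h1 h2 h3 hb n hn
  have hb0 : 0 < b := hb
  have hn0 : (0 : ℝ) < n := by exact_mod_cast Nat.pos_of_ne_zero hn
  have hr := abs_le.1 ((hR n hn b hb0).trans h3.le)
  have hp : 0 < n * b ^ (d / 2) := mul_pos hn0 (Real.rpow_pos_of_pos hb0 _)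
  have k1 := (le_div_iff₀ (by positivity)).1 h1.1
  have k2 := (div_le_iff₀ (by positivity)).1 h1.2
  rw [hF n hn b hb0]
  constructor
  · have : (1 - ε) * v / (n * b ^ (d / 2)) ≤ (W b + R n b) / (n * b ^ (d / 2)) := by
      gcongr
      linarith [h2.1]
    rw [mul_div_assoc] at this
    linarith
  · have : (W b + R n b) / (n * b ^ (d / 2)) ≤ (1 + ε) * v / (n * b ^ (d / 2)) := by
      gcongr
      linarith [h2.2]
    rw [mul_div_assoc] at this
    linarith

/-- Minimizers of a risk that is asymptotic to a bias-variance trade-off. -/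
theorem exists_forall_minimizer {G : ℕ → ℝ → ℝ≥0∞} (hβ : 0 < β) (hd : 1 ≤ d)
    (happ : ∀ ε > 0, ∀ᶠ b in 𝓝[>] 0, ∀ n ≠ 0,
      (1 - ε) * (β / 4 * b ^ 2 + v / (n * b ^ (d / 2))) ≤ F n b ∧
      F n b ≤ (1 + ε) * (β / 4 * b ^ 2 + v / (n * b ^ (d / 2))))
    (hG : ∀ n ≠ 0, ∀ b, 0 < b → G n b = ENNReal.ofReal (F n b))
    (hlsc : ∀ n, LowerSemicontinuousOn (G n) (Ioi 0))
    (hb₀ : ∀ n ≠ 0, 0 < b₀ n) (hb₀' : Tendsto b₀ atTop (𝓝 0))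
    (hopt : ∀ n ≠ 0, b₀ n ^ 2 * b₀ n ^ (d / 2) = d * v / β / n) :
    ∃ δ₀ : ℝ, 0 < δ₀ ∧ ∀ δ ∈ Ioc 0 δ₀,
      (∀ᶠ n in atTop, ∃ b ∈ Ioc 0 δ, IsMinOn (G n) (Ioc 0 δ) b) ∧
      ∀ b : ℕ → ℝ, (∀ᶠ n in atTop, b n ∈ Ioc 0 δ ∧ IsMinOn (G n) (Ioc 0 δ) (b n)) →
        Tendsto (fun n => b n / b₀ n) atTop (𝓝 1) ∧
        Tendsto (fun n => G n (b₀ n) / G n (b n)) atTop (𝓝 1) := by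
  have hd0 : 0 < d := by linarith
  set φ : ℝ → ℝ := fun r => r ^ 2 / 4 + r ^ (-(d / 2)) / d
  set φ₁ : ℝ := 1 / 4 + 1 / d
  have hφ1 : φ 1 = φ₁ := by simp [φ, φ₁]
  have hφ₁ : 0 < φ₁ := by positivity
  have happ' : ∀ ε > 0, ∃ a > 0, ∀ b, 0 < b → b ≤ a → ∀ n ≠ 0,
      (1 - ε) * (β * b₀ n ^ 2 * φ (b / b₀ n)) ≤ F n b ∧
      F n b ≤ (1 + ε) * (β * b₀ n ^ 2 * φ (b / b₀ n)) := by
    intro ε hε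
    obtain ⟨a, ha, h⟩ := mem_nhdsGT_iff_exists_Ioc_subset.1 (happ ε hε)
    refine ⟨a, ha, fun b hb hba n hn => ?_⟩
    have h1 := h ⟨hb, hba⟩ n hn
    rwa [trade_off_eq hd0 (by exact_mod_cast Nat.pos_of_ne_zero hn) hb (hb₀ n hn) (hopt n hn) hβ]
      at h1
  have hup : ∀ ε > 0, ∀ᶠ n in atTop, F n (b₀ n) ≤ (1 + ε) * (β * b₀ n ^ 2 * φ₁) := by
    intro ε hε
    obtain ⟨a, ha, h⟩ := happ' ε hε
    filter_upwards [eventually_ne_atTop 0, hb₀'.eventually (gt_mem_nhds ha)] with n hn hna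
    have h1 := (h _ (hb₀ n hn) hna.le n hn).2
    rwa [div_self (hb₀ n hn).ne', hφ1] at h1
  -- A crude accuracy of 1/2 fixes δ₀. On (0, δ₀] it gives positivity of the risk and separate lower
  -- bounds by its bias part and its variance part.
  obtain ⟨δ₀, hδ₀, hhalf⟩ := happ' (1 / 2) (by norm_num)
  have hlow : ∀ n ≠ 0, ∀ b, 0 < b → b ≤ δ₀ → 0 < F n b ∧ β / 8 * b ^ 2 ≤ F n b ∧
      β * b₀ n ^ 2 / (2 * d) * (b / b₀ n) ^ (-(d / 2)) ≤ F n b := by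
    intro n hn b hb hbδ
    have h0 := hb₀ n hn
    have h1 := (hhalf b hb hbδ n hn).1
    have hr : 0 < (b / b₀ n) ^ (-(d / 2)) := by positivity
    have e1 : (1 - 1 / 2) * (β * b₀ n ^ 2 * φ (b / b₀ n)) =
        β / 8 * b ^ 2 + β * b₀ n ^ 2 / (2 * d) * (b / b₀ n) ^ (-(d / 2)) := by
      simp only [φ]
      field_simp
      ring
    rw [e1] at h1
    have h2 : 0 < β / 8 * b ^ 2 := by positivity
    have h3 : 0 < β * b₀ n ^ 2 / (2 * d) * (b / b₀ n) ^ (-(d / 2)) := by positivity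
    exact ⟨by linarith, by linarith, by linarith⟩
  refine ⟨δ₀, hδ₀, fun δ hδ => ⟨?_, fun b hb => ?_⟩⟩
  · filter_upwards [eventually_ne_atTop 0, hb₀'.eventually (gt_mem_nhds hδ.1)] with n hn hnδ
    have h0 := hb₀ n hn
    have hlim : Tendsto (fun b => β * b₀ n ^ 2 / (2 * d) * (b / b₀ n) ^ (-(d / 2))) (𝓝[>] 0)
        atTop := by
      refine Tendsto.const_mul_atTop (by positivity) ?_
      refine (tendsto_rpow_neg_nhdsGT_zero (by linarith)).comp ?_
      refine tendsto_nhdsWithin_iff.2 ⟨?_, ?_⟩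
      · have : Continuous fun b => b / b₀ n := by fun_prop
        simpa using (this.tendsto 0).mono_left nhdsWithin_le_nhds
      · filter_upwards [eventually_mem_nhdsWithin] with b hb using div_pos hb h0
    -- Below a the variance part alone exceeds the risk at b₀, so a minimum over the compact
    -- interval [a', δ] is a minimum over (0, δ]; a' ≤ b₀ keeps b₀ in that interval.
    obtain ⟨a, ha, hlarge⟩ := mem_nhdsGT_iff_exists_Ioc_subset.1
      (hlim.eventually_gt_atTop (F n (b₀ n)))
    set a' := min a (b₀ n)
    have ha' : 0 < a' := lt_min ha h0
    have hl : LowerSemicontinuousOn (G n) (Icc a' δ) :=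
      (hlsc n).mono fun c hc => lt_of_lt_of_le ha' hc.1
    obtain ⟨c, hc, hmin⟩ := LowerSemicontinuousOn.exists_isMinOn (s := Icc a' δ)
      ⟨b₀ n, min_le_right _ _, hnδ.le⟩ isCompact_Icc hl
    refine ⟨c, ⟨ha'.trans_le hc.1, hc.2⟩, fun y hy => ?_⟩
    rcases le_total a' y with h | h
    · exact hmin ⟨h, hy.2⟩
    · have h1 : G n c ≤ G n (b₀ n) := hmin ⟨min_le_right _ _, hnδ.le⟩
      refine h1.trans ?_
      rw [hG n hn _ h0, hG n hn _ hy.1]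
      refine ENNReal.ofReal_le_ofReal ?_
      have h2 : F n (b₀ n) < _ := hlarge ⟨hy.1, h.trans (min_le_left _ _)⟩
      exact h2.le.trans (hlow n hn y hy.1 (hy.2.trans hδ.2)).2.2
  have hle : ∀ᶠ n in atTop, n ≠ 0 ∧ 0 < b n ∧ b n ≤ δ₀ ∧ F n (b n) ≤ F n (b₀ n) := by
    filter_upwards [hb, eventually_ne_atTop 0, hb₀'.eventually (gt_mem_nhds hδ.1)]
      with n hbn hn hnδ
    have h0 := hb₀ n hn
    have hbδ := hbn.1.2.trans hδ.2
    refine ⟨hn, hbn.1.1, hbδ, ?_⟩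
    have h1 : G n (b n) ≤ G n (b₀ n) := hbn.2 ⟨h0, hnδ.le⟩
    rw [hG n hn _ h0, hG n hn _ hbn.1.1] at h1
    exact (ENNReal.ofReal_le_ofReal_iff (hlow n hn _ h0 (hnδ.le.trans hδ.2)).1.le).1 h1
  -- The bias part bounds a minimizer: (β/8)b² ≤ F(b) ≤ F(b₀) ≤ 2βb₀²φ₁. Only after this does the
  -- sharp approximation apply at b.
  have hb0 : Tendsto b atTop (𝓝 0) := by
    have h1 : Tendsto (fun n => √(16 * φ₁) * b₀ n) atTop (𝓝 0) := by
      simpa using hb₀'.const_mul (√(16 * φ₁))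
    refine squeeze_zero' (hle.mono fun n h => h.2.1.le) ?_ h1
    filter_upwards [hle, hup 1 one_pos] with n hn hu
    have h2 := (hlow n hn.1 _ hn.2.1 hn.2.2.1).2.1
    refine (le_abs_self _).trans
      (abs_le_of_sq_le_sq ?_ (mul_nonneg (Real.sqrt_nonneg _) (hb₀ n hn.1).le))
    rw [mul_pow, Real.sq_sqrt (by positivity)]
    have h3 : β / 8 * b n ^ 2 ≤ β / 8 * (16 * φ₁ * b₀ n ^ 2) := by
      have := hn.2.2.2
      linarith
    exact le_of_mul_le_mul_left h3 (by positivity)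
  have hsq : ∀ ε, 0 < ε → ε < 1 → ∀ᶠ n in atTop,
      n ≠ 0 ∧ 0 < b n ∧ 0 < F n (b n) ∧ F n (b n) ≤ F n (b₀ n) ∧
      F n (b₀ n) ≤ (1 + ε) * (β * b₀ n ^ 2 * φ₁) ∧
      (1 - ε) * (β * b₀ n ^ 2 * (φ₁ + Real.log (b n / b₀ n) ^ 2 / 8)) ≤ F n (b n) := by
    intro ε hε hε1
    obtain ⟨a, ha, h⟩ := happ' ε hε
    filter_upwards [hle, hup ε hε, hb0.eventually (gt_mem_nhds ha)] with n hn hu hna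
    have h0 := hb₀ n hn.1
    refine ⟨hn.1, hn.2.1, (hlow n hn.1 _ hn.2.1 hn.2.2.1).1, hn.2.2.2, hu,
      le_trans ?_ (h _ hn.2.1 hna.le n hn.1).1⟩
    have h1 := le_trade_off hd (div_pos hn.2.1 h0)
    have h2 : 0 ≤ 1 - ε := by linarith
    gcongr
  constructor
  · have hlog : Tendsto (fun n => Real.log (b n / b₀ n)) atTop (𝓝 0) := by
      have h2 : Tendsto (fun n => Real.log (b n / b₀ n) ^ 2) atTop (𝓝 0) := by
        refine tendsto_order.2 ⟨fun a ha => Eventually.of_forall fun n =>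
          ha.trans_le (sq_nonneg _), fun a ha => ?_⟩
        -- Comparing upper and lower bounds gives (1-ε)(log)² ≤ 16εφ₁. This ε makes 16εφ₁ < (1-ε)a,
        -- the 1 in the denominator giving strictness.
        set ε := a / (a + 16 * φ₁ + 1)
        have hε : 0 < ε := by positivity
        have hden : 0 < a + 16 * φ₁ + 1 := by positivity
        have hε1 : ε < 1 := by rw [div_lt_one hden]; linarith
        filter_upwards [hsq ε hε hε1] with n hn
        obtain ⟨h1, h3, h4, h5, h6, h7⟩ := hn
        have h0 := hb₀ n h1
        have h8 : β * b₀ n ^ 2 * ((1 - ε) * (φ₁ + Real.log (b n / b₀ n) ^ 2 / 8)) ≤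
            β * b₀ n ^ 2 * ((1 + ε) * φ₁) := by linarith
        have h9 := le_of_mul_le_mul_left h8 (by positivity)
        have e1 : ε * (a + 16 * φ₁ + 1) = a := div_mul_cancel₀ _ hden.ne'
        have h10 : (1 - ε) * Real.log (b n / b₀ n) ^ 2 < (1 - ε) * a := by linarith
        exact lt_of_mul_lt_mul_left h10 (by linarith)
      have h3 := (Real.continuous_sqrt.tendsto 0).comp h2
      rw [Real.sqrt_zero] at h3
      refine (tendsto_zero_iff_abs_tendsto_zero _).2 (h3.congr fun n => ?_)
      simp [Real.sqrt_sq_eq_abs]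
    have h4 := (Real.continuous_exp.tendsto 0).comp hlog
    rw [Real.exp_zero] at h4
    refine h4.congr' ?_
    filter_upwards [hle] with n hn
    exact Real.exp_log (div_pos hn.2.1 (hb₀ n hn.1))
  · have hratio : Tendsto (fun n => F n (b₀ n) / F n (b n)) atTop (𝓝 1) := by
      refine tendsto_order.2 ⟨fun a ha => ?_, fun a ha => ?_⟩
      · filter_upwards [hsq (1 / 2) (by norm_num) (by norm_num)] with n hn
        exact ha.trans_le ((one_le_div hn.2.2.1).2 hn.2.2.2.1)
      -- Chosen so that 1 + ε < a(1-ε), which needs ε(a+1) < a - 1.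
      · set ε := (a - 1) / (a + 3)
        have hden : 0 < a + 3 := by linarith
        have hε : 0 < ε := div_pos (by linarith) hden
        have hε1 : ε < 1 := by rw [div_lt_one hden]; linarith
        have e1 : ε * (a + 3) = a - 1 := div_mul_cancel₀ _ hden.ne'
        filter_upwards [hsq ε hε hε1] with n hn
        obtain ⟨h1, h3, h4, h5, h6, h7⟩ := hn
        have h0 := hb₀ n h1
        rw [div_lt_iff₀ h4]
        have hm : 0 < β * b₀ n ^ 2 * φ₁ := by positivity
        have h8 : (1 - ε) * (β * b₀ n ^ 2 * φ₁) ≤ F n (b n) := by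
          refine le_trans ?_ h7
          have h2 : 0 ≤ 1 - ε := by linarith
          gcongr
          have := sq_nonneg (Real.log (b n / b₀ n))
          linarith
        have h9 : (1 + ε) * (β * b₀ n ^ 2 * φ₁) < a * ((1 - ε) * (β * b₀ n ^ 2 * φ₁)) := by
          rw [← mul_assoc a]
          refine mul_lt_mul_of_pos_right ?_ hm
          nlinarith
        have h10 : a * ((1 - ε) * (β * b₀ n ^ 2 * φ₁)) ≤ a * F n (b n) :=
          mul_le_mul_of_nonneg_left h8 (by linarith)
        linarith
    have h11 := (ENNReal.continuous_ofReal.tendsto 1).comp hratio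
    rw [ENNReal.ofReal_one] at h11
    refine h11.congr' ?_
    filter_upwards [hsq (1 / 2) (by norm_num) (by norm_num)] with n hn
    rw [hG n hn.1 _ (hb₀ n hn.1), hG n hn.1 _ hn.2.1, Function.comp,
      ENNReal.ofReal_div_of_pos hn.2.2.1]

end TradeOff

/-! ### The optimal bandwidth -/

/-- The shape depends on x and b only through x/b, and as a function of that ratio the two branches
agree at 2. -/
theorem continuousAt_shape (x : ℝ) {b : ℝ} (hb : 0 < b) : ContinuousAt (fun b => shape x b) b := by
  have h : ContinuousAt (fun b => shape (x / b) 1) b :=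
    ContinuousAt.comp (f := fun b => x / b) (continuous_shape one_pos).continuousAt
      (continuousAt_const.div continuousAt_id hb.ne')
  refine h.congr ?_
  filter_upwards [lt_mem_nhds hb] with c hc
  have e : 2 * 1 ≤ x / c ↔ 2 * c ≤ x := by rw [mul_one, le_div_iff₀ hc]
  unfold shape
  simp only [e]
  split_ifs
  · rw [div_one]
  · rw [mul_one, div_div, mul_comm c]

theorem continuousAt_gammaKernel {x b : ℝ} (hx : 0 < x) (t : ℝ) (hb : 0 < b) :
    ContinuousAt (fun b => gammaKernel x b t) b := by
  rcases le_or_gt t 0 with ht | ht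
  · refine (continuousAt_const (y := (0 : ℝ))).congr ?_
    filter_upwards [lt_mem_nhds hb] with c hc
    rcases ht.eq_or_lt with rfl | ht
    -- At t = 0 the exponent is positive because x > 0, so the kernel vanishes there for every
    -- bandwidth.
    · have h1 := one_lt_shape hc hx
      simp only [gammaKernel, gammaPDFReal, le_refl, if_true]
      rw [Real.zero_rpow (by linarith)]
      simp
    · simp [gammaKernel, gammaPDFReal, not_le.2 ht]
  · have hs := continuousAt_shape x hb
    have hr : ContinuousAt (fun b : ℝ => 1 / b) b := continuousAt_const.div continuousAt_id hb.ne'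
    have hG : ContinuousAt (fun b => Real.Gamma (shape x b)) b :=
      ContinuousAt.comp (f := fun b => shape x b) (continuousAt_Gamma_of_pos (shape_pos hb x)) hs
    have h : ContinuousAt (fun b => (1 / b) ^ shape x b / Real.Gamma (shape x b) *
        t ^ (shape x b - 1) * Real.exp (-(1 / b * t))) b := by
      refine ContinuousAt.mul (ContinuousAt.mul (ContinuousAt.div ?_ hG
        (Real.Gamma_pos_of_pos (shape_pos hb x)).ne') ?_) ?_
      · exact hr.rpow hs (Or.inl (by positivity))
      · exact continuousAt_const.rpow (hs.sub continuousAt_const) (Or.inl ht.ne')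
      · exact ((hr.mul continuousAt_const).neg).rexp
    refine h.congr (Eventually.of_forall fun c => ?_)
    exact (gammaPDFReal_of_pos _ _ ht).symm

theorem continuousAt_estimator {Ω : Type*} {τ : ℕ} (X : ℕ → Ω → (Fin (τ + 1) → ℝ)) (n : ℕ)
    {b : ℝ} (hb : 0 < b) {x : Fin (τ + 1) → ℝ} (hx : x ∈ orthant τ) (ω : Ω) :
    ContinuousAt (fun b => estimator X n b x ω) b := by
  unfold estimator productKernel
  exact continuousAt_const.mul (tendsto_finsetSum _ fun i _ => tendsto_finsetProd _ fun j _ =>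
    continuousAt_gammaKernel (hx j) (X i ω j) hb)

namespace MixingModel

variable {Ω : Type*} [MeasurableSpace Ω] {P : Measure Ω} {τ : ℕ}
  {X : ℕ → Ω → (Fin (τ + 1) → ℝ)} {f : (Fin (τ + 1) → ℝ) → ℝ}
  {g : ℕ → (Fin (τ + 1) → ℝ) → (Fin (τ + 1) → ℝ) → ℝ} {κ M : ℝ}
  [IsProbabilityMeasure P] (S : MixingModel P τ X f g κ M) {b : ℝ}
include S

omit [IsProbabilityMeasure P] in
theorem measurable_sq_error (hb : 0 < b) (n : ℕ) : Measurable fun q : Ω × (Fin (τ + 1) → ℝ) =>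
    ENNReal.ofReal ((cutoff f q.2 - estimator X n b q.2 q.1) ^ 2) :=
  ((((measurable_cutoff S.smooth).comp measurable_snd).sub
    (S.measurable_estimator hb n)).pow_const 2).ennreal_ofReal

omit [IsProbabilityMeasure P] in
theorem mise_eq_lintegral_prod (hb : 0 < b) (n : ℕ) : mise P X f n b =
    ∫⁻ q, ENNReal.ofReal ((cutoff f q.2 - estimator X n b q.2 q.1) ^ 2)
      ∂P.prod (orthantVolume τ) := by
  rw [lintegral_prod _ (S.measurable_sq_error hb n).aemeasurable]
  refine lintegral_congr fun ω => lintegral_congr_ae ?_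
  filter_upwards [cutoff_ae_eq f] with x hx
  rw [hx]

omit [IsProbabilityMeasure P] in
-- Fatou's lemma, since the integrand is nonnegative and continuous in the bandwidth at every point
-- of the orthant. Lower semicontinuity suffices for a minimizer, so no domination uniform in b is
-- needed.
theorem lowerSemicontinuousOn_mise (n : ℕ) : LowerSemicontinuousOn (mise P X f n) (Ioi 0) := by
  intro b hb
  have hb0 : 0 < b := hb
  refine LowerSemicontinuousAt.lowerSemicontinuousWithinAt _
    (lowerSemicontinuousAt_iff_le_liminf.2 ?_)
  -- Replacing c by max(c, b/2) keeps the bandwidth positive for all c, so that measurability holds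
  -- along the whole family and not only near b.
  set H : ℝ → Ω × (Fin (τ + 1) → ℝ) → ℝ≥0∞ := fun c q =>
    ENNReal.ofReal ((cutoff f q.2 - estimator X n (max c (b / 2)) q.2 q.1) ^ 2)
  have hc : ∀ c, 0 < max c (b / 2) := fun c => lt_max_of_lt_right (by positivity)
  have e1 : liminf (mise P X f n) (𝓝 b) =
      liminf (fun c => ∫⁻ q, H c q ∂P.prod (orthantVolume τ)) (𝓝 b) := by
    refine liminf_congr ?_
    filter_upwards [lt_mem_nhds (half_lt_self hb0)] with c hcb
    rw [← S.mise_eq_lintegral_prod (hc c), max_eq_left hcb.le]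
  rw [e1]
  refine le_trans ?_ (lintegral_liminf_le' fun c => (S.measurable_sq_error (hc c) n).aemeasurable)
  rw [S.mise_eq_lintegral_prod hb0]
  refine lintegral_mono_ae ?_
  have hae : ∀ᵐ q ∂P.prod (orthantVolume τ), q.2 ∈ orthant τ :=
    Measure.quasiMeasurePreserving_snd.ae (ae_mem_orthant τ)
  filter_upwards [hae] with q hq
  have h1 : Tendsto (fun c => H c q) (𝓝 b)
      (𝓝 (ENNReal.ofReal ((cutoff f q.2 - estimator X n b q.2 q.1) ^ 2))) := by
    refine (ENNReal.continuous_ofReal.tendsto _).comp (((tendsto_const_nhds).sub ?_).pow 2)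
    have h2 := (continuousAt_estimator X n hb0 hq q.1).tendsto
    refine h2.congr' ?_
    filter_upwards [lt_mem_nhds (half_lt_self hb0)] with c hcb
    rw [max_eq_left hcb.le]
  exact h1.liminf_eq.ge

omit [IsProbabilityMeasure P] in
theorem optBandwidth_base_pos (hv : 0 < varianceConst f) :
    0 < ((τ : ℝ) + 1) * varianceConst f / biasConst f := by
  have := S.bias_pos
  positivity

theorem optBandwidth_pos {n : ℕ} (hn : n ≠ 0) : 0 < optBandwidth f n := by
  have hn0 : (0 : ℝ) < n := by exact_mod_cast Nat.pos_of_ne_zero hn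
  exact mul_pos (Real.rpow_pos_of_pos (S.optBandwidth_base_pos S.varianceConst_pos) _)
    (Real.rpow_pos_of_pos hn0 _)

/-- The stationarity condition for (β/4)b² + v/(n b^(d/2)); the exponent 2/(τ+5) is the reciprocal
of 2 + (τ+1)/2. -/
theorem optBandwidth_eq {n : ℕ} (hn : n ≠ 0) :
    optBandwidth f n ^ 2 * optBandwidth f n ^ (((τ : ℝ) + 1) / 2) =
      ((τ : ℝ) + 1) * varianceConst f / biasConst f / n := by
  have hn0 : (0 : ℝ) < n := by exact_mod_cast Nat.pos_of_ne_zero hn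
  have h0 := S.optBandwidth_pos hn
  have hc := S.optBandwidth_base_pos S.varianceConst_pos
  have hτ : (0 : ℝ) < (τ : ℝ) + 5 := by positivity
  rw [← Real.rpow_natCast, ← Real.rpow_add h0, optBandwidth,
    Real.mul_rpow (by positivity) (by positivity), ← Real.rpow_mul hc.le, ← Real.rpow_mul hn0.le]
  have e1 : 2 / ((τ : ℝ) + 5) * (((2 : ℕ) : ℝ) + ((τ : ℝ) + 1) / 2) = 1 := by
    push_cast
    field_simp
    ring
  rw [neg_mul, e1, Real.rpow_one, Real.rpow_neg_one, div_eq_mul_inv _ (n : ℝ)]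

omit S [IsProbabilityMeasure P] in
theorem tendsto_optBandwidth : Tendsto (fun n => optBandwidth f n) atTop (𝓝 0) := by
  have h := ((tendsto_rpow_neg_atTop (show (0 : ℝ) < 2 / ((τ : ℝ) + 5) by positivity)).comp
    tendsto_natCast_atTop_atTop).const_mul
    ((((τ : ℝ) + 1) * varianceConst f / biasConst f) ^ (2 / ((τ : ℝ) + 5)))
  rw [mul_zero] at h
  exact h

/-- The asymptotically optimal bandwidth for the mean integrated squared error. -/
theorem exists_forall_mise_minimizer : ∃ δ₀ : ℝ, 0 < δ₀ ∧ ∀ δ ∈ Ioc 0 δ₀,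
      (∀ᶠ n in atTop, ∃ b ∈ Ioc 0 δ, IsMinOn (mise P X f n) (Ioc 0 δ) b) ∧
      ∀ β : ℕ → ℝ, (∀ᶠ n in atTop, β n ∈ Ioc 0 δ ∧ IsMinOn (mise P X f n) (Ioc 0 δ) (β n)) →
        Tendsto (fun n => β n / optBandwidth f n) atTop (𝓝 1) ∧
        Tendsto (fun n => mise P X f n (optBandwidth f n) / mise P X f n (β n)) atTop (𝓝 1) := by
  set R : ℕ → ℝ → ℝ := fun n b =>
    n * √b ^ (τ + 1) * ∫ x, covTerm P X n b x ∂orthantVolume τ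
  set W : ℝ → ℝ := fun b => √b ^ (τ + 1) *
    ∫ x, (kernelSq (P.map (X 0)) b x - kernelMean (P.map (X 0)) b x ^ 2) ∂orthantVolume τ
  set F : ℕ → ℝ → ℝ := fun n b => (∫ x, (smoothed f b x - f x) ^ 2 ∂orthantVolume τ) +
    ((∫ x, varTerm P X n b x ∂orthantVolume τ) + ∫ x, covTerm P X n b x ∂orthantVolume τ)
  have hpow : ∀ b : ℝ, 0 < b → b ^ (((τ : ℝ) + 1) / 2) = √b ^ (τ + 1) := by
    intro b hb
    rw [← Real.rpow_natCast, Real.sqrt_eq_rpow, ← Real.rpow_mul hb.le]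
    congr 1
    push_cast
    ring
  have hT := S.tendsto_tsum_lagCov.2.const_mul 2
  rw [mul_zero] at hT
  have hR : ∀ n ≠ 0, ∀ b, 0 < b → |R n b| ≤
      2 * ∑' k, √b ^ (τ + 1) * |∫ x, lagCov P X b (k + 1) x ∂orthantVolume τ| := by
    intro n hn b hb
    simp only [R]
    rw [abs_mul, abs_of_nonneg (by positivity)]
    exact S.abs_integral_covTerm_le hb hn
  have hF : ∀ n ≠ 0, ∀ b, 0 < b → F n b = (∫ x, (smoothed f b x - f x) ^ 2 ∂orthantVolume τ) +
      (W b + R n b) / (n * b ^ (((τ : ℝ) + 1) / 2)) := by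
    intro n hn b hb
    have hn0 : (n : ℝ) ≠ 0 := by exact_mod_cast hn
    have hs : √b ^ (τ + 1) ≠ 0 := (pow_pos (Real.sqrt_pos.2 hb) _).ne'
    simp only [F, W, R]
    rw [hpow b hb, S.integral_varTerm hb]
    field_simp
  exact exists_forall_minimizer (F := F) S.bias_pos (by norm_num : (1 : ℝ) ≤ (τ : ℝ) + 1)
    (fun ε hε => eventually_trade_off S.bias_pos S.varianceConst_pos
      (tendsto_integral_sq_bias S.smooth S.memLp S.bias_memLp) S.tendsto_integral_kernelVar hT hR hF hε)
    (fun n hn b hb => S.mise_eq hb hn) S.lowerSemicontinuousOn_mise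
    (fun n hn => S.optBandwidth_pos hn) tendsto_optBandwidth fun n hn => S.optBandwidth_eq hn

end MixingModel

end GammaKDE

/-! ### The main theorem -/

theorem theorem2 {Ω : Type*} [MeasurableSpace Ω] (P : Measure Ω) [IsProbabilityMeasure P]
    (τ : ℕ) (X : ℕ → Ω → (Fin (τ + 1) → ℝ)) (f : (Fin (τ + 1) → ℝ) → ℝ)
    (g : ℕ → (Fin (τ + 1) → ℝ) → (Fin (τ + 1) → ℝ) → ℝ) (κ M : ℝ)
    -- a strictly stationary sequence with marginal density `f` on the orthant
    (hX : ∀ i, Measurable (X i))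
    (hstat : IsStationary P X)
    (hf_nonneg : ∀ x ∈ orthant τ, 0 ≤ f x)
    (hf_law : P.map (X 0) = (orthantVolume τ).withDensity (fun x => ENNReal.ofReal (f x)))
    -- strong mixing
    (hκ0 : 0 < κ) (hκ : κ < 1 / 2)
    (hmix : Summable (fun k : ℕ => (k : ℝ) * alphaMixing P X k ^ (2 * κ)))
    -- joint densities `g k` at lag `k ≥ 1`, uniformly close to the product density
    (hg_meas : ∀ k, 1 ≤ k → Measurable (Function.uncurry (g k)))
    (hg_nonneg : ∀ k, 1 ≤ k → ∀ x ∈ orthant τ, ∀ y ∈ orthant τ, 0 ≤ g k x y)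
    (hg_law : ∀ k, 1 ≤ k → P.map (fun ω => (X 0 ω, X k ω)) =
      ((orthantVolume τ).prod (orthantVolume τ)).withDensity
        (fun p => ENNReal.ofReal (g k p.1 p.2)))
    (hM : ∀ k, 1 ≤ k → ∀ x ∈ orthant τ, ∀ y ∈ orthant τ, |g k x y - f x * f y| ≤ M)
    -- smoothness, and finiteness of the integrals that enter the error
    (hf_smooth : ContDiffOn ℝ 2 f (orthant τ))
    (hf_L2 : MemLp f 2 (orthantVolume τ))
    (hf_bias : ∀ j, MemLp (fun x => x j * secondPartial f j x) 2 (orthantVolume τ))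
    (hf_bias_pos : 0 < biasConst f)
    (hf_moment : Integrable (fun x => (∏ j, x j ^ (-(κ + 1 / 2))) * f x) (orthantVolume τ)) :
    -- the covariance term is negligible against the variance term, pointwise and integrated
    (∀ b : ℕ → ℝ, (∀ n, 0 < b n) → Tendsto b atTop (𝓝 0) →
      (∀ x ∈ orthant τ, 0 < f x →
        (fun n => covTerm P X n (b n) x) =o[atTop] (fun n => varTerm P X n (b n) x)) ∧
      (∀ n, Integrable (covTerm P X n (b n)) (orthantVolume τ)) ∧
      (∀ n, Integrable (varTerm P X n (b n)) (orthantVolume τ)) ∧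
      (fun n => ∫ x, covTerm P X n (b n) x ∂(orthantVolume τ)) =o[atTop]
        (fun n => ∫ x, varTerm P X n (b n) x ∂(orthantVolume τ))) ∧
    -- for every small `δ`, the MISE has a minimizer on `(0, δ]` for all large `n`; all minimizers
    -- are asymptotic to `optBandwidth f n`, which attains the minimum asymptotically
    (∃ δ₀ : ℝ, 0 < δ₀ ∧ ∀ δ ∈ Set.Ioc 0 δ₀,
      (∀ᶠ n in atTop, ∃ b ∈ Set.Ioc 0 δ, IsMinOn (mise P X f n) (Set.Ioc 0 δ) b) ∧
      ∀ β : ℕ → ℝ,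
        (∀ᶠ n in atTop, β n ∈ Set.Ioc 0 δ ∧ IsMinOn (mise P X f n) (Set.Ioc 0 δ) (β n)) →
        Tendsto (fun n => β n / optBandwidth f n) atTop (𝓝 1) ∧
        Tendsto (fun n => mise P X f n (optBandwidth f n) / mise P X f n (β n))
          atTop (𝓝 1)) := by
  have S : MixingModel P τ X f g κ M := ⟨hX, hstat, hf_nonneg, hf_law, hκ0, hκ, hmix, hg_meas,
    hg_nonneg, hg_law, hM, hf_smooth, hf_L2, hf_bias, hf_bias_pos, hf_moment⟩
  exact ⟨fun b hb hb0 => ⟨fun x hx hfx => S.isLittleO_covTerm hx hfx hb hb0,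
    fun n => S.integrable_covTerm (hb n) n, fun n => S.integrable_varTerm (hb n) n,
    S.isLittleO_integral_covTerm hb hb0⟩, S.exists_forall_mise_minimizer⟩
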